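/- **Setting.** Fix a dimension $d\ge 0$. A *complex* $\mathcal C$ in $\mathbb R^d$ is a finite family of nonempty finite subsets of $\mathbb R^d$ (its *simplices*), closed under taking nonempty subsets, such that every simplex $\Psi$ is affinely independent, and such that $\mathrm{conv}(\Psi)\cap\mathrm{conv}(\Upsilon)=\mathrm{conv}(\Psi\cap\Upsilon)$ for all simplices $\Psi,\Upsilon$ with $\Psi\cap\Upsilon\neq\emptyset$ (the convex hulls of disjoint simplices may intersect). Its vertices are the points $v$ with $\{v\}\in\mathcal C$, and $|\mathcal C|$ is the number of its simplices. Two simplices are *adjacent* if one contains the other; $\mathcal C$ is *connected* if any two simplices are joined by a chain of successively adjacent simplices. A *simplicial path* in $\mathcal C$ is a map $\varphi:[0,1]\to\mathcal C$ such that each $\varphi^{-1}(\Delta)$ is a finite union of open intervals and points, and such that $\Delta,\Psi$ are adjacent whenever $\varphi$ takes exactly the values $\Delta,\Psi$ on some interval $[x,y]\subseteq[0,1]$. A *path in $\mathcal C$ from a vertex $s$ to a vertex $t$* is a continuous curve $\pi:[0,1]\to\mathbb R^d$ together with a simplicial path $\varphi$ such that $\varphi(0)=\{s\}$, $\varphi(1)=\{t\}$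 and, for every $u\in[0,1]$, $\varphi(u)$ is the lowest-dimensional one among its faces whose convex hull contains $\pi(u)$. The *weak Fréchet distance* of two curves $\pi,\sigma$ is $\inf_{f,g}\max_{u\in[0,1]}\|\pi(f(u))-\sigma(g(u))\|$ over all continuous $f,g:[0,1]\to[0,1]$ fixing $0$ and $1$; the (monotone) *Fréchet distance* is the same infimum over those $f,g$ that are moreover injective. The model of computation is the real RAM: arrays of natural numbers and arrays of real numbers, indirect addressing, and, at unit cost, addition, truncated subtraction and comparison of natural numbers and $+,-,\times,/$ and exact comparison of real numbers. A complex is given by the list of its vertices with their coordinates and the list of its simplices, each as a list of vertex indices, in arbitrary order. **Theorem.** For every $d$ there are a real RAM program and a constant $C$ such that the following holds. Let $\mathcal C_1,\mathcal C_2$ be connected complexes in $\mathbb R^d$ and $n=\max(|\mathcal C_1|,|\mathcal C_2|)$; let $s_1,t_1$ be vertices of $\mathcal C_1$ and $s_2,t_2$ vertices of $\mathcal C_2$. On this input (for any listing of the complexes), the program halts within $Cn^2$ steps and outputs two polygonal curves $\pi,\sigma$ with the same number (at most $Cn^2$) of segments, each given by its successive vertices and, for every segment, a simplex that contains it, such that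 1. $\pi$ is a path in $\mathcal C_1$ from $s_1$ to $t_1$ and $\sigma$ is a path in $\mathcal C_2$ from $s_2$ to $t_2$, with simplicial paths that on every segment take only faces of the simplex given for it; 2. among all pairs $(\pi',\sigma')$ of a path in $\mathcal C_1$ from $s_1$ to $t_1$ and a path in $\mathcal C_2$ from $s_2$ to $t_2$, the pair $(\pi,\sigma)$ minimizes the weak Fréchet distance, and it also minimizes the Fréchet distance; 3. traversing the $i$-th segments of $\pi$ and $\sigma$ simultaneously at constant speed, for $i=1,2,\dots$, realizes the weak Fréchet distance: $\max_{u}\|\pi(u)-\sigma(u)\|$ equals the weak Fréchet distance of $\pi$ and $\sigma$. -/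

import Mathlib

/-! ### Complexes in Euclidean space -/

/-- A (finite) complex in `ℝ^d`: a finite abstract simplicial complex whose ground set consists of
points of `ℝ^d`, together with the realization that sends a simplex to its convex hull.
Every simplex is affinely independent, and the realization is locally consistent: two simplices
that share a vertex meet exactly in their common face. Disjoint simplices may have intersecting
realizations, as in a self-crossing polygonal curve. The empty simplex is not listed. -/
structure GeomComplex (d : ℕ) extends PreAbstractSimplicialComplex (EuclideanSpace ℝ (Fin d)) where
  finite_faces : faces.Finite
  indep : ∀ Ψ ∈ faces, AffineIndependent ℝ ((↑) : Ψ → EuclideanSpace ℝ (Fin d))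
  locally_consistent : ∀ Ψ ∈ faces, ∀ Υ ∈ faces,
    ((Ψ : Set (EuclideanSpace ℝ (Fin d))) ∩ (Υ : Set (EuclideanSpace ℝ (Fin d)))).Nonempty →
      convexHull ℝ (Ψ : Set (EuclideanSpace ℝ (Fin d))) ∩
          convexHull ℝ (Υ : Set (EuclideanSpace ℝ (Fin d))) =
        convexHull ℝ
          ((Ψ : Set (EuclideanSpace ℝ (Fin d))) ∩ (Υ : Set (EuclideanSpace ℝ (Fin d))))

namespace GeomComplex

variable {d : ℕ}

/-- Two simplices are adjacent if one contains the other. -/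
def Adjacent (Ψ Υ : Finset (EuclideanSpace ℝ (Fin d))) : Prop :=
  Ψ ⊆ Υ ∨ Υ ⊆ Ψ

/-- The size of a complex: its number of simplices (of all dimensions). -/
noncomputable def size (K : GeomComplex d) : ℕ := K.faces.ncard

/-- Any two simplices are joined by a chain of successively adjacent simplices. -/
def Connected (K : GeomComplex d) : Prop :=
  ∀ Ψ ∈ K.faces, ∀ Υ ∈ K.faces,
    Relation.ReflTransGen (fun A B => A ∈ K.faces ∧ B ∈ K.faces ∧ Adjacent A B) Ψ Υ

/-- A simplicial path in `K`: a function from `[0,1]` to the simplices of `K` such that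
every simplex is taken on a finite union of open intervals and points, and
whenever the function takes exactly the values `Δ` and `Ψ` on a closed interval, these two
simplices are adjacent. -/
structure IsSimplicialPath (K : GeomComplex d)
    (φ : unitInterval → Finset (EuclideanSpace ℝ (Fin d))) : Prop where
  mem_faces : ∀ t, φ t ∈ K.faces
  tame : ∀ Δ ∈ K.faces, ∃ (S : Finset (unitInterval × unitInterval)) (T : Finset unitInterval),
    {t | φ t = Δ} = (⋃ p ∈ S, Set.Ioo p.1 p.2) ∪ (T : Set unitInterval)
  adjacent : ∀ x y : unitInterval, x ≤ y → ∀ Δ Ψ, φ '' Set.Icc x y = {Δ, Ψ} → Adjacent Δ Ψ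

/-- The curve `π` realizes `φ`: at every time `t` the point `π t` lies in the realization of the
simplex `φ t`, and `φ t` is the lowest dimensional one among its faces that contains `π t`. -/
def Realizes (π : C(unitInterval, EuclideanSpace ℝ (Fin d)))
    (φ : unitInterval → Finset (EuclideanSpace ℝ (Fin d))) : Prop :=
  ∀ t, π t ∈ convexHull ℝ (φ t : Set (EuclideanSpace ℝ (Fin d))) ∧
    ∀ Ψ, Ψ ⊂ φ t → π t ∉ convexHull ℝ (Ψ : Set (EuclideanSpace ℝ (Fin d)))

/-- `π`, with its associated simplicial path `φ`, is a path in `K` from the vertex `s` to the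
vertex `t`. -/
structure IsPath (K : GeomComplex d) (s t : EuclideanSpace ℝ (Fin d))
    (π : C(unitInterval, EuclideanSpace ℝ (Fin d)))
    (φ : unitInterval → Finset (EuclideanSpace ℝ (Fin d))) : Prop where
  simplicial : K.IsSimplicialPath φ
  realizes : Realizes π φ
  source : φ 0 = {s}
  target : φ 1 = {t}

/-- A listing of a complex, which is how it is given to an algorithm: an enumeration of its
vertices, an enumeration of its simplices, and for every simplex a list, in some order and without
repetition, of the indices of its vertices. -/
structure Listing (K : GeomComplex d) where
  numVerts : ℕ
  vert : Fin numVerts → EuclideanSpace ℝ (Fin d)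
  vert_injective : Function.Injective vert
  range_vert : Set.range vert = {v | {v} ∈ K.faces}
  face : Fin K.size ≃ {Ψ // Ψ ∈ K.faces}
  cell : Fin K.size → List (Fin numVerts)
  cell_nodup : ∀ i, (cell i).Nodup
  mem_face : ∀ i v, v ∈ (face i).1 ↔ ∃ j ∈ cell i, vert j = v

end GeomComplex

/-! ### Fréchet distances -/

section Frechet

variable {d : ℕ}

/-- The width of two curves under two maps of the parameter interval. -/
noncomputable def curveWidth (π σ : C(unitInterval, EuclideanSpace ℝ (Fin d)))
    (f g : C(unitInterval, unitInterval)) : ℝ :=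
  ⨆ s : unitInterval, dist (π (f s)) (σ (g s))

/-- A weak reparameterization: continuous and fixing both endpoints. -/
def IsWeakReparam (f : C(unitInterval, unitInterval)) : Prop := f 0 = 0 ∧ f 1 = 1

/-- The weak Fréchet distance of two curves. -/
noncomputable def weakFrechetDist (π σ : C(unitInterval, EuclideanSpace ℝ (Fin d))) : ℝ :=
  sInf {w | ∃ f g : C(unitInterval, unitInterval),
    IsWeakReparam f ∧ IsWeakReparam g ∧ w = curveWidth π σ f g}

/-- The (monotone) Fréchet distance of two curves: the reparameterizations are also injective. -/
noncomputable def frechetDist (π σ : C(unitInterval, EuclideanSpace ℝ (Fin d))) : ℝ :=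
  sInf {w | ∃ f g : C(unitInterval, unitInterval), IsWeakReparam f ∧ Function.Injective f ∧
    IsWeakReparam g ∧ Function.Injective g ∧ w = curveWidth π σ f g}

end Frechet

/-! ### The real random access machine -/

namespace RealRAM

/-- The memory: a bank of arrays of natural numbers and a bank of arrays of real numbers.
A program only names finitely many of the arrays; entry `0` of an array serves as a register. -/
structure State where
  nat : ℕ → ℕ → ℕ
  real : ℕ → ℕ → ℝ

/-- Integer expressions: constants, array access, sum, truncated difference. There is no
multiplication, and no conversion of reals to integers. -/
inductive NExp where
  | const (k : ℕ)
  | get (a : ℕ) (i : NExp)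
  | add (e₁ e₂ : NExp)
  | sub (e₁ e₂ : NExp)

/-- Real expressions: rational constants, array access and the four arithmetic operations. -/
inductive RExp where
  | const (q : ℚ)
  | get (a : ℕ) (i : NExp)
  | add (e₁ e₂ : RExp)
  | sub (e₁ e₂ : RExp)
  | mul (e₁ e₂ : RExp)
  | div (e₁ e₂ : RExp)

/-- Tests: exact comparisons of integers and of reals, and their Boolean combinations. -/
inductive Test where
  | nle (e₁ e₂ : NExp)
  | rle (e₁ e₂ : RExp)
  | not (b : Test)
  | and (b₁ b₂ : Test)

/-- Programs. -/
inductive Cmd where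
  | skip
  | setNat (a : ℕ) (i e : NExp)
  | setReal (a : ℕ) (i : NExp) (e : RExp)
  | seq (c₁ c₂ : Cmd)
  | ite (b : Test) (c₁ c₂ : Cmd)
  | while (b : Test) (c : Cmd)

/-- The value of an integer expression. -/
def NExp.eval (s : State) : NExp → ℕ
  | .const k => k
  | .get a i => s.nat a (i.eval s)
  | .add e₁ e₂ => e₁.eval s + e₂.eval s
  | .sub e₁ e₂ => e₁.eval s - e₂.eval s

/-- The value of a real expression (a quotient by zero has value zero). -/
noncomputable def RExp.eval (s : State) : RExp → ℝ
  | .const q => (q : ℝ)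
  | .get a i => s.real a (i.eval s)
  | .add e₁ e₂ => e₁.eval s + e₂.eval s
  | .sub e₁ e₂ => e₁.eval s - e₂.eval s
  | .mul e₁ e₂ => e₁.eval s * e₂.eval s
  | .div e₁ e₂ => e₁.eval s / e₂.eval s

/-- The truth of a test. -/
def Test.Holds (s : State) : Test → Prop
  | .nle e₁ e₂ => e₁.eval s ≤ e₂.eval s
  | .rle e₁ e₂ => e₁.eval s ≤ e₂.eval s
  | .not b => ¬ b.Holds s
  | .and b₁ b₂ => b₁.Holds s ∧ b₂.Holds s

/-- The number of steps that the evaluation of an integer expression takes: one for each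
constant, memory access and operation. -/
def NExp.cost : NExp → ℕ
  | .const _ => 1
  | .get _ i => i.cost + 1
  | .add e₁ e₂ => e₁.cost + e₂.cost + 1
  | .sub e₁ e₂ => e₁.cost + e₂.cost + 1

/-- The number of steps that the evaluation of a real expression takes. -/
def RExp.cost : RExp → ℕ
  | .const _ => 1
  | .get _ i => i.cost + 1
  | .add e₁ e₂ => e₁.cost + e₂.cost + 1
  | .sub e₁ e₂ => e₁.cost + e₂.cost + 1
  | .mul e₁ e₂ => e₁.cost + e₂.cost + 1
  | .div e₁ e₂ => e₁.cost + e₂.cost + 1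

/-- The number of steps that the evaluation of a test takes. -/
def Test.cost : Test → ℕ
  | .nle e₁ e₂ => e₁.cost + e₂.cost + 1
  | .rle e₁ e₂ => e₁.cost + e₂.cost + 1
  | .not b => b.cost + 1
  | .and b₁ b₂ => b₁.cost + b₂.cost + 1

/-- The memory after entry `i` of integer array `a` is set to `x`. -/
def State.updNat (s : State) (a i x : ℕ) : State :=
  { s with nat := Function.update s.nat a (Function.update (s.nat a) i x) }

/-- The memory after entry `i` of real array `a` is set to `x`. -/
noncomputable def State.updReal (s : State) (a i : ℕ) (x : ℝ) : State :=
  { s with real := Function.update s.real a (Function.update (s.real a) i x) }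

/-- `Exec c s T s'`: started in memory `s`, the program `c` halts after exactly `T` steps in
memory `s'`. -/
inductive Exec : Cmd → State → ℕ → State → Prop where
  | skip (s : State) : Exec .skip s 1 s
  | setNat (s : State) (a : ℕ) (i e : NExp) :
      Exec (.setNat a i e) s (i.cost + e.cost + 1) (s.updNat a (i.eval s) (e.eval s))
  | setReal (s : State) (a : ℕ) (i : NExp) (e : RExp) :
      Exec (.setReal a i e) s (i.cost + e.cost + 1) (s.updReal a (i.eval s) (e.eval s))
  | seq {c₁ c₂ : Cmd} {s s' s'' : State} {T₁ T₂ : ℕ} :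
      Exec c₁ s T₁ s' → Exec c₂ s' T₂ s'' → Exec (.seq c₁ c₂) s (T₁ + T₂) s''
  | iteTrue {b : Test} {c₁ c₂ : Cmd} {s s' : State} {T : ℕ} :
      b.Holds s → Exec c₁ s T s' → Exec (.ite b c₁ c₂) s (b.cost + T + 1) s'
  | iteFalse {b : Test} {c₁ c₂ : Cmd} {s s' : State} {T : ℕ} :
      ¬ b.Holds s → Exec c₂ s T s' → Exec (.ite b c₁ c₂) s (b.cost + T + 1) s'
  | whileFalse {b : Test} {c : Cmd} {s : State} :
      ¬ b.Holds s → Exec (.while b c) s (b.cost + 1) s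
  | whileTrue {b : Test} {c : Cmd} {s s' s'' : State} {T₁ T₂ : ℕ} :
      b.Holds s → Exec c s T₁ s' → Exec (.while b c) s' T₂ s'' →
        Exec (.while b c) s (b.cost + T₁ + 1 + T₂) s''

end RealRAM

/-! ### Input and output -/

namespace GeomComplex.Listing

variable {d : ℕ} {K : GeomComplex d}

/-- Header of the input: numbers of vertices and of simplices, indices of start and end vertex. -/
noncomputable def header (L : K.Listing) (s t : Fin L.numVerts) : ℕ → ℕ :=
  fun i => [L.numVerts, K.size, (s : ℕ), (t : ℕ)].getD i 0

/-- Entry `i` is the number of vertices of simplex `i`. -/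
noncomputable def cellCard (L : K.Listing) : ℕ → ℕ :=
  fun i => if h : i < K.size then (L.cell ⟨i, h⟩).length else 0

/-- Entry `i * (d + 1) + j`, with `j ≤ d`, is the index of the `j`-th vertex of simplex `i`
(a simplex in `ℝ^d` has at most `d + 1` vertices; unused entries are `0`). -/
noncomputable def cellVerts (L : K.Listing) : ℕ → ℕ :=
  fun k => if h : k / (d + 1) < K.size then
    ((L.cell ⟨k / (d + 1), h⟩).map (fun v => (v : ℕ))).getD (k % (d + 1)) 0 else 0

/-- Entry `i * d + j`, with `j < d`, is the `j`-th coordinate of vertex `i`. -/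
noncomputable def coords (L : K.Listing) : ℕ → ℝ :=
  fun k => if h : k / d < L.numVerts ∧ k % d < d then
    L.vert ⟨k / d, h.1⟩ ⟨k % d, h.2⟩ else 0

end GeomComplex.Listing

section InputOutput

variable {d : ℕ}

/-- The initial memory: the integer arrays `0, 1, 2` and the real array `0` hold the first
complex with its start and end vertex, the integer arrays `3, 4, 5` and the real array `1` hold the
second one, everything else is `0`. -/
noncomputable def inputState {K₁ K₂ : GeomComplex d}
    (L₁ : K₁.Listing) (s₁ t₁ : Fin L₁.numVerts)
    (L₂ : K₂.Listing) (s₂ t₂ : Fin L₂.numVerts) : RealRAM.State where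
  nat
    | 0 => L₁.header s₁ t₁
    | 1 => L₁.cellCard
    | 2 => L₁.cellVerts
    | 3 => L₂.header s₂ t₂
    | 4 => L₂.cellCard
    | 5 => L₂.cellVerts
    | _ => fun _ => 0
  real
    | 0 => L₁.coords
    | 1 => L₂.coords
    | _ => fun _ => 0

/-- The number of segments of the two polygonal curves in the output. -/
def outLength (s : RealRAM.State) : ℕ := s.nat 6 0

/-- The `i`-th point stored in the real array `a`. -/
noncomputable def outPoint (d : ℕ) (s : RealRAM.State) (a i : ℕ) : EuclideanSpace ℝ (Fin d) :=
  WithLp.toLp 2 fun j => s.real a (i * d + j)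

/-- The polygonal curve through `p 0, …, p m`, where time `i / m` belongs to `p i` and every
segment is traversed at constant speed. -/
noncomputable def polyline (m : ℕ) (p : ℕ → EuclideanSpace ℝ (Fin d)) (t : ℝ) :
    EuclideanSpace ℝ (Fin d) :=
  p ⌊(m : ℝ) * t⌋₊ + ((m : ℝ) * t - ⌊(m : ℝ) * t⌋₊) • (p (⌊(m : ℝ) * t⌋₊ + 1) - p ⌊(m : ℝ) * t⌋₊)

/-- The curve `π` with its simplicial path `φ` is described by the points `p 0, …, p m` and the
simplex indices `c 0, …, c (m - 1)`: `π` is the polygonal curve through the points, and on the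
`i`-th segment it runs inside simplex number `c i`, that is, `φ` only takes faces of it there. -/
def DescribesCurve {K : GeomComplex d} (L : K.Listing) (m : ℕ)
    (p : ℕ → EuclideanSpace ℝ (Fin d)) (c : ℕ → ℕ)
    (π : C(unitInterval, EuclideanSpace ℝ (Fin d)))
    (φ : unitInterval → Finset (EuclideanSpace ℝ (Fin d))) : Prop :=
  (∀ t : unitInterval, π t = polyline m p t) ∧
  ∀ i < m, ∃ h : c i < K.size, ∀ t : unitInterval,
    (i : ℝ) ≤ m * (t : ℝ) → m * (t : ℝ) ≤ i + 1 → φ t ⊆ (L.face ⟨c i, h⟩).1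

end InputOutput

namespace RealRAM

/-! ### Program logic for the real RAM -/

/-! Take the pairs (Ψ, Υ) of a simplex of each complex as the nodes of a graph, weighted by the
squared distance of their convex hulls, and join two nodes that agree in one component and are
adjacent in the other. The optimal distance is the bottleneck value of this graph: the least w such
that the pair of start vertices is joined to the pair of end vertices through nodes at distance at
most w.

Lower bound. Along a path the simplex at time t is a face of the simplices at all nearby times
(`IsSimplicialPath.eventually_subset`): it is adjacent to them, the convex hulls are closed, and it
is minimal for its point. So in any simultaneous traversal of two paths, the pairs of simplices at
two close times are at most two steps apart, and connectedness of the unit interval gives a chain of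
nodes that are as near as the traversal (`pairStep_of_isPath`). Monotonicity plays no role, so the
bound holds for both Fréchet distances.

Upper bound. Choose a closest pair of points in every node of an optimal chain and join successive
choices by segments. Two joined nodes lie in the larger one of them, so the segments run in
simplices (`isPath_polyline`), and convexity of the norm keeps corresponding points within w
(`dist_polyline_le`). The simultaneous traversal is the identity reparameterization, which is
injective, so it serves both distances.

Computation. A simplex in dimension d has at most 2^(d+1) faces, so there are O(n²) arcs
(`facePairs_le`). The arc weight is that of its smaller pair, which is the farther one. Closest
points need only field operations: the shortest difference vector is the point of least norm in the
affine span of finitely many vertex differences, with nonnegative coefficients (`exists_candidate`),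
and for fixed d all candidates can be tried. The bottleneck value takes linear time: use an
approximate median as threshold; if the terminals are joined below it, keep only the lighter arcs,
otherwise contract the components and keep only the heavier ones (`Inv.low`, `Inv.high`). A fixed
fraction of the arcs disappears each time, so the costs form a geometric series. The approximate
median is the median of a sample that is repeatedly thinned out (`IsSample.thin`,
`IsSample.isPivot`). A last search at the optimal threshold in the uncontracted graph yields the
chain itself. -/

theorem State.updNat_nat (s : State) (a i x b : ℕ) :
    (s.updNat a i x).nat b = if b = a then Function.update (s.nat a) i x else s.nat b := by
  simp only [State.updNat, Function.update_apply]

theorem State.updReal_real (s : State) (a i : ℕ) (x : ℝ) (b : ℕ) :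
    (s.updReal a i x).real b = if b = a then Function.update (s.real a) i x else s.real b := by
  simp only [State.updReal, Function.update_apply]

@[simp] theorem State.updNat_real (s : State) (a i x : ℕ) : (s.updNat a i x).real = s.real := rfl

@[simp] theorem State.updReal_nat (s : State) (a i : ℕ) (x : ℝ) :
    (s.updReal a i x).nat = s.nat := rfl

/-- The integer register `v`. -/
abbrev NExp.var (v : ℕ) : NExp := .get v (.const 0)

/-- The real register `v`. -/
abbrev RExp.var (v : ℕ) : RExp := .get v (.const 0)

/-- Assignment to an integer register. -/
abbrev Cmd.letNat (v : ℕ) (e : NExp) : Cmd := .setNat v (.const 0) e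

/-- Assignment to a real register. -/
abbrev Cmd.letReal (v : ℕ) (e : RExp) : Cmd := .setReal v (.const 0) e

/-- Equality of integers. -/
def Test.neq (e₁ e₂ : NExp) : Test := .and (.nle e₁ e₂) (.nle e₂ e₁)

/-- Strict order of integers. -/
def Test.nlt (e₁ e₂ : NExp) : Test := .not (.nle e₂ e₁)

/-- Equality of reals. -/
def Test.req (e₁ e₂ : RExp) : Test := .and (.rle e₁ e₂) (.rle e₂ e₁)

/-- Strict order of reals. -/
def Test.rlt (e₁ e₂ : RExp) : Test := .not (.rle e₂ e₁)

/-- Disjunction. -/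
def Test.or (b₁ b₂ : Test) : Test := .not (.and (.not b₁) (.not b₂))

@[simp] theorem Test.holds_nle (s : State) (e₁ e₂ : NExp) :
    (Test.nle e₁ e₂).Holds s ↔ e₁.eval s ≤ e₂.eval s := Iff.rfl

@[simp] theorem Test.holds_rle (s : State) (e₁ e₂ : RExp) :
    (Test.rle e₁ e₂).Holds s ↔ e₁.eval s ≤ e₂.eval s := Iff.rfl

@[simp] theorem Test.holds_not (s : State) (b : Test) : (Test.not b).Holds s ↔ ¬ b.Holds s :=
  Iff.rfl

@[simp] theorem Test.holds_and (s : State) (b₁ b₂ : Test) :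
    (Test.and b₁ b₂).Holds s ↔ b₁.Holds s ∧ b₂.Holds s := Iff.rfl

@[simp] theorem Test.holds_neq (s : State) (e₁ e₂ : NExp) :
    (Test.neq e₁ e₂).Holds s ↔ e₁.eval s = e₂.eval s := by
  simp [Test.neq, le_antisymm_iff]

@[simp] theorem Test.holds_nlt (s : State) (e₁ e₂ : NExp) :
    (Test.nlt e₁ e₂).Holds s ↔ e₁.eval s < e₂.eval s := by
  simp [Test.nlt]

@[simp] theorem Test.holds_req (s : State) (e₁ e₂ : RExp) :
    (Test.req e₁ e₂).Holds s ↔ e₁.eval s = e₂.eval s := by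
  simp [Test.req, le_antisymm_iff]

@[simp] theorem Test.holds_rlt (s : State) (e₁ e₂ : RExp) :
    (Test.rlt e₁ e₂).Holds s ↔ e₁.eval s < e₂.eval s := by
  simp [Test.rlt]

@[simp] theorem Test.holds_or (s : State) (b₁ b₂ : Test) :
    (Test.or b₁ b₂).Holds s ↔ b₁.Holds s ∨ b₂.Holds s := by
  simp [Test.or]; tauto

@[simp] theorem NExp.eval_const (s : State) (k : ℕ) : (NExp.const k).eval s = k := rfl
@[simp] theorem NExp.eval_get (s : State) (a : ℕ) (i : NExp) :
    (NExp.get a i).eval s = s.nat a (i.eval s) := rfl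
@[simp] theorem NExp.eval_add (s : State) (e₁ e₂ : NExp) :
    (NExp.add e₁ e₂).eval s = e₁.eval s + e₂.eval s := rfl
@[simp] theorem NExp.eval_sub (s : State) (e₁ e₂ : NExp) :
    (NExp.sub e₁ e₂).eval s = e₁.eval s - e₂.eval s := rfl
@[simp] theorem RExp.eval_const (s : State) (q : ℚ) : (RExp.const q).eval s = q := rfl
@[simp] theorem RExp.eval_get (s : State) (a : ℕ) (i : NExp) :
    (RExp.get a i).eval s = s.real a (i.eval s) := rfl
@[simp] theorem RExp.eval_add (s : State) (e₁ e₂ : RExp) :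
    (RExp.add e₁ e₂).eval s = e₁.eval s + e₂.eval s := rfl
@[simp] theorem RExp.eval_sub (s : State) (e₁ e₂ : RExp) :
    (RExp.sub e₁ e₂).eval s = e₁.eval s - e₂.eval s := rfl
@[simp] theorem RExp.eval_mul (s : State) (e₁ e₂ : RExp) :
    (RExp.mul e₁ e₂).eval s = e₁.eval s * e₂.eval s := rfl
@[simp] theorem RExp.eval_div (s : State) (e₁ e₂ : RExp) :
    (RExp.div e₁ e₂).eval s = e₁.eval s / e₂.eval s := rfl

/-- Whether a program may write to the integer array `a`. -/
def Cmd.wN : Cmd → ℕ → Bool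
  | .skip, _ => false
  | .setNat b _ _, a => a == b
  | .setReal _ _ _, _ => false
  | .seq c₁ c₂, a => c₁.wN a || c₂.wN a
  | .ite _ c₁ c₂, a => c₁.wN a || c₂.wN a
  | .while _ c, a => c.wN a

/-- Whether a program may write to the real array `a`. -/
def Cmd.wR : Cmd → ℕ → Bool
  | .skip, _ => false
  | .setNat _ _ _, _ => false
  | .setReal b _ _, a => a == b
  | .seq c₁ c₂, a => c₁.wR a || c₂.wR a
  | .ite _ c₁ c₂, a => c₁.wR a || c₂.wR a
  | .while _ c, a => c.wR a

/-- The memories `s` and `s'` agree on all arrays to which `c` does not write. -/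
structure Cmd.Same (c : Cmd) (s s' : State) : Prop where
  nat : ∀ a, c.wN a = false → s'.nat a = s.nat a
  real : ∀ a, c.wR a = false → s'.real a = s.real a

theorem Cmd.Same.refl (c : Cmd) (s : State) : c.Same s s := ⟨fun _ _ => rfl, fun _ _ => rfl⟩

theorem Cmd.Same.trans {c : Cmd} {s s' s'' : State} (h : c.Same s s') (h' : c.Same s' s'') :
    c.Same s s'' :=
  ⟨fun a ha => (h'.nat a ha).trans (h.nat a ha), fun a ha => (h'.real a ha).trans (h.real a ha)⟩

theorem Cmd.Same.mono {c c' : Cmd} {s s' : State} (h : c.Same s s')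
    (hN : ∀ a, c'.wN a = false → c.wN a = false) (hR : ∀ a, c'.wR a = false → c.wR a = false) :
    c'.Same s s' :=
  ⟨fun a ha => h.nat a (hN a ha), fun a ha => h.real a (hR a ha)⟩

/-- Frame rule. `Cmd.wN` and `Cmd.wR` compute on the program text, so for concrete programs the
preservation of an array is settled by `rfl`. -/
theorem Exec.same {c : Cmd} {s s' : State} {T : ℕ} (h : Exec c s T s') : c.Same s s' := by
  induction h with
  | skip s => exact Cmd.Same.refl _ _
  | setNat s a i e =>
    refine ⟨fun b hb => ?_, fun _ _ => rfl⟩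
    have : b ≠ a := by simpa [Cmd.wN] using hb
    rw [State.updNat_nat, if_neg this]
  | setReal s a i e =>
    refine ⟨fun _ _ => rfl, fun b hb => ?_⟩
    have : b ≠ a := by simpa [Cmd.wR] using hb
    rw [State.updReal_real, if_neg this]
  | seq _ _ h₁ h₂ =>
    refine Cmd.Same.trans (h₁.mono ?_ ?_) (h₂.mono ?_ ?_) <;> simp +contextual [Cmd.wN, Cmd.wR]
  | iteTrue _ _ h => refine h.mono ?_ ?_ <;> simp +contextual [Cmd.wN, Cmd.wR]
  | iteFalse _ _ h => refine h.mono ?_ ?_ <;> simp +contextual [Cmd.wN, Cmd.wR]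
  | whileFalse _ => exact Cmd.Same.refl _ _
  | whileTrue _ _ _ h₁ h₂ =>
    refine Cmd.Same.trans (h₁.mono ?_ ?_) (h₂.mono ?_ ?_) <;> simp +contextual [Cmd.wN, Cmd.wR]

/-- Started in memory `s`, the program `c` halts within `k` steps in a memory that satisfies
`Q`. -/
def Runs (c : Cmd) (s : State) (k : ℕ) (Q : State → Prop) : Prop :=
  ∃ T s', Exec c s T s' ∧ T ≤ k ∧ Q s'

theorem Runs.mono {c : Cmd} {s : State} {k k' : ℕ} {Q Q' : State → Prop} (h : Runs c s k Q)
    (hk : k ≤ k') (hQ : ∀ s', c.Same s s' → Q s' → Q' s') : Runs c s k' Q' := by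
  obtain ⟨T, s', he, hT, hq⟩ := h
  exact ⟨T, s', he, hT.trans hk, hQ s' he.same hq⟩

theorem Runs.seq {c₁ c₂ : Cmd} {s : State} {k₁ k₂ : ℕ} {Q R : State → Prop}
    (h₁ : Runs c₁ s k₁ R) (h₂ : ∀ s', c₁.Same s s' → R s' → Runs c₂ s' k₂ Q) :
    Runs (.seq c₁ c₂) s (k₁ + k₂) Q := by
  obtain ⟨T, s', he, hT, hq⟩ := h₁
  obtain ⟨T', s'', he', hT', hq'⟩ := h₂ s' he.same hq
  exact ⟨_, _, .seq he he', by omega, hq'⟩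

theorem Runs.ite {b : Test} {c₁ c₂ : Cmd} {s : State} {k : ℕ} {Q : State → Prop}
    (h₁ : b.Holds s → Runs c₁ s k Q) (h₂ : ¬ b.Holds s → Runs c₂ s k Q) :
    Runs (.ite b c₁ c₂) s (b.cost + k + 1) Q := by
  by_cases hb : b.Holds s
  · obtain ⟨T, s', he, hT, hq⟩ := h₁ hb
    exact ⟨_, _, .iteTrue hb he, by omega, hq⟩
  · obtain ⟨T, s', he, hT, hq⟩ := h₂ hb
    exact ⟨_, _, .iteFalse hb he, by omega, hq⟩

/-- The weakest precondition of a program without loops. -/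
def Cmd.wp : Cmd → (State → Prop) → State → Prop
  | .skip, Q, s => Q s
  | .setNat a i e, Q, s => Q (s.updNat a (i.eval s) (e.eval s))
  | .setReal a i e, Q, s => Q (s.updReal a (i.eval s) (e.eval s))
  | .seq c₁ c₂, Q, s => c₁.wp (c₂.wp Q) s
  | .ite b c₁ c₂, Q, s => (b.Holds s → c₁.wp Q s) ∧ (¬ b.Holds s → c₂.wp Q s)
  | .while _ _, _, _ => False

/-- A bound for the number of steps of a program without loops. -/
def Cmd.bound : Cmd → ℕ
  | .skip => 1
  | .setNat _ i e => i.cost + e.cost + 1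
  | .setReal _ i e => i.cost + e.cost + 1
  | .seq c₁ c₂ => c₁.bound + c₂.bound
  | .ite b c₁ c₂ => b.cost + max c₁.bound c₂.bound + 1
  | .while _ _ => 0

/-- Loops have precondition `False`, so the value 0 that `Cmd.bound` gives them is never relied
upon. -/
theorem Runs.of_wp {c : Cmd} {s : State} {Q : State → Prop} (h : c.wp Q s) :
    Runs c s c.bound Q := by
  induction c generalizing s Q with
  | skip => exact ⟨_, _, .skip s, le_rfl, h⟩
  | setNat a i e => exact ⟨_, _, .setNat s a i e, le_rfl, h⟩
  | setReal a i e => exact ⟨_, _, .setReal s a i e, le_rfl, h⟩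
  | seq c₁ c₂ ih₁ ih₂ => exact (ih₁ h).seq fun s' _ hs' => ih₂ hs'
  | ite b c₁ c₂ ih₁ ih₂ =>
    exact Runs.ite (fun hb => (ih₁ (h.1 hb)).mono (le_max_left _ _) fun _ _ h => h)
      (fun hb => (ih₂ (h.2 hb)).mono (le_max_right _ _) fun _ _ h => h)
  | _ b c => exact h.elim

/-- Amortized rule for loops: every iteration is paid for by a drop of the potential `Φ`. -/
theorem Runs.while {b : Test} {c : Cmd} {s₀ : State} (I : State → Prop) (Φ : State → ℕ)
    (h₀ : I s₀) (step : ∀ s, I s → c.Same s₀ s → b.Holds s →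
      ∃ k, Runs c s k fun s' => I s' ∧ k + b.cost + 1 + Φ s' ≤ Φ s) :
    Runs (.while b c) s₀ (Φ s₀ + b.cost + 1) fun s' => I s' ∧ ¬ b.Holds s' := by
  -- Induction on a bound for the potential. At bound 0 the loop test must fail, because a further
  -- round would cost at least one step.
  have key : ∀ n s, Φ s ≤ n → I s → c.Same s₀ s →
      Runs (.while b c) s (Φ s + b.cost + 1) fun s' => I s' ∧ ¬ b.Holds s' := by
    intro n
    induction n with
    | zero =>
      intro s hn hI hs
      by_cases hb : b.Holds s
      · obtain ⟨k, T, s', -, -, -, h⟩ := step s hI hs hb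
        omega
      · exact ⟨_, _, .whileFalse hb, by omega, hI, hb⟩
    | succ n ih =>
      intro s hn hI hs
      by_cases hb : b.Holds s
      · obtain ⟨k, T, s', he, hT, hI', h⟩ := step s hI hs hb
        obtain ⟨T', s'', he', hT', hq⟩ := ih s' (by omega) hI' (hs.trans he.same)
        exact ⟨_, _, .whileTrue hb he he', by omega, hq⟩
      · exact ⟨_, _, .whileFalse hb, by omega, hI, hb⟩
  exact key _ s₀ le_rfl h₀ (Cmd.Same.refl _ _)

/-- Rule for loops whose iterations have bounded cost and decrease the measure `μ`. -/
theorem Runs.while_measure {b : Test} {c : Cmd} {s₀ : State} (I : State → Prop) (μ : State → ℕ)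
    (k : ℕ) (h₀ : I s₀) (step : ∀ s, I s → c.Same s₀ s → b.Holds s →
      Runs c s k fun s' => I s' ∧ μ s' < μ s) :
    Runs (.while b c) s₀ ((k + b.cost + 1) * (μ s₀ + 1)) fun s' => I s' ∧ ¬ b.Holds s' := by
  refine (Runs.while I (fun s => (k + b.cost + 1) * μ s) h₀ fun s hI hs hb =>
    ⟨k, (step s hI hs hb).mono le_rfl fun s' _ h => ⟨h.1, ?_⟩⟩).mono ?_ fun _ _ h => h
  · calc k + b.cost + 1 + (k + b.cost + 1) * μ s' = (k + b.cost + 1) * (μ s' + 1) := by ring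
      _ ≤ _ := Nat.mul_le_mul_left _ h.2
  · simp only [mul_add, mul_one]; omega

/-- The loop `for v = 0, …, N - 1 do c`. -/
def Cmd.for (v : ℕ) (N : NExp) (c : Cmd) : Cmd :=
  .seq (.letNat v (.const 0))
    (.while (.nlt (.var v) N) (.seq c (.letNat v (.add (.var v) (.const 1)))))

/-- The loop itself writes the counter, hence the invariant must be insensitive to it (`hI`) and the
body must not touch it (`hv`). The bound `N` is evaluated anew in every round, hence `hN`. The
overhead `N.cost + 12` per round covers the test and the increment. -/
theorem Runs.for {v : ℕ} {N : NExp} {c : Cmd} {s₀ : State} (n : ℕ) (I : ℕ → State → Prop)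
    (k : ℕ → ℕ) (hv : c.wN v = false)
    (hN : ∀ s, (Cmd.for v N c).Same s₀ s → N.eval s = n)
    (hI : ∀ j s x, I j s → I j (s.updNat v 0 x)) (h₀ : I 0 s₀)
    (step : ∀ j < n, ∀ s, I j s → (Cmd.for v N c).Same s₀ s → s.nat v 0 = j →
      Runs c s (k j) (I (j + 1))) :
    Runs (Cmd.for v N c) s₀ (∑ j ∈ Finset.range n, k j + (N.cost + 12) * (n + 1)) (I n) := by
  set W : Cmd := .seq c (.letNat v (.add (.var v) (.const 1))) with hW
  set F := Cmd.for v N c with hF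
  have hsame : ∀ s s', W.Same s s' → F.Same s s' := fun s s' h => h.mono
    (by intro a; simp +contextual [hF, hW, Cmd.for, Cmd.wN])
    (by intro a; simp +contextual [hF, hW, Cmd.for, Cmd.wR])
  have hcF : ∀ s s', c.Same s s' → F.Same s s' := fun s s' h => h.mono
    (by intro a; simp +contextual [hF, Cmd.for, Cmd.wN])
    (by intro a; simp +contextual [hF, Cmd.for, Cmd.wR])
  have hFv : F.wN v = true := by simp [hF, Cmd.for, Cmd.wN]
  have h1 : F.Same s₀ (s₀.updNat v 0 0) := by
    refine ⟨fun a ha => ?_, fun _ _ => rfl⟩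
    rw [State.updNat_nat, if_neg]
    rintro rfl
    simp [ha] at hFv
  have hupd : ∀ s x, F.Same s (s.updNat v 0 x) := by
    refine fun s x => ⟨fun a ha => ?_, fun _ _ => rfl⟩
    rw [State.updNat_nat, if_neg]
    rintro rfl
    simp [ha] at hFv
  let b : Test := .nlt (.var v) N
  have hb : b.cost = N.cost + 4 := by simp [b, Test.nlt, Test.cost, NExp.cost]
  -- The potential is the cost of the rounds that are still to come.
  let Φ : State → ℕ := fun s => ∑ j ∈ Finset.Ico (s.nat v 0) n, (k j + N.cost + 12)
  have hloop := Runs.while (b := b) (c := W) (s₀ := s₀.updNat v 0 0)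
    (fun s => s.nat v 0 ≤ n ∧ I (s.nat v 0) s ∧ F.Same s₀ s) Φ
    ⟨by simp [State.updNat_nat], by simpa [State.updNat_nat] using hI 0 s₀ 0 h₀, h1⟩
    (by
      rintro s ⟨hle, hIs, hs⟩ - hbs
      have hlt : s.nat v 0 < n := by
        have := hN s hs
        simp only [b, Test.holds_nlt, NExp.eval_get, NExp.eval_const] at hbs
        omega
      -- The 6 is the cost of incrementing the counter.
      refine ⟨k (s.nat v 0) + 6, ?_⟩
      refine ((step _ hlt s hIs hs rfl).seq (Q := fun s' => (s'.nat v 0 ≤ n ∧ I (s'.nat v 0) s' ∧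
        F.Same s₀ s') ∧ _) (k₂ := 6) fun s' hs' hI' =>
        ((Runs.of_wp (Q := _) ?_).mono (by simp [Cmd.bound, NExp.cost]) fun _ _ h => h))
      simp only [Cmd.wp, NExp.eval_add, NExp.eval_get, NExp.eval_const]
      have hv' : s'.nat v 0 = s.nat v 0 := by rw [hs'.nat v hv]
      have hnv : (s'.updNat v 0 (s'.nat v 0 + 1)).nat v 0 = s.nat v 0 + 1 := by
        simp [State.updNat_nat, hv']
      refine ⟨⟨by omega, ?_, (hs.trans (hcF _ _ hs')).trans (hupd _ _)⟩, ?_⟩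
      · rw [hnv]; exact hI _ _ _ hI'
      · simp only [Φ, hnv, hb]
        rw [← Finset.sum_Ioo_add_eq_sum_Ico hlt]
        have : Finset.Ioo (s.nat v 0) n = Finset.Ico (s.nat v 0 + 1) n := by
          ext; simp
        rw [this]
        omega)
  have hinit : Runs (.letNat v (.const 0)) s₀ 3 fun s' => s' = s₀.updNat v 0 0 :=
    Runs.of_wp (by simp [Cmd.wp])
  refine (hinit.seq (k₂ := Φ (s₀.updNat v 0 0) + b.cost + 1) (Q := I n) ?_).mono ?_ fun _ _ h => h
  · rintro s' - rfl
    refine hloop.mono le_rfl ?_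
    rintro s' - ⟨⟨hle, hIs, hs⟩, hnb⟩
    have : s'.nat v 0 = n := by
      have := hN s' hs
      simp only [b, Test.holds_nlt, NExp.eval_get, NExp.eval_const] at hnb
      omega
    rwa [this] at hIs
  · simp only [Φ, hb, State.updNat_nat, if_true, Function.update_self]
    rw [Finset.range_eq_Ico]
    simp only [add_assoc, Finset.sum_add_distrib, Finset.sum_const, Nat.card_Ico, smul_eq_mul,
      tsub_zero]
    ring_nf
    omega

/-- Rule for counting loops whose body has no loop. -/
theorem Runs.for_wp {v : ℕ} {N : NExp} {c : Cmd} {s₀ : State} (n : ℕ) (I : ℕ → State → Prop)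
    {K : ℕ} (hK : c.bound + N.cost + 12 ≤ K) (hv : c.wN v = false)
    (hN : ∀ s, (Cmd.for v N c).Same s₀ s → N.eval s = n)
    (hI : ∀ j s x, I j s → I j (s.updNat v 0 x)) (h₀ : I 0 s₀)
    (step : ∀ j < n, ∀ s, I j s → (Cmd.for v N c).Same s₀ s → s.nat v 0 = j →
      c.wp (I (j + 1)) s) :
    Runs (Cmd.for v N c) s₀ (K * (n + 1)) (I n) := by
  refine (Runs.for n I (fun _ => c.bound) hv hN hI h₀
    fun j hj s h1 h2 h3 => Runs.of_wp (step j hj s h1 h2 h3)).mono ?_ fun _ _ h => h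
  simp only [Finset.sum_const, Finset.card_range, smul_eq_mul]
  calc n * c.bound + (N.cost + 12) * (n + 1) ≤ (c.bound + N.cost + 12) * (n + 1) := by
        ring_nf; omega
    _ ≤ _ := Nat.mul_le_mul_right _ hK

theorem Runs.prefix {c₁ c₂ : Cmd} {s : State} {k₁ k₂ k : ℕ} {Q : State → Prop} (R : State → Prop)
    (hk : c₁.bound ≤ k₁) (hk' : k₁ + k₂ ≤ k) (h₁ : c₁.wp R s)
    (h₂ : ∀ s', c₁.Same s s' → R s' → Runs c₂ s' k₂ Q) : Runs (.seq c₁ c₂) s k Q :=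
  ((Runs.of_wp h₁).seq h₂).mono ((Nat.add_le_add_right hk _).trans hk') fun _ _ h => h

/-- A list of programs, executed one after the other. -/
def Cmd.seqs : List Cmd → Cmd
  | [] => .skip
  | c :: l => .seq c (Cmd.seqs l)

@[simp] theorem Cmd.wN_seqs (l : List Cmd) (a : ℕ) :
    (Cmd.seqs l).wN a = false ↔ ∀ c ∈ l, c.wN a = false := by
  induction l with
  | nil => simp [Cmd.seqs, Cmd.wN]
  | cons c l ih => simp [Cmd.seqs, Cmd.wN, ih]

@[simp] theorem Cmd.wR_seqs (l : List Cmd) (a : ℕ) :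
    (Cmd.seqs l).wR a = false ↔ ∀ c ∈ l, c.wR a = false := by
  induction l with
  | nil => simp [Cmd.seqs, Cmd.wR]
  | cons c l ih => simp [Cmd.seqs, Cmd.wR, ih]

theorem Cmd.wp_mono {c : Cmd} {Q Q' : State → Prop} {s : State} (h : c.wp Q s)
    (hQ : ∀ s, Q s → Q' s) : c.wp Q' s := by
  induction c generalizing s Q Q' with
  | skip => exact hQ _ h
  | setNat a i e => exact hQ _ h
  | setReal a i e => exact hQ _ h
  | seq c₁ c₂ ih₁ ih₂ => exact ih₁ h fun s hs => ih₂ hs hQ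
  | ite b c₁ c₂ ih₁ ih₂ => exact ⟨fun hb => ih₁ (h.1 hb) hQ, fun hb => ih₂ (h.2 hb) hQ⟩
  | _ b c => exact h.elim

/-- Lets the frame condition be added to a postcondition afterwards, so that specifications need not
list the untouched arrays. -/
theorem Cmd.wp_same {c : Cmd} {Q : State → Prop} {s : State} (h : c.wp Q s) :
    c.wp (fun s' => Q s' ∧ c.Same s s') s := by
  have aux : ∀ (c : Cmd) (Q : State → Prop) (s₁ : State), c.wp Q s₁ →
      c.wp (fun s' => Q s' ∧ c.Same s₁ s') s₁ := by
    intro c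
    induction c with
    | skip => exact fun Q s h => ⟨h, Cmd.Same.refl _ _⟩
    | setNat a i e => exact fun Q s h => ⟨h, (Exec.setNat s a i e).same⟩
    | setReal a i e => exact fun Q s h => ⟨h, (Exec.setReal s a i e).same⟩
    | seq c₁ c₂ ih₁ ih₂ =>
      intro Q s h
      change c₁.wp (c₂.wp _) s
      refine Cmd.wp_mono (ih₁ _ _ h) fun s' hs' => Cmd.wp_mono (ih₂ _ _ hs'.1) fun s'' hs'' =>
        ⟨hs''.1, Cmd.Same.trans (hs'.2.mono ?_ ?_) (hs''.2.mono ?_ ?_)⟩ <;>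
      simp +contextual [Cmd.wN, Cmd.wR]
    | ite b c₁ c₂ ih₁ ih₂ =>
      refine fun Q s h => ⟨fun hb => Cmd.wp_mono (ih₁ _ _ (h.1 hb)) fun s' hs' => ⟨hs'.1, ?_⟩,
        fun hb => Cmd.wp_mono (ih₂ _ _ (h.2 hb)) fun s' hs' => ⟨hs'.1, ?_⟩⟩
      all_goals refine hs'.2.mono ?_ ?_ <;> simp +contextual [Cmd.wN, Cmd.wR]
    | _ b c => exact fun Q s h => h.elim
  exact aux c Q s h

/-- A list of programs without loops that establishes the successive assertions `P 0, P 1, …`. -/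
theorem Cmd.wp_seqs {l : List Cmd} (P : ℕ → State → Prop) {s : State} (h₀ : P 0 s)
    (step : ∀ i (hi : i < l.length), ∀ s, P i s → l[i].wp (P (i + 1)) s) :
    (Cmd.seqs l).wp (P l.length) s := by
  induction l generalizing P s with
  | nil => exact h₀
  | cons c l ih =>
    change c.wp ((Cmd.seqs l).wp _) s
    refine Cmd.wp_mono (step 0 (by simp) s h₀) fun s' hs' => ?_
    refine ih (fun i => P (i + 1)) hs' fun i hi s hs => ?_
    have := step (i + 1) (by simpa using hi) s hs
    rwa [List.getElem_cons_succ] at this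

/-- The multiple `k * e` of an integer expression. -/
def NExp.nmul : ℕ → NExp → NExp
  | 0, _ => .const 0
  | k + 1, e => .add (NExp.nmul k e) e

@[simp] theorem NExp.eval_nmul (s : State) (k : ℕ) (e : NExp) :
    (NExp.nmul k e).eval s = e.eval s * k := by
  induction k with
  | zero => simp [NExp.nmul]
  | succ k ih => simp [NExp.nmul, ih, mul_add]

/-- The sum of a list of real expressions. -/
def RExp.sum : List RExp → RExp
  | [] => .const 0
  | e :: l => .add e (RExp.sum l)

@[simp] theorem RExp.eval_sum (s : State) (l : List RExp) :
    (RExp.sum l).eval s = (l.map fun e => e.eval s).sum := by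
  induction l with
  | nil => simp [RExp.sum]
  | cons e l ih => simp [RExp.sum, ih]

/-- The conjunction of a list of tests. -/
def Test.all : List Test → Test
  | [] => .nle (.const 0) (.const 0)
  | b :: l => .and b (Test.all l)

@[simp] theorem Test.holds_all (s : State) (l : List Test) :
    (Test.all l).Holds s ↔ ∀ b ∈ l, b.Holds s := by
  induction l with
  | nil => simp [Test.all]
  | cons b l ih => simp [Test.all, ih]

/-- The disjunction of a list of tests. -/
def Test.any (l : List Test) : Test := .not (Test.all (l.map Test.not))

@[simp] theorem Test.holds_any (s : State) (l : List Test) :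
    (Test.any l).Holds s ↔ ∃ b ∈ l, b.Holds s := by
  simp [Test.any]

end RealRAM

/-! ### Components of a threshold graph -/

/-- Connectivity through the arcs `0, …, M - 1` of weight at most `m`. -/
def ArcConn (M : ℕ) (S D : ℕ → ℕ) (W : ℕ → ℝ) (m : ℝ) : ℕ → ℕ → Prop :=
  Relation.ReflTransGen fun x y => ∃ a < M, S a = x ∧ D a = y ∧ W a ≤ m

/-- Every arc occurs in both directions with the same weight. -/
def ArcSymm (M : ℕ) (S D : ℕ → ℕ) (W : ℕ → ℝ) : Prop :=
  ∀ a < M, ∃ a' < M, S a' = D a ∧ D a' = S a ∧ W a' = W a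

theorem ArcConn.symm {M : ℕ} {S D : ℕ → ℕ} {W : ℕ → ℝ} (h : ArcSymm M S D W) {m : ℝ} {x y : ℕ}
    (hxy : ArcConn M S D W m x y) : ArcConn M S D W m y x := by
  induction hxy with
  | refl => exact .refl
  | tail _ hyz ih =>
    obtain ⟨a, ha, rfl, rfl, hw⟩ := hyz
    obtain ⟨a', ha', h1, h2, h3⟩ := h a ha
    exact .head ⟨a', ha', h1, h2, h3 ▸ hw⟩ ih

theorem ArcConn.mono {M : ℕ} {S D : ℕ → ℕ} {W : ℕ → ℝ} {m m' : ℝ} (h : m ≤ m') {x y : ℕ}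
    (hxy : ArcConn M S D W m x y) : ArcConn M S D W m' x y :=
  Relation.ReflTransGen.mono
    (fun _ _ h' => by obtain ⟨a, ha, h1, h2, h3⟩ := h'; exact ⟨a, ha, h1, h2, h3.trans h⟩) _ _ hxy

/-! ### Invariant and correctness of the graph search -/

namespace RealRAM.Search

/-- One plus the number of the last arc before arc `k` that leaves `x` with weight at most `m`;
zero if there is none. -/
noncomputable def lastArc (S : ℕ → ℕ) (W : ℕ → ℝ) (m : ℝ) (x : ℕ) : ℕ → ℕ
  | 0 => 0
  | k + 1 => if W k ≤ m ∧ S k = x then k + 1 else lastArc S W m x k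

theorem lastArc_le (S : ℕ → ℕ) (W : ℕ → ℝ) (m : ℝ) (x k : ℕ) : lastArc S W m x k ≤ k := by
  induction k with
  | zero => simp [lastArc]
  | succ k ih => rw [lastArc]; split_ifs <;> omega

theorem lastArc_spec (S : ℕ → ℕ) (W : ℕ → ℝ) (m : ℝ) (x k : ℕ) (h : lastArc S W m x k ≠ 0) :
    W (lastArc S W m x k - 1) ≤ m ∧ S (lastArc S W m x k - 1) = x := by
  induction k with
  | zero => simp [lastArc] at h
  | succ k ih =>
    rw [lastArc] at h ⊢
    split_ifs at h ⊢ with hk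
    · simpa using hk
    · exact ih h

theorem lt_lastArc {S : ℕ → ℕ} {W : ℕ → ℝ} {m : ℝ} {x k a : ℕ} (ha : a < k) (hW : W a ≤ m)
    (hS : S a = x) : a < lastArc S W m x k := by
  induction k with
  | zero => omega
  | succ k ih =>
    rw [lastArc]
    split_ifs with hk
    · omega
    · exact ih (lt_of_le_of_ne (by omega) fun h => hk (h ▸ ⟨hW, hS⟩))

/-- The data of the search that do not change: number of arcs, tails, heads and weights of arcs,
threshold, and two special vertices. -/
structure Graph where
  M : ℕ
  S : ℕ → ℕ
  D : ℕ → ℕ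
  W : ℕ → ℝ
  m : ℝ
  s : ℕ
  t : ℕ
  symm : ArcSymm M S D W

variable (G : Graph)

/-- The arc `a` belongs to the threshold graph. -/
def Graph.Light (a : ℕ) : Prop := a < G.M ∧ G.W a ≤ G.m

/-- The finite set of vertices. -/
def Graph.verts : Finset ℕ := insert G.s (insert G.t ((Finset.range G.M).image G.S))

theorem Graph.src_mem {a : ℕ} (h : a < G.M) : G.S a ∈ G.verts := by
  simp only [verts, Finset.mem_insert, Finset.mem_image, Finset.mem_range]
  exact .inr (.inr ⟨a, h, rfl⟩)

theorem Graph.dst_mem {a : ℕ} (h : a < G.M) : G.D a ∈ G.verts := by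
  obtain ⟨a', ha', h1, -⟩ := G.symm a h
  exact h1 ▸ G.src_mem ha'

/-- The invariant of the graph search: `h x` is one plus the number of the next arc to be explored
at `x`, `μ` holds the labels, `st` and `sp` form the stack, `e` is the number of the arc whose tail
is the next candidate for a new root, `r` is the current root, `p` and `δ` hold arcs to parents and
depths. -/
structure Inv (h μ st : ℕ → ℕ) (sp e r : ℕ) (p δ : ℕ → ℕ) : Prop where
  head : ∀ x ∈ G.verts, h x ≠ 0 → G.Light (h x - 1) ∧ G.S (h x - 1) = x
  stack : ∀ i < sp, st i ∈ G.verts ∧ μ (st i) = r + 1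
  arc : ∀ a, G.Light a → (a < h (G.S a) ∧ (μ (G.S a) = 0 ∨ ∃ i < sp, st i = G.S a)) ∨
    (h (G.S a) ≤ a ∧ μ (G.S a) ≠ 0 ∧ μ (G.D a) = μ (G.S a))
  label : ∀ x ∈ G.verts, μ x ≠ 0 → ArcConn G.M G.S G.D G.W G.m (μ x - 1) x
  done : ∀ a < e, μ (G.S a) ≠ 0
  e_le : e ≤ G.M
  start : μ G.s = G.s + 1
  parent : ∀ x ∈ G.verts, μ x = G.s + 1 → (x = G.s ∧ δ x = 0) ∨
    (p x ≠ 0 ∧ G.Light (p x - 1) ∧ G.D (p x - 1) = x ∧ μ (G.S (p x - 1)) = G.s + 1 ∧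
      δ x = δ (G.S (p x - 1)) + 1)
  depth : ∀ x ∈ G.verts, μ x = G.s + 1 →
    δ x + 1 + (G.verts.filter fun x => μ x = 0).card ≤ G.verts.card

/-- The measure that bounds the remaining number of steps of the graph search. -/
def measure (h μ : ℕ → ℕ) (sp e : ℕ) : ℕ :=
  ((Finset.range G.M).filter fun a => a < h (G.S a)).card +
    2 * (G.verts.filter fun x => μ x = 0).card + sp + (G.M - e)

variable {G} {h μ st : ℕ → ℕ} {sp e r : ℕ} {p δ : ℕ → ℕ}

theorem card_unmarked {x : ℕ} (hx : x ∈ G.verts) (hμ : μ x = 0) {k : ℕ} (hk : k ≠ 0) :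
    (G.verts.filter fun y => Function.update μ x k y = 0).card + 1 =
      (G.verts.filter fun x => μ x = 0).card := by
  rw [← Finset.card_erase_add_one (s := G.verts.filter fun x => μ x = 0) (a := x)
    (by simp [hx, hμ])]
  congr 2
  ext y
  by_cases hy : y = x
  · subst hy; simp [hk]
  · simp [hy]

/-- In `measure` an unlabelled vertex counts twice, which pays for its labelling and for one entry
on the stack. The clauses on parents and depths concern only the label `G.s + 1`; the new root
differs from `G.s`, which is labelled from the outset, so these clauses are not disturbed. -/
theorem Inv.newRoot (I : Inv G h μ st 0 e r p δ) (he : e < G.M) (hμ : μ (G.S e) = 0) :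
    Inv G h (Function.update μ (G.S e) (G.S e + 1)) (Function.update st 0 (G.S e)) 1 e (G.S e) p
      (Function.update δ (G.S e) 0) ∧
    measure G h (Function.update μ (G.S e) (G.S e + 1)) 1 e < measure G h μ 0 e := by
  have hcard := card_unmarked (G.src_mem he) hμ (k := G.S e + 1) (by omega)
  have hs : G.s ≠ G.S e := fun h' => by have := I.start; rw [h', hμ] at this; omega
  refine ⟨⟨I.head, ?_, ?_, ?_, ?_, I.e_le, ?_, ?_, ?_⟩, ?_⟩
  · intro i hi
    obtain rfl : i = 0 := by omega
    simp [G.src_mem he]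
  · intro a ha
    by_cases hS : G.S a = G.S e
    · rcases I.arc a ha with h1 | h1
      · exact .inl ⟨h1.1, .inr ⟨0, by simp [hS]⟩⟩
      · rw [hS] at h1; exact (h1.2.1 hμ).elim
    · rcases I.arc a ha with h1 | h1
      · refine .inl ⟨h1.1, .inl ?_⟩
        rw [Function.update_of_ne hS]
        simpa using h1.2
      · refine .inr ⟨h1.1, ?_, ?_⟩
        · rw [Function.update_of_ne hS]; exact h1.2.1
        · rw [Function.update_of_ne hS, Function.update_of_ne, h1.2.2]
          intro h2
          rw [h2, hμ] at h1
          exact h1.2.1 h1.2.2.symm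
  · intro x hx hx'
    by_cases hS : x = G.S e
    · subst hS; simp only [Function.update_self, Nat.add_sub_cancel]; exact .refl
    · rw [Function.update_of_ne hS] at hx' ⊢
      exact I.label x hx hx'
  · intro a ha
    by_cases hS : G.S a = G.S e
    · simp [hS]
    · rw [Function.update_of_ne hS]; exact I.done a ha
  · rw [Function.update_of_ne hs]; exact I.start
  · intro x hx hx'
    have hS : x ≠ G.S e := by rintro rfl; simp at hx'; exact hs hx'.symm
    rw [Function.update_of_ne hS] at hx' ⊢
    refine (I.parent x hx hx').imp id fun h1 => ⟨h1.1, h1.2.1, h1.2.2.1, ?_⟩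
    have hS' : G.S (p x - 1) ≠ G.S e := by
      intro h2; rw [h2, hμ] at h1; omega
    rw [Function.update_of_ne hS', Function.update_of_ne hS']
    exact h1.2.2.2
  · intro x hx hx'
    have hS : x ≠ G.S e := by rintro rfl; simp at hx'; exact hs hx'.symm
    rw [Function.update_of_ne hS] at hx' ⊢
    have := I.depth x hx hx'
    omega
  · simp only [measure]; omega

theorem Inv.skipRoot (I : Inv G h μ st 0 e r p δ) (he : e < G.M) (hμ : μ (G.S e) ≠ 0) :
    Inv G h μ st 0 (e + 1) r p δ ∧ measure G h μ 0 (e + 1) < measure G h μ 0 e := by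
  refine ⟨{ I with done := ?_, e_le := he }, by simp only [measure]; omega⟩
  intro a ha
  rcases Nat.lt_succ_iff_lt_or_eq.1 ha with h1 | rfl
  exacts [I.done a h1, hμ]

theorem Inv.pop (I : Inv G h μ st (sp + 1) e r p δ) (hh : h (st sp) = 0) :
    Inv G h μ st sp e r p δ ∧ measure G h μ sp e < measure G h μ (sp + 1) e := by
  refine ⟨{ I with stack := fun i hi => I.stack i (by omega), arc := ?_ }, by
    simp only [measure]; omega⟩
  intro a ha
  refine (I.arc a ha).imp (fun h1 => ⟨h1.1, h1.2.imp id ?_⟩) id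
  rintro ⟨i, hi, hi'⟩
  refine ⟨i, lt_of_le_of_ne (by omega) ?_, hi'⟩
  rintro rfl
  rw [← hi', hh] at h1
  omega

/-- The next arc leads to a labelled vertex and is used up. That this label is the current one
follows from the reverse arc: either its tail is on the stack, where all labels are current, or it
has been explored and its ends agree. The stack position `j` is arbitrary because after a push the
vertex whose list advances is no longer on top. -/
theorem Inv.advance (I : Inv G h μ st sp e r p δ) {j : ℕ} (hj : j < sp) (hh : h (st j) ≠ 0)
    (hμ : μ (G.D (h (st j) - 1)) ≠ 0) :
    Inv G (Function.update h (st j) (lastArc G.S G.W G.m (st j) (h (st j) - 1))) μ st sp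
      e r p δ ∧
    measure G (Function.update h (st j) (lastArc G.S G.W G.m (st j) (h (st j) - 1))) μ
      sp e < measure G h μ sp e := by
  obtain ⟨hv, hr⟩ := I.stack j hj
  obtain ⟨hl, hS⟩ := I.head _ hv hh
  have hle := lastArc_le G.S G.W G.m (st j) (h (st j) - 1)
  refine ⟨{ I with head := ?_, arc := ?_ }, ?_⟩
  · intro x hx hx'
    by_cases hxs : x = st j
    · subst hxs
      rw [Function.update_self] at hx' ⊢
      obtain ⟨h1, h2⟩ := lastArc_spec _ _ _ _ _ hx'
      exact ⟨⟨by have := hl.1; omega, h1⟩, h2⟩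
    · rw [Function.update_of_ne hxs] at hx' ⊢
      exact I.head x hx hx'
  · intro a ha
    by_cases hxs : G.S a = st j
    · rw [hxs, Function.update_self]
      have h1 := I.arc a ha
      rw [hxs] at h1
      rcases lt_trichotomy a (h (st j) - 1) with h2 | h2 | h2
      · exact .inl ⟨lt_lastArc h2 ha.2 hxs, .inr ⟨j, hj, rfl⟩⟩
      · refine .inr ⟨by omega, by rw [hr]; omega, ?_⟩
        obtain ⟨a', ha', h3, h4, h5⟩ := G.symm a ha.1
        rw [← h2] at hμ
        have h6 := I.arc a' ⟨ha', h5 ▸ ha.2⟩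
        rw [h3, h4, hxs] at h6
        rcases h6 with ⟨-, h6 | ⟨i, hi, h6⟩⟩ | h6
        · exact (hμ h6).elim
        · rw [← h6, hr, (I.stack i hi).2]
        · exact h6.2.2.symm
      · rcases h1 with ⟨h1, -⟩ | h1
        · omega
        · exact .inr ⟨by omega, h1.2⟩
    · rw [Function.update_of_ne hxs]; exact I.arc a ha
  · simp only [measure]
    have : ((Finset.range G.M).filter fun a => a < Function.update h (st j)
        (lastArc G.S G.W G.m (st j) (h (st j) - 1)) (G.S a)) ⊂
        (Finset.range G.M).filter fun a => a < h (G.S a) := by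
      rw [Finset.ssubset_iff_of_subset]
      · refine ⟨h (st j) - 1, ?_, ?_⟩
        · simp only [Finset.mem_filter, Finset.mem_range]; rw [hS]; exact ⟨hl.1, by omega⟩
        · simp only [Finset.mem_filter, Finset.mem_range]; rw [hS, Function.update_self]; omega
      · intro a
        simp only [Finset.mem_filter, Finset.mem_range]
        by_cases hxs : G.S a = st j
        · rw [hxs, Function.update_self]; rintro ⟨h1, h2⟩; exact ⟨h1, by omega⟩
        · rw [Function.update_of_ne hxs]; exact id
    have := Finset.card_lt_card this
    omega

/-- The depth bound survives because the new depth is larger by one than that of the top of the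
stack while the number of unlabelled vertices drops by one. -/
theorem Inv.push (I : Inv G h μ st (sp + 1) e r p δ) {a : ℕ} (hl : G.Light a)
    (hS : G.S a = st sp) (hμ : μ (G.D a) = 0) :
    Inv G h (Function.update μ (G.D a) (r + 1)) (Function.update st (sp + 1) (G.D a)) (sp + 2) e r
      (Function.update p (G.D a) (a + 1))
      (Function.update δ (G.D a) (δ (st sp) + 1)) ∧
    measure G h (Function.update μ (G.D a) (r + 1)) (sp + 2) e < measure G h μ (sp + 1) e := by
  obtain ⟨hv, hr⟩ := I.stack sp (by omega)
  have hcard := card_unmarked (G.dst_mem hl.1) hμ (k := r + 1) (by omega)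
  have hs : G.s ≠ G.D a := fun h' => by have := I.start; rw [h', hμ] at this; omega
  refine ⟨⟨I.head, ?_, ?_, ?_, ?_, I.e_le, ?_, ?_, ?_⟩, ?_⟩
  · intro i hi
    by_cases his : i = sp + 1
    · subst his; simp [G.dst_mem hl.1]
    · rw [Function.update_of_ne his]
      obtain ⟨h1, h2⟩ := I.stack i (by omega)
      refine ⟨h1, ?_⟩
      rw [Function.update_of_ne, h2]
      intro h3; rw [h3, hμ] at h2; omega
  · intro b hb
    by_cases hbS : G.S b = G.D a
    · rcases I.arc b hb with h1 | h1
      · exact .inl ⟨h1.1, .inr ⟨sp + 1, by simp [hbS]⟩⟩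
      · rw [hbS] at h1; exact (h1.2.1 hμ).elim
    · rcases I.arc b hb with ⟨h1, h2⟩ | h1
      · refine .inl ⟨h1, ?_⟩
        rw [Function.update_of_ne hbS]
        refine h2.imp id ?_
        rintro ⟨i, hi, h3⟩
        exact ⟨i, by omega, by rw [Function.update_of_ne (by omega), h3]⟩
      · refine .inr ⟨h1.1, ?_, ?_⟩
        · rw [Function.update_of_ne hbS]; exact h1.2.1
        · rw [Function.update_of_ne hbS, Function.update_of_ne, h1.2.2]
          intro h2
          rw [h2, hμ] at h1
          exact h1.2.1 h1.2.2.symm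
  · intro x hx hx'
    by_cases hxa : x = G.D a
    · subst hxa
      rw [Function.update_self]
      have := I.label _ hv (by omega)
      rw [hr] at this
      exact this.tail ⟨a, hl.1, hS, rfl, hl.2⟩
    · rw [Function.update_of_ne hxa] at hx' ⊢
      exact I.label x hx hx'
  · intro b hb
    by_cases hbS : G.S b = G.D a
    · simp [hbS]
    · rw [Function.update_of_ne hbS]; exact I.done b hb
  · rw [Function.update_of_ne hs]; exact I.start
  · intro x hx hx'
    by_cases hxa : x = G.D a
    · subst hxa
      simp only [Function.update_self] at hx' ⊢
      refine .inr ⟨by omega, hl, rfl, ?_, ?_⟩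
      · have : G.S a ≠ G.D a := by intro h2; rw [← h2, hS] at hμ; omega
        simp only [Nat.add_sub_cancel]
        rw [Function.update_of_ne this, hS, hr]; exact hx'
      · have : G.S a ≠ G.D a := by intro h2; rw [← h2, hS] at hμ; omega
        simp only [Nat.add_sub_cancel]
        rw [Function.update_of_ne this, hS]
    · rw [Function.update_of_ne hxa] at hx'
      rw [Function.update_of_ne hxa, Function.update_of_ne hxa]
      refine (I.parent x hx hx').imp id fun h1 => ⟨h1.1, h1.2.1, h1.2.2.1, ?_⟩
      have hS' : G.S (p x - 1) ≠ G.D a := by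
        intro h2; rw [h2, hμ] at h1; omega
      rw [Function.update_of_ne hS', Function.update_of_ne hS']
      exact h1.2.2.2
  · intro x hx hx'
    by_cases hxa : x = G.D a
    · subst hxa
      rw [Function.update_self] at hx' ⊢
      have := I.depth _ hv (hr.trans hx')
      omega
    · rw [Function.update_of_ne hxa] at hx' ⊢
      have := I.depth x hx hx'
      omega
  · simp only [measure]; omega

/-- Label the head of the arc first; then the arc leads to a labelled vertex and `Inv.advance`
applies at the old position `sp`, just below the new top. -/
theorem Inv.advance_push (I : Inv G h μ st (sp + 1) e r p δ) (hh : h (st sp) ≠ 0)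
    (hμ : μ (G.D (h (st sp) - 1)) = 0) :
    Inv G (Function.update h (st sp) (lastArc G.S G.W G.m (st sp) (h (st sp) - 1)))
      (Function.update μ (G.D (h (st sp) - 1)) (r + 1))
      (Function.update st (sp + 1) (G.D (h (st sp) - 1))) (sp + 2) e r
      (Function.update p (G.D (h (st sp) - 1)) (h (st sp)))
      (Function.update δ (G.D (h (st sp) - 1)) (δ (st sp) + 1)) ∧
    measure G (Function.update h (st sp) (lastArc G.S G.W G.m (st sp) (h (st sp) - 1)))
      (Function.update μ (G.D (h (st sp) - 1)) (r + 1)) (sp + 2) e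
        < measure G h μ (sp + 1) e := by
  obtain ⟨hv, hr⟩ := I.stack sp (by omega)
  obtain ⟨hl, hS⟩ := I.head _ hv hh
  obtain ⟨I', hm⟩ := I.push hl hS hμ
  rw [show h (st sp) - 1 + 1 = h (st sp) by omega] at I'
  have e1 : Function.update st (sp + 1) (G.D (h (st sp) - 1)) sp = st sp :=
    Function.update_of_ne (by omega) _ _
  have := I'.advance (j := sp) (by omega) (by rwa [e1]) (by rw [e1]; simp)
  rw [e1] at this
  exact ⟨this.1, this.2.trans hm⟩

/-- What the labels, parents and depths tell when the search is finished. -/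
structure Result (G : Graph) (μ p δ : ℕ → ℕ) : Prop where
  conn : ∀ x ∈ G.verts, ∀ y ∈ G.verts, μ x = μ y ↔ ArcConn G.M G.S G.D G.W G.m x y
  start : μ G.s = G.s + 1
  parent : ∀ x ∈ G.verts, μ x = G.s + 1 → (x = G.s ∧ δ x = 0) ∨
    (p x ≠ 0 ∧ G.Light (p x - 1) ∧ G.D (p x - 1) = x ∧ μ (G.S (p x - 1)) = G.s + 1 ∧
      δ x = δ (G.S (p x - 1)) + 1)
  depth : ∀ x ∈ G.verts, μ x = G.s + 1 → δ x < G.verts.card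

/-- With an empty stack and all tails labelled, every light arc has been explored, so labels are
constant on components; a nonzero label names a root joined to the vertex, so equal nonzero labels
imply a connection. Label 0 can remain only at `G.t`, when no arc leaves it. -/
theorem Inv.result (I : Inv G h μ st 0 G.M r p δ) : Result G μ p δ := by
  have harc : ∀ a, G.Light a → μ (G.D a) = μ (G.S a) := by
    intro a ha
    rcases I.arc a ha with ⟨-, h1 | ⟨i, hi, -⟩⟩ | h1
    · exact (I.done a ha.1 h1).elim
    · omega
    · exact h1.2.2
  refine ⟨fun x hx y hy => ⟨fun hxy => ?_, fun hxy => ?_⟩, I.start, I.parent, fun x hx h1 => ?_⟩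
  · by_cases h0 : μ x = 0
    · have key : ∀ z ∈ G.verts, μ z = 0 → z = G.t := by
        intro z hz hz0
        simp only [Graph.verts, Finset.mem_insert, Finset.mem_image, Finset.mem_range] at hz
        rcases hz with rfl | rfl | ⟨a, ha, rfl⟩
        · have := I.start; omega
        · rfl
        · exact (I.done a ha hz0).elim
      rw [key x hx h0, key y hy (hxy ▸ h0)]
      exact .refl
    · have h1 := I.label x hx h0
      have h2 := I.label y hy (hxy ▸ h0)
      rw [← hxy] at h2
      exact Relation.ReflTransGen.trans (ArcConn.symm G.symm h1) h2
  · clear hx hy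
    induction hxy with
    | refl => rfl
    | tail _ h1 ih =>
      obtain ⟨a, ha, rfl, rfl, hw⟩ := h1
      rw [ih, harc a ⟨ha, hw⟩]
  · have := I.depth x hx h1; omega

end RealRAM.Search

namespace RealRAM.Search

/-! ### The search program

Integer arrays: `20` tails, `21` heads, `22` number of arcs, `23`, `24` the two special vertices,
`30` lists of arcs, `31` their links, `32` labels, `33` stack, `34` its size, `35` next arc,
`36`, `37`, `38` current vertex, arc and neighbour, `39` current root, `40` arcs to the parents,
`41` depths, `42` loop counter. Real arrays: `20` weights, `21` threshold. -/

/-- Clears the lists and the labels. -/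
def clear : Cmd :=
  .seq (.seq (.setNat 30 (.var 23) (.const 0)) <|
    .seq (.setNat 32 (.var 23) (.const 0)) <|
    .seq (.setNat 30 (.var 24) (.const 0)) (.setNat 32 (.var 24) (.const 0))) <|
  .for 42 (.var 22) <|
    .seq (.setNat 30 (.get 20 (.var 42)) (.const 0)) (.setNat 32 (.get 20 (.var 42)) (.const 0))

/-- Builds the lists of the arcs whose weight is at most the threshold. -/
def link : Cmd :=
  .for 42 (.var 22) <|
    .ite (.rle (.get 20 (.var 42)) (.var 21))
      (.seq (.setNat 31 (.var 42) (.get 30 (.get 20 (.var 42))))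
        (.setNat 30 (.get 20 (.var 42)) (.add (.var 42) (.const 1))))
      .skip

/-- Makes the first special vertex the first root. -/
def begin : Cmd :=
  .seq (.setNat 32 (.var 23) (.add (.var 23) (.const 1))) <|
  .seq (.letNat 39 (.var 23)) <|
  .seq (.setNat 41 (.var 23) (.const 0)) <|
  .seq (.setNat 33 (.const 0) (.var 23)) <|
  .seq (.letNat 34 (.const 1)) (.letNat 35 (.const 0))

/-- Looks for the next root. -/
def nextRoot : Cmd :=
  .ite (.nle (.get 32 (.get 20 (.var 35))) (.const 0))
    (.seq (.letNat 39 (.get 20 (.var 35))) <|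
      .seq (.setNat 32 (.var 39) (.add (.var 39) (.const 1))) <|
      .seq (.setNat 41 (.var 39) (.const 0)) <|
      .seq (.setNat 33 (.const 0) (.var 39)) (.letNat 34 (.const 1)))
    (.letNat 35 (.add (.var 35) (.const 1)))

/-- Processes the next arc at the top of the stack. -/
def visit : Cmd :=
  .seq (.letNat 36 (.get 33 (.sub (.var 34) (.const 1)))) <|
  .seq (.letNat 37 (.get 30 (.var 36))) <|
  .ite (.nle (.var 37) (.const 0))
    (.letNat 34 (.sub (.var 34) (.const 1)))
    (.seq (.setNat 30 (.var 36) (.get 31 (.sub (.var 37) (.const 1)))) <|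
      .seq (.letNat 38 (.get 21 (.sub (.var 37) (.const 1)))) <|
      .ite (.nle (.get 32 (.var 38)) (.const 0))
        (.seq (.setNat 32 (.var 38) (.add (.var 39) (.const 1))) <|
          .seq (.setNat 40 (.var 38) (.var 37)) <|
          .seq (.setNat 41 (.var 38) (.add (.get 41 (.var 36)) (.const 1))) <|
          .seq (.setNat 33 (.var 34) (.var 38)) (.letNat 34 (.add (.var 34) (.const 1))))
        .skip)

/-- The exploration of the graph. -/
def explore : Cmd :=
  .while (.or (.nlt (.const 0) (.var 34)) (.nlt (.var 35) (.var 22)))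
    (.ite (.nle (.var 34) (.const 0)) nextRoot visit)

/-- The components of the graph of the arcs whose weight is at most the threshold. -/
def search : Cmd := .seq clear (.seq link (.seq begin explore))

/-- The memory `s` holds the graph `G`. -/
structure Loaded (G : Graph) (s : State) : Prop where
  M : s.nat 22 0 = G.M
  S : ∀ a < G.M, s.nat 20 a = G.S a
  D : ∀ a < G.M, s.nat 21 a = G.D a
  W : ∀ a < G.M, s.real 20 a = G.W a
  m : s.real 21 0 = G.m
  s_eq : s.nat 23 0 = G.s
  t_eq : s.nat 24 0 = G.t

theorem Loaded.same {G : Graph} {s s' : State} {c : Cmd} (h : Loaded G s) (hs : c.Same s s')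
    (h20 : c.wN 20 = false) (h21 : c.wN 21 = false) (h22 : c.wN 22 = false)
    (h23 : c.wN 23 = false) (h24 : c.wN 24 = false) (r20 : c.wR 20 = false)
    (r21 : c.wR 21 = false) : Loaded G s' where
  M := by rw [hs.nat _ h22]; exact h.M
  S := by rw [hs.nat _ h20]; exact h.S
  D := by rw [hs.nat _ h21]; exact h.D
  W := by rw [hs.real _ r20]; exact h.W
  m := by rw [hs.real _ r21]; exact h.m
  s_eq := by rw [hs.nat _ h23]; exact h.s_eq
  t_eq := by rw [hs.nat _ h24]; exact h.t_eq

theorem Graph.mem_verts {G : Graph} {x : ℕ} :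
    x ∈ G.verts ↔ x = G.s ∨ x = G.t ∨ ∃ a < G.M, G.S a = x := by
  simp [Graph.verts]

/-- Only tails and the two special vertices are reset. By symmetry every head is a tail, so this
reaches all vertices in time linear in the number of arcs, however large the numbers of the vertices
are. -/
theorem clear_runs (G : Graph) (s : State) (hG : Loaded G s) :
    Runs clear s (100 * (G.M + 1)) fun s' => ∀ x ∈ G.verts, s'.nat 30 x = 0 ∧ s'.nat 32 x = 0 := by
  refine Runs.prefix (k₁ := 30) (k₂ := 70 * (G.M + 1))
    (fun s => ∀ x, x = G.s ∨ x = G.t → s.nat 30 x = 0 ∧ s.nat 32 x = 0) (by decide) (by omega) ?_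
    fun s₁ hs₁ h₁ => ?_
  · have h23 := hG.s_eq
    have h24 := hG.t_eq
    simp only [Cmd.wp, NExp.eval_get, NExp.eval_const, State.updNat_nat, h23]
    simp only [reduceIte, Nat.reduceEqDiff, h23, h24]
    rintro x (rfl | rfl) <;> simp [Function.update_apply]
  · replace hG := hG.same hs₁ rfl rfl rfl rfl rfl rfl rfl
    refine (Runs.for_wp (K := 70) G.M (fun j s => ∀ x, (x = G.s ∨ x = G.t ∨ ∃ a < j, G.S a = x) →
        s.nat 30 x = 0 ∧ s.nat 32 x = 0) (by decide) rfl ?_ ?_ ?_ ?_).mono le_rfl ?_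
    · exact fun s hs => by simpa [hs.nat 22 rfl] using hG.M
    · exact fun j s x h => by simpa [State.updNat_nat] using h
    · simpa using h₁
    · intro j hj s hI hs hv
      have hS : s.nat 20 j = G.S j := by rw [hs.nat 20 rfl]; exact hG.S j hj
      simp only [Cmd.wp, NExp.eval_get, NExp.eval_const, State.updNat_nat, hv]
      simp only [reduceIte, Nat.reduceEqDiff, hS, Function.update_apply, hv]
      intro x hx
      by_cases hxj : x = G.S j
      · simp [hxj]
      · have hx' : x = G.s ∨ x = G.t ∨ ∃ a < j, G.S a = x := by
          refine hx.imp id (Or.imp id ?_)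
          rintro ⟨a, ha, rfl⟩
          refine ⟨a, lt_of_le_of_ne (by omega) ?_, rfl⟩
          rintro rfl; exact hxj rfl
        simpa [hxj] using hI x hx'
    · intro s' _ h x hx
      exact h x (Graph.mem_verts.1 hx)

/-- Arcs are put in front of the lists in increasing order. Hence the list of `x` starts with its
last light arc, and the link stored with arc `a` is the value of `lastArc` just before `a` was
inserted. -/
theorem link_runs (G : Graph) (s : State) (hG : Loaded G s)
    (h0 : ∀ x ∈ G.verts, s.nat 30 x = 0) :
    Runs link s (100 * (G.M + 1)) fun s' =>
      (∀ x ∈ G.verts, s'.nat 30 x = lastArc G.S G.W G.m x G.M) ∧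
      ∀ a, G.Light a → s'.nat 31 a = lastArc G.S G.W G.m (G.S a) a := by
  refine (Runs.for_wp (K := 100) G.M (fun j s =>
      (∀ x ∈ G.verts, s.nat 30 x = lastArc G.S G.W G.m x j) ∧
      ∀ a < j, G.Light a → s.nat 31 a = lastArc G.S G.W G.m (G.S a) a) (by decide) rfl ?_ ?_ ?_
      ?_).mono le_rfl ?_
  · exact fun s hs => by simpa [hs.nat 22 rfl] using hG.M
  · exact fun j s x h => by simpa [State.updNat_nat] using h
  · simpa [lastArc] using h0
  · intro j hj s hI hs hv
    have hS : s.nat 20 j = G.S j := by rw [hs.nat 20 rfl]; exact hG.S j hj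
    have hW : s.real 20 j = G.W j := by rw [hs.real 20 rfl]; exact hG.W j hj
    have hm : s.real 21 0 = G.m := by rw [hs.real 21 rfl]; exact hG.m
    simp only [Cmd.wp, NExp.eval_get, NExp.eval_const, State.updNat_nat, hv, Test.holds_rle,
      RExp.eval_get, hW, hm, hS, NExp.eval_add]
    simp only [reduceIte, Nat.reduceEqDiff, hS, Function.update_apply, hv]
    refine ⟨fun hle => ⟨fun x hx => ?_, fun a ha hl => ?_⟩, fun hle => ⟨fun x hx => ?_,
      fun a ha hl => ?_⟩⟩
    · rw [lastArc]
      by_cases hxj : x = G.S j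
      · simp [hxj, hle]
      · rw [if_neg hxj, if_neg (fun h => hxj h.2.symm), hI.1 x hx]
    · by_cases haj : a = j
      · subst haj; simp [hI.1 _ (G.src_mem hj)]
      · rw [if_neg haj]; exact hI.2 a (by omega) hl
    · rw [lastArc, if_neg (fun h => hle h.1), hI.1 x hx]
    · refine hI.2 a (lt_of_le_of_ne (by omega) ?_) hl
      rintro rfl; exact hle hl.2
  · rintro s' - ⟨h1, h2⟩
    exact ⟨h1, fun a ha => h2 a ha.1 ha⟩

/-- The invariant of the exploration, read off from the memory. -/
def State.Inv (G : Graph) (s : State) : Prop :=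
  Search.Inv G (s.nat 30) (s.nat 32) (s.nat 33) (s.nat 34 0) (s.nat 35 0) (s.nat 39 0) (s.nat 40)
    (s.nat 41)

theorem explore_runs (G : Graph) (s : State) (hG : Loaded G s)
    (hn : ∀ a, G.Light a → s.nat 31 a = lastArc G.S G.W G.m (G.S a) a) (hI : State.Inv G s)
    (hmes : measure G (s.nat 30) (s.nat 32) (s.nat 34 0) (s.nat 35 0) ≤ 4 * G.M + 4) :
    Runs explore s (200 * (4 * G.M + 5)) fun s' => Result G (s'.nat 32) (s'.nat 40) (s'.nat 41) := by
  refine (Runs.while_measure (State.Inv G)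
    (fun s => measure G (s.nat 30) (s.nat 32) (s.nat 34 0) (s.nat 35 0)) 180 hI ?_).mono ?_ ?_
  · intro s₁ I hs hb
    replace hG := hG.same hs rfl rfl rfl rfl rfl rfl rfl
    replace hn : ∀ a, G.Light a → s₁.nat 31 a = lastArc G.S G.W G.m (G.S a) a := by
      rw [hs.nat 31 rfl]; exact hn
    have hM := hG.M
    refine (Runs.of_wp ?_).mono (k := Cmd.bound _) (by decide) fun _ _ h => h
    simp only [Test.holds_or, Test.holds_nlt, NExp.eval_get, NExp.eval_const, hM] at hb
    simp only [Cmd.wp, nextRoot, visit, Test.holds_nle, NExp.eval_get, NExp.eval_const,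
      nonpos_iff_eq_zero, NExp.eval_sub, NExp.eval_add]
    refine ⟨fun h34 => ?_, fun h34 => ?_⟩
    · have he : s₁.nat 35 0 < G.M := by omega
      rw [State.Inv, h34] at I
      rw [hG.S _ he]
      refine ⟨fun h32 => ?_, fun h32 => ?_⟩
      · have := I.newRoot he h32
        simpa [State.updNat_nat, State.Inv, h34, hG.S _ he] using this
      · have := I.skipRoot he h32
        simpa [State.updNat_nat, State.Inv, h34, hG.S _ he] using this
    · obtain ⟨sp, hsp⟩ := Nat.exists_eq_succ_of_ne_zero h34
      rw [State.Inv, hsp] at I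
      simp only [State.updNat_nat, State.Inv, hsp, Nat.succ_eq_add_one, Nat.add_sub_cancel,
        reduceIte, Nat.reduceEqDiff, Function.update_self]
      refine ⟨fun h37 => ?_, fun h37 => ?_⟩
      · have := I.pop h37
        simpa using this
      · obtain ⟨hv, -⟩ := I.stack sp (by omega)
        obtain ⟨hl, hS⟩ := I.head _ hv h37
        rw [hn _ hl, hS, hG.D _ hl.1]
        refine ⟨fun h38 => ?_, fun h38 => ?_⟩
        · have := I.advance_push h37 h38
          simpa using this
        · have := I.advance (Nat.lt_succ_self sp) h37 h38
          simpa using this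
  · have : (Test.or (.nlt (.const 0) (.var 34)) (.nlt (.var 35) (.var 22))).cost ≤ 19 := by decide
    exact Nat.mul_le_mul (by omega) (by omega)
  · rintro s₁ hs ⟨I, hb⟩
    have hM := (hG.same hs rfl rfl rfl rfl rfl rfl rfl).M
    simp only [Test.holds_or, Test.holds_nlt, NExp.eval_get, NExp.eval_const, hM, not_or,
      not_lt, nonpos_iff_eq_zero] at hb
    have h1 := I.e_le
    rw [State.Inv, hb.1, le_antisymm h1 hb.2] at I
    exact I.result

theorem card_verts_le (G : Graph) : G.verts.card ≤ G.M + 2 := by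
  refine (Finset.card_insert_le _ _).trans (Nat.succ_le_succ ((Finset.card_insert_le _ _).trans
    (Nat.succ_le_succ (Finset.card_image_le.trans ?_))))
  simp

theorem Inv.init (G : Graph) {h μ st p δ : ℕ → ℕ}
    (hh : ∀ x ∈ G.verts, h x = lastArc G.S G.W G.m x G.M) (hμ : ∀ x ∈ G.verts, μ x = 0) :
    Inv G h (Function.update μ G.s (G.s + 1)) (Function.update st 0 G.s) 1 0 G.s p
      (Function.update δ G.s 0) := by
  have hs : G.s ∈ G.verts := by simp [Graph.verts]
  have hne : ∀ x ∈ G.verts, Function.update μ G.s (G.s + 1) x ≠ 0 → x = G.s := by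
    intro x hx h1
    by_contra h2
    rw [Function.update_of_ne h2] at h1
    exact h1 (hμ x hx)
  refine ⟨fun x hx hx' => ?_, fun i hi => ?_, fun a ha => ?_, fun x hx hx' => ?_, by simp, by simp,
    by simp, fun x hx hx' => ?_, fun x hx hx' => ?_⟩
  · rw [hh x hx] at hx' ⊢
    have := lastArc_spec _ _ _ _ _ hx'
    have h2 := lastArc_le G.S G.W G.m x G.M
    exact ⟨⟨by omega, this.1⟩, this.2⟩
  · obtain rfl : i = 0 := by omega
    simp [hs]
  · refine .inl ⟨?_, ?_⟩
    · rw [hh _ (G.src_mem ha.1)]; exact lt_lastArc ha.1 ha.2 rfl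
    · by_cases h1 : G.S a = G.s
      · exact .inr ⟨0, by simp [h1]⟩
      · rw [Function.update_of_ne h1]; exact .inl (hμ _ (G.src_mem ha.1))
  · rw [hne x hx hx', Function.update_self]; exact .refl
  · rw [hne x hx (by omega)]; simp
  · rw [hne x hx (by omega)]
    have := card_unmarked hs (hμ _ hs) (k := G.s + 1) (by omega)
    have h2 := Finset.card_filter_le G.verts fun x => μ x = 0
    simp only [Function.update_self]
    omega

theorem search_runs (G : Graph) (s : State) (hG : Loaded G s) :
    Runs search s (2000 * (G.M + 1)) fun s' =>
      Result G (s'.nat 32) (s'.nat 40) (s'.nat 41) := by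
  refine ((clear_runs G s hG).seq (k₂ := 1900 * (G.M + 1)) fun s₁ hs₁ h₁ => ?_).mono
    (by omega) fun _ _ h => h
  replace hG := hG.same hs₁ rfl rfl rfl rfl rfl rfl rfl
  refine ((link_runs G s₁ hG fun x hx => (h₁ x hx).1).seq (k₂ := 1800 * (G.M + 1))
    fun s₂ hs₂ h₂ => ?_).mono (by omega) fun _ _ h => h
  have h32 : ∀ x ∈ G.verts, s₂.nat 32 x = 0 := by
    rw [hs₂.nat 32 rfl]; exact fun x hx => (h₁ x hx).2
  replace hG := hG.same hs₂ rfl rfl rfl rfl rfl rfl rfl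
  refine Runs.prefix (k₁ := 100) (k₂ := 200 * (4 * G.M + 5)) (fun s₃ => State.Inv G s₃ ∧
    measure G (s₃.nat 30) (s₃.nat 32) (s₃.nat 34 0) (s₃.nat 35 0) ≤ 4 * G.M + 4)
    (by decide) (by omega) ?_ fun s₃ hs₃ h₃ => ?_
  · have := Inv.init G (st := s₂.nat 33) (p := s₂.nat 40) (δ := s₂.nat 41) h₂.1 h32
    have h23 := hG.s_eq
    simp only [begin, Cmd.wp, NExp.eval_get, NExp.eval_const, NExp.eval_add]
    refine ⟨by simpa [State.updNat_nat, State.Inv, h23] using this, ?_⟩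
    simp only [State.updNat_nat, reduceIte, Nat.reduceEqDiff, h23, Function.update_self]
    have h1 := card_unmarked (G := G) (x := G.s) (by simp [Graph.verts])
      (h32 _ (by simp [Graph.verts])) (k := G.s + 1) (by omega)
    have h2 := Finset.card_filter_le G.verts fun x => s₂.nat 32 x = 0
    have h3 := Finset.card_filter_le (Finset.range G.M) fun a => a < s₂.nat 30 (G.S a)
    have h4 := card_verts_le G
    simp only [Finset.card_range] at h3
    simp only [measure]
    omega
  · replace hG := hG.same hs₃ rfl rfl rfl rfl rfl rfl rfl
    refine explore_runs G s₃ hG ?_ h₃.1 h₃.2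
    rw [hs₃.nat 31 rfl]; exact h₂.2

end RealRAM.Search

/-! ### Approximate medians -/

/-- The order of the entries of `X` by value, ties being broken by position. -/
def Before (X : ℕ → ℝ) (j i : ℕ) : Prop := X j < X i ∨ (X j = X i ∧ j < i)

open Classical in
/-- The number of the entries of `X` in the finite set `A` that satisfy `p`. -/
noncomputable def countIn (X : ℕ → ℝ) (A : Finset ℕ) (p : ℝ → Prop) : ℕ :=
  (A.filter fun i => p (X i)).card

open Classical in
/-- The rank of entry `i` among the entries in the finite set `A`. -/
noncomputable def rankIn (X : ℕ → ℝ) (A : Finset ℕ) (i : ℕ) : ℕ := (A.filter (Before X · i)).card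

/-- A property of reals that passes to smaller reals. -/
def IsLowerProp (p : ℝ → Prop) : Prop := ∀ x y, x ≤ y → p y → p x

theorem Before.trans {X : ℕ → ℝ} {i j k : ℕ} (h : Before X i j) (h' : Before X j k) :
    Before X i k := by
  rcases h with h | h <;> rcases h' with h' | h'
  · exact .inl (h.trans h')
  · exact .inl (h'.1 ▸ h)
  · exact .inl (h.1 ▸ h')
  · exact .inr ⟨h.1.trans h'.1, h.2.trans h'.2⟩

theorem Before.irrefl {X : ℕ → ℝ} {i : ℕ} : ¬ Before X i i := by
  simp [Before]

theorem before_or {X : ℕ → ℝ} {i j : ℕ} (h : i ≠ j) : Before X i j ∨ Before X j i := by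
  rcases lt_trichotomy (X i) (X j) with h1 | h1 | h1
  · exact .inl (.inl h1)
  · rcases lt_or_gt_of_ne h with h2 | h2
    · exact .inl (.inr ⟨h1, h2⟩)
    · exact .inr (.inr ⟨h1.symm, h2⟩)
  · exact .inr (.inl h1)

theorem rankIn_lt {X : ℕ → ℝ} {A : Finset ℕ} {i j : ℕ} (hi : i ∈ A) (h : Before X i j) :
    rankIn X A i < rankIn X A j := by
  refine Finset.card_lt_card ((Finset.ssubset_iff_of_subset ?_).2 ⟨i, ?_, ?_⟩)
  · intro k; simp only [Finset.mem_filter]; exact fun hk => ⟨hk.1, hk.2.trans h⟩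
  · simp [hi, h]
  · simp [Before.irrefl]

theorem rankIn_injOn (X : ℕ → ℝ) (A : Finset ℕ) : Set.InjOn (rankIn X A) A := by
  intro i hi j hj h
  by_contra hne
  rcases before_or (X := X) hne with h1 | h1
  · exact (rankIn_lt hi h1).ne h
  · exact (rankIn_lt hj h1).ne' h

/-- Ranks refine the order by value, so the entries with a downward closed property occupy an
initial segment of the ranks. -/
theorem lower_iff_rankIn_lt {X : ℕ → ℝ} {A : Finset ℕ} {p : ℝ → Prop} (hp : IsLowerProp p) {i : ℕ}
    (hi : i ∈ A) : p (X i) ↔ rankIn X A i < countIn X A p := by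
  classical
  constructor
  · intro h
    refine Finset.card_lt_card ((Finset.ssubset_iff_of_subset ?_).2 ⟨i, ?_, ?_⟩)
    · intro k
      simp only [Finset.mem_filter]
      refine fun hk => ⟨hk.1, hp _ _ ?_ h⟩
      rcases hk.2 with h1 | h1
      exacts [h1.le, h1.1.le]
    · simp [hi, h]
    · simp [Before.irrefl]
  · contrapose!
    intro h
    refine Finset.card_le_card ?_
    intro k
    simp only [Finset.mem_filter]
    refine fun hk => ⟨hk.1, .inl ?_⟩
    by_contra h1
    exact h (hp _ _ (not_lt.1 h1) hk.2)

theorem card_range_filter_mod (c : ℕ) :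
    ((Finset.range c).filter fun r => r % 4 = 0).card = (c + 3) / 4 := by
  induction c with
  | zero => simp
  | succ c ih =>
    rw [Finset.range_add_one, Finset.filter_insert]
    split_ifs with h
    · rw [Finset.card_insert_of_notMem (by simp), ih]; omega
    · rw [ih]; omega

open Classical in
-- The entries of `A` with property `p` carry the ranks 0, …, c - 1, where c is their number, and
-- every fourth of these ranks is kept.
theorem card_kept {X : ℕ → ℝ} {A : Finset ℕ} {p : ℝ → Prop} (hp : IsLowerProp p) :
    (A.filter fun i => rankIn X A i % 4 = 0 ∧ p (X i)).card = (countIn X A p + 3) / 4 := by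
  rw [← card_range_filter_mod]
  have himg : (A.filter fun i => p (X i)).image (rankIn X A) = Finset.range (countIn X A p) := by
    refine Finset.eq_of_subset_of_card_le ?_ ?_
    · intro r
      simp only [Finset.mem_image, Finset.mem_filter, Finset.mem_range]
      rintro ⟨i, ⟨hi, h⟩, rfl⟩
      exact (lower_iff_rankIn_lt hp hi).1 h
    · rw [Finset.card_range, Finset.card_image_of_injOn]
      · rfl
      · exact (rankIn_injOn X A).mono fun i hi => by simp at hi; exact hi.1
  rw [← himg, Finset.filter_image, Finset.card_image_of_injOn]
  · congr 1; ext i; simp only [Finset.mem_filter]; tauto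
  · exact (rankIn_injOn X A).mono fun i hi => by simp at hi; exact hi.1.1

/-- The block of size `g` among the positions below `n` that contains `i`. -/
def block (g n i : ℕ) : Finset ℕ := Finset.Ico (g * (i / g)) (min (g * (i / g) + g) n)

/-- Entry `i` is kept when the blocks are thinned out to a quarter. -/
def Kept (X : ℕ → ℝ) (g n i : ℕ) : Prop := rankIn X (block g n i) i % 4 = 0

open Classical in
-- In every block the count is rounded up to a multiple of four, which adds at most 3, and there are
-- at most `n / g + 1` blocks. Rounding goes up only, so the first inequality has no error term.
theorem countIn_thinned (X : ℕ → ℝ) {g : ℕ} (hg : 0 < g) (n : ℕ) {p : ℝ → Prop}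
    (hp : IsLowerProp p) :
    countIn X (Finset.range n) p ≤
      4 * ((Finset.range n).filter fun i => Kept X g n i ∧ p (X i)).card ∧
    4 * ((Finset.range n).filter fun i => Kept X g n i ∧ p (X i)).card ≤
      countIn X (Finset.range n) p + 3 * (n / g + 1) := by
  have hmaps : ∀ A ⊆ Finset.range n, ∀ i ∈ A, i / g ∈ Finset.range (n / g + 1) := by
    intro A hA i hi
    have := Finset.mem_range.1 (hA hi)
    exact Finset.mem_range.2 (Nat.lt_succ_of_le (Nat.div_le_div_right this.le))
  let B : ℕ → Finset ℕ := fun b => Finset.Ico (g * b) (min (g * b + g) n)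
  have hB : ∀ b i, i ∈ B b ↔ i < n ∧ i / g = b := by
    intro b i
    simp only [B, Finset.mem_Ico, lt_min_iff, Nat.div_eq_iff hg]
    rw [mul_comm b g]
    omega
  have h1 : countIn X (Finset.range n) p = ∑ b ∈ Finset.range (n / g + 1), countIn X (B b) p := by
    unfold countIn
    rw [Finset.card_eq_sum_card_fiberwise (hmaps _ (Finset.filter_subset _ _))]
    refine Finset.sum_congr rfl fun b _ => congrArg _ ?_
    ext i
    simp only [Finset.mem_filter, Finset.mem_range, hB]
    tauto
  have h2 : ((Finset.range n).filter fun i => Kept X g n i ∧ p (X i)).card =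
      ∑ b ∈ Finset.range (n / g + 1), (countIn X (B b) p + 3) / 4 := by
    rw [Finset.card_eq_sum_card_fiberwise (hmaps _ (Finset.filter_subset _ _))]
    refine Finset.sum_congr rfl fun b _ => ?_
    rw [← card_kept hp]
    congr 1
    ext i
    simp only [Finset.mem_filter, Finset.mem_range, hB]
    constructor
    · rintro ⟨⟨hi, hk, hpi⟩, rfl⟩; exact ⟨⟨hi, rfl⟩, hk, hpi⟩
    · rintro ⟨⟨hi, rfl⟩, hk, hpi⟩; exact ⟨⟨hi, hk, hpi⟩, rfl⟩
  rw [h1, h2, Finset.mul_sum]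
  refine ⟨Finset.sum_le_sum fun b _ => by omega, ?_⟩
  rw [show 3 * (n / g + 1) = ∑ b ∈ Finset.range (n / g + 1), 3 by simp [mul_comm],
    ← Finset.sum_add_distrib]
  exact Finset.sum_le_sum fun b _ => by omega

/-- The first `n` entries of `X`, each counted with multiplicity `q`, are a sample of the first
`M` entries of `W` that is accurate for blocks of size `g`. -/
structure IsSample (W : ℕ → ℝ) (M : ℕ) (X : ℕ → ℝ) (n g : ℕ) : Prop where
  pos : 0 < n
  size : 128 ≤ g
  mem : ∀ k < n, ∃ i < M, X k = W i
  accurate : ∃ q : ℕ, ∀ p, IsLowerProp p →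
    countIn W (Finset.range M) p ≤ q * countIn X (Finset.range n) p ∧
    (q * countIn X (Finset.range n) p : ℝ) ≤
      countIn W (Finset.range M) p + 24 * M * (1 / 128 - 1 / g)

theorem IsSample.refl (W : ℕ → ℝ) {M : ℕ} (hM : 0 < M) : IsSample W M W M 128 where
  pos := hM
  size := le_rfl
  mem k hk := ⟨k, hk, rfl⟩
  accurate := ⟨1, fun p _ => by norm_num⟩

theorem countIn_true (X : ℕ → ℝ) (n : ℕ) : countIn X (Finset.range n) (fun _ => True) = n := by
  simp [countIn]

open Classical in
-- The multiplicity grows from `q` to `4q`. The rounding error is at most 3 for each of at most 2n/g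
-- blocks, in total 6qn/g ≤ 12M/g = 24M(1/g - 1/(2g)), so the errors of successive rounds telescope.
-- The product of sample size and block size falls by a quarter although the block size doubles.
theorem IsSample.thin {W X Y : ℕ → ℝ} {M n g n' : ℕ} (h : IsSample W M X n g) (hn : g < n)
    (hY : ∀ p : ℝ → Prop, countIn Y (Finset.range n') p =
      ((Finset.range n).filter fun i => Kept X g n i ∧ p (X i)).card) :
    IsSample W M Y n' (g + g) ∧ 4 * (n' * (g + g)) ≤ 3 * (n * g) := by
  have hg := h.size
  have hT : IsLowerProp fun _ => True := fun _ _ _ _ => trivial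
  have key := fun p hp => countIn_thinned X (g := g) (by omega) n (p := p) hp
  simp only [← hY] at key
  have hk := key _ hT
  rw [countIn_true, countIn_true] at hk
  have hdiv : n / g + 1 ≤ 2 * (n / g) := by
    have : 1 ≤ n / g := (Nat.one_le_div_iff (by omega)).2 hn.le
    omega
  have hdiv' : g * (n / g) ≤ n := Nat.mul_div_le n g
  refine ⟨⟨by omega, by omega, fun k hk => ?_, ?_⟩, ?_⟩
  -- `hY` covers all properties, not only the downward closed ones; counting the occurrences of the
  -- value `Y k` shows that it was in the old sample.
  · have h1 := hY (fun y => y = Y k)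
    have h2 : 0 < countIn Y (Finset.range n') fun y => y = Y k :=
      Finset.card_pos.2 ⟨k, by simp [hk]⟩
    rw [h1] at h2
    obtain ⟨i, hi⟩ := Finset.card_pos.1 h2
    simp only [Finset.mem_filter, Finset.mem_range] at hi
    rw [← hi.2.2]
    exact h.mem i hi.1
  · obtain ⟨q, hq⟩ := h.accurate
    refine ⟨q * 4, fun p hp => ?_⟩
    obtain ⟨h1, h2⟩ := key p hp
    obtain ⟨h3, h4⟩ := hq p hp
    have h5 := (hq _ hT).2
    rw [countIn_true, countIn_true] at h5
    refine ⟨h3.trans (by rw [mul_assoc]; exact Nat.mul_le_mul_left _ h1), ?_⟩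
    have hg' : (128 : ℝ) ≤ g := by exact_mod_cast hg
    -- The accumulated error stays below 24M/128, hence below M.
    have hqn : (q * n : ℝ) ≤ 2 * M := by
      have h6 : (0 : ℝ) ≤ 24 * M * (1 / g) := by positivity
      have h7 : (0 : ℝ) ≤ M := by positivity
      linarith
    have h8 : (4 * countIn Y (Finset.range n') p : ℝ) ≤ countIn X (Finset.range n) p + 6 * (n / g) := by
      have h9 : (4 * countIn Y (Finset.range n') p : ℝ) ≤
          countIn X (Finset.range n) p + 3 * ((n / g : ℕ) + 1) := by exact_mod_cast h2
      have h10 : (((n / g : ℕ) + 1 : ℕ) : ℝ) ≤ ((2 * (n / g) : ℕ) : ℝ) := by exact_mod_cast hdiv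
      have h11 : ((n / g : ℕ) : ℝ) ≤ n / g := Nat.cast_div_le
      push_cast at h10
      linarith
    push_cast
    calc (q * 4 * countIn Y (Finset.range n') p : ℝ)
        = q * (4 * countIn Y (Finset.range n') p) := by ring
      _ ≤ q * (countIn X (Finset.range n) p + 6 * (n / g)) := by gcongr
      _ = q * countIn X (Finset.range n) p + 6 * (q * n) / g := by ring
      _ ≤ (countIn W (Finset.range M) p + 24 * M * (1 / 128 - 1 / g)) + 6 * (2 * M) / g := by
        gcongr
      _ = _ := by field_simp; ring
  · have h1 : 4 * n' ≤ n + 6 * (n / g) := by omega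
    calc 4 * (n' * (g + g)) = 4 * n' * (2 * g) := by ring
      _ ≤ (n + 6 * (n / g)) * (2 * g) := Nat.mul_le_mul_right _ h1
      _ = 2 * (n * g) + 12 * (g * (n / g)) := by ring
      _ ≤ 2 * (n * g) + g * n := by
        refine Nat.add_le_add_left (Nat.mul_le_mul ?_ hdiv') _; omega
      _ = 3 * (n * g) := by ring

/-- At most three quarters of the first `M` entries of `W` are below `m`, and at most three
quarters are above. -/
def IsPivot (W : ℕ → ℝ) (M : ℕ) (m : ℝ) : Prop :=
  (∃ i < M, m = W i) ∧ 4 * countIn W (Finset.range M) (· < m) ≤ 3 * M ∧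
    4 * countIn W (Finset.range M) (m < ·) ≤ 3 * M

/-- The error is at most 3M/16, and `r` is half of the sample size, rounded down. At most qn/2 ≤
19M/32 weights lie below the sample median, and at least qn/2 - 3M/16 ≥ 5M/16 weights do not exceed
it; both are within the bound of three quarters. -/
theorem IsSample.isPivot {W X : ℕ → ℝ} {M n g i : ℕ} (h : IsSample W M X n g) (hi : i < n)
    (h₁ : 2 * rankIn X (Finset.range n) i ≤ n) (h₂ : n < 2 * rankIn X (Finset.range n) i + 2) :
    IsPivot W M (X i) := by
  classical
  set r := rankIn X (Finset.range n) i with hr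
  obtain ⟨q, hq⟩ := h.accurate
  have hT : IsLowerProp fun _ => True := fun _ _ _ _ => trivial
  have hlt : IsLowerProp (· < X i) := fun _ _ h1 h2 => h1.trans_lt h2
  have hle : IsLowerProp (· ≤ X i) := fun _ _ h1 h2 => h1.trans h2
  obtain ⟨a1, a2⟩ := hq _ hT
  obtain ⟨b1, -⟩ := hq _ hlt
  obtain ⟨-, c2⟩ := hq _ hle
  rw [countIn_true, countIn_true] at a1 a2
  have hg' : (128 : ℝ) ≤ g := by exact_mod_cast h.size
  have h6 : (0 : ℝ) ≤ 24 * M * (1 / g) := by positivity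
  have h7 : (0 : ℝ) ≤ M := by positivity
  have hc1 : countIn X (Finset.range n) (· < X i) ≤ r := by
    refine Finset.card_le_card fun k => ?_
    simp only [Finset.mem_filter]
    exact fun hk => ⟨hk.1, .inl hk.2⟩
  have hc2 : r + 1 ≤ countIn X (Finset.range n) (· ≤ X i) := by
    refine Finset.card_lt_card ((Finset.ssubset_iff_of_subset ?_).2 ⟨i, ?_, ?_⟩)
    · intro k
      simp only [Finset.mem_filter]
      refine fun hk => ⟨hk.1, ?_⟩
      rcases hk.2 with h1 | h1
      exacts [h1.le, h1.1.le]
    · simp [hi]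
    · simp [Before.irrefl]
  have hsum : countIn W (Finset.range M) (· ≤ X i) + countIn W (Finset.range M) (X i < ·) = M := by
    unfold countIn
    simp only [← not_le]
    rw [Finset.card_filter_add_card_filter_not, Finset.card_range]
  refine ⟨h.mem i hi, ?_, ?_⟩
  · have h8 : (countIn W (Finset.range M) (· < X i) : ℝ) ≤ q * r := by
      exact_mod_cast b1.trans (Nat.mul_le_mul_left _ hc1)
    have h9 : (q * (2 * r) : ℝ) ≤ q * n := by
      have : ((2 * r : ℕ) : ℝ) ≤ n := by exact_mod_cast h₁
      push_cast at this
      gcongr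
    have : (4 * countIn W (Finset.range M) (· < X i) : ℝ) ≤ 3 * M := by linarith
    exact_mod_cast this
  · have h8 : (q * (r + 1) : ℝ) ≤ q * countIn X (Finset.range n) (· ≤ X i) := by
      have : ((r + 1 : ℕ) : ℝ) ≤ countIn X (Finset.range n) (· ≤ X i) := by exact_mod_cast hc2
      push_cast at this
      gcongr
    have h9 : (q * n : ℝ) ≤ q * (2 * r + 2) := by
      have : (n : ℝ) ≤ ((2 * r + 2 : ℕ) : ℝ) := by exact_mod_cast h₂.le
      push_cast at this
      gcongr
    have h10 : (M : ℝ) ≤ q * n := by exact_mod_cast a1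
    have h11 : (countIn W (Finset.range M) (· ≤ X i) + countIn W (Finset.range M) (X i < ·) : ℝ)
        = M := by exact_mod_cast hsum
    have : (4 * countIn W (Finset.range M) (X i < ·) : ℝ) ≤ 3 * M := by linarith
    exact_mod_cast this

/-- The rank is an injection of the `n` positions into the `n` ranks, hence onto. -/
theorem exists_rankIn_eq (X : ℕ → ℝ) (n : ℕ) {r : ℕ} (hr : r < n) :
    ∃ i < n, rankIn X (Finset.range n) i = r := by
  have hlt : ∀ i < n, rankIn X (Finset.range n) i < n := by
    intro i hi
    have := (lower_iff_rankIn_lt (X := X) (A := Finset.range n) (p := fun _ => True)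
      (fun _ _ _ _ => trivial) (Finset.mem_range.2 hi)).1 trivial
    rwa [countIn_true] at this
  have himg : (Finset.range n).image (rankIn X (Finset.range n)) = Finset.range n := by
    refine Finset.eq_of_subset_of_card_le ?_ ?_
    · intro r
      simp only [Finset.mem_image, Finset.mem_range]
      rintro ⟨i, hi, rfl⟩
      exact hlt i hi
    · rw [Finset.card_image_of_injOn (rankIn_injOn _ _)]
  have : r ∈ (Finset.range n).image (rankIn X (Finset.range n)) := by rw [himg]; simpa using hr
  simpa using this

namespace RealRAM.Pivot

/-! ### The program for approximate medians

Integer arrays: `22` number of weights, `50` size of the sample, `51` size of the blocks, `52`, `53`,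
`59` loop counters, `54`, `55` ends of the current block, `56`, `57` rank and its residue modulo
four, `58` size of the next sample. Real arrays: `20` weights, `21` result, `22` sample, `23` next
sample. -/

/-- The rank of an entry of the sample in the current block. -/
def rank : Cmd :=
  .seq (.seq (.letNat 56 (.const 0)) (.letNat 57 (.const 0))) <|
  .for 59 (.sub (.var 55) (.var 54)) <|
    .seq (.letNat 53 (.add (.var 54) (.var 59))) <|
    .ite (.or (.rlt (.get 22 (.var 53)) (.get 22 (.var 52)))
        (.and (.req (.get 22 (.var 53)) (.get 22 (.var 52))) (.nlt (.var 53) (.var 52))))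
      (.seq (.letNat 56 (.add (.var 56) (.const 1))) <|
        .seq (.letNat 57 (.add (.var 57) (.const 1))) <|
        .ite (.nle (.const 4) (.var 57)) (.letNat 57 (.const 0)) .skip)
      .skip

/-- One round of thinning out. -/
def thin : Cmd :=
  .seq (.seq (.letNat 58 (.const 0)) (.letNat 54 (.const 0))) <|
  .seq
    (.for 52 (.var 50) <|
      .seq
        (.seq (.ite (.neq (.var 52) (.add (.var 54) (.var 51)))
            (.letNat 54 (.add (.var 54) (.var 51))) .skip)
          (.ite (.nle (.add (.var 54) (.var 51)) (.var 50))
            (.letNat 55 (.add (.var 54) (.var 51))) (.letNat 55 (.var 50)))) <|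
      .seq rank <|
        .ite (.nle (.var 57) (.const 0))
          (.seq (.setReal 23 (.var 58) (.get 22 (.var 52)))
            (.letNat 58 (.add (.var 58) (.const 1))))
          .skip) <|
  .seq (.for 52 (.var 58) (.setReal 22 (.var 52) (.get 23 (.var 52)))) <|
    .seq (.letNat 50 (.var 58)) (.letNat 51 (.add (.var 51) (.var 51)))

/-- Selects the median of the sample. -/
def select : Cmd :=
  .seq (.seq (.letNat 54 (.const 0)) (.letNat 55 (.var 50))) <|
  .for 52 (.var 50) <| .seq rank <|
    .ite (.and (.nle (.add (.var 56) (.var 56)) (.var 50))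
        (.nlt (.var 50) (.add (.add (.var 56) (.var 56)) (.const 2))))
      (.letReal 21 (.get 22 (.var 52))) .skip

/-- Stores an approximate median of the weights as threshold. -/
def pivot : Cmd :=
  .seq (.for 52 (.var 22) (.setReal 22 (.var 52) (.get 20 (.var 52)))) <|
  .seq (.seq (.letNat 50 (.var 22)) (.letNat 51 (.const 128))) <|
  .seq (.while (.nlt (.var 51) (.var 50)) thin) select

/-- Register 57 counts modulo four by being reset to 0, since integer expressions have no remainder.
-/
theorem rank_runs (s : State) (b hi i : ℕ) (hb : s.nat 54 0 = b) (hhi : s.nat 55 0 = hi)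
    (hs : s.nat 52 0 = i) : Runs rank s (200 * (hi - b + 1)) fun s' =>
      s'.nat 56 0 = rankIn (s.real 22) (Finset.Ico b hi) i ∧
      s'.nat 57 0 = rankIn (s.real 22) (Finset.Ico b hi) i % 4 := by
  classical
  refine Runs.prefix (k₁ := 20) (k₂ := 170 * (hi - b + 1))
    (fun s => s.nat 56 0 = 0 ∧ s.nat 57 0 = 0) (by decide) (by omega)
    (by simp [Cmd.wp, State.updNat_nat]) fun s₁ hs₁ h₁ => ?_
  rw [← hs₁.real 22 rfl]
  rw [← hs₁.nat 54 rfl] at hb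
  rw [← hs₁.nat 55 rfl] at hhi
  rw [← hs₁.nat 52 rfl] at hs
  clear hs₁
  refine (Runs.for_wp (K := 170) (hi - b) (fun k s =>
      s.nat 56 0 = rankIn (s₁.real 22) (Finset.Ico b (b + k)) i ∧
      s.nat 57 0 = rankIn (s₁.real 22) (Finset.Ico b (b + k)) i % 4) (by decide) rfl ?_ ?_ ?_
      ?_).mono le_rfl ?_
  · intro s' h; simp [h.nat 54 rfl, h.nat 55 rfl, hb, hhi]
  · exact fun j s x h => by simpa [State.updNat_nat] using h
  · simpa [rankIn] using h₁
  · intro k hk s₂ hI h hv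
    have e : rankIn (s₁.real 22) (Finset.Ico b (b + (k + 1))) i =
        rankIn (s₁.real 22) (Finset.Ico b (b + k)) i +
          if Before (s₁.real 22) (b + k) i then 1 else 0 := by
      unfold rankIn
      rw [← add_assoc, ← Finset.insert_Ico_right_eq_Ico_add_one (by omega), Finset.filter_insert]
      split_ifs with h1
      · rw [Finset.card_insert_of_notMem (by simp)]
      · rfl
    have h54 : s₂.nat 54 0 = b := by rw [h.nat 54 rfl, hb]
    have h52 : s₂.nat 52 0 = i := by rw [h.nat 52 rfl, hs]
    have hX : s₂.real 22 = s₁.real 22 := h.real 22 rfl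
    rw [e]
    simp only [Cmd.wp, NExp.eval_get, NExp.eval_const, NExp.eval_add, RExp.eval_get,
      Test.holds_or, Test.holds_and, Test.holds_rlt, Test.holds_req, Test.holds_nlt,
      Test.holds_nle]
    simp only [State.updNat_nat, State.updNat_real, reduceIte, Nat.reduceEqDiff,
      Function.update_self, h54, h52, hX, hv, hI.1, hI.2]
    rw [← Before]
    refine ⟨fun h1 => ?_, fun h1 => ?_⟩
    · rw [if_pos h1]
      refine ⟨fun h2 => ⟨rfl, by omega⟩, fun h2 => ⟨rfl, by omega⟩⟩
    · rw [if_neg h1]; exact ⟨rfl, rfl⟩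
  · intro s' _ h
    by_cases hle : b ≤ hi
    · rwa [Nat.add_sub_cancel' hle] at h
    · rw [Finset.Ico_eq_empty (by omega)] at h ⊢
      exact h

open Classical in
theorem countIn_range_succ (Y : ℕ → ℝ) (k : ℕ) (y : ℝ) (p : ℝ → Prop) :
    countIn (Function.update Y k y) (Finset.range (k + 1)) p =
      countIn Y (Finset.range k) p + if p y then 1 else 0 := by
  unfold countIn
  rw [Finset.range_add_one, Finset.filter_insert, Function.update_self]
  have : ((Finset.range k).filter fun i => p (Function.update Y k y i)) =
      (Finset.range k).filter fun i => p (Y i) := by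
    refine Finset.filter_congr fun i hi => ?_
    rw [Function.update_of_ne (Finset.mem_range.1 hi).ne]
  split_ifs with h
  · rw [Finset.card_insert_of_notMem (by simp), this]
  · rw [this]; rfl

open Classical in
-- The rank of every entry is found by running through its block, so one round costs O(n g).
theorem thin_runs (s : State) (X : ℕ → ℝ) (n g : ℕ) (hg : 0 < g) (hX : s.real 22 = X)
    (hn : s.nat 50 0 = n) (hgs : s.nat 51 0 = g) :
    Runs thin s (1000 * (n + 1) * (g + 1)) fun s' => ∃ n', s'.nat 50 0 = n' ∧
      s'.nat 51 0 = g + g ∧ ∀ p : ℝ → Prop, countIn (s'.real 22) (Finset.range n') p =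
        ((Finset.range n).filter fun i => Kept X g n i ∧ p (X i)).card := by
  have hcost : 20 + (600 * (n + 1) * (g + 1) + (100 * (n + 1) + 20)) ≤
      1000 * (n + 1) * (g + 1) := by
    have hP := Nat.le_mul_of_pos_right (n + 1) (show 0 < g + 1 by omega)
    simp only [mul_assoc]
    generalize (n + 1) * (g + 1) = P at *
    omega
  refine Runs.prefix (k₁ := 20) (fun s => s.nat 58 0 = 0 ∧ s.nat 54 0 = 0) (by decide)
    hcost (by simp [Cmd.wp, State.updNat_nat]) fun s₁ hs₁ h₁ => ?_
  replace hX := (hs₁.real 22 rfl).trans hX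
  rw [← hs₁.nat 50 rfl] at hn
  rw [← hs₁.nat 51 rfl] at hgs
  clear hs₁
  have hfor := Runs.for (v := 52) (N := .var 50) (s₀ := s₁) n
    -- The start of the block is brought up to date only at the beginning of round `j`, so
    -- beforehand it belongs to position `j - 1`; for `j = 0` truncated subtraction gives the right
    -- start 0.
    (fun j s => s.nat 54 0 = g * ((j - 1) / g) ∧ s.nat 58 0 ≤ j ∧ ∀ p : ℝ → Prop,
      countIn (s.real 23) (Finset.range (s.nat 58 0)) p =
        ((Finset.range j).filter fun i => Kept X g n i ∧ p (X i)).card)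
    (c := .seq
        (.seq (.ite (.neq (.var 52) (.add (.var 54) (.var 51)))
            (.letNat 54 (.add (.var 54) (.var 51))) .skip)
          (.ite (.nle (.add (.var 54) (.var 51)) (.var 50))
            (.letNat 55 (.add (.var 54) (.var 51))) (.letNat 55 (.var 50)))) <|
      .seq rank <|
        .ite (.nle (.var 57) (.const 0))
          (.seq (.setReal 23 (.var 58) (.get 22 (.var 52)))
            (.letNat 58 (.add (.var 58) (.const 1))))
          .skip) (fun _ => 100 + (200 * (g + 1) + 100)) rfl
    (fun s' h => by simpa [h.nat 50 rfl] using hn)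
    (fun j s x h => by simpa [State.updNat_nat] using h)
    ⟨by simp [h₁.2], by simp [h₁.1], fun p => by simp [h₁.1, countIn]⟩
    (by
      intro j hj s₂ hI h hv
      have h50 : s₂.nat 50 0 = n := by rw [h.nat 50 rfl, hn]
      have h51 : s₂.nat 51 0 = g := by rw [h.nat 51 rfl, hgs]
      replace hX : s₂.real 22 = X := by rw [h.real 22 rfl, hX]
      refine Runs.prefix (k₁ := 100) (fun s => s.nat 54 0 = g * (j / g) ∧
        s.nat 55 0 = min (g * (j / g) + g) n) (by decide) le_rfl ?_ fun s₃ hs₃ h₃ => ?_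
      -- The start of the block moves exactly when `j` reaches the end of the old block; one
      -- comparison replaces the division.
      · have hdiv : g * (j / g) = if j = g * ((j - 1) / g) + g then g * ((j - 1) / g) + g
            else g * ((j - 1) / g) := by
          have e1 := Nat.div_add_mod j g
          have e2 := Nat.mod_lt j hg
          have e3 := Nat.div_add_mod (j - 1) g
          have e4 := Nat.mod_lt (j - 1) hg
          split_ifs with h1
          · rw [show g * ((j - 1) / g) + g = g * ((j - 1) / g + 1) by ring] at h1 ⊢
            nth_rewrite 1 [h1]
            rw [Nat.mul_div_cancel_left _ hg]
          · congr 1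
            rcases Nat.eq_zero_or_pos j with rfl | hj0
            · rfl
            · rw [Nat.div_eq_iff hg]
              have : (j - 1) / g * g = g * ((j - 1) / g) := mul_comm _ _
              omega
        simp only [Cmd.wp, NExp.eval_get, NExp.eval_const, NExp.eval_add, Test.holds_neq,
          Test.holds_nle, State.updNat_nat, hv, h51, h50, hI.1, reduceIte, Nat.reduceEqDiff,
          Function.update_self]
        rw [hdiv]
        refine ⟨fun h1 => ?_, fun h1 => ?_⟩
        · simp only [if_pos h1]
          exact ⟨fun h2 => ⟨trivial, (min_eq_left h2).symm⟩,
            fun h2 => ⟨trivial, (min_eq_right (by omega)).symm⟩⟩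
        · simp only [if_neg h1]
          exact ⟨fun h2 => ⟨trivial, (min_eq_left h2).symm⟩,
            fun h2 => ⟨trivial, (min_eq_right (by omega)).symm⟩⟩
      · have h52 : s₃.nat 52 0 = j := by rw [hs₃.nat 52 rfl, hv]
        have hX₃ : s₃.real 22 = X := by rw [hs₃.real 22 rfl, hX]
        refine ((rank_runs s₃ _ _ j h₃.1 h₃.2 h52).seq fun s₄ hs₄ h₄ => (Runs.of_wp (Q := _)
          ?_).mono (k' := 100) (by decide) fun _ _ h => h).mono ?_ fun _ _ h => h
        · rw [hX₃] at h₄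
          have hk : s₄.nat 57 0 = 0 ↔ Kept X g n j := by rw [h₄.2]; rfl
          have h52' : s₄.nat 52 0 = j := by rw [hs₄.nat 52 rfl, h52]
          have h54 : s₄.nat 54 0 = g * (j / g) := by rw [hs₄.nat 54 rfl, h₃.1]
          have h58 : s₄.nat 58 0 = s₂.nat 58 0 := by rw [hs₄.nat 58 rfl, hs₃.nat 58 rfl]
          have hX₄ : s₄.real 22 = X := by rw [hs₄.real 22 rfl, hX₃]
          have hY : s₄.real 23 = s₂.real 23 := by rw [hs₄.real 23 rfl, hs₃.real 23 rfl]
          have hrec : ∀ p : ℝ → Prop,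
              ((Finset.range (j + 1)).filter fun i => Kept X g n i ∧ p (X i)).card =
              ((Finset.range j).filter fun i => Kept X g n i ∧ p (X i)).card +
                if Kept X g n j ∧ p (X j) then 1 else 0 := by
            intro p
            rw [Finset.range_add_one, Finset.filter_insert]
            split_ifs
            · rw [Finset.card_insert_of_notMem (by simp)]
            · rfl
          simp only [Cmd.wp, NExp.eval_get, NExp.eval_const, NExp.eval_add, Test.holds_nle,
            nonpos_iff_eq_zero, hk, RExp.eval_get, State.updNat_nat, State.updReal_real,
            State.updReal_nat, State.updNat_real, reduceIte, Nat.reduceEqDiff,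
            Function.update_self, h52', h54, h58, hX₄, hY, Nat.add_sub_cancel, hrec]
          refine ⟨fun h1 => ⟨trivial, by have := hI.2.1; omega, fun p => ?_⟩,
            fun h1 => ⟨trivial, by have := hI.2.1; omega, fun p => ?_⟩⟩
          · rw [countIn_range_succ, hI.2.2]; simp [h1]
          · rw [hI.2.2]; simp [h1]
        · have : min (g * (j / g) + g) n - g * (j / g) ≤ g := by
            have := min_le_left (g * (j / g) + g) n
            omega
          omega)
  refine hfor.seq (k₂ := 100 * (n + 1) + 20) (fun s₂ hs₂ h₂ => ?_) |>.mono ?_ fun _ _ h => h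
  · have hfor₂ := Runs.for_wp (K := 50) (v := 52) (N := .var 58) (s₀ := s₂)
      (c := .setReal 22 (.var 52) (.get 23 (.var 52))) (s₂.nat 58 0)
      (fun j s => ∀ k < j, s.real 22 k = s₂.real 23 k) (by decide) rfl
      (fun s' h => by simp [h.nat 58 rfl])
      (fun j s x h => by simpa [State.updNat_nat] using h) (by simp)
      (by
        intro j hj s₃ hI h hv
        have : s₃.real 23 = s₂.real 23 := h.real 23 rfl
        simp only [Cmd.wp, NExp.eval_get, NExp.eval_const, RExp.eval_get, State.updReal_real,
          reduceIte, hv, this]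
        intro k hk
        by_cases hkj : k = j
        · simp [hkj]
        · rw [Function.update_of_ne hkj]; exact hI k (by omega))
    refine (hfor₂.seq (k₂ := 20) fun s₃ hs₃ h₃ => ?_).mono ?_ fun _ _ h => h
    · refine (Runs.of_wp ?_).mono (k := Cmd.bound _) (by decide) fun _ _ h => h
      have h58 : s₃.nat 58 0 = s₂.nat 58 0 := by rw [hs₃.nat 58 rfl]
      have h51 : s₃.nat 51 0 = g := by rw [hs₃.nat 51 rfl, hs₂.nat 51 rfl, hgs]
      simp only [Cmd.wp, NExp.eval_get, NExp.eval_const, NExp.eval_add, State.updNat_nat,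
        State.updNat_real, reduceIte, Nat.reduceEqDiff, Function.update_self, h58, h51]
      refine ⟨_, rfl, trivial, fun p => ?_⟩
      rw [← h₂.2.2]
      unfold countIn
      refine congrArg _ (Finset.filter_congr fun k hk => ?_)
      rw [h₃ k (Finset.mem_range.1 hk)]
    · have := h₂.2.1
      omega
  · simp only [Finset.sum_const, Finset.card_range, smul_eq_mul, NExp.cost]
    have hP := Nat.le_mul_of_pos_right (n + 1) (show 0 < g + 1 by omega)
    have hP' : n * (g + 1) ≤ (n + 1) * (g + 1) := Nat.mul_le_mul_right _ (by omega)
    rw [mul_assoc 600, show n * (100 + (200 * (g + 1) + 100)) = 200 * (n * (g + 1)) + 200 * n by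
      ring]
    generalize (n + 1) * (g + 1) = P at *
    generalize n * (g + 1) = P' at *
    omega

/-- The two inequalities single out the rank n/2, rounded down, which exactly one entry has. All
ranks are computed in quadratic time. -/
theorem select_runs (s : State) (X : ℕ → ℝ) (n : ℕ) (h0 : 0 < n) (hX : s.real 22 = X)
    (hn : s.nat 50 0 = n) :
    Runs select s (1000 * (n + 1) * (n + 1)) fun s' => ∃ i < n, s'.real 21 0 = X i ∧
      2 * rankIn X (Finset.range n) i ≤ n ∧ n < 2 * rankIn X (Finset.range n) i + 2 := by
  have hcost : 20 + 900 * (n + 1) * (n + 1) ≤ 1000 * (n + 1) * (n + 1) := by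
    have hP := Nat.le_mul_of_pos_right (n + 1) (show 0 < n + 1 by omega)
    simp only [mul_assoc]
    generalize (n + 1) * (n + 1) = P at *
    omega
  refine Runs.prefix (k₁ := 20) (fun s => s.nat 54 0 = 0 ∧ s.nat 55 0 = n) (by decide)
    hcost (by simp [Cmd.wp, State.updNat_nat, hn]) fun s₁ hs₁ h₁ => ?_
  replace hX := (hs₁.real 22 rfl).trans hX
  rw [← hs₁.nat 50 rfl] at hn
  clear hs₁
  let good : ℕ → Prop := fun i => 2 * rankIn X (Finset.range n) i ≤ n ∧
    n < 2 * rankIn X (Finset.range n) i + 2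
  refine (Runs.for (v := 52) (N := .var 50) (s₀ := s₁) n
    (fun j s => (∃ i < j, good i) → ∃ i < n, s.real 21 0 = X i ∧ good i)
    (fun _ => 200 * (n + 1) + 100) rfl (fun s' h => by simpa [h.nat 50 rfl] using hn)
    (fun j s x h => by simpa [State.updNat_nat] using h) (by simp) ?_).mono ?_ ?_
  · intro j hj s₂ hI h hv
    have h50 : s₂.nat 50 0 = n := by rw [h.nat 50 rfl, hn]
    have h54 : s₂.nat 54 0 = 0 := by rw [h.nat 54 rfl, h₁.1]
    have h55 : s₂.nat 55 0 = n := by rw [h.nat 55 rfl, h₁.2]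
    replace hX : s₂.real 22 = X := by rw [h.real 22 rfl, hX]
    refine ((rank_runs s₂ 0 n j h54 h55 hv).seq fun s₃ hs₃ h₃ => (Runs.of_wp (Q := _)
      ?_).mono (k' := 100) (by decide) fun _ _ h => h).mono le_rfl fun _ _ h => h
    rw [hX, ← Finset.range_eq_Ico] at h₃
    have h52 : s₃.nat 52 0 = j := by rw [hs₃.nat 52 rfl, hv]
    have h50' : s₃.nat 50 0 = n := by rw [hs₃.nat 50 rfl, h50]
    have hX' : s₃.real 22 = X := by rw [hs₃.real 22 rfl, hX]
    have h21 : s₃.real 21 = s₂.real 21 := hs₃.real 21 rfl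
    simp only [Cmd.wp, NExp.eval_get, NExp.eval_const, NExp.eval_add, Test.holds_nle,
      Test.holds_and, Test.holds_nlt, RExp.eval_get, State.updReal_real, reduceIte,
      Function.update_self, h52, h50', hX', h₃.1, h21, ← two_mul]
    refine ⟨fun h1 _ => ⟨j, hj, rfl, h1⟩, fun h1 => ?_⟩
    rintro ⟨i, hi, h2⟩
    refine hI ⟨i, lt_of_le_of_ne (by omega) ?_, h2⟩
    rintro rfl; exact h1 h2
  · simp only [Finset.sum_const, Finset.card_range, smul_eq_mul, NExp.cost]
    have hP := Nat.le_mul_of_pos_right (n + 1) (show 0 < n + 1 by omega)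
    have hP' : n * (n + 1) ≤ (n + 1) * (n + 1) := Nat.mul_le_mul_right _ (by omega)
    rw [mul_assoc 900, show n * (200 * (n + 1) + 100) = 200 * (n * (n + 1)) + 100 * n by ring]
    generalize (n + 1) * (n + 1) = P at *
    generalize n * (n + 1) = P' at *
    omega
  · rintro s' - h
    obtain ⟨i, hi, h2⟩ := exists_rankIn_eq X n (r := n / 2) (by omega)
    exact h ⟨i, hi, by simp only [good, h2]; omega⟩

open Classical in
-- A round costs a multiple of the product of sample size and block size, and this product falls by
-- a quarter each time. It starts at 128M, so the rounds are linear in M together. At the end the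
-- sample is no larger than a block, so the quadratic selection is paid for by the same product.
theorem pivot_runs : ∃ K, ∀ (s : State) (W : ℕ → ℝ) (M : ℕ), 0 < M → (∀ a < M, s.real 20 a = W a) →
    s.nat 22 0 = M → Runs pivot s (K * M) fun s' => IsPivot W M (s'.real 21 0) := by
  refine ⟨4100000, fun s W M hM hW h22 => ?_⟩
  have hfor := Runs.for_wp (K := 50) (v := 52) (N := .var 22) (s₀ := s)
    (c := .setReal 22 (.var 52) (.get 20 (.var 52))) M
    (fun j s => ∀ k < j, s.real 22 k = W k) (by decide) rfl
    (fun s' h => by simpa [h.nat 22 rfl] using h22)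
    (fun j s x h => by simpa [State.updNat_nat] using h) (by simp)
    (by
      intro j hj s₃ hI h hv
      have : s₃.real 20 j = W j := by rw [h.real 20 rfl]; exact hW j hj
      simp only [Cmd.wp, NExp.eval_get, NExp.eval_const, RExp.eval_get, State.updReal_real,
        reduceIte, hv, this]
      intro k hk
      by_cases hkj : k = j
      · simp [hkj]
      · rw [Function.update_of_ne hkj]; exact hI k (by omega))
  refine (hfor.seq (k₂ := 4000000 * M) fun s₁ hs₁ h₁ => ?_).mono (by omega) fun _ _ h => h
  rw [← hs₁.nat 22 rfl] at h22
  let I : State → Prop := fun s => IsSample W M (s.real 22) (s.nat 50 0) (s.nat 51 0)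
  have hinit : IsSample W M (s₁.real 22) M 128 := by
    have h := IsSample.refl W hM
    have hc : ∀ p, countIn (s₁.real 22) (Finset.range M) p = countIn W (Finset.range M) p := by
      intro p
      refine congrArg Finset.card (Finset.filter_congr fun k hk => ?_)
      rw [h₁ k (Finset.mem_range.1 hk)]
    exact ⟨h.pos, h.size, fun k hk => ⟨k, hk, h₁ k hk⟩, by simpa only [hc] using h.accurate⟩
  refine Runs.prefix (k₁ := 20) (k₂ := 3900000 * M) (fun s => I s ∧ s.nat 50 0 = M ∧
    s.nat 51 0 = 128) (by decide) (by omega) ?_ fun s₂ hs₂ h₂ => ?_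
  · simp only [I, Cmd.wp, NExp.eval_get, NExp.eval_const, State.updNat_nat, State.updNat_real,
      reduceIte, Nat.reduceEqDiff, Function.update_self, h22]
    exact ⟨hinit, trivial, trivial⟩
  have hloop := Runs.while (b := .nlt (.var 51) (.var 50)) (c := thin) (s₀ := s₂)
    -- A round costs less than 2000 times the product of sample size and block size, that is, a
    -- quarter of this potential.
    (fun s => I s ∧ s.nat 50 0 * s.nat 51 0 ≤ 128 * M) (fun s => 8000 * (s.nat 50 0 * s.nat 51 0))
    ⟨h₂.1, by rw [h₂.2.1, h₂.2.2]; omega⟩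
    (by
      rintro s₃ ⟨hI, hle⟩ - hb
      simp only [Test.holds_nlt, NExp.eval_get, NExp.eval_const] at hb
      have hsz := hI.size
      refine ⟨_, (thin_runs s₃ _ _ _ (by omega) rfl rfl rfl).mono le_rfl ?_⟩
      rintro s₄ - ⟨n', h50, h51, h⟩
      obtain ⟨hS, hsize⟩ := hI.thin hb h
      refine ⟨⟨?_, ?_⟩, ?_⟩
      · simp only [I, h50, h51]; exact hS
      · rw [h50, h51]; omega
      · rw [h50, h51]
        have hc : Test.cost (.nlt (.var 51) (.var 50)) = 6 := by decide
        rw [hc]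
        have : (s₃.nat 50 0 + 1) * (s₃.nat 51 0 + 1) + 7 ≤ 2 * (s₃.nat 50 0 * s₃.nat 51 0) := by
          nlinarith
        have e : 1000 * (s₃.nat 50 0 + 1) * (s₃.nat 51 0 + 1) =
          1000 * ((s₃.nat 50 0 + 1) * (s₃.nat 51 0 + 1)) := by ring
        rw [e]
        omega)
  refine (hloop.seq (k₂ := 1000 * 4 * 128 * M) fun s₃ hs₃ h₃ => ?_).mono ?_ fun _ _ h => h
  · obtain ⟨⟨hI, hle⟩, hb⟩ := h₃
    simp only [Test.holds_nlt, NExp.eval_get, NExp.eval_const, not_lt] at hb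
    have hpos := hI.pos
    refine (select_runs s₃ _ _ hI.pos rfl rfl).mono ?_ ?_
    · have : (s₃.nat 50 0 + 1) * (s₃.nat 50 0 + 1) ≤ 4 * (s₃.nat 50 0 * s₃.nat 51 0) := by
        nlinarith
      have e : 1000 * (s₃.nat 50 0 + 1) * (s₃.nat 50 0 + 1) =
          1000 * ((s₃.nat 50 0 + 1) * (s₃.nat 50 0 + 1)) := by ring
      rw [e]
      omega
    · rintro s₄ - ⟨i, hi, h21, h4, h5⟩
      rw [h21]
      exact hI.isPivot hi h4 h5
  · rw [h₂.2.1, h₂.2.2]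
    have hc : Test.cost (.nlt (.var 51) (.var 50)) = 6 := by decide
    rw [hc]
    omega

end RealRAM.Pivot

namespace RealRAM.Bottleneck

open RealRAM.Search

/-! ### The bottleneck value -/

/-- A graph with two special vertices. -/
structure ArcGraph where
  M : ℕ
  S : ℕ → ℕ
  D : ℕ → ℕ
  W : ℕ → ℝ
  s : ℕ
  t : ℕ

/-- The special vertices are connected through arcs of weight at most `τ`. -/
def ArcGraph.Joined (G : ArcGraph) (τ : ℝ) : Prop := ArcConn G.M G.S G.D G.W τ G.s G.t

/-- The arcs of `G'` are the arcs of `G` with weights in `keep`, relabelled by `f`. -/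
structure IsFiltered (G G' : ArcGraph) (keep : ℝ → Prop) (f : ℕ → ℕ) : Prop where
  of_new : ∀ k < G'.M, ∃ e < G.M, keep (G.W e) ∧ G'.S k = f (G.S e) ∧ G'.D k = f (G.D e) ∧
    G'.W k = G.W e
  to_new : ∀ e < G.M, keep (G.W e) → ∃ k < G'.M, G'.S k = f (G.S e) ∧ G'.D k = f (G.D e) ∧
    G'.W k = G.W e
  card : G'.M = countIn G.W (Finset.range G.M) keep

theorem IsFiltered.symm {G G' : ArcGraph} {keep : ℝ → Prop} {f : ℕ → ℕ}
    (h : IsFiltered G G' keep f) (hG : ArcSymm G.M G.S G.D G.W) :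
    ArcSymm G'.M G'.S G'.D G'.W := by
  intro k hk
  obtain ⟨e, he, hkeep, h1, h2, h3⟩ := h.of_new k hk
  obtain ⟨e', he', h4, h5, h6⟩ := hG e he
  obtain ⟨k', hk', h7, h8, h9⟩ := h.to_new e' he' (h6 ▸ hkeep)
  exact ⟨k', hk', by rw [h7, h4, h2], by rw [h8, h5, h1], by rw [h9, h6, h3]⟩

/-- The bottleneck value of `G₀` is the smaller one of `best` and the bottleneck value of `G`. -/
structure Inv (G₀ G : ArcGraph) (best : ℝ) : Prop where
  symm : ArcSymm G.M G.S G.D G.W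
  path : ∀ τ, G₀.Joined τ → G.Joined τ ∨ (G₀.Joined best ∧ best ≤ τ ∧ ∀ e < G.M, G.W e < best)
  back : ∀ τ, (∃ e < G.M, G.W e ≤ τ) → G.Joined τ → G₀.Joined τ
  ne : G₀.s ≠ G₀.t → G.s ≠ G.t

/-- The initial value of `best` is arbitrary, because the first alternative of `path` always holds.
-/
theorem Inv.refl {G : ArcGraph} (h : ArcSymm G.M G.S G.D G.W) (best : ℝ) : Inv G G best :=
  ⟨h, fun _ h => .inl h, fun _ _ h => h, fun h => h⟩

/-- The pivot `m` is the weight of an arc, so `back` applies at `m` and `m` is attained in `G₀`.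
Connections below `m` survive in `G'`, and for thresholds from `m` on the new best value answers. An
earlier best value exceeds all remaining weights, in particular `m`. -/
theorem Inv.low {G₀ G G' : ArcGraph} {best m : ℝ} (I : Inv G₀ G best) (hm : ∃ i < G.M, m = G.W i)
    (hj : G.Joined m) (hf : IsFiltered G G' (· < m) id) (hs : G'.s = G.s) (ht : G'.t = G.t) :
    Inv G₀ G' m := by
  obtain ⟨i, hi, him⟩ := hm
  have hjm : G₀.Joined m := I.back m ⟨i, hi, him.ge⟩ hj
  have hlt : ∀ e < G'.M, G'.W e < m := by
    intro e he
    obtain ⟨e', -, h1, -, -, h2⟩ := hf.of_new e he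
    rwa [h2]
  refine ⟨hf.symm I.symm, fun τ hτ => ?_, fun τ hτ h => ?_, fun h => by rw [hs, ht]; exact I.ne h⟩
  · rcases I.path τ hτ with h1 | ⟨-, h1, h2⟩
    · by_cases hmτ : m ≤ τ
      · exact .inr ⟨hjm, hmτ, hlt⟩
      · refine .inl ?_
        rw [ArcGraph.Joined, hs, ht]
        refine Relation.ReflTransGen.mono (fun x y hxy => ?_) _ _ h1
        obtain ⟨e, he, rfl, rfl, hw⟩ := hxy
        obtain ⟨k, hk, h3, h4, h5⟩ := hf.to_new e he (by linarith)
        exact ⟨k, hk, h3, h4, h5 ▸ hw⟩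
    · have := h2 i hi
      exact .inr ⟨hjm, by linarith, hlt⟩
  · obtain ⟨e, he, hw⟩ := hτ
    obtain ⟨e', he', -, -, -, h2⟩ := hf.of_new e he
    refine I.back τ ⟨e', he', h2 ▸ hw⟩ ?_
    rw [ArcGraph.Joined, hs, ht] at h
    refine Relation.ReflTransGen.mono (fun x y hxy => ?_) _ _ h
    obtain ⟨k, hk, rfl, rfl, hw⟩ := hxy
    obtain ⟨e, he, -, h3, h4, h5⟩ := hf.of_new k hk
    exact ⟨e, he, h3.symm, h4.symm, h5 ▸ hw⟩

/-- The components at threshold `m` become vertices. A connection of the quotient at threshold `τ`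
can be lifted only if `m ≤ τ`. This is what the arc of weight at most `τ` in `back` is for: only
arcs heavier than `m` remain. The special vertices stay distinct because `m` does not join them. -/
theorem Inv.high {G₀ G G' : ArcGraph} {best m : ℝ} {μ : ℕ → ℕ} {V : Finset ℕ} (I : Inv G₀ G best)
    (hj : ¬ G.Joined m) (hf : IsFiltered G G' (m < ·) μ)
    (hV : ∀ e < G.M, G.S e ∈ V ∧ G.D e ∈ V) (hsV : G.s ∈ V) (htV : G.t ∈ V)
    (hμ : ∀ x ∈ V, ∀ y ∈ V, μ x = μ y ↔ ArcConn G.M G.S G.D G.W m x y)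
    (hs : G'.s = μ G.s) (ht : G'.t = μ G.t) : Inv G₀ G' best := by
  refine ⟨hf.symm I.symm, fun τ hτ => ?_, fun τ hτ h => ?_, fun _ h => ?_⟩
  · refine (I.path τ hτ).imp (fun h => ?_) fun h => ⟨h.1, h.2.1, fun e he => ?_⟩
    · rw [ArcGraph.Joined, hs, ht]
      have key : ∀ y, ArcConn G.M G.S G.D G.W τ G.s y →
          ArcConn G'.M G'.S G'.D G'.W τ (μ G.s) (μ y) := by
        intro y hy
        induction hy with
        | refl => exact .refl
        | tail _ h1 ih =>
          obtain ⟨e, he, rfl, rfl, hw⟩ := h1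
          by_cases hm : G.W e ≤ m
          · rwa [← (hμ _ (hV e he).1 _ (hV e he).2).2 (.single ⟨e, he, rfl, rfl, hm⟩)]
          · obtain ⟨k, hk, h3, h4, h5⟩ := hf.to_new e he (not_le.1 hm)
            exact ih.tail ⟨k, hk, h3, h4, h5 ▸ hw⟩
      exact key _ h
    · obtain ⟨e', he', -, -, -, h2⟩ := hf.of_new e he
      rw [h2]
      exact h.2.2 e' he'
  · obtain ⟨e, he, hw⟩ := hτ
    obtain ⟨e', he', hm, -, -, h2⟩ := hf.of_new e he
    rw [h2] at hw
    refine I.back τ ⟨e', he', hw⟩ ?_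
    have key : ∀ a, ArcConn G'.M G'.S G'.D G'.W τ (μ G.s) a → ∀ y ∈ V, μ y = a →
        ArcConn G.M G.S G.D G.W τ G.s y := by
      intro a ha
      induction ha with
      | refl =>
        intro y hy hya
        exact ArcConn.mono (hm.le.trans hw) ((hμ _ hsV _ hy).1 hya.symm)
      | tail _ h1 ih =>
        intro y hy hya
        obtain ⟨k, hk, rfl, rfl, hwk⟩ := h1
        obtain ⟨i, hi, -, h3, h4, h5⟩ := hf.of_new k hk
        have := (ih _ (hV i hi).1 h3.symm).tail ⟨i, hi, rfl, rfl, h5 ▸ hwk⟩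
        refine Relation.ReflTransGen.trans this (ArcConn.mono (hm.le.trans hw) ?_)
        exact (hμ _ (hV i hi).2 _ hy).1 (by rw [hya, h4])
    rw [ArcGraph.Joined, hs, ht] at h
    exact key _ h _ htV rfl
  · rw [hs, ht] at h
    exact hj ((hμ _ hsV _ htV).1 h)

/-- Without arcs distinct vertices are never joined, so distinct special vertices leave only the
second alternative of `path`. Coinciding ones are joined at every threshold, and then `best` carries
no information. -/
theorem Inv.final {G₀ G : ArcGraph} {best : ℝ} (I : Inv G₀ G best) (hM : G.M = 0) :
    ∀ τ, G₀.Joined τ → G₀.Joined best ∧ (G₀.s ≠ G₀.t → best ≤ τ) := by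
  intro τ hτ
  by_cases hst : G₀.s = G₀.t
  · refine ⟨?_, fun h => (h hst).elim⟩
    rw [ArcGraph.Joined, hst]
    exact .refl
  · rcases I.path τ hτ with h | h
    · have : ∀ y, ArcConn G.M G.S G.D G.W τ G.s y → y = G.s := by
        intro y hy
        induction hy with
        | refl => rfl
        | tail _ h1 _ => obtain ⟨e, he, -⟩ := h1; omega
      exact (I.ne hst (this _ h).symm).elim
    · exact ⟨h.1, fun _ => h.2.1⟩

/-! ### The bottleneck program

Integer arrays: those of the search, `60` number of arcs that are kept, `61` loop counter. Real
arrays: those of the search and of the approximate median, `24` best threshold so far. -/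

/-- Keeps the arcs that satisfy `b` and replaces their ends by `eS` and `eD`. -/
def compact (b : Test) (eS eD : NExp) : Cmd :=
  .seq (.letNat 60 (.const 0)) <|
  .seq
    (.for 61 (.var 22) <|
      .ite b
        (.seq (.setNat 20 (.var 60) eS) <|
          .seq (.setNat 21 (.var 60) eD) <|
          .seq (.setReal 20 (.var 60) (.get 20 (.var 61)))
            (.letNat 60 (.add (.var 60) (.const 1))))
        .skip)
    (.letNat 22 (.var 60))

/-- Keeps the arcs below the threshold. -/
def low : Cmd :=
  .seq (.letReal 24 (.var 21)) <|
  compact (.rlt (.get 20 (.var 61)) (.var 21)) (.get 20 (.var 61)) (.get 21 (.var 61))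

/-- Contracts the arcs up to the threshold. -/
def high : Cmd :=
  .seq
    (compact (.rlt (.var 21) (.get 20 (.var 61))) (.get 32 (.get 20 (.var 61)))
      (.get 32 (.get 21 (.var 61))))
    (.seq (.letNat 23 (.get 32 (.var 23))) (.letNat 24 (.get 32 (.var 24))))

/-- Computes the bottleneck value. -/
def bottleneck : Cmd :=
  .while (.nlt (.const 0) (.var 22)) <|
    .seq Pivot.pivot <| .seq search <|
    .ite (.neq (.get 32 (.var 23)) (.get 32 (.var 24))) low high

/-- The graph in the memory. -/
def graphOf (s : State) : ArcGraph :=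
  ⟨s.nat 22 0, s.nat 20, s.nat 21, s.real 20, s.nat 23 0, s.nat 24 0⟩

open Classical in
-- Filtering in place is safe because the write position never passes the read position. In `hD` the
-- expression for the head is evaluated after the tail has been written, hence in a memory with an
-- updated array 20.
theorem compact_runs {b : Test} {eS eD : NExp} {s : State} {K : ℕ} {keep : ℝ → Prop} {f : ℕ → ℕ}
    (hK : (compact b eS eD).bound + 100 + b.cost + eS.cost + eD.cost ≤ K)
    (hb : ∀ s', (compact b eS eD).Same s s' → (b.Holds s' ↔ keep (s'.real 20 (s'.nat 61 0))))
    (hS : ∀ s', (compact b eS eD).Same s s' → eS.eval s' = f (s'.nat 20 (s'.nat 61 0)))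
    (hD : ∀ s', (compact b eS eD).Same s s' → ∀ k a, k ≤ s'.nat 61 0 →
      eD.eval (s'.updNat 20 k a) = f (s'.nat 21 (s'.nat 61 0))) :
    Runs (compact b eS eD) s (K * (s.nat 22 0 + 3)) fun s' => IsFiltered (graphOf s)
      { graphOf s' with s := s.nat 23 0, t := s.nat 24 0 } keep f := by
  set G := graphOf s with hG
  have hM : s.nat 22 0 = G.M := rfl
  refine Runs.prefix (k₁ := K) (k₂ := K * (G.M + 1) + K) (fun s' => s'.nat 60 0 = 0) ?_ ?_ ?_
    fun s₁ hs₁ h₁ => ?_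
  · simp [Cmd.bound, NExp.cost]; omega
  · rw [hM]; ring_nf; omega
  · simp [Cmd.wp, State.updNat_nat]
  have hs₁' : (compact b eS eD).Same s s₁ := hs₁.mono
    (fun a => by simp +contextual [compact, Cmd.wN]) (fun a => by simp +contextual [compact, Cmd.wR])
  have hfor := Runs.for_wp (K := K) (v := 61) (N := .var 22) (s₀ := s₁) G.M
    (c := .ite b
        (.seq (.setNat 20 (.var 60) eS) <|
          .seq (.setNat 21 (.var 60) eD) <|
          .seq (.setReal 20 (.var 60) (.get 20 (.var 61)))
            (.letNat 60 (.add (.var 60) (.const 1))))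
        .skip)
    (fun j s => s.nat 60 0 = countIn G.W (Finset.range j) keep ∧ s.nat 60 0 ≤ j ∧
      (∀ k, j ≤ k → s.nat 20 k = G.S k ∧ s.nat 21 k = G.D k ∧ s.real 20 k = G.W k) ∧
      (∀ k < s.nat 60 0, ∃ e < j, keep (G.W e) ∧ s.nat 20 k = f (G.S e) ∧
        s.nat 21 k = f (G.D e) ∧ s.real 20 k = G.W e) ∧
      (∀ e < j, keep (G.W e) → ∃ k < s.nat 60 0, s.nat 20 k = f (G.S e) ∧
        s.nat 21 k = f (G.D e) ∧ s.real 20 k = G.W e))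
    ?_ ?_ ?_ ?_ ?_ ?_
  · refine (hfor.seq (k₂ := K) fun s₂ hs₂ h₂ => ?_).mono le_rfl fun _ _ h => h
    refine (Runs.of_wp ?_).mono ?_ fun _ _ h => h
    · simp only [Cmd.wp, NExp.eval_get, NExp.eval_const]
      simp only [graphOf, State.updNat_nat, State.updNat_real, reduceIte, Nat.reduceEqDiff,
        Function.update_self]
      exact ⟨h₂.2.2.2.1, h₂.2.2.2.2, h₂.1⟩
    · simp [Cmd.bound, NExp.cost]; omega
  · simp only [compact, Cmd.bound, NExp.cost, Cmd.for, RExp.cost] at hK ⊢; omega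
  · simp [Cmd.wN]
  · intro s' h
    have : s'.nat 22 = s₁.nat 22 := h.nat 22 (by simp [Cmd.for, Cmd.wN])
    simp only [NExp.eval_get, NExp.eval_const, this, hs₁.nat 22 (by simp [Cmd.wN])]
    rfl
  · exact fun j s x h => by simpa [State.updNat_nat] using h
  · rw [hs₁.nat 20 (by simp [Cmd.wN]), hs₁.nat 21 (by simp [Cmd.wN]), hs₁.real 20 rfl]
    refine ⟨by simp [h₁, countIn], by omega, fun k _ => ⟨rfl, rfl, rfl⟩, ?_, by simp⟩
    intro k hk; omega
  · rintro j hj s₂ ⟨hcnt, hle, hfix, hof, hto⟩ h hv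
    have hs₂ : (compact b eS eD).Same s s₂ := hs₁'.trans <| h.mono
      (fun a => by simp +contextual [compact, Cmd.wN, Cmd.for])
      (fun a => by simp +contextual [compact, Cmd.wR, Cmd.for])
    obtain ⟨f1, f2, f3⟩ := hfix j le_rfl
    have hcnt' : countIn G.W (Finset.range (j + 1)) keep =
        countIn G.W (Finset.range j) keep + if keep (G.W j) then 1 else 0 := by
      unfold countIn
      rw [Finset.range_add_one, Finset.filter_insert]
      split_ifs
      · rw [Finset.card_insert_of_notMem (by simp)]
      · rfl
    have hb' := hb s₂ hs₂
    have hS' := hS s₂ hs₂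
    have hD' := hD s₂ hs₂ (s₂.nat 60 0) (eS.eval s₂) (by omega)
    rw [hv] at hb' hS' hD'
    rw [f1] at hS'
    rw [f2] at hD'
    rw [f3] at hb'
    simp only [Cmd.wp, NExp.eval_get, NExp.eval_const, NExp.eval_add, RExp.eval_get, hb']
    rw [hS'] at hD' ⊢
    simp only [State.updNat_nat, State.updReal_real, State.updReal_nat, State.updNat_real,
      reduceIte, Nat.reduceEqDiff, Function.update_self, hv, hcnt']
    rw [hD']
    refine ⟨fun h1 => ⟨by rw [if_pos h1, hcnt], by omega, fun k hk => ?_, fun k hk => ?_,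
      fun e he hke => ?_⟩, fun h1 => ⟨by rw [if_neg h1, hcnt, Nat.add_zero], by omega, fun k hk => ?_,
      fun k hk => ?_, fun e he hke => ?_⟩⟩
    · have : k ≠ s₂.nat 60 0 := by omega
      simp only [Function.update_of_ne this]
      exact hfix k (by omega)
    · by_cases hk0 : k = s₂.nat 60 0
      · subst hk0
        simp only [Function.update_self]
        exact ⟨j, by omega, h1, rfl, rfl, f3⟩
      · simp only [Function.update_of_ne hk0]
        obtain ⟨e, he, h2⟩ := hof k (by omega)
        exact ⟨e, by omega, h2⟩
    · by_cases hej : e = j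
      · subst hej
        refine ⟨s₂.nat 60 0, by omega, ?_⟩
        simp only [Function.update_self]
        exact ⟨trivial, trivial, f3⟩
      · obtain ⟨k, hk, h2⟩ := hto e (by omega) hke
        refine ⟨k, by omega, ?_⟩
        have : k ≠ s₂.nat 60 0 := by omega
        simp only [Function.update_of_ne this]
        exact h2
    · exact hfix k (by omega)
    · obtain ⟨e, he, h2⟩ := hof k hk
      exact ⟨e, by omega, h2⟩
    · refine hto e (lt_of_le_of_ne (by omega) ?_) hke
      rintro rfl; exact h1 hke

/-- A round is linear in the current number of arcs, and by the pivot property at most three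
quarters of them remain in either case, so the total is a geometric series. -/
theorem bottleneck_runs : ∃ K, ∀ (s : State), ArcSymm (graphOf s).M (graphOf s).S (graphOf s).D
    (graphOf s).W → Runs bottleneck s (K * ((graphOf s).M + 1)) fun s' =>
      ∀ τ, (graphOf s).Joined τ → (graphOf s).Joined (s'.real 24 0) ∧
        ((graphOf s).s ≠ (graphOf s).t → s'.real 24 0 ≤ τ) := by
  obtain ⟨Kp, hp⟩ := Pivot.pivot_runs
  refine ⟨4 * (Kp + 10000), fun s hsymm => ?_⟩
  have hloop := Runs.while (b := .nlt (.const 0) (.var 22)) (c := .seq Pivot.pivot <| .seq search <|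
    .ite (.neq (.get 32 (.var 23)) (.get 32 (.var 24))) low high) (s₀ := s)
    (fun s' => Inv (graphOf s) (graphOf s') (s'.real 24 0))
    (fun s' => 4 * (Kp + 10000) * s'.nat 22 0) (Inv.refl hsymm _)
    (by
      rintro s₁ I - hb
      simp only [Test.holds_nlt, NExp.eval_get, NExp.eval_const] at hb
      set M := s₁.nat 22 0 with hM
      refine ⟨Kp * M + (2000 * (M + 1) + 1000 * (M + 4)), ?_⟩
      refine (hp s₁ (s₁.real 20) M hb (fun _ _ => rfl) rfl).seq fun s₂ hs₂ hpiv => ?_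
      set m := s₂.real 21 0 with hm
      have hg : graphOf s₂ = graphOf s₁ := by
        simp only [graphOf, hs₂.nat 20 rfl, hs₂.nat 21 rfl, hs₂.nat 22 rfl, hs₂.nat 23 rfl,
          hs₂.nat 24 rfl, hs₂.real 20 rfl]
      let G : Search.Graph := ⟨M, s₁.nat 20, s₁.nat 21, s₁.real 20, m, s₁.nat 23 0, s₁.nat 24 0,
        I.symm⟩
      have hL : Loaded G s₂ := by
        refine ⟨?_, fun a _ => ?_, fun a _ => ?_, fun a _ => ?_, rfl, ?_, ?_⟩
        · rw [hs₂.nat 22 rfl]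
        · rw [hs₂.nat 20 rfl]
        · rw [hs₂.nat 21 rfl]
        · rw [hs₂.real 20 rfl]
        · rw [hs₂.nat 23 rfl]
        · rw [hs₂.nat 24 rfl]
      refine (search_runs G s₂ hL).seq fun s₃ hs₃ hres => ?_
      have hg₃ : graphOf s₃ = graphOf s₁ := by
        rw [← hg]
        simp only [graphOf, hs₃.nat 20 rfl, hs₃.nat 21 rfl, hs₃.nat 22 rfl, hs₃.nat 23 rfl,
          hs₃.nat 24 rfl, hs₃.real 20 rfl]
      have hm₃ : s₃.real 21 0 = m := by rw [hs₃.real 21 rfl]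
      have hM₃ : s₃.nat 22 0 = M := by rw [hs₃.nat 22 rfl, hs₂.nat 22 rfl]
      have hbest : s₃.real 24 0 = s₁.real 24 0 := by rw [hs₃.real 24 rfl, hs₂.real 24 rfl]
      have h23 : s₃.nat 23 0 = s₁.nat 23 0 := by rw [hs₃.nat 23 rfl, hs₂.nat 23 rfl]
      have h24 : s₃.nat 24 0 = s₁.nat 24 0 := by rw [hs₃.nat 24 rfl, hs₂.nat 24 rfl]
      have hjoin : s₃.nat 32 (s₃.nat 23 0) = s₃.nat 32 (s₃.nat 24 0) ↔ (graphOf s₁).Joined m := by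
        rw [h23, h24]
        exact hres.conn _ (by simp [Graph.verts, G]) _ (by simp [Graph.verts, G])
      -- The lost quarter of the potential pays for the round; the additive constants are absorbed
      -- because `M` is positive.
      have hcost : ∀ M', 4 * M' ≤ 3 * M → Kp * M + (2000 * (M + 1) + 1000 * (M + 4)) +
          Test.cost (.nlt (.const 0) (.var 22)) + 1 + 4 * (Kp + 10000) * M' ≤
          4 * (Kp + 10000) * M := by
        intro M' hM'
        have hc : Test.cost (.nlt (.const 0) (.var 22)) = 5 := by decide
        have h1 : 4 * (Kp + 10000) * M' ≤ (Kp + 10000) * (3 * M) := by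
          calc 4 * (Kp + 10000) * M' = (Kp + 10000) * (4 * M') := by ring
            _ ≤ _ := Nat.mul_le_mul_left _ hM'
        rw [hc]
        ring_nf at h1 ⊢
        omega
      refine (Runs.ite (k := 1000 * M + 3900) (fun hb => ?_) (fun hb => ?_)).mono
        (by
          have : Test.cost (.neq (.get 32 (.var 23)) (.get 32 (.var 24))) = 15 := by decide
          rw [this]; omega) fun _ _ h => h
      · simp only [Test.holds_neq, NExp.eval_get, NExp.eval_const, hjoin] at hb
        refine Runs.prefix (k₁ := 10) (k₂ := 1000 * (M + 3)) (fun s => s.real 24 0 = m) (by decide)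
          (by omega) (by simp [Cmd.wp, State.updReal_real, hm₃]) fun s₄ hs₄ h₄ => ?_
        have hg₄ : graphOf s₄ = graphOf s₁ := by
          rw [← hg₃]
          simp only [graphOf, hs₄.nat 20 rfl, hs₄.nat 21 rfl, hs₄.nat 22 rfl, hs₄.nat 23 rfl,
            hs₄.nat 24 rfl, hs₄.real 20 rfl]
        have hm₄ : s₄.real 21 0 = m := by rw [hs₄.real 21 rfl, hm₃]
        have hM₄ : s₄.nat 22 0 = M := by rw [hs₄.nat 22 rfl, hM₃]
        rw [← hM₄]
        refine (compact_runs (K := 1000) (keep := (· < m)) (f := id) (by decide) (fun s' h => ?_)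
          (fun s' h => ?_) fun s' h k a hk => ?_).mono le_rfl ?_
        · simp [h.real 21 rfl, hm₄]
        · simp
        · simp [State.updNat_nat]
        · intro s₅ hs₅ hf
          have e23 : s₅.nat 23 = s₄.nat 23 := hs₅.nat 23 rfl
          have e24 : s₅.nat 24 = s₄.nat 24 := hs₅.nat 24 rfl
          have e5 : ({ graphOf s₅ with s := s₄.nat 23 0, t := s₄.nat 24 0 } : ArcGraph) =
              graphOf s₅ := by simp only [graphOf, e23, e24]
          rw [e5, hg₄] at hf
          have ebest : s₅.real 24 0 = m := by rw [hs₅.real 24 rfl, h₄]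
          refine ⟨?_, ?_⟩
          · rw [ebest]
            exact I.low hpiv.1 hb hf (by simp only [graphOf, e23, hs₄.nat 23 rfl, h23])
              (by simp only [graphOf, e24, hs₄.nat 24 rfl, h24])
          · rw [hM₄]
            refine hcost _ ?_
            rw [show s₅.nat 22 0 = (graphOf s₅).M from rfl, hf.card]
            exact hpiv.2.1
      · simp only [Test.holds_neq, NExp.eval_get, NExp.eval_const, hjoin] at hb
        have hrun := compact_runs (s := s₃) (K := 1000) (keep := (m < ·)) (f := s₃.nat 32)
          (b := .rlt (.var 21) (.get 20 (.var 61))) (eS := .get 32 (.get 20 (.var 61)))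
          (eD := .get 32 (.get 21 (.var 61))) (by decide) (fun s' h => ?_)
          (fun s' h => ?_) fun s' h k a hk => ?_
        · rw [hM₃] at hrun
          refine (hrun.seq (k₂ := 100) fun s₄ hs₄ hf => (Runs.of_wp ?_).mono (k := Cmd.bound _)
            (by decide) fun _ _ h => h).mono (by omega) fun _ _ h => h
          rw [hg₃] at hf
          have e23 : s₄.nat 23 0 = s₁.nat 23 0 := by rw [hs₄.nat 23 rfl, h23]
          have e24 : s₄.nat 24 0 = s₁.nat 24 0 := by rw [hs₄.nat 24 rfl, h24]
          have e32 : s₄.nat 32 = s₃.nat 32 := hs₄.nat 32 rfl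
          have ebest : s₄.real 24 0 = s₁.real 24 0 := by rw [hs₄.real 24 rfl, hbest]
          simp only [Cmd.wp, NExp.eval_get, NExp.eval_const]
          simp only [graphOf, State.updNat_nat, State.updNat_real, reduceIte, Nat.reduceEqDiff,
            Function.update_self, e23, e24, e32, ebest]
          refine ⟨I.high (V := G.verts) (m := m) (μ := s₃.nat 32) hb ?_ ?_ ?_ ?_ hres.conn rfl rfl,
            hcost _ ?_⟩
          · exact ⟨hf.of_new, hf.to_new, hf.card⟩
          · exact fun e he => ⟨G.src_mem he, G.dst_mem he⟩
          · simp [Graph.verts, G, graphOf]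
          · simp [Graph.verts, G, graphOf]
          · rw [show s₄.nat 22 0 = (graphOf s₄).M from rfl, hf.card]
            exact hpiv.2.2
        · simp [h.real 21 rfl, hm₃]
        · simp [h.nat 32 rfl]
        · simp [State.updNat_nat, h.nat 32 rfl])
  refine hloop.mono ?_ ?_
  · have hc : Test.cost (.nlt (.const 0) (.var 22)) = 5 := by decide
    rw [hc]
    simp only [graphOf]
    ring_nf
    omega
  · rintro s' - ⟨I, hb⟩
    simp only [Test.holds_nlt, NExp.eval_get, NExp.eval_const, not_lt, nonpos_iff_eq_zero] at hb
    exact I.final hb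

end RealRAM.Bottleneck

/-! ### Paths in complexes -/

section Local

open Filter Topology

variable {d : ℕ}

/-- A set is decided by a filter if it or its complement belongs to the filter. -/
def DecidedBy {α : Type*} (l : Filter α) (A : Set α) : Prop :=
  (∀ᶠ t in l, t ∈ A) ∨ ∀ᶠ t in l, t ∉ A

theorem DecidedBy.union {α : Type*} {l : Filter α} {A B : Set α} (hA : DecidedBy l A)
    (hB : DecidedBy l B) : DecidedBy l (A ∪ B) := by
  rcases hA with hA | hA
  · exact .inl (hA.mono fun t h => .inl h)
  · rcases hB with hB | hB
    · exact .inl (hB.mono fun t h => .inr h)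
    · exact .inr ((hA.and hB).mono fun t h h' => h'.elim h.1 h.2)

theorem DecidedBy.inter {α : Type*} {l : Filter α} {A B : Set α} (hA : DecidedBy l A)
    (hB : DecidedBy l B) : DecidedBy l (A ∩ B) := by
  rcases hA with hA | hA
  · rcases hB with hB | hB
    · exact .inl (hA.and hB)
    · exact .inr (hB.mono fun t h h' => h h'.2)
  · exact .inr (hA.mono fun t h h' => h h'.1)

theorem decidedBy_biUnion {α ι : Type*} {l : Filter α} (S : Finset ι) {A : ι → Set α}
    (hA : ∀ i ∈ S, DecidedBy l (A i)) : DecidedBy l (⋃ i ∈ S, A i) := by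
  classical
  induction S using Finset.induction_on with
  | empty => exact .inr (by simp)
  | insert i S _ ih =>
    rw [Finset.set_biUnion_insert]
    exact (hA i (by simp)).union (ih fun j hj => hA j (by simp [hj]))

/-- Intervals are intersections of rays, and a point is what two opposite rays leave out. So a
filter that decides all rays decides the sets to which `tame` restricts the level sets of a
simplicial path. -/
theorem decidedBy_of_rays {l : Filter unitInterval} (h₁ : ∀ a, DecidedBy l (Set.Ioi a))
    (h₂ : ∀ a, DecidedBy l (Set.Iio a)) (S : Finset (unitInterval × unitInterval))
    (T : Finset unitInterval) :
    DecidedBy l ((⋃ p ∈ S, Set.Ioo p.1 p.2) ∪ (T : Set unitInterval)) := by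
  refine (decidedBy_biUnion S fun p _ => (h₁ p.1).inter (h₂ p.2)).union ?_
  have : (T : Set unitInterval) = ⋃ a ∈ T, (Set.Ioi a ∪ Set.Iio a)ᶜ := by
    ext x
    simp only [Finset.mem_coe, Set.mem_iUnion, Set.mem_compl_iff, Set.mem_union, Set.mem_Ioi,
      Set.mem_Iio, not_or, not_lt, exists_prop]
    exact ⟨fun h => ⟨x, h, le_rfl, le_rfl⟩, fun ⟨a, ha, h, h'⟩ => le_antisymm h h' ▸ ha⟩
  rw [this]
  refine decidedBy_biUnion T fun a _ => ?_
  rcases (h₁ a).union (h₂ a) with h | h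
  · exact .inr (h.mono fun t ht h' => h' ht)
  · exact .inl h

theorem decidedBy_nhdsGT (t a : unitInterval) :
    DecidedBy (𝓝[>] t) (Set.Ioi a) ∧ DecidedBy (𝓝[>] t) (Set.Iio a) := by
  have hself : ∀ᶠ u in 𝓝[>] t, t < u := eventually_mem_nhdsWithin
  rcases lt_trichotomy a t with h | rfl | h
  · exact ⟨.inl (hself.mono fun u hu => h.trans hu), .inr (hself.mono fun u hu =>
      not_lt.2 (h.trans hu).le)⟩
  · exact ⟨.inl hself, .inr (hself.mono fun u hu => not_lt.2 (le_of_lt hu))⟩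
  · have : ∀ᶠ u in 𝓝[>] t, u < a := eventually_nhdsWithin_of_eventually_nhds (eventually_lt_nhds h)
    exact ⟨.inr (this.mono fun u hu => not_lt.2 hu.le), .inl this⟩

theorem decidedBy_nhdsLT (t a : unitInterval) :
    DecidedBy (𝓝[<] t) (Set.Ioi a) ∧ DecidedBy (𝓝[<] t) (Set.Iio a) := by
  have hself : ∀ᶠ u in 𝓝[<] t, u < t := eventually_mem_nhdsWithin
  rcases lt_trichotomy a t with h | rfl | h
  · have : ∀ᶠ u in 𝓝[<] t, a < u := eventually_nhdsWithin_of_eventually_nhds (eventually_gt_nhds h)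
    exact ⟨.inl this, .inr (this.mono fun u hu => not_lt.2 hu.le)⟩
  · exact ⟨.inr (hself.mono fun u hu => not_lt.2 (le_of_lt hu)), .inl hself⟩
  · exact ⟨.inr (hself.mono fun u hu => not_lt.2 (hu.trans h).le), .inl (hself.mono fun u hu =>
      hu.trans h)⟩

namespace GeomComplex

variable {K : GeomComplex d} {φ : unitInterval → Finset (EuclideanSpace ℝ (Fin d))}
  {π : C(unitInterval, EuclideanSpace ℝ (Fin d))}

/-- Otherwise every simplex is eventually avoided, and since there are finitely many of them, at
some time no simplex is taken at all. -/
theorem IsSimplicialPath.eventually_const (h : K.IsSimplicialPath φ) {l : Filter unitInterval}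
    [l.NeBot] (h₁ : ∀ a, DecidedBy l (Set.Ioi a)) (h₂ : ∀ a, DecidedBy l (Set.Iio a)) :
    ∃ Ψ, ∀ᶠ t in l, φ t = Ψ := by
  by_contra! hne
  have hout : ∀ Δ ∈ K.faces, ∀ᶠ t in l, φ t ≠ Δ := by
    intro Δ hΔ
    obtain ⟨S, T, hST⟩ := h.tame Δ hΔ
    rcases decidedBy_of_rays h₁ h₂ S T with hd | hd <;> rw [← hST] at hd
    · exact (hne Δ (hd.mono fun t ht h => h ht)).elim
    · exact hd
  have hall : ∀ᶠ t in l, ∀ Δ ∈ K.faces, φ t ≠ Δ := (eventually_all_finite K.finite_faces).2 hout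
  obtain ⟨t, ht⟩ := hall.exists
  exact ht _ (h.mem_faces t) rfl

/-- The hull of `Ψ` is closed, so it contains `π t`; a proper face of `φ t` cannot contain it,
because `φ t` is minimal. -/
theorem Realizes.subset_of_eventually (hr : Realizes π φ) {t : unitInterval}
    {l : Filter unitInterval} [l.NeBot] (hl : l ≤ 𝓝 t) {Ψ : Finset (EuclideanSpace ℝ (Fin d))}
    (hΨ : ∀ᶠ u in l, φ u = Ψ) (hadj : Adjacent (φ t) Ψ) : φ t ⊆ Ψ := by
  rcases hadj with h | h
  · exact h
  · have hclosed : IsClosed (convexHull ℝ (Ψ : Set (EuclideanSpace ℝ (Fin d)))) :=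
      (Ψ.finite_toSet.isCompact_convexHull ℝ).isClosed
    have hmem : π t ∈ convexHull ℝ (Ψ : Set (EuclideanSpace ℝ (Fin d))) :=
      hclosed.mem_of_tendsto ((π.continuous.tendsto t).mono_left hl)
        (hΨ.mono fun u hu => hu ▸ (hr u).1)
    by_contra hcon
    exact (hr t).2 Ψ ⟨h, hcon⟩ hmem

/-- The simplices of a path are locally cofaces. -/
theorem IsSimplicialPath.eventually_subset (h : K.IsSimplicialPath φ) (hr : Realizes π φ)
    (t : unitInterval) : ∀ᶠ u in 𝓝 t, φ t ⊆ φ u := by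
  rw [← nhdsNE_sup_pure, eventually_sup, ← nhdsLT_sup_nhdsGT, eventually_sup]
  refine ⟨⟨?_, ?_⟩, by simp⟩
  · rcases eq_or_ne t 0 with rfl | ht
    · have : 𝓝[<] (0 : unitInterval) = ⊥ := by
        have : Set.Iio (0 : unitInterval) = ∅ := Set.Iio_eq_empty_iff.2 isMin_bot
        rw [this, nhdsWithin_empty]
      rw [this]; exact eventually_bot
    · have h0 : (0 : unitInterval) < t := unitInterval.pos_iff_ne_zero.2 ht
      have hb := nhdsLT_basis_of_exists_lt ⟨_, h0⟩
      have : (𝓝[<] t).NeBot := nhdsLT_neBot_of_exists_lt ⟨_, h0⟩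
      obtain ⟨Ψ, hΨ⟩ := h.eventually_const (fun a => (decidedBy_nhdsLT t a).1)
        fun a => (decidedBy_nhdsLT t a).2
      obtain ⟨u, hu, huΨ⟩ := hb.mem_iff.1 hΨ
      obtain ⟨v, huv, hvt⟩ := exists_between hu
      -- On the closed interval from `v` to `t` the only values are `φ t` and `Ψ`, which is the
      -- situation in which the definition of a simplicial path grants adjacency.
      have hadj : Adjacent (φ t) Ψ := by
        refine h.adjacent v t hvt.le _ _ ?_
        ext Δ
        simp only [Set.mem_image, Set.mem_insert_iff, Set.mem_singleton_iff]
        constructor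
        · rintro ⟨w, hw, rfl⟩
          rcases hw.2.eq_or_lt with rfl | hw'
          · exact .inl rfl
          · exact .inr (huΨ ⟨huv.trans_le hw.1, hw'⟩)
        · rintro (rfl | rfl)
          · exact ⟨t, ⟨hvt.le, le_rfl⟩, rfl⟩
          · exact ⟨v, ⟨le_rfl, hvt.le⟩, huΨ ⟨huv, hvt⟩⟩
      exact hΨ.mono fun u hu => hu ▸ hr.subset_of_eventually nhdsWithin_le_nhds hΨ hadj
  · rcases eq_or_ne t 1 with rfl | ht
    · have : 𝓝[>] (1 : unitInterval) = ⊥ := by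
        have : Set.Ioi (1 : unitInterval) = ∅ := Set.Ioi_eq_empty_iff.2 isMax_top
        rw [this, nhdsWithin_empty]
      rw [this]; exact eventually_bot
    · have h0 : t < (1 : unitInterval) := unitInterval.lt_one_iff_ne_one.2 ht
      have hb := nhdsGT_basis_of_exists_gt ⟨_, h0⟩
      have : (𝓝[>] t).NeBot := nhdsGT_neBot_of_exists_gt ⟨_, h0⟩
      obtain ⟨Ψ, hΨ⟩ := h.eventually_const (fun a => (decidedBy_nhdsGT t a).1)
        fun a => (decidedBy_nhdsGT t a).2
      obtain ⟨u, hu, huΨ⟩ := hb.mem_iff.1 hΨ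
      obtain ⟨v, htv, hvu⟩ := exists_between hu
      have hadj : Adjacent (φ t) Ψ := by
        refine h.adjacent t v htv.le _ _ ?_
        ext Δ
        simp only [Set.mem_image, Set.mem_insert_iff, Set.mem_singleton_iff]
        constructor
        · rintro ⟨w, hw, rfl⟩
          rcases hw.1.eq_or_lt with rfl | hw'
          · exact .inl rfl
          · exact .inr (huΨ ⟨hw', hw.2.trans_lt hvu⟩)
        · rintro (rfl | rfl)
          · exact ⟨t, ⟨le_rfl, htv.le⟩, rfl⟩
          · exact ⟨v, ⟨htv.le, le_rfl⟩, huΨ ⟨htv, hvu⟩⟩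
      exact hΨ.mono fun u hu => hu ▸ hr.subset_of_eventually nhdsWithin_le_nhds hΨ hadj

/-- The realizations of two simplices have distance at most `w`. -/
def Near (w : ℝ) (Ψ Υ : Finset (EuclideanSpace ℝ (Fin d))) : Prop :=
  ∃ x ∈ convexHull ℝ (Ψ : Set (EuclideanSpace ℝ (Fin d))),
    ∃ y ∈ convexHull ℝ (Υ : Set (EuclideanSpace ℝ (Fin d))), dist x y ≤ w

/-- A step between pairs of simplices at distance at most `w`, one of which stays the same while
the other one is replaced by an adjacent one. -/
def PairStep (K₁ K₂ : GeomComplex d) (w : ℝ)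
    (P Q : Finset (EuclideanSpace ℝ (Fin d)) × Finset (EuclideanSpace ℝ (Fin d))) : Prop :=
  (P.1 ∈ K₁.faces ∧ P.2 ∈ K₂.faces ∧ Near w P.1 P.2) ∧
    (Q.1 ∈ K₁.faces ∧ Q.2 ∈ K₂.faces ∧ Near w Q.1 Q.2) ∧
    (Adjacent P.1 Q.1 ∧ P.2 = Q.2 ∨ P.1 = Q.1 ∧ Adjacent P.2 Q.2)

theorem PairStep.symm {K₁ K₂ : GeomComplex d} {w : ℝ}
    {P Q : Finset (EuclideanSpace ℝ (Fin d)) × Finset (EuclideanSpace ℝ (Fin d))}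
    (h : PairStep K₁ K₂ w P Q) : PairStep K₁ K₂ w Q P :=
  ⟨h.2.1, h.1, h.2.2.imp (fun h => ⟨h.1.symm, h.2.symm⟩) fun h => ⟨h.1.symm, h.2.symm⟩⟩

/-- Simultaneous traversals of two paths join the ends through pairs of simplices that are as
near as the traversals. -/
theorem pairStep_of_isPath {K₁ K₂ : GeomComplex d} {s₁ t₁ s₂ t₂ : EuclideanSpace ℝ (Fin d)}
    {π σ : C(unitInterval, EuclideanSpace ℝ (Fin d))}
    {φ ψ : unitInterval → Finset (EuclideanSpace ℝ (Fin d))} (h₁ : K₁.IsPath s₁ t₁ π φ)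
    (h₂ : K₂.IsPath s₂ t₂ σ ψ) {f g : C(unitInterval, unitInterval)} (hf : IsWeakReparam f)
    (hg : IsWeakReparam g) {w : ℝ} (hw : ∀ u, dist (π (f u)) (σ (g u)) ≤ w) :
    Relation.ReflTransGen (PairStep K₁ K₂ w) ({s₁}, {s₂}) ({t₁}, {t₂}) := by
  let R : unitInterval → unitInterval → Prop := fun u v =>
    Relation.ReflTransGen (PairStep K₁ K₂ w) (φ (f u), ψ (g u)) (φ (f v), ψ (g v))
  have hsymm : ∀ P Q, Relation.ReflTransGen (PairStep K₁ K₂ w) P Q →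
      Relation.ReflTransGen (PairStep K₁ K₂ w) Q P := by
    intro P Q h
    induction h with
    | refl => exact .refl
    | tail _ h1 ih => exact .head h1.symm ih
  have hnear : ∀ u, Near w (φ (f u)) (ψ (g u)) := fun u =>
    ⟨_, (h₁.realizes (f u)).1, _, (h₂.realizes (g u)).1, hw u⟩
  have hR : R 0 1 := by
    refine PreconnectedSpace.induction₂' R (fun u => ?_)
      ⟨fun _ _ _ h h' => Relation.ReflTransGen.trans h h'⟩ 0 1
    have e1 := (f.continuous.tendsto u).eventually
      (h₁.simplicial.eventually_subset h₁.realizes (f u))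
    have e2 := (g.continuous.tendsto u).eventually
      (h₂.simplicial.eventually_subset h₂.realizes (g u))
    filter_upwards [e1, e2] with v hv1 hv2
    suffices R u v from ⟨this, hsymm _ _ this⟩
    -- A larger simplex has a larger hull, so the pair stays near when its first component grows.
    -- This is the intermediate node: the two curves may change their simplices at the same time,
    -- but a step changes only one component.
    have hmid : Near w (φ (f v)) (ψ (g u)) := by
      obtain ⟨x, hx, y, hy, hxy⟩ := hnear u
      exact ⟨x, convexHull_mono (by exact_mod_cast hv1) hx, y, hy, hxy⟩
    have m1 := h₁.simplicial.mem_faces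
    have m2 := h₂.simplicial.mem_faces
    exact Relation.ReflTransGen.tail (b := (φ (f v), ψ (g u)))
      (.single ⟨⟨m1 _, m2 _, hnear u⟩, ⟨m1 _, m2 _, hmid⟩, .inl ⟨.inl hv1, rfl⟩⟩)
      ⟨⟨m1 _, m2 _, hmid⟩, ⟨m1 _, m2 _, hnear v⟩, .inr ⟨rfl, .inl hv2⟩⟩
  simpa only [R, hf.1, hf.2, hg.1, hg.2, h₁.source, h₁.target, h₂.source, h₂.target] using hR

end GeomComplex

end Local

/-! ### Polygonal curves as paths in a complex -/

section Polyline

open Filter Topology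

variable {d : ℕ}

/-- Replaces the rounding in `polyline` by clamped linear functions, from which continuity is
evident. -/
theorem polyline_eq_sum (m : ℕ) (p : ℕ → EuclideanSpace ℝ (Fin d)) {t : ℝ} (h₀ : 0 ≤ t)
    (h₁ : t ≤ 1) : polyline m p t =
      p 0 + ∑ k ∈ Finset.range m, (max 0 (min 1 ((m : ℝ) * t - k))) • (p (k + 1) - p k) := by
  have ha : (0 : ℝ) ≤ m * t := by positivity
  have ha' : (m : ℝ) * t ≤ m := mul_le_of_le_one_right (by positivity) h₁
  set a := (m : ℝ) * t with hadef
  set n := ⌊a⌋₊ with hn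
  have hna : (n : ℝ) ≤ a := Nat.floor_le ha
  have han : a < n + 1 := Nat.lt_floor_add_one a
  have hnm : n ≤ m := by exact_mod_cast hna.trans ha'
  have hsum : ∀ j, n ≤ j → j ≤ m → (j = n ∨ True) →
      ∑ k ∈ Finset.range j, (max 0 (min 1 (a - k))) • (p (k + 1) - p k) =
      (p n - p 0) + if n < j then (a - n) • (p (n + 1) - p n) else 0 := by
    intro j hj hjm _
    induction j, hj using Nat.le_induction with
    | base =>
      rw [if_neg (lt_irrefl _), add_zero, ← Finset.sum_range_sub]
      refine Finset.sum_congr rfl fun k hk => ?_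
      have : (k : ℝ) + 1 ≤ n := by exact_mod_cast Finset.mem_range.1 hk
      rw [min_eq_left (by linarith), max_eq_right zero_le_one, one_smul]
    | succ j hj ih =>
      rw [Finset.sum_range_succ, ih (by omega) (.inr trivial), if_pos (by omega : n < j + 1)]
      rcases hj.eq_or_lt with rfl | h
      · rw [if_neg (lt_irrefl _), add_zero, min_eq_right (by linarith), max_eq_right (by linarith)]
      · have : (n : ℝ) + 1 ≤ j := by exact_mod_cast h
        rw [if_pos h, max_eq_left ((min_le_right _ _).trans (by linarith)), zero_smul, add_zero]
  rw [polyline, hsum m hnm le_rfl (.inr trivial)]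
  split_ifs with h
  · rw [← hadef, ← hn]; abel
  -- At time 1 the formula for `polyline` mentions the point `p (m + 1)` beyond the end, but with
  -- coefficient 0.
  · have hmn : m = n := le_antisymm (not_lt.1 h) hnm
    have : a - n = 0 := by rw [← hmn] at hna ⊢; linarith
    rw [← hadef, ← hn, this, zero_smul]; abel

theorem polyline_eq (m : ℕ) (p : ℕ → EuclideanSpace ℝ (Fin d)) {t : ℝ} {k : ℕ} {c : ℝ}
    (h : (m : ℝ) * t = k + c) (h₀ : 0 ≤ c) (h₁ : c < 1) :
    polyline m p t = p k + c • (p (k + 1) - p k) := by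
  have : ⌊(m : ℝ) * t⌋₊ = k := by
    rw [Nat.floor_eq_iff (by rw [h]; positivity)]
    constructor <;> linarith
  rw [polyline, this, h, add_sub_cancel_left]

/-- The polygonal curve through `p 0, …, p m`. -/
noncomputable def polylineMap (m : ℕ) (p : ℕ → EuclideanSpace ℝ (Fin d)) :
    C(unitInterval, EuclideanSpace ℝ (Fin d)) where
  toFun t := polyline m p t
  continuous_toFun := by
    have : (fun t : unitInterval => polyline m p t) = fun t : unitInterval => p 0 +
        ∑ k ∈ Finset.range m, (max 0 (min 1 ((m : ℝ) * t - k))) • (p (k + 1) - p k) :=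
      funext fun t => polyline_eq_sum m p t.2.1 t.2.2
    rw [this]
    fun_prop

/-- If a point inside a segment lies on a face of a simplex, then so does the whole segment. -/
theorem AffineIndependent.mem_face_of_segment {E : Type*} [AddCommGroup E] [Module ℝ E]
    {T Ψ : Finset E} (hT : AffineIndependent ℝ ((↑) : T → E)) (hΨ : Ψ ⊆ T) {x y : E}
    (hx : x ∈ convexHull ℝ (T : Set E)) (hy : y ∈ convexHull ℝ (T : Set E)) {a b : ℝ}
    (ha : 0 < a) (hb : 0 < b) (hab : a + b = 1) (hz : a • x + b • y ∈ convexHull ℝ (Ψ : Set E)) :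
    x ∈ convexHull ℝ (Ψ : Set E) := by
  classical
  rw [Finset.mem_convexHull'] at hx hy hz
  obtain ⟨u, hu0, hu1, hu⟩ := hx
  obtain ⟨v, hv0, hv1, hv⟩ := hy
  obtain ⟨w, hw0, hw1, hw⟩ := hz
  -- The difference of two barycentric representations of the same point. Affine independence makes
  -- it vanish, so outside `Ψ` the nonnegative numbers `a * u e` and `b * v e` have sum 0.
  let c : E → ℝ := fun e => a * u e + b * v e - if e ∈ Ψ then w e else 0
  have hsum : ∑ e ∈ T, c e = 0 := by
    simp only [c, Finset.sum_sub_distrib, Finset.sum_add_distrib, ← Finset.mul_sum, hu1, hv1]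
    rw [← Finset.sum_filter, Finset.filter_mem_eq_inter, Finset.inter_eq_right.2 hΨ, hw1]
    linarith
  have hvec : ∑ e ∈ T, c e • e = 0 := by
    simp only [c, sub_smul, add_smul, mul_smul, Finset.sum_sub_distrib, Finset.sum_add_distrib,
      ← Finset.smul_sum, hu, hv, ite_smul, zero_smul]
    rw [← Finset.sum_filter, Finset.filter_mem_eq_inter, Finset.inter_eq_right.2 hΨ, hw, sub_self]
  have hc := hT.eq_zero_of_sum_eq_zero_subtype hsum hvec
  have hzero : ∀ e ∈ T, e ∉ Ψ → u e = 0 := by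
    intro e he heΨ
    have h1 := hc e he
    simp only [c, if_neg heΨ, sub_zero] at h1
    have h2 : 0 ≤ a * u e := mul_nonneg ha.le (hu0 e he)
    have h3 : 0 ≤ b * v e := mul_nonneg hb.le (hv0 e he)
    have h4 : a * u e = 0 := by linarith
    exact (mul_eq_zero.1 h4).resolve_left ha.ne'
  rw [Finset.mem_convexHull']
  refine ⟨u, fun e he => hu0 e (hΨ he), ?_, ?_⟩
  · rw [Finset.sum_subset hΨ hzero, hu1]
  · rw [Finset.sum_subset hΨ fun e he h => by rw [hzero e he h, zero_smul], hu]

/-- `S` is the lowest dimensional one among its faces that contains `x`. -/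
def IsCarrier (S : Finset (EuclideanSpace ℝ (Fin d))) (x : EuclideanSpace ℝ (Fin d)) : Prop :=
  x ∈ convexHull ℝ (S : Set (EuclideanSpace ℝ (Fin d))) ∧
    ∀ Ψ, Ψ ⊂ S → x ∉ convexHull ℝ (Ψ : Set (EuclideanSpace ℝ (Fin d)))

theorem exists_isCarrier {F : Finset (EuclideanSpace ℝ (Fin d))} {x : EuclideanSpace ℝ (Fin d)}
    (h : x ∈ convexHull ℝ (F : Set (EuclideanSpace ℝ (Fin d)))) : ∃ S ⊆ F, IsCarrier S x := by
  induction F using Finset.strongInduction with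
  | H F ih =>
    by_cases hF : ∃ Ψ, Ψ ⊂ F ∧ x ∈ convexHull ℝ (Ψ : Set (EuclideanSpace ℝ (Fin d)))
    · obtain ⟨Ψ, h1, h2⟩ := hF
      obtain ⟨S, h3, h4⟩ := ih Ψ h1 h2
      exact ⟨S, h3.trans h1.1, h4⟩
    · push Not at hF
      exact ⟨F, subset_rfl, h, hF⟩

theorem IsCarrier.nonempty {S : Finset (EuclideanSpace ℝ (Fin d))} {x : EuclideanSpace ℝ (Fin d)}
    (h : IsCarrier S x) : S.Nonempty := by
  have := convexHull_nonempty_iff.1 ⟨x, h.1⟩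
  exact_mod_cast this

/-- For faces of an affinely independent set, the hull of `S ∩ Ψ` is the intersection of the hulls.
So it contains `x`, and by minimality it is not a proper face of `S`. -/
theorem IsCarrier.subset {T S Ψ : Finset (EuclideanSpace ℝ (Fin d))}
    {x : EuclideanSpace ℝ (Fin d)} (hT : AffineIndependent ℝ ((↑) : T → EuclideanSpace ℝ (Fin d)))
    (hS : S ⊆ T) (hΨ : Ψ ⊆ T) (h : IsCarrier S x)
    (hx : x ∈ convexHull ℝ (Ψ : Set (EuclideanSpace ℝ (Fin d)))) : S ⊆ Ψ := by
  classical
  by_contra hcon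
  refine h.2 (S ∩ Ψ) ⟨Finset.inter_subset_left, fun h' => hcon ?_⟩ ?_
  · exact fun e he => (Finset.mem_inter.1 (h' he)).2
  · rw [Finset.coe_inter, hT.convexHull_inter hS hΨ]
    exact ⟨h.1, hx⟩

open Classical in
-- A face that contains an inner point of the segment contains both ends, hence both carriers.
theorem IsCarrier.union {T S S' : Finset (EuclideanSpace ℝ (Fin d))}
    {x y : EuclideanSpace ℝ (Fin d)}
    (hT : AffineIndependent ℝ ((↑) : T → EuclideanSpace ℝ (Fin d))) (hS : S ⊆ T) (hS' : S' ⊆ T)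
    (h : IsCarrier S x) (h' : IsCarrier S' y) {c : ℝ} (h₀ : 0 < c) (h₁ : c < 1) :
    IsCarrier (S ∪ S') (x + c • (y - x)) := by
  have e : x + c • (y - x) = (1 - c) • x + c • y := by module
  rw [e]
  have hx := convexHull_mono (𝕜 := ℝ) (Finset.coe_subset.2 hS) h.1
  have hy := convexHull_mono (𝕜 := ℝ) (Finset.coe_subset.2 hS') h'.1
  refine ⟨?_, fun Ψ hΨ hz => hΨ.2 (Finset.union_subset ?_ ?_)⟩
  · refine convex_convexHull ℝ _ (convexHull_mono ?_ h.1) (convexHull_mono ?_ h'.1)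
      (by linarith) h₀.le (by ring)
    · simp
    · simp
  · have hΨT : Ψ ⊆ T := hΨ.1.trans (Finset.union_subset hS hS')
    exact h.subset hT hS hΨT (hT.mem_face_of_segment hΨT hx hy (by linarith) h₀ (by ring) hz)
  · have hΨT : Ψ ⊆ T := hΨ.1.trans (Finset.union_subset hS hS')
    rw [add_comm] at hz
    exact h'.subset hT hS' hΨT (hT.mem_face_of_segment hΨT hy hx h₀ (by linarith) (by ring) hz)

open Classical in
/-- The simplicial path that takes the value `S k` at time `k / m`, and `S k ∪ S (k + 1)` between
this time and the next one. -/
noncomputable def simplicialPolyline (m : ℕ) (S : ℕ → Finset (EuclideanSpace ℝ (Fin d)))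
    (t : unitInterval) : Finset (EuclideanSpace ℝ (Fin d)) :=
  if (m : ℝ) * t = ⌊(m : ℝ) * t⌋₊ then S ⌊(m : ℝ) * t⌋₊
  else S ⌊(m : ℝ) * t⌋₊ ∪ S (⌊(m : ℝ) * t⌋₊ + 1)

theorem simplicialPolyline_of_eq {m : ℕ} {S : ℕ → Finset (EuclideanSpace ℝ (Fin d))}
    {t : unitInterval} {k : ℕ} (h : (m : ℝ) * t = k) : simplicialPolyline m S t = S k := by
  simp [simplicialPolyline, h]

open Classical in
theorem simplicialPolyline_of_lt {m : ℕ} {S : ℕ → Finset (EuclideanSpace ℝ (Fin d))}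
    {t : unitInterval} {k : ℕ} (h : (k : ℝ) < m * t) (h' : (m : ℝ) * t < k + 1) :
    simplicialPolyline m S t = S k ∪ S (k + 1) := by
  have e : ⌊(m : ℝ) * t⌋₊ = k := by
    rw [Nat.floor_eq_iff ((Nat.cast_nonneg k).trans h.le)]
    exact ⟨h.le, h'⟩
  rw [simplicialPolyline, e, if_neg h.ne']

theorem exists_step (m : ℕ) (t : unitInterval) :
    (∃ k ≤ m, (m : ℝ) * t = k) ∨ ∃ k < m, (k : ℝ) < m * t ∧ (m : ℝ) * t < k + 1 := by
  have h0 : (0 : ℝ) ≤ m * t := mul_nonneg (by positivity) t.2.1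
  have h1 : (m : ℝ) * t ≤ m := mul_le_of_le_one_right (by positivity) t.2.2
  have h2 := Nat.floor_le h0
  have h3 := Nat.lt_floor_add_one ((m : ℝ) * t)
  rcases h2.eq_or_lt with h | h
  · exact .inl ⟨_, by exact_mod_cast h2.trans h1, h.symm⟩
  · exact .inr ⟨_, by exact_mod_cast h.trans_le h1, h, h3⟩

theorem simplicialPolyline_eventually_subset (m : ℕ)
    (S : ℕ → Finset (EuclideanSpace ℝ (Fin d))) (t : unitInterval) :
    ∀ᶠ u in 𝓝 t, simplicialPolyline m S t ⊆ simplicialPolyline m S u := by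
  classical
  have hc : Continuous fun u : unitInterval => (m : ℝ) * u := by fun_prop
  rcases exists_step m t with ⟨k, hk, h⟩ | ⟨k, hk, h, h'⟩
  · have h1 := (hc.tendsto t).eventually (lt_mem_nhds (show (k : ℝ) - 1 < m * t by linarith))
    have h2 := (hc.tendsto t).eventually (gt_mem_nhds (show (m : ℝ) * t < k + 1 by linarith))
    filter_upwards [h1, h2] with u hu1 hu2
    rw [simplicialPolyline_of_eq h]
    rcases lt_trichotomy ((m : ℝ) * u) k with h3 | h3 | h3
    · have hk0 : k ≠ 0 := by
        rintro rfl
        have : (0 : ℝ) ≤ m * u := mul_nonneg (by positivity) u.2.1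
        simp at h3; linarith
      obtain ⟨j, rfl⟩ := Nat.exists_eq_succ_of_ne_zero hk0
      push_cast at hu1 h3
      rw [simplicialPolyline_of_lt (k := j) (by linarith) (by linarith)]
      exact Finset.subset_union_right
    · rw [simplicialPolyline_of_eq h3]
    · rw [simplicialPolyline_of_lt h3 hu2]
      exact Finset.subset_union_left
  · have h1 := (hc.tendsto t).eventually (lt_mem_nhds h)
    have h2 := (hc.tendsto t).eventually (gt_mem_nhds h')
    filter_upwards [h1, h2] with u hu1 hu2
    rw [simplicialPolyline_of_lt h h', simplicialPolyline_of_lt hu1 hu2]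

/-- If neither of the two values contained the other, the local inclusions would be equalities, and
`φ` would be constant on the interval by connectedness. -/
theorem adjacent_of_image_Icc {φ : unitInterval → Finset (EuclideanSpace ℝ (Fin d))}
    (hφ : ∀ t, ∀ᶠ u in 𝓝 t, φ t ⊆ φ u) {x y : unitInterval}
    {Δ Ψ : Finset (EuclideanSpace ℝ (Fin d))} (h : φ '' Set.Icc x y = {Δ, Ψ}) :
    GeomComplex.Adjacent Δ Ψ := by
  by_contra hcon
  rw [GeomComplex.Adjacent, not_or] at hcon
  have hval : ∀ t ∈ Set.Icc x y, φ t = Δ ∨ φ t = Ψ := by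
    intro t ht
    have : φ t ∈ φ '' Set.Icc x y := ⟨t, ht, rfl⟩
    rwa [h] at this
  have hloc : ∀ t ∈ Set.Icc x y, ∀ᶠ u in 𝓝[Set.Icc x y] t, φ t = φ u := by
    intro t ht
    filter_upwards [eventually_nhdsWithin_of_eventually_nhds (hφ t), self_mem_nhdsWithin]
      with u hu hu'
    rcases hval t ht with h1 | h1 <;> rcases hval u hu' with h2 | h2 <;> rw [h1, h2] at hu ⊢
    · exact (hcon.1 hu).elim
    · exact (hcon.2 hu).elim
  have hΔ : Δ ∈ φ '' Set.Icc x y := by rw [h]; simp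
  have hΨ : Ψ ∈ φ '' Set.Icc x y := by rw [h]; simp
  obtain ⟨a, ha, rfl⟩ := hΔ
  obtain ⟨b, hb, rfl⟩ := hΨ
  have := isPreconnected_Icc.induction₂ (fun a b => φ a = φ b) hloc
    (fun _ _ _ _ _ _ => Eq.trans) (fun _ _ _ _ => Eq.symm) ha hb
  exact hcon.1 this.subset

theorem simplicialPolyline_tame (m : ℕ) (S : ℕ → Finset (EuclideanSpace ℝ (Fin d)))
    (Δ : Finset (EuclideanSpace ℝ (Fin d))) :
    ∃ (I : Finset (unitInterval × unitInterval)) (T : Finset unitInterval),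
      {t | simplicialPolyline m S t = Δ} =
        (⋃ p ∈ I, Set.Ioo p.1 p.2) ∪ (T : Set unitInterval) := by
  classical
  -- For `m = 0` the path is constant and the break points `k / m` make no sense, so this case is
  -- separate.
  rcases Nat.eq_zero_or_pos m with rfl | hm
  · have hconst : ∀ t, simplicialPolyline 0 S t = S 0 := fun t =>
      simplicialPolyline_of_eq (by simp)
    by_cases h : S 0 = Δ
    · refine ⟨{(0, 1)}, {0, 1}, ?_⟩
      ext t
      simp only [hconst, h, Finset.mem_singleton, Set.iUnion_iUnion_eq_left, Set.mem_union,
        Set.mem_Ioo, Finset.coe_insert, Finset.coe_singleton, Set.mem_insert_iff,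
        Set.mem_singleton_iff, Set.mem_ofPred_eq, true_iff]
      rcases eq_or_ne t 0 with h0 | h0
      · exact .inr (.inl h0)
      · rcases eq_or_ne t 1 with h1 | h1
        · exact .inr (.inr h1)
        · exact .inl ⟨unitInterval.pos_iff_ne_zero.2 h0, unitInterval.lt_one_iff_ne_one.2 h1⟩
    · refine ⟨∅, ∅, ?_⟩
      ext t
      simp [hconst, h]
  · have hm' : (0 : ℝ) < m := by exact_mod_cast hm
    let e : ℕ → unitInterval := fun k => Set.projIcc 0 1 zero_le_one ((k : ℝ) / m)
    have he : ∀ k ≤ m, (e k : ℝ) = k / m := by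
      intro k hk
      have : ((k : ℝ) / m) ∈ Set.Icc (0 : ℝ) 1 :=
        ⟨by positivity, (div_le_one hm').2 (by exact_mod_cast hk)⟩
      simp only [e, Set.projIcc_of_mem zero_le_one this]
    have hlt : ∀ k ≤ m, ∀ t : unitInterval, e k < t ↔ (k : ℝ) < m * t := by
      intro k hk t
      rw [← Subtype.coe_lt_coe, he k hk, div_lt_iff₀ hm', mul_comm]
    have hgt : ∀ k ≤ m, ∀ t : unitInterval, t < e k ↔ (m : ℝ) * t < k := by
      intro k hk t
      rw [← Subtype.coe_lt_coe, he k hk, lt_div_iff₀ hm', mul_comm]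
    have heq : ∀ k ≤ m, ∀ t : unitInterval, t = e k ↔ (m : ℝ) * t = k := by
      intro k hk t
      rw [Subtype.ext_iff, he k hk, eq_div_iff hm'.ne', mul_comm]
    refine ⟨((Finset.range m).filter fun k => S k ∪ S (k + 1) = Δ).image fun k => (e k, e (k + 1)),
      ((Finset.range (m + 1)).filter fun k => S k = Δ).image e, ?_⟩
    ext t
    simp only [Set.mem_ofPred_eq, Set.mem_union, Set.mem_iUnion, Finset.mem_image,
      Finset.mem_filter, Finset.mem_range, Finset.coe_image, Set.mem_image, Finset.mem_coe,
      exists_prop, Set.mem_Ioo]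
    constructor
    · intro h
      rcases exists_step m t with ⟨k, hk, hkt⟩ | ⟨k, hk, h1, h2⟩
      · rw [simplicialPolyline_of_eq hkt] at h
        exact .inr ⟨k, ⟨by omega, h⟩, ((heq k hk t).2 hkt).symm⟩
      · rw [simplicialPolyline_of_lt h1 h2] at h
        refine .inl ⟨_, ⟨k, ⟨hk, h⟩, rfl⟩, (hlt k hk.le t).2 h1, (hgt (k + 1) hk t).2 ?_⟩
        push_cast; exact h2
    · rintro (⟨_, ⟨k, ⟨hk, rfl⟩, rfl⟩, h1, h2⟩ | ⟨k, ⟨hk, rfl⟩, rfl⟩)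
      · have h2' := (hgt (k + 1) hk t).1 h2
        push_cast at h2'
        exact simplicialPolyline_of_lt ((hlt k hk.le t).1 h1) h2'
      · exact simplicialPolyline_of_eq ((heq k (by omega) _).1 rfl)

/-- A polygonal curve whose segments lie in simplices, and whose vertices lie in common faces, is
a path. -/
theorem isPath_polyline {K : GeomComplex d} {m : ℕ} {s t : EuclideanSpace ℝ (Fin d)}
    {F T : ℕ → Finset (EuclideanSpace ℝ (Fin d))} {p : ℕ → EuclideanSpace ℝ (Fin d)}
    (hF : ∀ k ≤ m, F k ∈ K.faces) (hT : ∀ k < m, T k ∈ K.faces)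
    (hFT : ∀ k < m, F k ⊆ T k ∧ F (k + 1) ⊆ T k)
    (hp : ∀ k ≤ m, p k ∈ convexHull ℝ (F k : Set (EuclideanSpace ℝ (Fin d))))
    (h₀ : F 0 = {s}) (h₁ : F m = {t}) :
    ∃ φ : unitInterval → Finset (EuclideanSpace ℝ (Fin d)), K.IsPath s t (polylineMap m p) φ ∧
      ∀ i < m, ∀ u : unitInterval, (i : ℝ) ≤ m * (u : ℝ) → m * (u : ℝ) ≤ i + 1 → φ u ⊆ T i := by
  classical
  -- The path must take the carrier of `p k` at time `k / m`, which may be a proper face of the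
  -- prescribed simplex `F k`.
  have hex : ∀ k, ∃ S, k ≤ m → S ⊆ F k ∧ IsCarrier S (p k) := by
    intro k
    by_cases hk : k ≤ m
    · obtain ⟨S, hS⟩ := exists_isCarrier (hp k hk)
      exact ⟨S, fun _ => hS⟩
    · exact ⟨∅, fun h => (hk h).elim⟩
  choose S hS using hex
  have hface : ∀ k ≤ m, S k ∈ K.faces := fun k hk =>
    (K.isRelLowerSet_faces (hF k hk)).2 (hS k hk).1 (hS k hk).2.nonempty
  have hST : ∀ k < m, S k ⊆ T k ∧ S (k + 1) ⊆ T k := fun k hk =>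
    ⟨(hS k hk.le).1.trans (hFT k hk).1, (hS (k + 1) hk).1.trans (hFT k hk).2⟩
  refine ⟨simplicialPolyline m S, ⟨⟨fun u => ?_, fun Δ _ => simplicialPolyline_tame m S Δ,
    fun x y _ Δ Ψ h => adjacent_of_image_Icc (simplicialPolyline_eventually_subset m S) h⟩,
    fun u => ?_, ?_, ?_⟩, fun i hi u h1 h2 => ?_⟩
  · rcases exists_step m u with ⟨k, hk, h⟩ | ⟨k, hk, h, h'⟩
    · rw [simplicialPolyline_of_eq h]; exact hface k hk
    · rw [simplicialPolyline_of_lt h h']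
      exact (K.isRelLowerSet_faces (hT k hk)).2 (Finset.union_subset (hST k hk).1 (hST k hk).2)
        ((hS k hk.le).2.nonempty.mono Finset.subset_union_left)
  · change IsCarrier (simplicialPolyline m S u) (polyline m p u)
    rcases exists_step m u with ⟨k, hk, h⟩ | ⟨k, hk, h, h'⟩
    · rw [simplicialPolyline_of_eq h, polyline_eq (k := k) (c := 0) m p (by rw [h, add_zero])
        le_rfl one_pos, zero_smul, add_zero]
      exact (hS k hk).2
    · rw [simplicialPolyline_of_lt h h', polyline_eq (k := k) (c := m * u - k) m p (by ring)
        (by linarith) (by linarith)]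
      exact IsCarrier.union (K.indep _ (hT k hk)) (hST k hk).1 (hST k hk).2 (hS k hk.le).2
        (hS (k + 1) hk).2 (by linarith) (by linarith)
  · rw [simplicialPolyline_of_eq (k := 0) (by simp)]
    have h2 := (hS 0 (Nat.zero_le _)).1
    rw [h₀] at h2
    exact (Finset.subset_singleton_iff.1 h2).resolve_left
      (hS 0 (Nat.zero_le _)).2.nonempty.ne_empty
  · rw [simplicialPolyline_of_eq (k := m) (by simp)]
    have h2 := (hS m le_rfl).1
    rw [h₁] at h2
    exact (Finset.subset_singleton_iff.1 h2).resolve_left (hS m le_rfl).2.nonempty.ne_empty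
  · rcases exists_step m u with ⟨k, hk, h⟩ | ⟨k, hk, h, h'⟩
    · rw [simplicialPolyline_of_eq h]
      rw [h] at h1 h2
      have h3 : i ≤ k := by exact_mod_cast h1
      have h4 : k ≤ i + 1 := by exact_mod_cast h2
      rcases (show k = i ∨ k = i + 1 by omega) with rfl | rfl
      exacts [(hST _ hi).1, (hST _ hi).2]
    · have h3 : (i : ℝ) < k + 1 := h1.trans_lt h'
      have h4 : (k : ℝ) < i + 1 := h.trans_le h2
      norm_cast at h3 h4
      obtain rfl : k = i := by omega
      rw [simplicialPolyline_of_lt h h']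
      exact Finset.union_subset (hST k hi).1 (hST k hi).2

/-- Corresponding points of two polygonal curves are as near as their vertices. -/
theorem dist_polyline_le {m : ℕ} {p q : ℕ → EuclideanSpace ℝ (Fin d)} {w : ℝ}
    (h : ∀ k ≤ m, dist (p k) (q k) ≤ w) (u : unitInterval) :
    dist (polylineMap m p u) (polylineMap m q u) ≤ w := by
  change dist (polyline m p u) (polyline m q u) ≤ w
  rcases exists_step m u with ⟨k, hk, hu⟩ | ⟨k, hk, hu, hu'⟩
  · rw [polyline_eq (k := k) (c := 0) m p (by rw [hu, add_zero]) le_rfl one_pos,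
      polyline_eq (k := k) (c := 0) m q (by rw [hu, add_zero]) le_rfl one_pos]
    simpa using h k hk
  · set c : ℝ := m * u - k with hc
    rw [polyline_eq (k := k) (c := c) m p (by ring) (by linarith) (by linarith),
      polyline_eq (k := k) (c := c) m q (by ring) (by linarith) (by linarith)]
    have h1 := h k hk.le
    have h2 := h (k + 1) hk
    rw [dist_eq_norm] at h1 h2 ⊢
    have e : p k + c • (p (k + 1) - p k) - (q k + c • (q (k + 1) - q k)) =
        (1 - c) • (p k - q k) + c • (p (k + 1) - q (k + 1)) := by module
    rw [e]
    calc ‖(1 - c) • (p k - q k) + c • (p (k + 1) - q (k + 1))‖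
        ≤ ‖(1 - c) • (p k - q k)‖ + ‖c • (p (k + 1) - q (k + 1))‖ := norm_add_le _ _
      _ = (1 - c) * ‖p k - q k‖ + c * ‖p (k + 1) - q (k + 1)‖ := by
        rw [norm_smul, norm_smul, Real.norm_of_nonneg (by linarith),
          Real.norm_of_nonneg (by linarith)]
      _ ≤ (1 - c) * w + c * w := by
        gcongr
        linarith
      _ = w := by ring

end Polyline

/-! ### Points of least norm in a convex hull -/

section LeastNorm

open scoped RealInnerProductSpace

variable {ι E : Type*} [Fintype ι] [NormedAddCommGroup E] [InnerProductSpace ℝ E]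

/-- The linear combination of the points `x i` with coefficients `w i`. -/
noncomputable def lcomb (x : ι → E) : (ι → ℝ) →ₗ[ℝ] E := Fintype.linearCombination ℝ x

theorem lcomb_apply (x : ι → E) (w : ι → ℝ) : lcomb x w = ∑ i, w i • x i :=
  Fintype.linearCombination_apply ℝ x w

/-- The projection of the coefficients `z` along the span of a list of coefficients, for the
semi-definite form that the points `x i` induce. -/
noncomputable def projAlong (x : ι → E) : List (ι → ℝ) → (ι → ℝ) → (ι → ℝ)
  | [], z => z
  | u :: us, z => projAlong x us z -
      (⟪lcomb x (projAlong x us z), lcomb x (projAlong x us u)⟫ /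
        ⟪lcomb x (projAlong x us u), lcomb x (projAlong x us u)⟫) • projAlong x us u

theorem sub_projAlong_mem (x : ι → E) (us : List (ι → ℝ)) (z : ι → ℝ) :
    z - projAlong x us z ∈ Submodule.span ℝ {u | u ∈ us} := by
  induction us generalizing z with
  | nil => simp [projAlong]
  | cons u us ih =>
    have hle : Submodule.span ℝ {v | v ∈ us} ≤ Submodule.span ℝ {v | v ∈ u :: us} :=
      Submodule.span_mono fun v hv => List.mem_cons_of_mem _ hv
    have hu : u ∈ Submodule.span ℝ {v | v ∈ u :: us} := Submodule.subset_span (by simp)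
    have hpu : projAlong x us u ∈ Submodule.span ℝ {v | v ∈ u :: us} := by
      have := Submodule.sub_mem _ hu (hle (ih u))
      rwa [sub_sub_cancel] at this
    rw [projAlong, ← sub_add]
    exact Submodule.add_mem _ (hle (ih z)) (Submodule.smul_mem _ _ hpu)

/-- Gram–Schmidt orthogonalization for a form that may be degenerate. If the projected vector `u` is
null, then its image under `lcomb x` is 0, so nothing has to be subtracted and the convention for
quotients by zero does no harm. -/
theorem inner_projAlong (x : ι → E) (us : List (ι → ℝ)) (z : ι → ℝ) :
    ∀ v ∈ Submodule.span ℝ {u | u ∈ us}, ⟪lcomb x (projAlong x us z), lcomb x v⟫ = 0 := by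
  induction us generalizing z with
  | nil => intro v hv; simp at hv; simp [hv]
  | cons u us ih =>
    intro v hv
    have key : ⟪lcomb x (projAlong x (u :: us) z), lcomb x (projAlong x us u)⟫ = 0 := by
      rw [projAlong, map_sub, map_smul, inner_sub_left, inner_smul_left]
      by_cases h0 : ⟪lcomb x (projAlong x us u), lcomb x (projAlong x us u)⟫ = 0
      · rw [inner_self_eq_zero.1 h0]; simp
      · simp only [conj_trivial]
        rw [div_mul_cancel₀ _ h0, sub_self]
    have key' : ∀ v ∈ Submodule.span ℝ {u | u ∈ us},
        ⟪lcomb x (projAlong x (u :: us) z), lcomb x v⟫ = 0 := by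
      intro v hv
      rw [projAlong, map_sub, map_smul, inner_sub_left, inner_smul_left, ih z v hv, ih u v hv]
      simp
    induction hv using Submodule.span_induction with
    | mem v hv =>
      rcases List.mem_cons.1 hv with rfl | hv
      · have := key' _ (sub_projAlong_mem x us v)
        rw [map_sub, inner_sub_right, key, sub_zero] at this
        exact this
      · exact key' v (Submodule.subset_span hv)
    | zero => simp
    | add v w _ _ hv hw => rw [map_add, inner_add_right, hv, hw, add_zero]
    | smul c v _ hv => rw [map_smul, inner_smul_right, hv, mul_zero]

/-- The coefficients of the point of least norm in the affine span of the points in a list. -/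
noncomputable def candidate [DecidableEq ι] (x : ι → E) : List ι → (ι → ℝ)
  | [] => 0
  | k :: ks => projAlong x (ks.map fun j => Pi.single j 1 - Pi.single k 1) (Pi.single k 1)

/-- The projection changes the unit vector of `k` only by combinations of differences of unit
vectors, and their coordinates sum to 0. -/
theorem sum_candidate [DecidableEq ι] (x : ι → E) {l : List ι} (hl : l ≠ []) : ∑ i, candidate x l i = 1 := by
  obtain ⟨k, ks, rfl⟩ := List.exists_cons_of_ne_nil hl
  let S : (ι → ℝ) →ₗ[ℝ] ℝ := Fintype.linearCombination ℝ fun _ => (1 : ℝ)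
  have hS : ∀ w, S w = ∑ i, w i := fun w => by simp [S, Fintype.linearCombination_apply]
  have hsingle : ∀ j, S (Pi.single j 1) = 1 := fun j => by simp [hS]
  have h := sub_projAlong_mem x (ks.map fun j => Pi.single j 1 - Pi.single k 1)
    (Pi.single k (1 : ℝ))
  have hker : Submodule.span ℝ {u | u ∈ ks.map fun j => Pi.single j (1 : ℝ) - Pi.single k 1} ≤
      LinearMap.ker S := by
    rw [Submodule.span_le]
    intro u hu
    simp only [List.mem_map, Set.mem_ofPred_eq] at hu
    obtain ⟨j, -, rfl⟩ := hu
    simp only [SetLike.mem_coe, LinearMap.mem_ker]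
    rw [map_sub, hsingle, hsingle, sub_self]
  have h2 := LinearMap.mem_ker.1 (hker h)
  rw [map_sub, hsingle, sub_eq_zero, hS] at h2
  simp only [candidate]
  exact h2.symm

/-- By Carathéodory the point `y₀` of least norm is a positive combination of affinely independent
points among the `x i`. The variational inequality forces each of them to have the same inner
product with `y₀` as `y₀` itself, so `y₀` is also the point of least norm in their affine span.
Independence makes its coefficients unique; so the candidate for these points has exactly the
Carathéodory coefficients and is nonnegative. -/
theorem exists_candidate [DecidableEq ι] [Nonempty ι] [FiniteDimensional ℝ E] (x : ι → E) :
    ∃ l ∈ (Finset.univ : Finset ι).toList.sublists, l ≠ [] ∧ (∀ i, 0 ≤ candidate x l i) ∧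
      ∀ y ∈ convexHull ℝ (Set.range x), ‖lcomb x (candidate x l)‖ ≤ ‖y‖ := by
  have hfin : (Set.range x).Finite := Set.finite_range x
  have hne : (convexHull ℝ (Set.range x)).Nonempty := (Set.range_nonempty x).convexHull
  obtain ⟨y₀, hy₀, hmin⟩ := exists_norm_eq_iInf_of_complete_convex hne
    (hfin.isCompact_convexHull ℝ).isComplete (convex_convexHull ℝ _) 0
  have hvar := (norm_eq_iInf_iff_real_inner_le_zero (convex_convexHull ℝ _) hy₀).1 hmin
  have hvar' : ∀ y ∈ convexHull ℝ (Set.range x), ⟪y₀, y₀⟫ ≤ ⟪y₀, y⟫ := by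
    intro y hy
    have := hvar y hy
    rw [zero_sub, inner_neg_left, inner_sub_right] at this
    linarith
  have hleast : ∀ y ∈ convexHull ℝ (Set.range x), ‖y₀‖ ≤ ‖y‖ := by
    intro y hy
    have h1 := hvar' y hy
    have h2 := real_inner_le_norm y₀ y
    rw [real_inner_self_eq_norm_mul_norm] at h1
    by_contra hcon
    push Not at hcon
    have h3 : 0 < ‖y₀‖ := (norm_nonneg y).trans_lt hcon
    have h4 := mul_lt_mul_of_pos_left hcon h3
    linarith
  obtain ⟨κ, _, z, w, hz, hind, hw, hw1, hwy⟩ := eq_pos_convex_span_of_mem_convexHull hy₀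
  choose j hj using fun i => hz (Set.mem_range_self i)
  have hjinj : Function.Injective j := fun a b hab => hind.injective (by rw [← hj a, ← hj b, hab])
  -- Each difference is nonnegative by the variational inequality, and their average with positive
  -- weights is 0.
  have hinner : ∀ i, ⟪y₀, z i⟫ = ⟪y₀, y₀⟫ := by
    have hge : ∀ i, 0 ≤ w i * (⟪y₀, z i⟫ - ⟪y₀, y₀⟫) := fun i =>
      mul_nonneg (hw i).le (sub_nonneg.2 (hvar' _ (subset_convexHull ℝ _ (hz (Set.mem_range_self i)))))
    have hsum : ∑ i, w i * (⟪y₀, z i⟫ - ⟪y₀, y₀⟫) = 0 := by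
      simp only [mul_sub, Finset.sum_sub_distrib, ← Finset.sum_mul, hw1, one_mul]
      rw [sub_eq_zero]
      have h1 : ⟪y₀, ∑ i, w i • z i⟫ = ⟪y₀, y₀⟫ := by rw [hwy]
      rw [inner_sum] at h1
      simpa only [inner_smul_right] using h1
    intro i
    have := (Finset.sum_eq_zero_iff_of_nonneg fun i _ => hge i).1 hsum i (Finset.mem_univ i)
    exact sub_eq_zero.1 ((mul_eq_zero.1 this).resolve_left (hw i).ne')
  let A : Finset ι := Finset.univ.image j
  let l : List ι := (Finset.univ : Finset ι).toList.filter (· ∈ A)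
  have hlA : ∀ i, i ∈ l ↔ i ∈ A := by simp [l]
  let w₀ : ι → ℝ := ∑ i, w i • Pi.single (j i) 1
  have hκ : Nonempty κ := by
    by_contra hcon
    rw [not_nonempty_iff] at hcon
    simp at hw1
  have hl : l ≠ [] := by
    obtain ⟨i⟩ := hκ
    exact List.ne_nil_of_mem ((hlA (j i)).2 (Finset.mem_image_of_mem _ (Finset.mem_univ i)))
  have hLw : lcomb x w₀ = y₀ := by
    simp only [w₀, map_sum, map_smul]
    rw [← hwy]
    refine Finset.sum_congr rfl fun i _ => ?_
    rw [← hj i, lcomb_apply]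
    simp [Pi.single_apply]
  have hwnn : ∀ i, 0 ≤ w₀ i := by
    intro i
    simp only [w₀, Finset.sum_apply, Pi.smul_apply, smul_eq_mul]
    exact Finset.sum_nonneg fun a _ => mul_nonneg (hw a).le (by
      by_cases h : i = j a <;> simp [h])
  suffices h : candidate x l = w₀ from
    ⟨l, List.mem_sublists.2 List.filter_sublist, hl, h ▸ hwnn, by rw [h, hLw]; exact hleast⟩
  obtain ⟨k, ks, hkks⟩ := List.exists_cons_of_ne_nil hl
  set us : List (ι → ℝ) := ks.map fun j => Pi.single j 1 - Pi.single k 1 with hus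
  have hc : candidate x l = projAlong x us (Pi.single k 1) := by
    rw [hkks]
    simp only [candidate, hus]
  have husmem : ∀ i ∈ A, Pi.single i (1 : ℝ) - Pi.single k 1 ∈ Submodule.span ℝ {u | u ∈ us} := by
    intro i hi
    rw [← hlA, hkks, List.mem_cons] at hi
    rcases hi with rfl | hi
    · simp
    · exact Submodule.subset_span (List.mem_map.2 ⟨i, hi, rfl⟩)
  have hw₀span : w₀ - Pi.single k 1 ∈ Submodule.span ℝ {u | u ∈ us} := by
    have : w₀ - Pi.single k 1 = ∑ i, w i • (Pi.single (j i) (1 : ℝ) - Pi.single k 1) := by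
      simp only [smul_sub, Finset.sum_sub_distrib, ← Finset.sum_smul, hw1, one_smul, w₀]
    rw [this]
    exact Submodule.sum_mem _ fun i _ => Submodule.smul_mem _ _
      (husmem _ (Finset.mem_image_of_mem _ (Finset.mem_univ i)))
  set δ := candidate x l - w₀ with hδ
  have hδspan : δ ∈ Submodule.span ℝ {u | u ∈ us} := by
    have h1 := Submodule.add_mem _ (sub_projAlong_mem x us (Pi.single k 1)) hw₀span
    rw [← hc] at h1
    have : δ = -(Pi.single k 1 - candidate x l + (w₀ - Pi.single k 1)) := by rw [hδ]; abel
    rw [this]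
    exact Submodule.neg_mem _ h1
  have hu : ∀ u ∈ us, (∀ i ∉ A, u i = 0) ∧ ∑ i, u i = 0 ∧ ⟪lcomb x w₀, lcomb x u⟫ = 0 := by
    intro u hu
    obtain ⟨i, hi, rfl⟩ := List.mem_map.1 hu
    have hiA : i ∈ A := (hlA i).1 (by rw [hkks]; exact List.mem_cons_of_mem _ hi)
    have hkA : k ∈ A := (hlA k).1 (by rw [hkks]; simp)
    refine ⟨fun a ha => ?_, by simp, ?_⟩
    · have h1 : a ≠ i := fun h => ha (h ▸ hiA)
      have h2 : a ≠ k := fun h => ha (h ▸ hkA)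
      simp [h1, h2]
    · have hx : ∀ a ∈ A, ⟪y₀, x a⟫ = ⟪y₀, y₀⟫ := by
        intro a ha
        obtain ⟨b, -, rfl⟩ := Finset.mem_image.1 ha
        rw [hj, hinner]
      have hs : ∀ a, lcomb x (Pi.single a 1) = x a := fun a => by
        rw [lcomb_apply]; simp [Pi.single_apply]
      rw [hLw, map_sub, hs, hs, inner_sub_right, hx i hiA, hx k hkA, sub_self]
  have hspan : ∀ v ∈ Submodule.span ℝ {u | u ∈ us},
      (∀ i ∉ A, v i = 0) ∧ ∑ i, v i = 0 ∧ ⟪lcomb x w₀, lcomb x v⟫ = 0 := by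
    intro v hv
    induction hv using Submodule.span_induction with
    | mem v hv => exact hu v hv
    | zero => simp
    | add v v' _ _ h h' =>
      refine ⟨fun i hi => by simp [h.1 i hi, h'.1 i hi], ?_, ?_⟩
      · simp [Finset.sum_add_distrib, h.2.1, h'.2.1]
      · rw [map_add, inner_add_right, h.2.2, h'.2.2, add_zero]
    | smul c v _ h =>
      refine ⟨fun i hi => by simp [h.1 i hi], ?_, ?_⟩
      · simp [← Finset.mul_sum, h.2.1]
      · rw [map_smul, inner_smul_right, h.2.2, mul_zero]
  obtain ⟨hδA, hδ0, hδi⟩ := hspan δ hδspan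
  -- The images of `candidate x l` and of `w₀` are both orthogonal to the directions of the affine
  -- span, and `δ` is one of these directions; so the image of their difference `δ` is orthogonal to
  -- itself.
  have hLδ : lcomb x δ = 0 := by
    rw [← inner_self_eq_zero (𝕜 := ℝ)]
    have h1 : lcomb x δ = lcomb x (candidate x l) - lcomb x w₀ := by rw [hδ, map_sub]
    calc ⟪lcomb x δ, lcomb x δ⟫ = ⟪lcomb x (candidate x l) - lcomb x w₀, lcomb x δ⟫ := by
          rw [← h1]
      _ = 0 := by
          rw [inner_sub_left, hδi, hc, inner_projAlong x us _ δ hδspan, sub_zero]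
  -- `δ` has coordinate sum 0 and image 0, so it is an affine dependence of independent points.
  have hδj : ∀ i, δ (j i) = 0 := by
    have himg : ∀ f : ι → E, (∀ i ∉ A, f i = 0) → ∑ i, f i = ∑ a, f (j a) := by
      intro f hf
      rw [← Finset.sum_subset (Finset.subset_univ A) fun i _ hi => hf i hi,
        Finset.sum_image fun a _ b _ h => hjinj h]
    have himg' : ∀ f : ι → ℝ, (∀ i ∉ A, f i = 0) → ∑ i, f i = ∑ a, f (j a) := by
      intro f hf
      rw [← Finset.sum_subset (Finset.subset_univ A) fun i _ hi => hf i hi,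
        Finset.sum_image fun a _ b _ h => hjinj h]
    refine fun i => hind.eq_zero_of_sum_eq_zero (s := Finset.univ) (w := fun a => δ (j a)) ?_ ?_ i
      (Finset.mem_univ i)
    · rw [← himg' δ hδA, hδ0]
    · rw [lcomb_apply, himg _ fun i hi => by rw [hδA i hi, zero_smul]] at hLδ
      simpa only [hj] using hLδ
  have : δ = 0 := by
    ext i
    by_cases hi : i ∈ A
    · obtain ⟨a, -, rfl⟩ := Finset.mem_image.1 hi
      exact hδj a
    · exact hδA i hi
  exact sub_eq_zero.1 this

end LeastNorm


namespace RealRAM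

/-! ### Program for a closest pair of points of two simplices -/

/-- The program that writes the values of `f 0, …, f (n - 1)` to the entries `e, e + 1, …` of the
real array `a`. -/
def Cmd.fill (a : ℕ) (e : NExp) (n : ℕ) (f : ℕ → RExp) : Cmd :=
  Cmd.seqs ((List.range n).map fun c => .setReal a (.add e (.const c)) (f c))

theorem Cmd.wN_fill (a : ℕ) (e : NExp) (n : ℕ) (f : ℕ → RExp) (b : ℕ) :
    (Cmd.fill a e n f).wN b = false := by
  simp [Cmd.fill, Cmd.wN]

theorem Cmd.wR_fill {a b : ℕ} (h : b ≠ a) (e : NExp) (n : ℕ) (f : ℕ → RExp) :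
    (Cmd.fill a e n f).wR b = false := by
  simp [Cmd.fill, Cmd.wR, h]

/-- In `hf` the array `a` is left unspecified, because the values are computed one by one while `a`
is being overwritten. -/
theorem Cmd.wp_fill {a : ℕ} {e : NExp} {n : ℕ} {f : ℕ → RExp} {v : ℕ → ℝ} {s : State}
    (hf : ∀ c < n, ∀ s' : State, s'.nat = s.nat → (∀ b ≠ a, s'.real b = s.real b) →
      (f c).eval s' = v c) :
    (Cmd.fill a e n f).wp (fun s' => s'.nat = s.nat ∧ (∀ b ≠ a, s'.real b = s.real b) ∧
      ∀ k, s'.real a k = if e.eval s ≤ k ∧ k < e.eval s + n then v (k - e.eval s)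
        else s.real a k) s := by
  have heval : ∀ (e : NExp) (s s' : State), s'.nat = s.nat → e.eval s' = e.eval s := by
    intro e s s' h
    induction e with
    | const k => rfl
    | get a i ih => simp [ih, h]
    | add a b iha ihb => simp [iha, ihb]
    | sub a b iha ihb => simp [iha, ihb]
  have := Cmd.wp_seqs (l := (List.range n).map fun c =>
      Cmd.setReal a (.add e (.const c)) (f c)) (s := s)
    (fun m s' => s'.nat = s.nat ∧ (∀ b ≠ a, s'.real b = s.real b) ∧
      ∀ k, s'.real a k = if e.eval s ≤ k ∧ k < e.eval s + m then v (k - e.eval s)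
        else s.real a k)
    ⟨rfl, fun _ _ => rfl, fun k => by rw [if_neg (by omega)]⟩ ?_
  · simpa [Cmd.fill] using this
  · intro m hm s' ⟨h1, h2, h3⟩
    have hm' : m < n := by simpa using hm
    simp only [List.getElem_map, List.getElem_range, Cmd.wp, NExp.eval_add, NExp.eval_const,
      State.updReal_nat, State.updReal_real, heval e s s' h1, hf m hm' s' h1 h2]
    refine ⟨h1, fun b hb => by rw [if_neg hb, h2 b hb], fun k => ?_⟩
    rw [if_pos trivial, Function.update_apply, h3]
    by_cases hk : k = e.eval s + m
    · subst hk
      simp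
    · rw [if_neg hk]
      by_cases hk' : e.eval s ≤ k ∧ k < e.eval s + m
      · rw [if_pos hk', if_pos (by omega)]
      · rw [if_neg hk', if_neg (by omega)]

/-! ### Real expressions for the candidates of least norm -/

section LeastNormExp

open scoped RealInnerProductSpace

variable {ι : Type*} [Fintype ι] {d : ℕ}

/-- The sum of a finite family of real expressions. -/
noncomputable def RExp.sumOver (f : ι → RExp) : RExp :=
  RExp.sum ((Finset.univ : Finset ι).toList.map f)

@[simp] theorem RExp.eval_sumOver (s : State) (f : ι → RExp) :
    (RExp.sumOver f).eval s = ∑ i, (f i).eval s := by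
  simp only [RExp.sumOver, RExp.eval_sum, List.map_map]
  exact Finset.sum_map_toList Finset.univ fun i => (f i).eval s

/-- The points whose coordinates are given by real expressions. -/
noncomputable def evalPoints (Y : ι → Fin d → RExp) (s : State) (i : ι) :
    EuclideanSpace ℝ (Fin d) :=
  WithLp.toLp 2 fun c => (Y i c).eval s

/-- An expression for the inner product of two linear combinations. -/
noncomputable def formExp (Y : ι → Fin d → RExp) (w w' : ι → RExp) : RExp :=
  .sumOver fun c : Fin d => .mul (.sumOver fun i => .mul (w i) (Y i c))
    (.sumOver fun i => .mul (w' i) (Y i c))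

theorem eval_formExp (Y : ι → Fin d → RExp) (w w' : ι → RExp) (s : State) :
    (formExp Y w w').eval s = ⟪lcomb (evalPoints Y s) (fun i => (w i).eval s),
      lcomb (evalPoints Y s) (fun i => (w' i).eval s)⟫ := by
  simp only [formExp, RExp.eval_sumOver, RExp.eval_mul, lcomb_apply, PiLp.inner_apply,
    PiLp.smul_apply, WithLp.ofLp_sum, Finset.sum_apply, evalPoints, smul_eq_mul,
    RCLike.inner_apply, conj_trivial]
  exact Finset.sum_congr rfl fun c _ => mul_comm _ _

/-- Expressions for the coefficients of `projAlong`. -/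
noncomputable def projExp (Y : ι → Fin d → RExp) : List (ι → RExp) → (ι → RExp) → (ι → RExp)
  | [], z => z
  | u :: us, z => fun i => .sub (projExp Y us z i)
      (.mul (.div (formExp Y (projExp Y us z) (projExp Y us u))
        (formExp Y (projExp Y us u) (projExp Y us u))) (projExp Y us u i))

theorem eval_projExp (Y : ι → Fin d → RExp) (us : List (ι → RExp)) (z : ι → RExp) (s : State) :
    (fun i => (projExp Y us z i).eval s) = projAlong (evalPoints Y s)
      (us.map fun u i => (u i).eval s) (fun i => (z i).eval s) := by
  induction us generalizing z with
  | nil => rfl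
  | cons u us ih =>
    ext i
    simp only [projExp, projAlong, List.map_cons, RExp.eval_sub, RExp.eval_mul, RExp.eval_div,
      eval_formExp, Pi.sub_apply, Pi.smul_apply, smul_eq_mul, ← ih]

/-- Expressions for the coefficients of `candidate`. -/
noncomputable def candidateExp [DecidableEq ι] (Y : ι → Fin d → RExp) : List ι → (ι → RExp)
  | [] => fun _ => .const 0
  | k :: ks => projExp Y
      (ks.map fun j i => .sub (.const (Pi.single (M := fun _ => ℚ) j 1 i))
        (.const (Pi.single (M := fun _ => ℚ) k 1 i)))
      fun i => .const (Pi.single (M := fun _ => ℚ) k 1 i)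

/-- For a fixed list the whole orthogonalization unfolds into one arithmetic expression, so that
closest points are found without loops. -/
theorem eval_candidateExp [DecidableEq ι] (Y : ι → Fin d → RExp) (l : List ι) (s : State) :
    (fun i => (candidateExp Y l i).eval s) = candidate (evalPoints Y s) l := by
  have h1 : ∀ j : ι, (fun i => ((Pi.single (M := fun _ => ℚ) j 1 i : ℚ) : ℝ)) =
      Pi.single j (1 : ℝ) := by
    intro j
    ext i
    by_cases h : i = j
    · subst h; simp
    · simp [h]
  cases l with
  | nil => ext i; simp [candidateExp, candidate]
  | cons k ks =>
    simp only [candidateExp, candidate, eval_projExp, List.map_map, RExp.eval_const, h1]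
    congr 1
    refine List.map_congr_left fun j _ => ?_
    simp only [Function.comp_apply, RExp.eval_sub, RExp.eval_const]
    rw [← h1 j, ← h1 k]
    rfl

end LeastNormExp

namespace Closest

/-! The real arrays `10` and `11` hold the vertices of two simplices. The squared distance is
written to `12`, a closest pair of points to `13` and `14`. -/

open scoped RealInnerProductSpace Pointwise

variable (d : ℕ)

/-- The coordinates of vertex `i` of the simplex in the array `a`. -/
def vertExp (a : ℕ) (i : Fin (d + 1)) (c : ℕ) : RExp := .get a (.const (i * d + c))

/-- The coordinates of the differences of the vertices. -/
def diffExp (i : Fin (d + 1) × Fin (d + 1)) (c : Fin d) : RExp :=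
  .sub (vertExp d 10 i.1 c) (vertExp d 11 i.2 c)

/-- Store the pair of points with coefficients `w`. -/
noncomputable def record (w : Fin (d + 1) × Fin (d + 1) → RExp) : Cmd :=
  .seq (.fill 12 (.const 0) 1 fun _ => formExp (diffExp d) w w)
  (.seq (.fill 13 (.const 0) d fun c => .sumOver fun i => .mul (w i) (vertExp d 10 i.1 c))
    (.fill 14 (.const 0) d fun c => .sumOver fun i => .mul (w i) (vertExp d 11 i.2 c)))

/-- Store the candidate that belongs to `l` if it is admissible and closer. -/
noncomputable def attempt (l : List (Fin (d + 1) × Fin (d + 1))) : Cmd :=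
  .ite (.and (.all ((Finset.univ : Finset (Fin (d + 1) × Fin (d + 1))).toList.map fun i =>
      .rle (.const 0) (candidateExp (diffExp d) l i)))
    (.rlt (formExp (diffExp d) (candidateExp (diffExp d) l) (candidateExp (diffExp d) l))
      (.var 12)))
    (record d (candidateExp (diffExp d) l)) .skip

/-- The nonempty lists of pairs of vertices. -/
noncomputable def lists : List (List (Fin (d + 1) × Fin (d + 1))) :=
  (Finset.univ : Finset (Fin (d + 1) × Fin (d + 1))).toList.sublists.filter (· ≠ [])

/-- The program that finds a closest pair of points. -/
noncomputable def closest : Cmd :=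
  .seq (record d (candidateExp (diffExp d) [(0, 0)])) (.seqs ((lists d).map (attempt d)))

variable {d}

/-- The pair of points with coefficients `w` is stored. -/
structure Recorded (a b : Fin (d + 1) → EuclideanSpace ℝ (Fin d))
    (w : Fin (d + 1) × Fin (d + 1) → ℝ) (s : State) : Prop where
  left : ∀ (i : Fin (d + 1)) (c : Fin d), s.real 10 (i * d + c) = a i c
  right : ∀ (i : Fin (d + 1)) (c : Fin d), s.real 11 (i * d + c) = b i c
  value : s.real 12 0 = ‖lcomb (fun i => a i.1 - b i.2) w‖ ^ 2
  fst : ∀ c : Fin d, s.real 13 c = (∑ i, w i • a i.1) c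
  snd : ∀ c : Fin d, s.real 14 c = (∑ i, w i • b i.2) c

variable {a b : Fin (d + 1) → EuclideanSpace ℝ (Fin d)}

theorem evalPoints_diffExp {s : State}
    (ha : ∀ (i : Fin (d + 1)) (c : Fin d), s.real 10 (i * d + c) = a i c)
    (hb : ∀ (i : Fin (d + 1)) (c : Fin d), s.real 11 (i * d + c) = b i c) :
    evalPoints (diffExp d) s = fun i => a i.1 - b i.2 := by
  ext i c
  simp [evalPoints, diffExp, vertExp, ha, hb]

theorem wp_record {s : State} (l : List (Fin (d + 1) × Fin (d + 1)))
    (ha : ∀ (i : Fin (d + 1)) (c : Fin d), s.real 10 (i * d + c) = a i c)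
    (hb : ∀ (i : Fin (d + 1)) (c : Fin d), s.real 11 (i * d + c) = b i c) :
    (record d (candidateExp (diffExp d) l)).wp
      (Recorded a b (candidate (fun i => a i.1 - b i.2) l)) s := by
  have hcand : ∀ s' : State, (∀ k, s'.real 10 k = s.real 10 k) →
      (∀ k, s'.real 11 k = s.real 11 k) →
      evalPoints (diffExp d) s' = (fun i => a i.1 - b i.2) ∧
      (fun i => (candidateExp (diffExp d) l i).eval s') =
        candidate (fun i => a i.1 - b i.2) l := by
    intro s' h1 h2
    have := evalPoints_diffExp (s := s') (a := a) (b := b)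
      (fun i c => by rw [h1, ha]) fun i c => by rw [h2, hb]
    exact ⟨this, by rw [eval_candidateExp, this]⟩
  change (Cmd.fill _ _ _ _).wp (Cmd.wp (.seq (.fill _ _ _ _) (.fill _ _ _ _)) _) s
  refine Cmd.wp_mono (Cmd.wp_fill
    (v := fun _ => ‖lcomb (fun i => a i.1 - b i.2) (candidate (fun i => a i.1 - b i.2) l)‖ ^ 2)
    ?_) ?_
  · intro c _ s' _ hs'
    obtain ⟨h1, h2⟩ := hcand s' (fun k => by rw [hs' 10 (by decide)])
      fun k => by rw [hs' 11 (by decide)]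
    rw [eval_formExp, h1, h2, real_inner_self_eq_norm_sq]
  rintro s₁ ⟨-, hs₁, hv⟩
  change (Cmd.fill _ _ _ _).wp (Cmd.wp (.fill _ _ _ _) _) s₁
  refine Cmd.wp_mono (Cmd.wp_fill
    (v := fun c => if h : c < d then
      (∑ i, candidate (fun i => a i.1 - b i.2) l i • a i.1) ⟨c, h⟩ else 0) ?_) ?_
  · intro c hc s' _ hs'
    have h10 : s'.real 10 = s.real 10 := by rw [hs' 10 (by decide), hs₁ 10 (by decide)]
    have h11 : s'.real 11 = s.real 11 := by rw [hs' 11 (by decide), hs₁ 11 (by decide)]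
    obtain ⟨h1, h2⟩ := hcand s' (fun k => by rw [h10]) fun k => by rw [h11]
    rw [dif_pos hc, ← h2]
    simp only [RExp.eval_sumOver, RExp.eval_mul, vertExp, RExp.eval_get, NExp.eval_const, h10,
      WithLp.ofLp_sum, Finset.sum_apply, PiLp.smul_apply, smul_eq_mul]
    exact Finset.sum_congr rfl fun i _ => by rw [ha i.1 ⟨c, hc⟩]
  rintro s₂ ⟨-, hs₂, hp⟩
  refine Cmd.wp_mono (Cmd.wp_fill
    (v := fun c => if h : c < d then
      (∑ i, candidate (fun i => a i.1 - b i.2) l i • b i.2) ⟨c, h⟩ else 0) ?_) ?_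
  · intro c hc s' _ hs'
    have h10 : s'.real 10 = s.real 10 := by
      rw [hs' 10 (by decide), hs₂ 10 (by decide), hs₁ 10 (by decide)]
    have h11 : s'.real 11 = s.real 11 := by
      rw [hs' 11 (by decide), hs₂ 11 (by decide), hs₁ 11 (by decide)]
    obtain ⟨h1, h2⟩ := hcand s' (fun k => by rw [h10]) fun k => by rw [h11]
    rw [dif_pos hc, ← h2]
    simp only [RExp.eval_sumOver, RExp.eval_mul, vertExp, RExp.eval_get, NExp.eval_const, h11,
      WithLp.ofLp_sum, Finset.sum_apply, PiLp.smul_apply, smul_eq_mul]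
    exact Finset.sum_congr rfl fun i _ => by rw [hb i.2 ⟨c, hc⟩]
  rintro s₃ ⟨-, hs₃, hq⟩
  simp only [NExp.eval_const, zero_add, zero_le, true_and, tsub_zero] at hv hp hq
  refine ⟨fun i c => ?_, fun i c => ?_, ?_, fun c => ?_, fun c => ?_⟩
  · rw [hs₃ 10 (by decide), hs₂ 10 (by decide), hs₁ 10 (by decide), ha]
  · rw [hs₃ 11 (by decide), hs₂ 11 (by decide), hs₁ 11 (by decide), hb]
  · rw [hs₃ 12 (by decide), hs₂ 12 (by decide), hv]; simp
  · rw [hs₃ 13 (by decide), hp, if_pos c.2, dif_pos c.2]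
  · rw [hq, if_pos c.2, dif_pos c.2]

/-- A closest pair of points of the convex hulls of `a` and `b` is stored. -/
structure Found (a b : Fin (d + 1) → EuclideanSpace ℝ (Fin d))
    (p q : EuclideanSpace ℝ (Fin d)) : Prop where
  left : p ∈ convexHull ℝ (Set.range a)
  right : q ∈ convexHull ℝ (Set.range b)
  le : ∀ x ∈ convexHull ℝ (Set.range a), ∀ y ∈ convexHull ℝ (Set.range b), dist p q ≤ dist x y

/-- The hull of the differences `a i - b j` is the difference of the hulls, so its least norm is the
distance. Every admissible candidate has nonnegative coefficients of sum 1 and thus records a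
genuine pair of points; by `exists_candidate` one of the lists attains the minimum. The pair (0, 0)
provides a first record. -/
theorem wp_closest {s : State}
    (ha : ∀ (i : Fin (d + 1)) (c : Fin d), s.real 10 (i * d + c) = a i c)
    (hb : ∀ (i : Fin (d + 1)) (c : Fin d), s.real 11 (i * d + c) = b i c) :
    (closest d).wp (fun s' => ∃ p q, Found a b p q ∧ s'.real 12 0 = dist p q ^ 2 ∧
      (∀ c : Fin d, s'.real 13 c = p c) ∧ ∀ c : Fin d, s'.real 14 c = q c) s := by
  set x : Fin (d + 1) × Fin (d + 1) → EuclideanSpace ℝ (Fin d) := fun i => a i.1 - b i.2 with hx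
  have hsingle : candidate x [((0 : Fin (d + 1)), (0 : Fin (d + 1)))] = Pi.single (0, 0) 1 := by
    simp [candidate, projAlong]
  change (record _ _).wp ((Cmd.seqs _).wp _) s
  refine Cmd.wp_mono (wp_record _ ha hb) fun s₁ hs₁ => ?_
  refine Cmd.wp_mono (Cmd.wp_seqs (l := (lists d).map (attempt d)) (fun m s' =>
    (∃ w, (∀ i, 0 ≤ w i) ∧ ∑ i, w i = 1 ∧ Recorded a b w s') ∧
    ∀ j (hj : j < (lists d).length), j < m → (∀ i, 0 ≤ candidate x (lists d)[j] i) →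
      s'.real 12 0 ≤ ‖lcomb x (candidate x (lists d)[j])‖ ^ 2) ?_ ?_) ?_
  · refine ⟨⟨_, ?_, sum_candidate _ (by simp), hs₁⟩, fun j _ hj => by omega⟩
    rw [← hx, hsingle]
    intro i
    by_cases h : i = (0, 0)
    · subst h; simp
    · simp [h]
  · rintro m hm s' ⟨⟨w, hw, hw1, hR⟩, hle⟩
    have hm' : m < (lists d).length := by simpa using hm
    have hne : (lists d)[m] ≠ [] := by
      have h1 : ∀ l ∈ lists d, l ≠ [] := fun l hl => by
        simpa using (List.mem_filter.1 hl).2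
      exact h1 _ (List.getElem_mem hm')
    have hx' : evalPoints (diffExp d) s' = x := evalPoints_diffExp hR.left hR.right
    have hc : ∀ i, (candidateExp (diffExp d) (lists d)[m] i).eval s' =
        candidate x (lists d)[m] i := fun i => by
      have := congrFun (eval_candidateExp (diffExp d) (lists d)[m] s') i
      rw [hx'] at this
      exact this
    have hval : (formExp (diffExp d) (candidateExp (diffExp d) (lists d)[m])
        (candidateExp (diffExp d) (lists d)[m])).eval s' =
        ‖lcomb x (candidate x (lists d)[m])‖ ^ 2 := by
      rw [eval_formExp, hx', real_inner_self_eq_norm_sq, eval_candidateExp, hx']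
    simp only [List.getElem_map, attempt, Cmd.wp, Test.holds_and, Test.holds_all, List.mem_map,
      Finset.mem_toList, Finset.mem_univ, true_and, forall_exists_index,
      forall_apply_eq_imp_iff, Test.holds_rle, RExp.eval_const, Test.holds_rlt, hval, hc,
      RExp.eval_get, NExp.eval_const, Rat.cast_zero]
    refine ⟨fun ⟨hnn, hlt⟩ => ?_, fun hcon => ?_⟩
    · refine Cmd.wp_mono (wp_record _ hR.left hR.right) fun s₂ hs₂ => ?_
      refine ⟨⟨_, hnn, sum_candidate _ hne, hs₂⟩, fun j hj hjm hcj => ?_⟩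
      rw [hs₂.value]
      rcases Nat.lt_succ_iff_lt_or_eq.1 hjm with h | rfl
      · exact hlt.le.trans (hle j hj h hcj)
      · exact le_rfl
    · refine ⟨⟨w, hw, hw1, hR⟩, fun j hj hjm hcj => ?_⟩
      rcases Nat.lt_succ_iff_lt_or_eq.1 hjm with h | rfl
      · exact hle j hj h hcj
      · by_contra h
        exact hcon ⟨hcj, not_le.1 h⟩
  · rintro s' ⟨⟨w, hw, hw1, hR⟩, hle⟩
    have hp : ∑ i, w i • a i.1 ∈ convexHull ℝ (Set.range a) :=
      (convex_convexHull ℝ _).sum_mem (fun i _ => hw i) hw1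
        fun i _ => subset_convexHull ℝ _ (Set.mem_range_self _)
    have hq : ∑ i, w i • b i.2 ∈ convexHull ℝ (Set.range b) :=
      (convex_convexHull ℝ _).sum_mem (fun i _ => hw i) hw1
        fun i _ => subset_convexHull ℝ _ (Set.mem_range_self _)
    have hpq : lcomb x w = (∑ i, w i • a i.1) - ∑ i, w i • b i.2 := by
      simp [lcomb_apply, hx, smul_sub]
    have hv : s'.real 12 0 = dist (∑ i, w i • a i.1) (∑ i, w i • b i.2) ^ 2 := by
      rw [hR.value, ← hx, hpq, dist_eq_norm]
    refine ⟨_, _, ⟨hp, hq, fun u hu v hv' => ?_⟩, hv, hR.fst, hR.snd⟩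
    obtain ⟨l, hl, hl0, hlnn, hleast⟩ := exists_candidate x
    have hmem : l ∈ lists d := by
      simp only [lists, List.mem_filter]
      exact ⟨hl, by simpa using hl0⟩
    obtain ⟨j, hj, rfl⟩ := List.getElem_of_mem hmem
    have h1 := hle j hj (by simpa using hj) hlnn
    have huv : u - v ∈ convexHull ℝ (Set.range x) := by
      have : Set.range x = Set.range a - Set.range b := by
        ext y
        simp [hx, Set.mem_sub]
      rw [this, convexHull_sub]
      exact Set.sub_mem_sub hu hv'
    rw [hv] at h1
    have h2 := (sq_le_sq₀ dist_nonneg (norm_nonneg _)).1 h1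
    rw [dist_eq_norm u v]
    exact h2.trans (hleast _ huv)

theorem wN_closest (k : ℕ) : (closest d).wN k = false := by
  simp [closest, attempt, record, Cmd.wN, Cmd.wN_fill]

theorem wR_closest {k : ℕ} (h₁ : k ≠ 12) (h₂ : k ≠ 13) (h₃ : k ≠ 14) :
    (closest d).wR k = false := by
  simp [closest, attempt, record, Cmd.wR, Cmd.wR_fill h₁, Cmd.wR_fill h₂, Cmd.wR_fill h₃]

end Closest

end RealRAM

namespace RealRAM

/-- The program that writes the values of `f 0, …, f (n - 1)` to the entries `e, e + 1, …` of the
integer array `a`. -/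
def Cmd.fillNat (a : ℕ) (e : NExp) (n : ℕ) (f : ℕ → NExp) : Cmd :=
  Cmd.seqs ((List.range n).map fun c => .setNat a (.add e (.const c)) (f c))

theorem Cmd.wN_fillNat {a b : ℕ} (h : b ≠ a) (e : NExp) (n : ℕ) (f : ℕ → NExp) :
    (Cmd.fillNat a e n f).wN b = false := by
  simp [Cmd.fillNat, Cmd.wN, h]

theorem Cmd.wR_fillNat (a : ℕ) (e : NExp) (n : ℕ) (f : ℕ → NExp) (b : ℕ) :
    (Cmd.fillNat a e n f).wR b = false := by
  simp [Cmd.fillNat, Cmd.wR]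

theorem Cmd.wp_fillNat {a : ℕ} {e : NExp} {n : ℕ} {f : ℕ → NExp} {x : ℕ} {v : ℕ → ℕ} {s : State}
    (he : ∀ s' : State, (∀ b ≠ a, s'.nat b = s.nat b) → e.eval s' = x)
    (hf : ∀ c < n, ∀ s' : State, (∀ b ≠ a, s'.nat b = s.nat b) → (f c).eval s' = v c) :
    (Cmd.fillNat a e n f).wp (fun s' => s'.real = s.real ∧ (∀ b ≠ a, s'.nat b = s.nat b) ∧
      ∀ k, s'.nat a k = if x ≤ k ∧ k < x + n then v (k - x) else s.nat a k) s := by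
  have := Cmd.wp_seqs (l := (List.range n).map fun c =>
      Cmd.setNat a (.add e (.const c)) (f c)) (s := s)
    (fun m s' => s'.real = s.real ∧ (∀ b ≠ a, s'.nat b = s.nat b) ∧
      ∀ k, s'.nat a k = if x ≤ k ∧ k < x + m then v (k - x) else s.nat a k)
    ⟨rfl, fun _ _ => rfl, fun k => by rw [if_neg (by omega)]⟩ ?_
  · simpa [Cmd.fillNat] using this
  · intro m hm s' ⟨h1, h2, h3⟩
    have hm' : m < n := by simpa using hm
    simp only [List.getElem_map, List.getElem_range, Cmd.wp, NExp.eval_add, NExp.eval_const,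
      State.updNat_real, State.updNat_nat, he s' h2, hf m hm' s' h2]
    refine ⟨h1, fun b hb => by rw [if_neg hb, h2 b hb], fun k => ?_⟩
    rw [if_pos trivial, Function.update_apply, h3]
    by_cases hk : k = x + m
    · subst hk
      simp
    · rw [if_neg hk]
      by_cases hk' : x ≤ k ∧ k < x + m
      · rw [if_pos hk', if_pos (by omega)]
      · rw [if_neg hk', if_neg (by omega)]

namespace Build

/-! ### The program that builds the graph of pairs of simplices

Integer arrays, for the first complex: `0`, `1`, `2` header, numbers of vertices, vertices of the
simplices, `70` vertices of the simplices, padded by repetition to `d + 1` entries, `71`, `72`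
numbers of the first and the last simplex. For the second complex these are shifted by `3`.
`76` first node of a row, `77` number of nodes, `78`, `79` row and column of a node,
`80`, `81`, `82` loop counters, `83`, `84`, `85` tails, heads and upper ends of the arcs,
`86` number of arcs.
Real arrays: `0`, `1` coordinates of the vertices, `15`, `16` closest points of the nodes,
`70`, `71` weights of the nodes and of the arcs. -/

/-- The padded vertex list of a simplex. -/
def padded (d : ℕ) (card verts : ℕ → ℕ) (i k : ℕ) : ℕ :=
  if k < card i then verts (i * (d + 1) + k) else verts (i * (d + 1))

/-- Pads the vertex list of the simplex in register `80`. -/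
def padStep (d q : ℕ) : Cmd :=
  .fillNat (70 + q) (.nmul (d + 1) (.var 80)) (d + 1) fun k =>
    .get (q + 2) (.add (.nmul (d + 1) (.var 80))
      (.sub (.const k) (.nmul k (.sub (.const 1) (.sub (.get (q + 1) (.var 80)) (.const k))))))

/-- The program that pads the vertex lists of a complex. -/
def pad (d q : ℕ) : Cmd := .for 80 (.get q (.const 1)) (padStep d q)

/-- The blocks of length d + 1 are disjoint, so writing one row leaves the other rows alone. -/
theorem div_lt_of_entry {d i k j : ℕ} (hk : k < d + 1) :
    (j * (d + 1) ≤ i * (d + 1) + k ∧ i * (d + 1) + k < j * (d + 1) + (d + 1)) ↔ i = j := by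
  constructor
  · rintro ⟨h1, h2⟩
    have h3 : j < i + 1 := by
      by_contra hcon
      have := Nat.mul_le_mul_right (d + 1) (not_lt.1 hcon)
      rw [add_mul] at this
      omega
    have h4 : i < j + 1 := by
      by_contra hcon
      have := Nat.mul_le_mul_right (d + 1) (not_lt.1 hcon)
      rw [add_mul] at this
      omega
    omega
  · rintro rfl
    omega

theorem pad_runs (d : ℕ) {q : ℕ} (hq : q = 0 ∨ q = 3) : ∃ K, ∀ s : State,
    Runs (pad d q) s (K * (s.nat q 1 + 1)) fun s' => ∀ i < s.nat q 1, ∀ k < d + 1,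
      s'.nat (70 + q) (i * (d + 1) + k) = padded d (s.nat (q + 1)) (s.nat (q + 2)) i k := by
  refine ⟨(padStep d q).bound + 14, fun s => ?_⟩
  have hw : ∀ b, b ≠ 80 → b ≠ 70 + q → (pad d q).wN b = false := by
    intro b h1 h2
    simp [pad, padStep, Cmd.for, Cmd.wN, h1, Cmd.wN_fillNat h2]
  refine Runs.for_wp (s.nat q 1) (fun j s' => ∀ i < j, ∀ k < d + 1,
      s'.nat (70 + q) (i * (d + 1) + k) = padded d (s.nat (q + 1)) (s.nat (q + 2)) i k) le_rfl
    (Cmd.wN_fillNat (by omega) _ _ _) ?_ ?_ ?_ ?_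
  · intro s' hs'
    simp only [NExp.eval_get, NExp.eval_const]
    rw [hs'.nat q (hw q (by omega) (by omega))]
  · intro j s' x h i hi k hk
    rw [State.updNat_nat, if_neg (by omega)]
    exact h i hi k hk
  · intro i hi; omega
  · intro j hj s' hI hs' hv
    refine Cmd.wp_mono (Cmd.wp_fillNat (x := j * (d + 1))
      (v := fun k => padded d (s.nat (q + 1)) (s.nat (q + 2)) j k) ?_ ?_) ?_
    · intro s₁ h1
      simp [h1 80 (by omega), hv]
    · intro c hc s₁ h1
      have h80 := h1 80 (by omega)
      have e1 : s₁.nat (q + 1) = s.nat (q + 1) := by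
        rw [h1 _ (by omega), hs'.nat _ (hw _ (by omega) (by omega))]
      have e2 : s₁.nat (q + 2) = s.nat (q + 2) := by
        rw [h1 _ (by omega), hs'.nat _ (hw _ (by omega) (by omega))]
      simp only [NExp.eval_get, NExp.eval_add, NExp.eval_sub, NExp.eval_nmul, NExp.eval_const,
        h80, hv, e1, e2, padded]
      -- Truncated subtraction acts as a case distinction: `1 - (card - c)` is 0 for `c < card` and
      -- 1 otherwise, so the entry read is number `c` or number 0.
      by_cases hcc : c < s.nat (q + 1) j
      · have : 1 - (s.nat (q + 1) j - c) = 0 := by omega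
        rw [if_pos hcc, this, zero_mul, tsub_zero]
      · have : 1 - (s.nat (q + 1) j - c) = 1 := by omega
        rw [if_neg hcc, this, one_mul, tsub_self, add_zero]
    · rintro s₁ ⟨-, -, h3⟩ i hi k hk
      rw [h3]
      simp only [div_lt_of_entry hk]
      by_cases hij : i = j
      · subst hij
        rw [if_pos rfl]
        congr 1
        omega
      · rw [if_neg hij]
        exact hI i (by omega) k hk

/-- Checks whether the vertex in entry `e` of the header is the only vertex of the simplex in
register `80`. -/
def findStep (d q e o : ℕ) : Cmd :=
  .ite (.and (.neq (.get (q + 1) (.var 80)) (.const 1))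
      (.neq (.get (q + 2) (.nmul (d + 1) (.var 80))) (.get q (.const e))))
    (.letNat o (.var 80)) .skip

/-- The program that finds the simplex whose only vertex is given by entry `e` of the header. -/
def find (d q e o : ℕ) : Cmd := .for 80 (.get q (.const 1)) (findStep d q e o)

/-- By assumption exactly one simplex passes the test, so the value that is stored once is never
overwritten by another one. -/
theorem find_runs (d : ℕ) {q e o : ℕ} (hq : q = 0 ∨ q = 3) (ho : 70 ≤ o) (ho' : o < 80) :
    ∃ K, ∀ (s : State) (i₀ : ℕ), i₀ < s.nat q 1 →
      (∀ i < s.nat q 1, (s.nat (q + 1) i = 1 ∧ s.nat (q + 2) (i * (d + 1)) = s.nat q e) ↔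
        i = i₀) →
    Runs (find d q e o) s (K * (s.nat q 1 + 1)) fun s' => s'.nat o 0 = i₀ := by
  refine ⟨(findStep d q e o).bound + 14, fun s i₀ hi₀ hu => ?_⟩
  have hw : ∀ b, b < 70 → (find d q e o).wN b = false := by
    intro b h1
    simp only [find, findStep, Cmd.for, Cmd.wN, Bool.or_false, Bool.or_eq_false_iff, beq_eq_false_iff_ne]
    omega
  refine (Runs.for_wp (s.nat q 1) (fun j s' => i₀ < j → s'.nat o 0 = i₀) le_rfl
    ?_ ?_ ?_ ?_ ?_).mono le_rfl fun s' _ h => h hi₀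
  · simp only [findStep, Cmd.wN, Bool.or_false, beq_eq_false_iff_ne]
    omega
  · intro s' hs'
    simp only [NExp.eval_get, NExp.eval_const]
    rw [hs'.nat q (hw q (by omega))]
  · intro j s' x h hj
    rw [State.updNat_nat, if_neg (by omega)]
    exact h hj
  · intro hj; omega
  · intro j hj s' hI hs' hv
    have e0 := hs'.nat q (hw q (by omega))
    have e1 := hs'.nat (q + 1) (hw _ (by omega))
    have e2 := hs'.nat (q + 2) (hw _ (by omega))
    have hjj := hu j hj
    simp only [findStep, Cmd.wp, Test.holds_and, Test.holds_neq, NExp.eval_get, NExp.eval_const,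
      NExp.eval_nmul, e0, e1, e2, hv, hjj, State.updNat_nat, reduceIte, Function.update_self]
    refine ⟨fun h _ => h, fun h h1 => hI (by omega)⟩

/-- The points of simplex number `i`. -/
noncomputable def cellPoints (d : ℕ) (V : ℕ → ℕ → ℕ) (r : ℕ → ℝ) (i : ℕ) (k : Fin (d + 1)) :
    EuclideanSpace ℝ (Fin d) :=
  WithLp.toLp 2 fun c => r (V i k * d + c)

/-- The program that loads the points of a simplex. -/
def load (d p r v a : ℕ) : Cmd :=
  .fill a (.const 0) ((d + 1) * d) fun e =>
    .get r (.add (.nmul d (.get p (.add (.nmul (d + 1) (.var v)) (.const (e / d)))))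
      (.const (e % d)))

/-- The quotients `e / d` and `e % d` are constants of the program text. At run time only multiples
by `d` and `d + 1` occur, which are repeated sums. -/
theorem wp_load {d p r v a i : ℕ} {s : State} {V : ℕ → ℕ → ℕ} (hra : r ≠ a)
    (hp : ∀ k < d + 1, s.nat p (i * (d + 1) + k) = V i k) (hv : s.nat v 0 = i) :
    (load d p r v a).wp (fun s' => s'.nat = s.nat ∧ (∀ b ≠ a, s'.real b = s.real b) ∧
      ∀ (k : Fin (d + 1)) (c : Fin d),
        s'.real a (k * d + c) = cellPoints d V (s.real r) i k c) s := by
  refine Cmd.wp_mono (Cmd.wp_fill (v := fun e => s.real r (V i (e / d) * d + e % d)) ?_) ?_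
  · intro e he s' h1 h2
    have : e / d < d + 1 := Nat.div_lt_of_lt_mul (by rwa [mul_comm])
    simp only [RExp.eval_get, NExp.eval_add, NExp.eval_nmul, NExp.eval_get, NExp.eval_const,
      h1, hv, h2 r hra, hp _ this]
  · rintro s' ⟨h1, h2, h3⟩
    refine ⟨h1, h2, fun k c => ?_⟩
    have hd : 0 < d := c.pos
    have hlt : (k : ℕ) * d + c < (d + 1) * d := by
      calc (k : ℕ) * d + c < k * d + d := Nat.add_lt_add_left c.2 _
        _ = (k + 1) * d := by ring
        _ ≤ _ := Nat.mul_le_mul_right _ k.2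
    have e1 : ((k : ℕ) * d + c) / d = k := by
      rw [mul_comm, Nat.mul_add_div hd, Nat.div_eq_of_lt c.2, add_zero]
    have e2 : ((k : ℕ) * d + c) % d = c := by
      rw [mul_comm, Nat.mul_add_mod, Nat.mod_eq_of_lt c.2]
    rw [h3]
    simp only [NExp.eval_const, zero_le, zero_add, hlt, and_self, if_true, tsub_zero, e1, e2,
      cellPoints]

/-- The program that processes the node in row `80` and column `81`. -/
noncomputable def node (d : ℕ) : Cmd :=
  .seq (load d 70 0 80 10) <| .seq (load d 73 1 81 11) <| .seq (Closest.closest d) <|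
  .seq (.setReal 70 (.var 77) (.var 12)) <|
  .seq (.fill 15 (.nmul d (.var 77)) d fun c => .get 13 (.const c)) <|
  .seq (.fill 16 (.nmul d (.var 77)) d fun c => .get 14 (.const c)) <|
  .seq (.setNat 78 (.var 77) (.var 80)) <| .seq (.setNat 79 (.var 77) (.var 81)) <|
  .letNat 77 (.add (.var 77) (.const 1))

/-- Node `x` is stored, and it belongs to simplices with the points `a` and `b` in row `i` and
column `j`. -/
structure NodeAt {d : ℕ} (s : State) (x i j : ℕ) (a b : Fin (d + 1) → EuclideanSpace ℝ (Fin d))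
    (p q : EuclideanSpace ℝ (Fin d)) : Prop where
  found : Closest.Found a b p q
  weight : s.real 70 x = dist p q ^ 2
  fst : ∀ c : Fin d, s.real 15 (x * d + c) = p c
  snd : ∀ c : Fin d, s.real 16 (x * d + c) = q c
  row : s.nat 78 x = i
  col : s.nat 79 x = j

theorem NodeAt.congr {d : ℕ} {s s' : State} {x i j : ℕ}
    {a b : Fin (d + 1) → EuclideanSpace ℝ (Fin d)} {p q : EuclideanSpace ℝ (Fin d)}
    (h : NodeAt s x i j a b p q) (h70 : s'.real 70 x = s.real 70 x)
    (h15 : ∀ c : Fin d, s'.real 15 (x * d + c) = s.real 15 (x * d + c))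
    (h16 : ∀ c : Fin d, s'.real 16 (x * d + c) = s.real 16 (x * d + c))
    (h78 : s'.nat 78 x = s.nat 78 x) (h79 : s'.nat 79 x = s.nat 79 x) :
    NodeAt s' x i j a b p q where
  found := h.found
  weight := h70.trans h.weight
  fst c := (h15 c).trans (h.fst c)
  snd c := (h16 c).trans (h.snd c)
  row := h78.trans h.row
  col := h79.trans h.col

/-- The points are stored in blocks in increasing order of the nodes, so it is enough to protect the
coordinates before the current block. -/
theorem wp_node {d : ℕ} {s : State} {V₁ V₂ : ℕ → ℕ → ℕ} {i j x : ℕ} (hi : s.nat 80 0 = i)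
    (hj : s.nat 81 0 = j) (hx : s.nat 77 0 = x)
    (h₁ : ∀ k < d + 1, s.nat 70 (i * (d + 1) + k) = V₁ i k)
    (h₂ : ∀ k < d + 1, s.nat 73 (j * (d + 1) + k) = V₂ j k) :
    (node d).wp (fun s' => s'.nat 77 0 = x + 1 ∧
      (∃ p q, NodeAt s' x i j (cellPoints d V₁ (s.real 0) i) (cellPoints d V₂ (s.real 1) j) p q) ∧
      (∀ y, y ≠ x → s'.nat 78 y = s.nat 78 y ∧ s'.nat 79 y = s.nat 79 y ∧
        s'.real 70 y = s.real 70 y) ∧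
      ∀ y < x * d, s'.real 15 y = s.real 15 y ∧ s'.real 16 y = s.real 16 y) s := by
  change (load _ _ _ _ _).wp (Cmd.wp (.seq _ _) _) s
  refine Cmd.wp_mono (wp_load (V := V₁) (by decide) h₁ hi) ?_
  rintro s₁ ⟨n₁, r₁, c₁⟩
  change (load _ _ _ _ _).wp (Cmd.wp (.seq _ _) _) s₁
  refine Cmd.wp_mono (wp_load (V := V₂) (i := j) (by decide) (by rwa [n₁]) (by rwa [n₁])) ?_
  rintro s₂ ⟨n₂, r₂, c₂⟩
  rw [r₁ 1 (by decide)] at c₂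
  change (Closest.closest d).wp (Cmd.wp (.seq _ _) _) s₂
  refine Cmd.wp_mono (Cmd.wp_same (Closest.wp_closest
    (fun k c => by rw [r₂ 10 (by decide)]; exact c₁ k c) c₂)) ?_
  rintro s₃ ⟨⟨p, q, hpq, hv, hp, hq⟩, hs₃⟩
  have n₃ : s₃.nat = s.nat := by
    rw [← n₁, ← n₂]
    exact funext fun b => hs₃.nat b (Closest.wN_closest b)
  have r₃ : ∀ b, 15 ≤ b → s₃.real b = s.real b := by
    intro b hb
    rw [hs₃.real b (Closest.wR_closest (by omega) (by omega) (by omega)), r₂ b (by omega),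
      r₁ b (by omega)]
  change (Cmd.fill _ _ _ _).wp (Cmd.wp (.seq _ _) _) _
  refine Cmd.wp_mono (Cmd.wp_fill (v := fun c => s₃.real 13 c) ?_) ?_
  · intro c _ s' _ hs'
    simp only [RExp.eval_get, NExp.eval_const, hs' 13 (by decide), State.updReal_real,
      Nat.reduceEqDiff, reduceIte]
  rintro s₄ ⟨n₄, r₄, c₄⟩
  change (Cmd.fill _ _ _ _).wp (Cmd.wp (.seq _ _) _) _
  refine Cmd.wp_mono (Cmd.wp_fill (v := fun c => s₃.real 14 c) ?_) ?_
  · intro c _ s' _ hs'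
    simp only [RExp.eval_get, NExp.eval_const, hs' 14 (by decide), r₄ 14 (by decide),
      State.updReal_real, Nat.reduceEqDiff, reduceIte]
  rintro s₅ ⟨n₅, r₅, c₅⟩
  have n₅' : s₅.nat = s.nat := by rw [n₅, n₄]; exact n₃
  have e77 : s₅.nat 77 0 = x := by rw [n₅', hx]
  have e4 : s₄.nat 77 0 = x := by rw [n₄]; simpa [n₃] using hx
  simp only [NExp.eval_nmul, NExp.eval_get, NExp.eval_const, State.updReal_nat, n₃, hx, e4] at c₄ c₅
  simp only [Cmd.wp, NExp.eval_add, NExp.eval_get, NExp.eval_const, State.updNat_nat,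
    Nat.reduceEqDiff, reduceIte, Function.update_self, e77]
  have e70 : s₅.real 70 = Function.update (s.real 70) x (s₃.real 12 0) := by
    rw [r₅ 70 (by decide), r₄ 70 (by decide)]
    simp [State.updReal_real, n₃, hx, r₃ 70 (by decide)]
  have e15 : s₅.real 15 = s₄.real 15 := r₅ 15 (by decide)
  have e15' : ∀ k, s₄.real 15 k = if x * d ≤ k ∧ k < x * d + d then s₃.real 13 (k - x * d)
      else s.real 15 k := by
    intro k
    rw [c₄, State.updReal_real, if_neg (show ¬ 15 = 70 by decide), r₃ 15 (by decide)]
  have e16' : ∀ k, s₅.real 16 k = if x * d ≤ k ∧ k < x * d + d then s₃.real 14 (k - x * d)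
      else s.real 16 k := by
    intro k
    rw [c₅, r₄ 16 (by decide), State.updReal_real,
      if_neg (show ¬ 16 = 70 by decide), r₃ 16 (by decide)]
  refine ⟨trivial, ⟨p, q, hpq, ?_, fun c => ?_, fun c => ?_, ?_, ?_⟩, fun y hy => ⟨?_, ?_, ?_⟩,
    fun y hy => ⟨?_, ?_⟩⟩
  · simp [e70, hv]
  · simp only [State.updNat_real, e15, e15']
    rw [if_pos (by omega), Nat.add_sub_cancel_left, hp]
  · simp only [State.updNat_real, e16']
    rw [if_pos (by omega), Nat.add_sub_cancel_left, hq]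
  · simp [State.updNat_nat, n₅', hi]
  · simp [State.updNat_nat, n₅', hj]
  · simp [n₅', hy]
  · simp [n₅', hy]
  · simp [e70, hy]
  · simp only [State.updNat_real, e15, e15']
    rw [if_neg (by omega)]
  · simp only [State.updNat_real, e16']
    rw [if_neg (by omega)]

/-- The program that processes all nodes. -/
noncomputable def nodes (d : ℕ) : Cmd :=
  .seq (.letNat 77 (.const 0)) <|
  .for 80 (.get 0 (.const 1)) <|
    .seq (.setNat 76 (.var 80) (.var 77)) (.for 81 (.get 3 (.const 1)) (node d))

theorem wN_node (d : ℕ) {b : ℕ} (h77 : b ≠ 77) (h78 : b ≠ 78) (h79 : b ≠ 79) :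
    (node d).wN b = false := by
  simp [node, load, Cmd.wN, Cmd.wN_fill, Closest.wN_closest, h77, h78, h79]

theorem wR_node (d : ℕ) {b : ℕ} (h10 : b ≠ 10) (h11 : b ≠ 11) (h12 : b ≠ 12) (h13 : b ≠ 13)
    (h14 : b ≠ 14) (h15 : b ≠ 15) (h16 : b ≠ 16) (h70 : b ≠ 70) :
    (node d).wR b = false := by
  simp [node, load, Cmd.wR, Cmd.wR_fill h10, Cmd.wR_fill h11, Cmd.wR_fill h15, Cmd.wR_fill h16,
    Closest.wR_closest h12 h13 h14, h70]

theorem wN_nodes (d : ℕ) {b : ℕ} (h : b < 76 ∨ 82 ≤ b) : (nodes d).wN b = false := by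
  simp [nodes, Cmd.for, Cmd.wN, wN_node d (b := b) (by omega) (by omega) (by omega)]
  omega

theorem wR_nodes (d : ℕ) {b : ℕ} (h : b < 10) : (nodes d).wR b = false := by
  simp [nodes, Cmd.for, Cmd.wR,
    wR_node d (b := b) (by omega) (by omega) (by omega) (by omega) (by omega) (by omega)
      (by omega) (by omega)]

/-- All nodes before node `N` are stored, in rows of length `n₂`. -/
def NodesAt (d : ℕ) (s : State) (V₁ V₂ : ℕ → ℕ → ℕ) (r₁ r₂ : ℕ → ℝ) (n₂ N : ℕ) : Prop :=
  ∀ x < N, ∃ p q, NodeAt s x (x / n₂) (x % n₂) (cellPoints d V₁ r₁ (x / n₂))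
    (cellPoints d V₂ r₂ (x % n₂)) p q

/-- Row `i` and column `j` get the number `i * n₂ + j`. The table 76 of the first nodes of the rows
replaces the integer multiplication that the machine does not offer. -/
theorem nodes_runs (d : ℕ) : ∃ K, ∀ (s : State) (V₁ V₂ : ℕ → ℕ → ℕ),
    (∀ i < s.nat 0 1, ∀ k < d + 1, s.nat 70 (i * (d + 1) + k) = V₁ i k) →
    (∀ i < s.nat 3 1, ∀ k < d + 1, s.nat 73 (i * (d + 1) + k) = V₂ i k) →
    Runs (nodes d) s (K * ((s.nat 0 1 + 1) * (s.nat 3 1 + 1))) fun s' =>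
      NodesAt d s' V₁ V₂ (s.real 0) (s.real 1) (s.nat 3 1) (s.nat 0 1 * s.nat 3 1) ∧
      ∀ i < s.nat 0 1, s'.nat 76 i = i * s.nat 3 1 := by
  refine ⟨(node d).bound + 100, fun s V₁ V₂ h₁ h₂ => ?_⟩
  set n₁ := s.nat 0 1
  set n₂ := s.nat 3 1
  set Kn := (node d).bound + 20
  refine Runs.prefix (k₁ := 3) (k₂ := n₁ * (Kn * (n₂ + 1) + 10) + 14 * (n₁ + 1))
    (fun s' => s'.nat 77 0 = 0) (by simp [Cmd.bound, NExp.cost]) ?_ (by simp [Cmd.wp, State.updNat_nat]) ?_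
  · have : (node d).bound + 100 = Kn + 80 := rfl
    rw [this]
    ring_nf
    have h1 : n₁ ≤ n₁ * n₂ + n₁ := by omega
    nlinarith [Nat.zero_le (n₁ * n₂)]
  intro s₁ hs₁ h77
  have hN : ∀ s', Cmd.Same (.for 80 (.get 0 (.const 1)) <|
      .seq (.setNat 76 (.var 80) (.var 77)) (.for 81 (.get 3 (.const 1)) (node d))) s₁ s' →
      (∀ b, b < 76 ∨ 82 ≤ b → s'.nat b = s.nat b) ∧ ∀ b < 10, s'.real b = s.real b := by
    intro s' hs'
    refine ⟨fun b hb => ?_, fun b hb => ?_⟩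
    · rw [hs'.nat b, hs₁.nat b]
      · simp only [Cmd.wN, beq_eq_false_iff_ne]; omega
      · have := wN_nodes d hb
        simp only [nodes, Cmd.wN, Bool.or_eq_false_iff] at this
        exact this.2
    · rw [hs'.real b, hs₁.real b rfl]
      have := wR_nodes d hb
      simp only [nodes, Cmd.wR, Bool.or_eq_false_iff] at this
      exact this.2
  refine (Runs.for n₁ (fun i s' => s'.nat 77 0 = i * n₂ ∧
    NodesAt d s' V₁ V₂ (s.real 0) (s.real 1) n₂ (i * n₂) ∧ ∀ i' < i, s'.nat 76 i' = i' * n₂)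
    (fun _ => Kn * (n₂ + 1) + 10) ?_ ?_ ?_ ?_ ?_).mono ?_ fun s' _ h => h.2
  · simp [Cmd.for, Cmd.wN, wN_node]
  · intro s' hs'
    simp only [NExp.eval_get, NExp.eval_const, (hN s' hs').1 0 (by decide), n₁]
  · rintro i s' x ⟨h1, h2, h3⟩
    refine ⟨by simpa [State.updNat_nat] using h1, fun y hy => ?_,
      by simpa [State.updNat_nat] using h3⟩
    obtain ⟨p, q, h⟩ := h2 y hy
    exact ⟨p, q, h.congr rfl (fun _ => rfl) (fun _ => rfl) (by simp [State.updNat_nat])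
      (by simp [State.updNat_nat])⟩
  · exact ⟨by rw [h77, zero_mul], fun x hx => by omega, fun i hi => by omega⟩
  · rintro i hi s₂ ⟨h1, h2, h3⟩ hs₂ h80
    obtain ⟨hn₂, hr₂⟩ := hN s₂ hs₂
    refine Runs.prefix (k₁ := 10) (k₂ := Kn * (n₂ + 1)) (fun s' => s'.nat 77 0 = i * n₂ ∧
      NodesAt d s' V₁ V₂ (s.real 0) (s.real 1) n₂ (i * n₂) ∧
      ∀ i' < i + 1, s'.nat 76 i' = i' * n₂) (by simp [Cmd.bound, NExp.cost]) (by omega) ?_ ?_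
    · simp only [Cmd.wp, NExp.eval_get, NExp.eval_const, State.updNat_nat, reduceIte,
        Nat.reduceEqDiff, h80, h1]
      refine ⟨trivial, fun y hy => ?_, fun i' hi' => ?_⟩
      · obtain ⟨p, q, h⟩ := h2 y hy
        exact ⟨p, q, h.congr rfl (fun _ => rfl) (fun _ => rfl) (by simp [State.updNat_nat])
          (by simp [State.updNat_nat])⟩
      · rw [Function.update_apply]
        split_ifs with h
        · rw [h]
        · exact h3 i' (by omega)
    · rintro s₃ hs₃ ⟨h1, h2, h3⟩
      have e₃ : ∀ b, b ≠ 76 → s₃.nat b = s₂.nat b := fun b hb => hs₃.nat b (by simp [Cmd.wN, hb])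
      have hsame : ∀ s', (Cmd.for 81 (.get 3 (.const 1)) (node d)).Same s₃ s' →
          (∀ b, b < 76 ∨ 82 ≤ b → s'.nat b = s.nat b) ∧ (∀ b < 10, s'.real b = s.real b) ∧
          s'.nat 80 = s₂.nat 80 ∧ s'.nat 76 = s₃.nat 76 := by
        intro s' hs'
        have aux : ∀ b, b ≠ 81 → b ≠ 77 → b ≠ 78 → b ≠ 79 → s'.nat b = s₃.nat b := by
          intro b h1 h2 h3 h4
          exact hs'.nat b (by simp [Cmd.for, Cmd.wN, wN_node d h2 h3 h4, h1])
        refine ⟨fun b hb => ?_, fun b hb => ?_, ?_, ?_⟩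
        · rw [aux b (by omega) (by omega) (by omega) (by omega), e₃ b (by omega), hn₂ b hb]
        · rw [hs'.real b, hs₃.real b rfl, hr₂ b hb]
          simp [Cmd.for, Cmd.wR, wR_node d (b := b) (by omega) (by omega) (by omega) (by omega)
            (by omega) (by omega) (by omega) (by omega)]
        · rw [aux 80 (by decide) (by decide) (by decide) (by decide), e₃ 80 (by decide)]
        · exact aux 76 (by decide) (by decide) (by decide) (by decide)
      refine (Runs.for_wp n₂ (fun j s' => s'.nat 77 0 = i * n₂ + j ∧
        NodesAt d s' V₁ V₂ (s.real 0) (s.real 1) n₂ (i * n₂ + j)) (K := Kn) ?_ ?_ ?_ ?_ ?_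
        ?_).mono le_rfl ?_
      · simp [Kn, NExp.cost]
      · exact wN_node d (by decide) (by decide) (by decide)
      · intro s' hs'
        simp only [NExp.eval_get, NExp.eval_const, (hsame s' hs').1 3 (by decide), n₂]
      · rintro j s' x ⟨h1, h2⟩
        refine ⟨by simpa [State.updNat_nat] using h1, fun y hy => ?_⟩
        obtain ⟨p, q, h⟩ := h2 y hy
        exact ⟨p, q, h.congr rfl (fun _ => rfl) (fun _ => rfl) (by simp [State.updNat_nat])
          (by simp [State.updNat_nat])⟩
      · exact ⟨h1, h2⟩
      · rintro j hj s₄ ⟨h1, h2⟩ hs₄ h81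
        obtain ⟨hn₄, hr₄, h80', -⟩ := hsame s₄ hs₄
        refine Cmd.wp_mono (wp_node (V₁ := V₁) (V₂ := V₂) (i := i) (j := j) (by rw [h80', h80])
          h81 h1 ?_ ?_) ?_
        · rw [hn₄ 70 (by decide)]; exact h₁ i hi
        · rw [hn₄ 73 (by decide)]; exact h₂ j hj
        · rintro s₅ ⟨h5, ⟨p, q, hpq⟩, h6, h7⟩
          refine ⟨h5, fun y hy => ?_⟩
          rw [hr₄ 0 (by decide), hr₄ 1 (by decide)] at hpq
          have hy' : y < i * n₂ + j ∨ y = i * n₂ + j := by omega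
          rcases hy' with hy | rfl
          · obtain ⟨p, q, h⟩ := h2 y hy
            have hlt : ∀ c : Fin d, y * d + c < (i * n₂ + j) * d := by
              intro c
              calc y * d + c < y * d + d := Nat.add_lt_add_left c.2 _
                _ = (y + 1) * d := by ring
                _ ≤ _ := Nat.mul_le_mul_right _ hy
            obtain ⟨g1, g2, g3⟩ := h6 y hy.ne
            exact ⟨p, q, h.congr g3 (fun c => (h7 _ (hlt c)).1) (fun c => (h7 _ (hlt c)).2) g1 g2⟩
          · have hn : 0 < n₂ := by omega
            have q1 : (i * n₂ + j) / n₂ = i := by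
              rw [mul_comm, Nat.mul_add_div hn, Nat.div_eq_of_lt hj, add_zero]
            have q2 : (i * n₂ + j) % n₂ = j := by
              rw [mul_comm, Nat.mul_add_mod, Nat.mod_eq_of_lt hj]
            rw [q1, q2]
            exact ⟨p, q, hpq⟩
      · rintro s' hs' ⟨h4, h5⟩
        refine ⟨by rw [h4]; ring, by rwa [add_mul, one_mul], ?_⟩
        rw [(hsame s' hs').2.2.2]
        exact h3
  · simp [NExp.cost]

end Build

end RealRAM

namespace RealRAM.Build

/-! ### The arcs -/

/-- The stored arcs, given by tail, head, upper end and lower end, are exactly those that satisfy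
`A`; their weights are the weights of the lower ends. -/
structure Arcs (s : State) (A : ℕ → ℕ → ℕ → ℕ → Prop) : Prop where
  sound : ∀ a < s.nat 86 0, ∃ lo, A (s.nat 83 a) (s.nat 84 a) (s.nat 85 a) lo ∧
    s.real 71 a = s.real 70 lo
  complete : ∀ x y hi lo, A x y hi lo → ∃ a < s.nat 86 0, s.nat 83 a = x ∧ s.nat 84 a = y ∧
    s.nat 85 a = hi ∧ s.real 71 a = s.real 70 lo

theorem Arcs.congr {s s' : State} {A : ℕ → ℕ → ℕ → ℕ → Prop} (h : Arcs s A)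
    (h83 : s'.nat 83 = s.nat 83) (h84 : s'.nat 84 = s.nat 84) (h85 : s'.nat 85 = s.nat 85)
    (h86 : s'.nat 86 = s.nat 86) (h70 : s'.real 70 = s.real 70) (h71 : s'.real 71 = s.real 71) :
    Arcs s' A :=
  ⟨by rw [h83, h84, h85, h86, h70, h71]; exact h.sound,
    by rw [h83, h84, h85, h86, h70, h71]; exact h.complete⟩

theorem Arcs.iff {s : State} {A A' : ℕ → ℕ → ℕ → ℕ → Prop} (h : Arcs s A)
    (hA : ∀ x y hi lo, A x y hi lo ↔ A' x y hi lo) : Arcs s A' := by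
  have : A = A' := by
    ext x y hi lo
    exact hA x y hi lo
  exact this ▸ h

/-- The program that appends an arc. -/
def push (x y hi lo : NExp) : Cmd :=
  .seq (.setNat 83 (.var 86) x) <| .seq (.setNat 84 (.var 86) y) <|
  .seq (.setNat 85 (.var 86) hi) <| .seq (.setReal 71 (.var 86) (.get 70 lo)) <|
  .letNat 86 (.add (.var 86) (.const 1))

/-- The expression has the same value in all memories that agree with `s` outside the lists of
arcs. -/
def Stable (s : State) (e : NExp) (x : ℕ) : Prop :=
  ∀ s' : State, (∀ b < 83, s'.nat b = s.nat b) → e.eval s' = x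

theorem wp_push {s : State} {x y hi lo : NExp} {x' y' hi' lo' : ℕ} {A : ℕ → ℕ → ℕ → ℕ → Prop}
    (hA : Arcs s A) (hx : Stable s x x') (hy : Stable s y y') (hhi : Stable s hi hi')
    (hlo : Stable s lo lo') :
    (push x y hi lo).wp (fun s' => (∀ b < 83, s'.nat b = s.nat b) ∧
      s'.nat 86 0 = s.nat 86 0 + 1 ∧
      Arcs s' fun a b c e => A a b c e ∨ a = x' ∧ b = y' ∧ c = hi' ∧ e = lo') s := by
  have e1 : x.eval s = x' := hx _ fun _ _ => rfl
  have e2 : ∀ i v, y.eval (s.updNat 83 i v) = y' := fun i v => hy _ fun b hb => by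
    rw [State.updNat_nat, if_neg (by omega)]
  have e3 : ∀ i v i' v', hi.eval ((s.updNat 83 i v).updNat 84 i' v') = hi' :=
    fun i v i' v' => hhi _ fun b hb => by
      rw [State.updNat_nat, if_neg (by omega), State.updNat_nat, if_neg (by omega)]
  have e4 : ∀ i v i' v' i'' v'', lo.eval
      (((s.updNat 83 i v).updNat 84 i' v').updNat 85 i'' v'') = lo' :=
    fun i v i' v' i'' v'' => hlo _ fun b hb => by
      rw [State.updNat_nat, if_neg (by omega), State.updNat_nat, if_neg (by omega),
        State.updNat_nat, if_neg (by omega)]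
  simp only [push, Cmd.wp, RExp.eval_get, e1, e2, e3, e4]
  simp only [NExp.eval_get, NExp.eval_const, NExp.eval_add, State.updNat_nat, State.updReal_nat,
    Nat.reduceEqDiff, reduceIte, State.updNat_real, Function.update_self]
  refine ⟨fun b hb => ?_, trivial, ⟨fun a ha => ?_, fun a b c e h => ?_⟩⟩
  · rw [if_neg (by omega), if_neg (by omega), if_neg (by omega), if_neg (by omega)]
  · simp only [State.updNat_nat, State.updReal_nat, State.updNat_real, State.updReal_real,
      Nat.reduceEqDiff, reduceIte, Function.update_self] at ha ⊢
    rcases Nat.lt_succ_iff_lt_or_eq.1 ha with ha | rfl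
    · obtain ⟨lo, h1, h2⟩ := hA.sound a ha
      simp only [Function.update_of_ne ha.ne]
      exact ⟨lo, .inl h1, h2⟩
    · simp only [Function.update_self]
      exact ⟨lo', .inr (by trivial), rfl⟩
  · simp only [State.updNat_nat, State.updReal_nat, State.updNat_real, State.updReal_real,
      Nat.reduceEqDiff, reduceIte, Function.update_self]
    rcases h with h | ⟨rfl, rfl, rfl, rfl⟩
    · obtain ⟨k, hk, h1⟩ := hA.complete a b c e h
      refine ⟨k, by omega, ?_⟩
      simp only [Function.update_of_ne hk.ne]
      exact h1
    · refine ⟨_, Nat.lt_succ_self _, ?_⟩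
      simp only [Function.update_self, and_self]

/-- Both directions of the arcs between pairs that satisfy `R`. -/
def both (R : ℕ → ℕ → Prop) (x y hi lo : ℕ) : Prop :=
  R lo hi ∧ (x = lo ∧ y = hi ∨ x = hi ∧ y = lo)

/-- The program that appends an arc in both directions. -/
def pushBoth (hi lo : NExp) : Cmd := .seq (push lo hi hi lo) (push hi lo hi lo)

theorem wp_pushBoth {s : State} {hi lo : NExp} {hi' lo' : ℕ} {R : ℕ → ℕ → Prop}
    (hA : Arcs s (both R)) (hhi : Stable s hi hi') (hlo : Stable s lo lo') :
    (pushBoth hi lo).wp (fun s' => (∀ b < 83, s'.nat b = s.nat b) ∧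
      s'.nat 86 0 = s.nat 86 0 + 2 ∧
      Arcs s' (both fun a b => R a b ∨ a = lo' ∧ b = hi')) s := by
  have hst : ∀ {s' : State} {e x}, (∀ b < 83, s'.nat b = s.nat b) → Stable s e x →
      Stable s' e x := fun h1 h2 s'' h3 => h2 s'' fun b hb => by rw [h3 b hb, h1 b hb]
  rw [pushBoth, Cmd.wp]
  refine Cmd.wp_mono (wp_push hA hlo hhi hhi hlo) ?_
  rintro s₁ ⟨h1, h2, h3⟩
  refine Cmd.wp_mono (wp_push h3 (hst h1 hhi) (hst h1 hlo) (hst h1 hhi) (hst h1 hlo)) ?_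
  rintro s₂ ⟨h4, h5, h6⟩
  refine ⟨fun b hb => by rw [h4 b hb, h1 b hb], by omega, h6.iff fun x y hi lo => ?_⟩
  simp only [both]
  constructor
  · rintro ((⟨h1, h2⟩ | ⟨rfl, rfl, rfl, rfl⟩) | ⟨rfl, rfl, rfl, rfl⟩)
    · exact ⟨.inl h1, h2⟩
    · exact ⟨.inr ⟨rfl, rfl⟩, .inl ⟨rfl, rfl⟩⟩
    · exact ⟨.inr ⟨rfl, rfl⟩, .inr ⟨rfl, rfl⟩⟩
  · rintro ⟨h1 | ⟨rfl, rfl⟩, h2⟩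
    · exact .inl (.inl ⟨h1, h2⟩)
    · rcases h2 with ⟨rfl, rfl⟩ | ⟨rfl, rfl⟩
      · exact .inl (.inr ⟨rfl, rfl, rfl, rfl⟩)
      · exact .inr ⟨rfl, rfl, rfl, rfl⟩

/-- The vertices of simplex `i'` are vertices of simplex `i`. -/
def Sub (d : ℕ) (V : ℕ → ℕ → ℕ) (i' i : ℕ) : Prop :=
  ∀ k < d + 1, ∃ k' < d + 1, V i' k = V i k'

/-- Whether the simplex in register `81` is a face of the simplex in register `80`. -/
def subTest (d q : ℕ) : Test :=
  .all <| (List.range (d + 1)).map fun k => .any <| (List.range (d + 1)).map fun k' =>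
    .neq (.get (70 + q) (.add (.nmul (d + 1) (.var 81)) (.const k)))
      (.get (70 + q) (.add (.nmul (d + 1) (.var 80)) (.const k')))

theorem holds_subTest {d q : ℕ} {s : State} {V : ℕ → ℕ → ℕ} {i i' : ℕ} (hi : s.nat 80 0 = i)
    (hi' : s.nat 81 0 = i') (hV : ∀ k < d + 1, s.nat (70 + q) (i * (d + 1) + k) = V i k)
    (hV' : ∀ k < d + 1, s.nat (70 + q) (i' * (d + 1) + k) = V i' k) :
    (subTest d q).Holds s ↔ Sub d V i' i := by
  simp only [subTest, Test.holds_all, List.mem_map, List.mem_range, forall_exists_index, and_imp,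
    forall_apply_eq_imp_iff₂, Test.holds_any, exists_exists_and_eq_and, Test.holds_neq,
    NExp.eval_get, NExp.eval_add, NExp.eval_nmul, NExp.eval_const, hi, hi', Sub]
  refine forall₂_congr fun k hk => exists_congr fun k' => and_congr_right fun hk' => ?_
  rw [hV k' hk', hV' k hk]

/-- The program that appends the arcs that belong to the faces of the simplices of one complex
and the simplices of the other one. -/
def arcs (d q q' : ℕ) (hi lo : NExp) : Cmd :=
  .for 80 (.get q (.const 1)) <| .for 81 (.get q (.const 1)) <|
    .ite (subTest d q) (.for 82 (.get q' (.const 1)) (pushBoth hi lo)) .skip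

/-- The expensive branch is charged only to the indices that satisfy `p`. -/
theorem sum_ite_le_count (p : ℕ → Prop) [DecidablePred p] (c e n : ℕ) :
    ∑ i ∈ Finset.range n, (c + if p i then e else 1) ≤ n * (c + 1) + e * Nat.count p n := by
  induction n with
  | zero => simp
  | succ n ih =>
    rw [Finset.sum_range_succ, Nat.count_succ]
    split_ifs with h
    · rw [mul_add e, mul_one, add_mul n 1, one_mul]
      omega
    · rw [add_zero, add_mul n 1, one_mul]
      omega

theorem wN_push (x y hi lo : NExp) {b : ℕ} (h : b < 83 ∨ 86 < b) :
    (push x y hi lo).wN b = false := by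
  simp only [push, Cmd.wN, Bool.false_or, Bool.or_eq_false_iff,
    beq_eq_false_iff_ne]
  omega

theorem wN_arcs (d q q' : ℕ) (hi lo : NExp) {b : ℕ} (h : b < 80 ∨ 86 < b) :
    (arcs d q q' hi lo).wN b = false := by
  simp [arcs, pushBoth, Cmd.for, Cmd.wN, wN_push _ _ _ _ (b := b) (by omega)]
  omega

theorem wR_arcs (d q q' : ℕ) (hi lo : NExp) {b : ℕ} (h : b ≠ 71) :
    (arcs d q q' hi lo).wR b = false := by
  simp [arcs, pushBoth, push, Cmd.for, Cmd.wR, h]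

open Classical in
/-- The number of pairs of a simplex and one of its faces. -/
noncomputable def facePairs (d : ℕ) (V : ℕ → ℕ → ℕ) (n : ℕ) : ℕ :=
  ∑ i ∈ Finset.range n, Nat.count (fun i' => Sub d V i' i) n

/-- All pairs of simplices of one complex are tested at constant cost, but the loop over the other
complex runs only for pairs of a simplex and a face. This keeps the cost at n² + F n', with F the
number of such pairs, instead of n² n'. A simplex is a face of itself, which only adds harmless
loops to the graph. The relation `R` accumulates, so that the program can be used once for each
complex. -/
theorem arcs_runs (d : ℕ) {q q' : ℕ} (hq : q = 0 ∨ q = 3) (hq' : q' = 0 ∨ q' = 3) (hi lo : NExp) :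
    ∃ K, ∀ (s : State) (V N : ℕ → ℕ → ℕ) (R : ℕ → ℕ → Prop) (n n' : ℕ),
    s.nat q 1 = n → s.nat q' 1 = n' →
    (∀ i < n, ∀ k < d + 1, s.nat (70 + q) (i * (d + 1) + k) = V i k) →
    (∀ (s' : State) (i i' j : ℕ), i < n → i' < n → j < n' → s'.nat 76 = s.nat 76 →
      s'.nat 80 0 = i → s'.nat 81 0 = i' → s'.nat 82 0 = j →
      hi.eval s' = N i j ∧ lo.eval s' = N i' j) →
    Arcs s (both R) →
    Runs (arcs d q q' hi lo) s (K * ((n + 1) * (n + 1) + facePairs d V n * (n' + 1))) fun s' =>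
      Arcs s' (both fun a b => R a b ∨ ∃ i < n, ∃ i' < n, ∃ j < n',
        Sub d V i' i ∧ a = N i' j ∧ b = N i j) ∧
      s'.nat 86 0 = s.nat 86 0 + 2 * n' * facePairs d V n := by
  classical
  refine ⟨(pushBoth hi lo).bound + (subTest d q).cost + 60,
    fun s V N R n n' hn hn' hV hN hA => ?_⟩
  set B := (pushBoth hi lo).bound
  set T := (subTest d q).cost
  have hbody : ∀ b, (arcs d q q' hi lo).wN b = false →
      (Cmd.for 81 (.get q (.const 1)) <|
      .ite (subTest d q) (.for 82 (.get q' (.const 1)) (pushBoth hi lo)) .skip).wN b = false := by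
    intro b hb
    rw [arcs, Cmd.for] at hb
    simp only [Cmd.wN, Bool.or_eq_false_iff] at hb ⊢
    exact hb.2.1
  refine (Runs.for n (fun i s' => Arcs s' (both fun a b => R a b ∨ ∃ i₀ < i, ∃ i' < n, ∃ j < n',
      Sub d V i' i₀ ∧ a = N i' j ∧ b = N i₀ j) ∧
      s'.nat 86 0 = s.nat 86 0 + 2 * n' *
        ∑ i₀ ∈ Finset.range i, Nat.count (fun i' => Sub d V i' i₀) n)
    (fun i => n * (T + 2) + (B + 14) * (n' + 1) * Nat.count (fun i' => Sub d V i' i) n +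
      14 * (n + 1)) ?_ ?_ ?_ ?_ ?_).mono ?_ fun s' _ h => h
  · simp [Cmd.for, Cmd.wN, pushBoth, wN_push]
  · intro s' hs'
    simp only [NExp.eval_get, NExp.eval_const]
    rw [hs'.nat q (wN_arcs _ _ _ _ _ (by omega)), hn]
  · rintro i s' x ⟨h1, h2⟩
    exact ⟨h1.congr (by simp [State.updNat_nat]) (by simp [State.updNat_nat])
      (by simp [State.updNat_nat]) (by simp [State.updNat_nat]) rfl rfl,
      by simpa [State.updNat_nat] using h2⟩
  · exact ⟨hA.iff fun x y hi lo => by simp [both], by simp⟩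
  · rintro i hi₀ s₁ ⟨hA₁, hM₁⟩ hs₁ h80
    set C := Nat.count (fun i' => Sub d V i' i) with hC
    refine (Runs.for n (fun i₁ s' => Arcs s' (both fun a b => (R a b ∨ ∃ i₀ < i, ∃ i' < n,
        ∃ j < n', Sub d V i' i₀ ∧ a = N i' j ∧ b = N i₀ j) ∨ ∃ i' < i₁, ∃ j < n',
        Sub d V i' i ∧ a = N i' j ∧ b = N i j) ∧
        s'.nat 86 0 = s₁.nat 86 0 + 2 * n' * C i₁)
      (fun i' => T + 1 + if Sub d V i' i then (B + 14) * (n' + 1) else 1)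
      ?_ ?_ ?_ ?_ ?_).mono ?_ ?_
    · simp [Cmd.for, Cmd.wN, pushBoth, wN_push]
    · intro s' hs'
      simp only [NExp.eval_get, NExp.eval_const]
      have := wN_arcs d q q' hi lo (b := q) (by omega)
      rw [hs'.nat q (hbody q this), hs₁.nat q this, hn]
    · rintro i s' x ⟨h1, h2⟩
      exact ⟨h1.congr (by simp [State.updNat_nat]) (by simp [State.updNat_nat])
        (by simp [State.updNat_nat]) (by simp [State.updNat_nat]) rfl rfl,
        by simpa [State.updNat_nat] using h2⟩
    · exact ⟨hA₁.iff fun x y hi lo => by simp [both], by simp [hC]⟩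
    · rintro i' hi' s₂ ⟨hA₂, hM₂⟩ hs₂ h81
      have e₂ : ∀ b < 80, s₂.nat b = s.nat b := fun b hb => by
        have := wN_arcs d q q' hi lo (b := b) (.inl hb)
        rw [hs₂.nat b (hbody b this), hs₁.nat b this]
      have h80' : s₂.nat 80 0 = i := by
        rw [hs₂.nat 80 (by simp [Cmd.for, Cmd.wN, pushBoth, wN_push]), h80]
      have htest := holds_subTest (q := q) h80' h81
        (fun k hk => by rw [e₂ _ (by omega)]; exact hV i hi₀ k hk)
        (fun k hk => by rw [e₂ _ (by omega)]; exact hV i' hi' k hk)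
      by_cases hsub : Sub d V i' i
      · refine (Runs.ite (k := (B + 14) * (n' + 1)) (fun _ => ?_)
          fun h => absurd (htest.2 hsub) h).mono ?_ fun _ _ h => h
        · refine (Runs.for_wp n' (fun j s' => Arcs s' (both fun a b => ((R a b ∨ ∃ i₀ < i,
            ∃ i' < n, ∃ j < n', Sub d V i' i₀ ∧ a = N i' j ∧ b = N i₀ j) ∨ ∃ i₁ < i', ∃ j < n',
            Sub d V i₁ i ∧ a = N i₁ j ∧ b = N i j) ∨ ∃ j₀ < j, a = N i' j₀ ∧ b = N i j₀) ∧
            s'.nat 86 0 = s₂.nat 86 0 + 2 * j) (by simp [NExp.cost, B]) ?_ ?_ ?_ ?_ ?_).mono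
              le_rfl ?_
          · simp [Cmd.wN, pushBoth, wN_push]
          · intro s' hs'
            simp only [NExp.eval_get, NExp.eval_const]
            rw [hs'.nat q', e₂ q' (by omega), hn']
            simp [Cmd.for, Cmd.wN, pushBoth, wN_push _ _ _ _ (b := q') (by omega)]
            omega
          · rintro j s' x ⟨h1, h2⟩
            exact ⟨h1.congr (by simp [State.updNat_nat]) (by simp [State.updNat_nat])
              (by simp [State.updNat_nat]) (by simp [State.updNat_nat]) rfl rfl,
              by simpa [State.updNat_nat] using h2⟩
          · exact ⟨hA₂.iff fun x y hi lo => by simp [both], by simp⟩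
          · rintro j hj s₃ ⟨hA₃, hM₃⟩ hs₃ h82
            have e₃ : ∀ b < 82, s₃.nat b = s₂.nat b := fun b hb => hs₃.nat b (by
              simp [Cmd.for, Cmd.wN, pushBoth, wN_push _ _ _ _ (b := b) (by omega)]
              omega)
            have hst : ∀ s', (∀ b < 83, s'.nat b = s₃.nat b) →
                hi.eval s' = N i j ∧ lo.eval s' = N i' j := fun s' hs' =>
              hN s' i i' j hi₀ hi' hj
                (by rw [hs' 76 (by decide), e₃ 76 (by decide), e₂ 76 (by decide)])
                (by rw [hs' 80 (by decide), e₃ 80 (by decide), h80'])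
                (by rw [hs' 81 (by decide), e₃ 81 (by decide), h81])
                (by rw [hs' 82 (by decide), h82])
            refine Cmd.wp_mono (wp_pushBoth hA₃ (fun s' h => (hst s' h).1)
              fun s' h => (hst s' h).2) ?_
            rintro s₄ ⟨-, hM₄, hA₄⟩
            refine ⟨hA₄.iff fun x y hi lo => and_congr_left fun _ => ?_, by omega⟩
            refine or_assoc.trans ?_
            refine or_congr_right ⟨?_, ?_⟩
            · rintro (⟨j₀, hj₀, h⟩ | h)
              · exact ⟨j₀, by omega, h⟩
              · exact ⟨j, by omega, h⟩
            · rintro ⟨j₀, hj₀, h⟩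
              rcases Nat.lt_succ_iff_lt_or_eq.1 hj₀ with h' | rfl
              · exact .inl ⟨j₀, h', h⟩
              · exact .inr h
          · rintro s' - ⟨hA', hM'⟩
            refine ⟨hA'.iff fun x y hi lo => and_congr_left fun _ => ?_, ?_⟩
            · refine or_assoc.trans ?_
              refine or_congr_right ⟨?_, ?_⟩
              · rintro (⟨i₀, hi₀, h⟩ | ⟨j, hj, h⟩)
                · exact ⟨i₀, by omega, h⟩
                · exact ⟨i', by omega, j, hj, hsub, h⟩
              · rintro ⟨i₀, hi₀, h⟩
                rcases Nat.lt_succ_iff_lt_or_eq.1 hi₀ with h' | rfl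
                · exact .inl ⟨i₀, h', h⟩
                · obtain ⟨j, hj, -, h⟩ := h
                  exact .inr ⟨j, hj, h⟩
            · rw [hM', hM₂, hC, Nat.count_succ, if_pos hsub]
              ring
        · rw [if_pos hsub]
          omega
      · refine (Runs.ite (k := 1) (fun h => absurd (htest.1 h) hsub)
          fun _ => Runs.of_wp (c := .skip) ?_).mono ?_ fun _ _ h => h
        · refine ⟨hA₂.iff fun x y hi lo => and_congr_left fun _ => or_congr_right ⟨?_, ?_⟩, ?_⟩
          · rintro ⟨i₀, hi₀, h⟩
            exact ⟨i₀, by omega, h⟩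
          · rintro ⟨i₀, hi₀, h⟩
            rcases Nat.lt_succ_iff_lt_or_eq.1 hi₀ with h' | rfl
            · exact ⟨i₀, h', h⟩
            · obtain ⟨j, hj, h', -⟩ := h
              exact absurd h' hsub
          · rw [hM₂, hC, Nat.count_succ, if_neg hsub, add_zero]
        · rw [if_neg hsub]
    · refine (Nat.add_le_add_right (sum_ite_le_count _ _ _ _) _).trans ?_
      rw [add_assoc T 1 1]
      simp only [NExp.cost, ← hC, Nat.reduceAdd]
      omega
    · rintro s' - ⟨hA', hM'⟩
      refine ⟨hA'.iff fun x y hi lo => and_congr_left fun _ => ?_, ?_⟩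
      · refine or_assoc.trans ?_
        refine or_congr_right ⟨?_, ?_⟩
        · rintro (⟨i₀, hi₀, h⟩ | h)
          · exact ⟨i₀, by omega, h⟩
          · exact ⟨i, by omega, h⟩
        · rintro ⟨i₀, hi₀, h⟩
          rcases Nat.lt_succ_iff_lt_or_eq.1 hi₀ with h' | rfl
          · exact .inl ⟨i₀, h', h⟩
          · exact .inr h
      · rw [hM', hM₁, Finset.sum_range_succ, hC]
        ring
  · have : ∑ j ∈ Finset.range n, (n * (T + 2) + (B + 14) * (n' + 1) *
        Nat.count (fun i' => Sub d V i' j) n + 14 * (n + 1)) =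
        n * (n * (T + 2) + 14 * (n + 1)) + (B + 14) * ((n' + 1) * facePairs d V n) := by
      simp only [Finset.sum_add_distrib, ← Finset.mul_sum, Finset.sum_const, Finset.card_range,
        smul_eq_mul, facePairs]
      ring
    rw [this]
    simp only [NExp.cost]
    generalize facePairs d V n = F
    have h1 : n * (n * (T + 2) + 14 * (n + 1)) + (1 + 1 + 12) * (n + 1) ≤
        (T + 30) * ((n + 1) * (n + 1)) := by
      have h2 : n * (n * (T + 2)) ≤ (T + 2) * ((n + 1) * (n + 1)) := by
        calc n * (n * (T + 2)) = (T + 2) * (n * n) := by ring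
          _ ≤ _ := Nat.mul_le_mul_left _ (Nat.mul_le_mul (Nat.le_succ n) (Nat.le_succ n))
      have h3 : n * (14 * (n + 1)) + 14 * (n + 1) = 14 * ((n + 1) * (n + 1)) := by ring
      rw [mul_add]
      calc n * (n * (T + 2)) + n * (14 * (n + 1)) + (1 + 1 + 12) * (n + 1)
          ≤ (T + 2) * ((n + 1) * (n + 1)) + 14 * ((n + 1) * (n + 1)) := by omega
        _ = (T + 16) * ((n + 1) * (n + 1)) := by ring
        _ ≤ _ := Nat.mul_le_mul_right _ (by omega)
    calc _ = (n * (n * (T + 2) + 14 * (n + 1)) + (1 + 1 + 12) * (n + 1)) +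
          (B + 14) * (F * (n' + 1)) := by ring
      _ ≤ (B + T + 60) * ((n + 1) * (n + 1)) + (B + T + 60) * (F * (n' + 1)) :=
        Nat.add_le_add (h1.trans (Nat.mul_le_mul_right _ (by omega)))
          (Nat.mul_le_mul_right _ (by omega))
      _ = _ := by ring

end RealRAM.Build

/-! ### Assembling the graph of pairs of simplices -/

namespace RealRAM.Build

theorem wN_pad (d q : ℕ) {b : ℕ} (h₁ : b ≠ 80) (h₂ : b ≠ 70 + q) : (pad d q).wN b = false := by
  simp [pad, padStep, Cmd.for, Cmd.wN, h₁, Cmd.wN_fillNat h₂]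

theorem wR_pad (d q b : ℕ) : (pad d q).wR b = false := by
  simp [pad, padStep, Cmd.for, Cmd.wR, Cmd.wR_fillNat]

theorem wN_find (d q e o : ℕ) {b : ℕ} (h₁ : b ≠ 80) (h₂ : b ≠ o) :
    (find d q e o).wN b = false := by
  simp [find, findStep, Cmd.for, Cmd.wN, h₁, h₂]

theorem wR_find (d q e o b : ℕ) : (find d q e o).wR b = false := by
  simp [find, findStep, Cmd.for, Cmd.wR]

/-- The program that builds the graph. -/
noncomputable def build (d : ℕ) : Cmd :=
  .seq (pad d 0) <| .seq (pad d 3) <| .seq (find d 0 2 71) <| .seq (find d 0 3 72) <|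
  .seq (find d 3 2 74) <| .seq (find d 3 3 75) <| .seq (nodes d) <| .seq (.letNat 86 (.const 0)) <|
  .seq (arcs d 0 3 (.add (.get 76 (.var 80)) (.var 82)) (.add (.get 76 (.var 81)) (.var 82))) <|
  arcs d 3 0 (.add (.get 76 (.var 82)) (.var 80)) (.add (.get 76 (.var 82)) (.var 81))

/-- The arcs: one of two simplices is replaced by a face. -/
def Step (d : ℕ) (V₁ V₂ : ℕ → ℕ → ℕ) (n₁ n₂ lo hi : ℕ) : Prop :=
  (∃ i < n₁, ∃ i' < n₁, ∃ j < n₂, Sub d V₁ i' i ∧ lo = i' * n₂ + j ∧ hi = i * n₂ + j) ∨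
    ∃ j < n₂, ∃ j' < n₂, ∃ i < n₁, Sub d V₂ j' j ∧ lo = i * n₂ + j' ∧ hi = i * n₂ + j

/-- The memory holds the graph of pairs of simplices. -/
structure Built (d : ℕ) (s : State) (V₁ V₂ : ℕ → ℕ → ℕ) (r₁ r₂ : ℕ → ℝ)
    (n₁ n₂ a₁ b₁ a₂ b₂ : ℕ) : Prop where
  nodes : NodesAt d s V₁ V₂ r₁ r₂ n₂ (n₁ * n₂)
  row : ∀ i < n₁, s.nat 76 i = i * n₂
  src₁ : s.nat 71 0 = a₁
  dst₁ : s.nat 72 0 = b₁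
  src₂ : s.nat 74 0 = a₂
  dst₂ : s.nat 75 0 = b₂
  arcs : Arcs s (both (Step d V₁ V₂ n₁ n₂))
  count : s.nat 86 0 = 2 * n₂ * facePairs d V₁ n₁ + 2 * n₁ * facePairs d V₂ n₂

/-- Entry `e` of the header `H` of a complex is the only vertex of simplex `i₀` and of no other
simplex. -/
def IsVertexCell (d : ℕ) (H card verts : ℕ → ℕ) (e i₀ : ℕ) : Prop :=
  i₀ < H 1 ∧ ∀ i < H 1, (card i = 1 ∧ verts (i * (d + 1)) = H e) ↔ i = i₀

theorem NodesAt.congr {d : ℕ} {s s' : State} {V₁ V₂ : ℕ → ℕ → ℕ} {r₁ r₂ : ℕ → ℝ} {n N : ℕ}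
    (h : NodesAt d s V₁ V₂ r₁ r₂ n N) (h70 : s'.real 70 = s.real 70)
    (h15 : s'.real 15 = s.real 15) (h16 : s'.real 16 = s.real 16) (h78 : s'.nat 78 = s.nat 78)
    (h79 : s'.nat 79 = s.nat 79) : NodesAt d s' V₁ V₂ r₁ r₂ n N := by
  intro x hx
  obtain ⟨p, q, hpq⟩ := h x hx
  exact ⟨p, q, hpq.congr (by rw [h70]) (fun _ => by rw [h15]) (fun _ => by rw [h16])
    (by rw [h78]) (by rw [h79])⟩

theorem build_runs (d E : ℕ) : ∃ K, ∀ (s : State) (V₁ V₂ : ℕ → ℕ → ℕ) (N a₁ b₁ a₂ b₂ : ℕ),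
    s.nat 0 1 ≤ N → s.nat 3 1 ≤ N →
    V₁ = padded d (s.nat 1) (s.nat 2) → V₂ = padded d (s.nat 4) (s.nat 5) →
    facePairs d V₁ (s.nat 0 1) ≤ E * N → facePairs d V₂ (s.nat 3 1) ≤ E * N →
    IsVertexCell d (s.nat 0) (s.nat 1) (s.nat 2) 2 a₁ →
    IsVertexCell d (s.nat 0) (s.nat 1) (s.nat 2) 3 b₁ →
    IsVertexCell d (s.nat 3) (s.nat 4) (s.nat 5) 2 a₂ →
    IsVertexCell d (s.nat 3) (s.nat 4) (s.nat 5) 3 b₂ →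
    Runs (build d) s (K * ((N + 1) * (N + 1))) fun s' =>
      Built d s' V₁ V₂ (s.real 0) (s.real 1) (s.nat 0 1) (s.nat 3 1) a₁ b₁ a₂ b₂ := by
  obtain ⟨K₁, hK₁⟩ := pad_runs d (q := 0) (.inl rfl)
  obtain ⟨K₂, hK₂⟩ := pad_runs d (q := 3) (.inr rfl)
  obtain ⟨K₃, hK₃⟩ := find_runs d (q := 0) (e := 2) (o := 71) (.inl rfl) (by decide) (by decide)
  obtain ⟨K₄, hK₄⟩ := find_runs d (q := 0) (e := 3) (o := 72) (.inl rfl) (by decide) (by decide)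
  obtain ⟨K₅, hK₅⟩ := find_runs d (q := 3) (e := 2) (o := 74) (.inr rfl) (by decide) (by decide)
  obtain ⟨K₆, hK₆⟩ := find_runs d (q := 3) (e := 3) (o := 75) (.inr rfl) (by decide) (by decide)
  obtain ⟨K₇, hK₇⟩ := nodes_runs d
  obtain ⟨K₈, hK₈⟩ := arcs_runs d (q := 0) (q' := 3) (.inl rfl) (.inr rfl)
    (.add (.get 76 (.var 80)) (.var 82)) (.add (.get 76 (.var 81)) (.var 82))
  obtain ⟨K₉, hK₉⟩ := arcs_runs d (q := 3) (q' := 0) (.inr rfl) (.inl rfl)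
    (.add (.get 76 (.var 82)) (.var 80)) (.add (.get 76 (.var 82)) (.var 81))
  refine ⟨K₁ + K₂ + K₃ + K₄ + K₅ + K₆ + K₇ + 3 + K₈ * (E + 1) + K₉ * (E + 1),
    fun s V₁ V₂ N a₁ b₁ a₂ b₂ hN₁ hN₂ hV₁ hV₂ hF₁ hF₂ ha₁ hb₁ ha₂ hb₂ => ?_⟩
  generalize hn₁ : s.nat 0 1 = n₁ at *
  generalize hn₂ : s.nat 3 1 = n₂ at *
  set X := (N + 1) * (N + 1) with hX
  have hX1 : 1 ≤ X := Nat.mul_pos (Nat.succ_pos _) (Nat.succ_pos _)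
  have hlin : ∀ (K : ℕ) {n : ℕ}, n ≤ N → K * (n + 1) ≤ K * X := fun K n hn =>
    Nat.mul_le_mul_left _ ((Nat.succ_le_succ hn).trans (Nat.le_mul_of_pos_left _ (Nat.succ_pos _)))
  -- The number of face pairs is linear in `N`, so that generating the arcs stays quadratic.
  have harc : ∀ (K : ℕ) {n n' F : ℕ}, n ≤ N → n' ≤ N → F ≤ E * N →
      K * ((n + 1) * (n + 1) + F * (n' + 1)) ≤ K * (E + 1) * X := by
    intro K n n' F h1 h2 h3
    rw [mul_assoc]
    refine Nat.mul_le_mul_left _ ?_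
    have e1 : (n + 1) * (n + 1) ≤ X := Nat.mul_le_mul (Nat.succ_le_succ h1) (Nat.succ_le_succ h1)
    have e2 : F * (n' + 1) ≤ E * X := by
      calc F * (n' + 1) ≤ E * N * (N + 1) := Nat.mul_le_mul h3 (Nat.succ_le_succ h2)
        _ = E * (N * (N + 1)) := by ring
        _ ≤ _ := Nat.mul_le_mul_left _ (Nat.mul_le_mul_right _ (Nat.le_succ N))
    rw [add_mul E 1 X, one_mul]
    omega
  have hsum : ∀ k₁ k₂ k₃ k₄ k₅ k₆ k₇ k₈ k₉ : ℕ, k₁ ≤ K₁ * X → k₂ ≤ K₂ * X → k₃ ≤ K₃ * X →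
      k₄ ≤ K₄ * X → k₅ ≤ K₅ * X → k₆ ≤ K₆ * X → k₇ ≤ K₇ * X → k₈ ≤ K₈ * (E + 1) * X →
      k₉ ≤ K₉ * (E + 1) * X → k₁ + (k₂ + (k₃ + (k₄ + (k₅ + (k₆ + (k₇ + (3 + (k₈ + k₉)))))))) ≤
        (K₁ + K₂ + K₃ + K₄ + K₅ + K₆ + K₇ + 3 + K₈ * (E + 1) + K₉ * (E + 1)) * X := by
    intros
    simp only [add_mul _ _ X]
    omega
  refine Runs.mono (Q := fun s' => Built d s' V₁ V₂ (s.real 0) (s.real 1) n₁ n₂ a₁ b₁ a₂ b₂) ?_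
    (hsum _ _ _ _ _ _ _ _ _ (hlin K₁ hN₁) (hlin K₂ hN₂) (hlin K₃ hN₁) (hlin K₄ hN₁) (hlin K₅ hN₂)
      (hlin K₆ hN₂) (Nat.mul_le_mul_left K₇ (Nat.mul_le_mul (Nat.succ_le_succ hN₁)
        (Nat.succ_le_succ hN₂))) (harc K₈ hN₁ hN₂ hF₁) (harc K₉ hN₂ hN₁ hF₂)) fun _ _ h => h
  -- padding
  refine (by simpa only [hn₁] using hK₁ s : Runs (pad d 0) s (K₁ * (n₁ + 1)) _).seq
    fun s₁ hs₁ h₁ => ?_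
  have f₁ : ∀ b < 70, s₁.nat b = s.nat b := fun b hb =>
    hs₁.nat b (wN_pad d 0 (by omega) (by omega))
  have r₁ : s₁.real = s.real := funext fun b => hs₁.real b (wR_pad d 0 b)
  refine (by simpa only [f₁ 3 (by decide), hn₂] using hK₂ s₁ :
    Runs (pad d 3) s₁ (K₂ * (n₂ + 1)) _).seq fun s₂ hs₂ h₂ => ?_
  have f₂ : ∀ b < 70, s₂.nat b = s.nat b := fun b hb => by
    rw [hs₂.nat b (wN_pad d 3 (by omega) (by omega)), f₁ b hb]
  have r₂ : s₂.real = s.real := (funext fun b => hs₂.real b (wR_pad d 3 b)).trans r₁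
  have g₂ : ∀ i < n₁, ∀ k < d + 1, s₂.nat 70 (i * (d + 1) + k) = V₁ i k := by
    intro i hi k hk
    rw [hs₂.nat 70 (wN_pad d 3 (by decide) (by decide)), hV₁]
    exact h₁ i hi k hk
  have g₂' : ∀ i < n₂, ∀ k < d + 1, s₂.nat 73 (i * (d + 1) + k) = V₂ i k := by
    intro i hi k hk
    have := h₂ i hi k hk
    simp only [Nat.reduceAdd, f₁ 4 (by decide), f₁ 5 (by decide)] at this
    rw [hV₂]
    exact this
  -- start and target
  have hfind : ∀ (q e o K : ℕ) (s' : State) (i₀ n : ℕ), q < 60 → (∀ b < 70, s'.nat b = s.nat b) →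
      (∀ (s : State) (i₀ : ℕ), i₀ < s.nat q 1 →
      (∀ i < s.nat q 1, (s.nat (q + 1) i = 1 ∧ s.nat (q + 2) (i * (d + 1)) = s.nat q e) ↔
        i = i₀) →
      Runs (find d q e o) s (K * (s.nat q 1 + 1)) fun s' => s'.nat o 0 = i₀) →
      IsVertexCell d (s.nat q) (s.nat (q + 1)) (s.nat (q + 2)) e i₀ → s.nat q 1 = n →
      Runs (find d q e o) s' (K * (n + 1)) fun s' => s'.nat o 0 = i₀ := by
    intro q e o K s' i₀ n hq hs' hK hv hn
    have := hK s' i₀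
    rw [hs' q (by omega), hs' (q + 1) (by omega), hs' (q + 2) (by omega), hn] at this
    exact this (hn ▸ hv.1) (hn ▸ hv.2)
  have fr : ∀ {q e o : ℕ} {s' s'' : State}, (find d q e o).Same s' s'' →
      s''.real = s'.real ∧ ∀ b, b ≠ 80 → b ≠ o → s''.nat b = s'.nat b := fun h =>
    ⟨funext fun b => h.real b (wR_find ..), fun b h1 h2 => h.nat b (wN_find _ _ _ _ h1 h2)⟩
  refine (hfind 0 2 71 K₃ s₂ a₁ n₁ (by decide) f₂ hK₃ ha₁ hn₁).seq fun s₃ hs₃ h₃ => ?_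
  obtain ⟨r₃, f₃⟩ := fr hs₃
  refine (hfind 0 3 72 K₄ s₃ b₁ n₁ (by decide) (fun b hb => by
    rw [f₃ b (by omega) (by omega), f₂ b hb]) hK₄ hb₁ hn₁).seq fun s₄ hs₄ h₄ => ?_
  obtain ⟨r₄, f₄⟩ := fr hs₄
  refine (hfind 3 2 74 K₅ s₄ a₂ n₂ (by decide) (fun b hb => by
    rw [f₄ b (by omega) (by omega), f₃ b (by omega) (by omega), f₂ b hb]) hK₅ ha₂ hn₂).seq
    fun s₅ hs₅ h₅ => ?_
  obtain ⟨r₅, f₅⟩ := fr hs₅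
  refine (hfind 3 3 75 K₆ s₅ b₂ n₂ (by decide) (fun b hb => by
    rw [f₅ b (by omega) (by omega), f₄ b (by omega) (by omega), f₃ b (by omega) (by omega),
      f₂ b hb]) hK₆ hb₂ hn₂).seq fun s₆ hs₆ h₆ => ?_
  obtain ⟨r₆, f₆⟩ := fr hs₆
  have F₆ : ∀ b, b ≠ 80 → b ≠ 71 → b ≠ 72 → b ≠ 74 → b ≠ 75 → s₆.nat b = s₂.nat b := by
    intro b h80 h71 h72 h74 h75
    rw [f₆ b h80 h75, f₅ b h80 h74, f₄ b h80 h72, f₃ b h80 h71]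
  have R₆ : s₆.real = s.real := by rw [r₆, r₅, r₄, r₃, r₂]
  have k71 : s₆.nat 71 0 = a₁ := by
    rw [f₆ _ (by decide) (by decide), f₅ _ (by decide) (by decide), f₄ _ (by decide) (by decide),
      h₃]
  have k72 : s₆.nat 72 0 = b₁ := by
    rw [f₆ _ (by decide) (by decide), f₅ _ (by decide) (by decide), h₄]
  have k74 : s₆.nat 74 0 = a₂ := by rw [f₆ _ (by decide) (by decide), h₅]
  have g₆ : ∀ i < n₁, ∀ k < d + 1, s₆.nat 70 (i * (d + 1) + k) = V₁ i k := by
    rw [F₆ 70 (by decide) (by decide) (by decide) (by decide) (by decide)]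
    exact g₂
  have g₆' : ∀ i < n₂, ∀ k < d + 1, s₆.nat 73 (i * (d + 1) + k) = V₂ i k := by
    rw [F₆ 73 (by decide) (by decide) (by decide) (by decide) (by decide)]
    exact g₂'
  have m₁ : s₆.nat 0 1 = n₁ := by
    rw [F₆ 0 (by decide) (by decide) (by decide) (by decide) (by decide), f₂ 0 (by decide), hn₁]
  have m₂ : s₆.nat 3 1 = n₂ := by
    rw [F₆ 3 (by decide) (by decide) (by decide) (by decide) (by decide), f₂ 3 (by decide), hn₂]
  -- nodes
  have hnodes := hK₇ s₆ V₁ V₂ (by rwa [m₁]) (by rwa [m₂])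
  rw [m₁, m₂, R₆] at hnodes
  refine hnodes.seq fun s₇ hs₇ h₇ => ?_
  have f₇ : ∀ b, b < 76 → s₇.nat b = s₆.nat b := fun b hb => hs₇.nat b (wN_nodes d (.inl hb))
  have hinit : Runs (.letNat 86 (.const 0)) s₇ 3 fun s' => s' = s₇.updNat 86 0 0 :=
    Runs.of_wp (by simp [Cmd.wp])
  refine hinit.seq fun s₈ _ hs₈ => ?_
  have f₈ : ∀ b ≠ 86, s₈.nat b = s₇.nat b := fun b hb => by
    rw [hs₈, State.updNat_nat, if_neg hb]
  have z₈ : s₈.nat 86 0 = 0 := by simp [hs₈, State.updNat_nat]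
  have A₈ : Arcs s₈ (both fun _ _ => False) :=
    ⟨fun a ha => by omega, fun _ _ _ _ h => h.1.elim⟩
  -- arcs
  refine (hK₈ s₈ V₁ (fun i j => i * n₂ + j) _ n₁ n₂ ?_ ?_ ?_ ?_ A₈).seq fun s₉ hs₉ h₉ => ?_
  · rw [f₈ 0 (by decide), f₇ 0 (by decide), m₁]
  · rw [f₈ 3 (by decide), f₇ 3 (by decide), m₂]
  · rw [f₈ (70 + 0) (by decide), f₇ (70 + 0) (by decide)]
    exact g₆
  · intro s' i i' j hi hi' hj e76 e80 e81 e82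
    simp only [NExp.eval_add, NExp.eval_get, NExp.eval_const, e76, e80, e81, e82,
      f₈ 76 (by decide), h₇.2 i hi, h₇.2 i' hi', and_self]
  have f₉ : ∀ b < 80, s₉.nat b = s₈.nat b := fun b hb => hs₉.nat b (wN_arcs _ _ _ _ _ (.inl hb))
  -- Here the two outer loops run over the second complex and the inner one over the first, so the
  -- row of a node is in register 82 and the arguments of the numbering are exchanged.
  refine (hK₉ s₉ V₂ (fun j i => i * n₂ + j) _ n₂ n₁ ?_ ?_ ?_ ?_ h₉.1).mono le_rfl
    fun s' hs' h => ?_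
  · rw [f₉ 3 (by decide), f₈ 3 (by decide), f₇ 3 (by decide), m₂]
  · rw [f₉ 0 (by decide), f₈ 0 (by decide), f₇ 0 (by decide), m₁]
  · rw [f₉ (70 + 3) (by decide), f₈ (70 + 3) (by decide), f₇ (70 + 3) (by decide)]
    exact g₆'
  · intro s' j j' i hj hj' hi e76 e80 e81 e82
    simp only [NExp.eval_add, NExp.eval_get, NExp.eval_const, e76, e80, e81, e82,
      f₉ 76 (by decide), f₈ 76 (by decide), h₇.2 i hi, and_self]
  have f' : ∀ b < 80, s'.nat b = s₇.nat b := fun b hb => by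
    rw [hs'.nat b (wN_arcs _ _ _ _ _ (.inl hb)), f₉ b hb, f₈ b (by omega)]
  have r' : ∀ b, b ≠ 71 → s'.real b = s₇.real b := fun b hb => by
    rw [hs'.real b (wR_arcs _ _ _ _ _ hb), hs₉.real b (wR_arcs _ _ _ _ _ hb), hs₈]
    rfl
  refine ⟨h₇.1.congr (r' _ (by decide)) (r' _ (by decide)) (r' _ (by decide)) (f' _ (by decide))
    (f' _ (by decide)), by rw [f' 76 (by decide)]; exact h₇.2, ?_, ?_, ?_, ?_, ?_, ?_⟩
  · rw [f' 71 (by decide), f₇ 71 (by decide), k71]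
  · rw [f' 72 (by decide), f₇ 72 (by decide), k72]
  · rw [f' 74 (by decide), f₇ 74 (by decide), k74]
  · rw [f' 75 (by decide), f₇ 75 (by decide), h₆]
  · exact h.1.iff fun x y hi lo => and_congr_left fun _ => by simp [Step]
  · rw [h.2, h₉.2, z₈, zero_add]

end RealRAM.Build

/-! ### Recovering an optimal route -/

namespace RealRAM

namespace Search

/-- Induction on the depth: the parent arc leads to a vertex of depth one less, and depth 0 excludes
a parent, leaving only the start. -/
theorem Result.exists_route {G : Graph} {μ p δ : ℕ → ℕ} (R : Result G μ p δ) (n : ℕ) :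
    ∀ x ∈ G.verts, μ x = G.s + 1 → δ x = n → ∃ y e : ℕ → ℕ, y 0 = G.s ∧ y n = x ∧ ∀ i < n,
      G.Light (e i) ∧ G.S (e i) = y i ∧ G.D (e i) = y (i + 1) ∧ p (y (i + 1)) = e i + 1 := by
  induction n with
  | zero =>
    intro x hx h1 h2
    rcases R.parent x hx h1 with ⟨h, -⟩ | ⟨-, -, -, -, h⟩
    · exact ⟨fun _ => x, fun _ => 0, h, rfl, fun i hi => by omega⟩
    · omega
  | succ n ih =>
    intro x hx h1 h2
    rcases R.parent x hx h1 with ⟨-, h⟩ | ⟨h3, h4, h5, h6, h7⟩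
    · omega
    obtain ⟨y, e, hy0, hyn, hye⟩ := ih _ (G.src_mem h4.1) h6 (by omega)
    refine ⟨fun i => if i ≤ n then y i else x, fun i => if i < n then e i else p x - 1, ?_, ?_, ?_⟩
    · simpa using hy0
    · simp
    · intro i hi
      rcases Nat.lt_succ_iff_lt_or_eq.1 hi with hi | rfl
      · simpa [hi, hi.le] using hye i hi
      · simp only [lt_self_iff_false, if_false, le_refl, if_true, Nat.not_succ_le_self]
        exact ⟨h4, hyn.symm, h5, by omega⟩

end Search

namespace Build

open Search Bottleneck

/-! ### The program that finds the optimal route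

`87` current node, `88` number of arcs that are still to be traced, `89` current arc. The output is
written to the integer arrays `6`, `7`, `8` and the real arrays `2`, `3`. -/

/-- The program that loads the graph into the work arrays. -/
def copy : Cmd :=
  .seq (.for 80 (.var 86) <| .seq (.setNat 20 (.var 80) (.get 83 (.var 80))) <|
    .seq (.setNat 21 (.var 80) (.get 84 (.var 80))) (.setReal 20 (.var 80) (.get 71 (.var 80)))) <|
  .seq (.letNat 22 (.var 86)) <| .seq (.letNat 23 (.add (.get 76 (.var 71)) (.var 74))) <|
  .letNat 24 (.add (.get 76 (.var 72)) (.var 75))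

/-- The first node. -/
def srcNode (s : State) : ℕ := s.nat 76 (s.nat 71 0) + s.nat 74 0

/-- The last node. -/
def dstNode (s : State) : ℕ := s.nat 76 (s.nat 72 0) + s.nat 75 0

/-- The work arrays of `s'` hold the graph of `s`. -/
structure Copied (s s' : State) : Prop where
  card : s'.nat 22 0 = s.nat 86 0
  src : s'.nat 23 0 = srcNode s
  dst : s'.nat 24 0 = dstNode s
  tail : ∀ a < s.nat 86 0, s'.nat 20 a = s.nat 83 a
  head : ∀ a < s.nat 86 0, s'.nat 21 a = s.nat 84 a
  weight : ∀ a < s.nat 86 0, s'.real 20 a = s.real 71 a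

theorem copy_runs (s : State) :
    Runs copy s (60 * (s.nat 86 0 + 1)) (Copied s) := by
  refine ((Runs.for_wp (K := 40) (s.nat 86 0) (fun j s' => ∀ a < j, s'.nat 20 a = s.nat 83 a ∧
    s'.nat 21 a = s.nat 84 a ∧ s'.real 20 a = s.real 71 a) (by decide) rfl ?_ ?_ ?_ ?_).seq
    (k₂ := 20) fun s₁ hs₁ h₁ => (Runs.of_wp ?_).mono (by decide) fun _ _ h => h).mono
    (by omega) fun _ _ h => h
  · intro s' hs'
    simp only [NExp.eval_get, NExp.eval_const]
    rw [hs'.nat 86 rfl]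
  · intro j s' x h
    simpa [State.updNat_nat] using h
  · intro a ha; omega
  · intro j hj s' hI hs' hv a ha
    have e83 := hs'.nat 83 rfl
    have e84 := hs'.nat 84 rfl
    have e71 := hs'.real 71 rfl
    simp only [RExp.eval_get, NExp.eval_get, NExp.eval_const, State.updNat_nat, State.updReal_nat,
      State.updNat_real, State.updReal_real, Nat.reduceEqDiff, reduceIte, hv, e83, e84, e71]
    rcases Nat.lt_succ_iff_lt_or_eq.1 ha with ha | rfl
    · simpa only [Function.update_of_ne ha.ne] using hI a ha
    · simp only [Function.update_self, and_self]
  · have e86 := hs₁.nat 86 rfl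
    have e76 := hs₁.nat 76 rfl
    have e71 := hs₁.nat 71 rfl
    have e72 := hs₁.nat 72 rfl
    have e74 := hs₁.nat 74 rfl
    have e75 := hs₁.nat 75 rfl
    simp only [Cmd.wp, NExp.eval_get, NExp.eval_const, NExp.eval_add, State.updNat_nat,
      Nat.reduceEqDiff, reduceIte]
    refine ⟨?_, ?_, ?_, fun a ha => ?_, fun a ha => ?_, fun a ha => ?_⟩
    · simp [State.updNat_nat, e86]
    · simp [State.updNat_nat, e76, e71, e74, srcNode]
    · simp [State.updNat_nat, e76, e72, e75, dstNode]
    · simpa [State.updNat_nat] using (h₁ a ha).1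
    · simpa [State.updNat_nat] using (h₁ a ha).2.1
    · simpa using (h₁ a ha).2.2

/-- The program that writes the points of the node `87` to position `88` of the output. -/
def put (d : ℕ) : Cmd :=
  .seq (.fill 2 (.nmul d (.var 88)) d fun c => .get 15 (.add (.nmul d (.var 87)) (.const c)))
    (.fill 3 (.nmul d (.var 88)) d fun c => .get 16 (.add (.nmul d (.var 87)) (.const c)))

theorem wp_put {d : ℕ} {s : State} {x k : ℕ} (hx : s.nat 87 0 = x) (hk : s.nat 88 0 = k) :
    (put d).wp (fun s' => s'.nat = s.nat ∧ (∀ b, b ≠ 2 → b ≠ 3 → s'.real b = s.real b) ∧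
      (∀ c : Fin d, s'.real 2 (k * d + c) = s.real 15 (x * d + c) ∧
        s'.real 3 (k * d + c) = s.real 16 (x * d + c)) ∧
      ∀ i, k < i → ∀ c : Fin d, s'.real 2 (i * d + c) = s.real 2 (i * d + c) ∧
        s'.real 3 (i * d + c) = s.real 3 (i * d + c)) s := by
  rw [put, Cmd.wp]
  refine Cmd.wp_mono (Cmd.wp_fill (v := fun c => s.real 15 (x * d + c)) ?_) ?_
  · intro c _ s' h1 h2
    simp only [RExp.eval_get, NExp.eval_add, NExp.eval_nmul, NExp.eval_get, NExp.eval_const, h1, hx,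
      h2 15 (by decide)]
  rintro s₁ ⟨n₁, r₁, c₁⟩
  refine Cmd.wp_mono (Cmd.wp_fill (v := fun c => s.real 16 (x * d + c)) ?_) ?_
  · intro c _ s' h1 h2
    simp only [RExp.eval_get, NExp.eval_add, NExp.eval_nmul, NExp.eval_get, NExp.eval_const, h1, n₁,
      hx, h2 16 (by decide), r₁ 16 (by decide)]
  rintro s₂ ⟨n₂, r₂, c₂⟩
  simp only [NExp.eval_nmul, NExp.eval_get, NExp.eval_const, n₁, hk] at c₁ c₂
  have hlt : ∀ i, k < i → ∀ c : Fin d, ¬ (k * d ≤ i * d + c ∧ i * d + c < k * d + d) := by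
    intro i hi c h
    have : (k + 1) * d ≤ i * d := Nat.mul_le_mul_right _ hi
    rw [add_mul, one_mul] at this
    omega
  refine ⟨n₂.trans n₁, fun b h2 h3 => by rw [r₂ b h3, r₁ b h2], fun c => ⟨?_, ?_⟩,
    fun i hi c => ⟨?_, ?_⟩⟩
  · rw [r₂ 2 (by decide), c₁, if_pos (by omega), Nat.add_sub_cancel_left]
  · rw [c₂, if_pos (by omega), Nat.add_sub_cancel_left]
  · rw [r₂ 2 (by decide), c₁, if_neg (hlt i hi c)]
  · rw [c₂, if_neg (hlt i hi c), r₁ 3 (by decide)]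

/-- The program that processes one arc of the route. -/
def hop (d : ℕ) : Cmd :=
  .seq (put d) <| .seq (.letNat 89 (.sub (.get 40 (.var 87)) (.const 1))) <|
  .seq (.letNat 88 (.sub (.var 88) (.const 1))) <|
  .seq (.setNat 7 (.var 88) (.get 78 (.get 85 (.var 89)))) <|
  .seq (.setNat 8 (.var 88) (.get 79 (.get 85 (.var 89)))) (.letNat 87 (.get 83 (.var 89)))

/-- The program that traces the route back from the last node. -/
def trace (d : ℕ) : Cmd :=
  .seq (.seq (.ite (.neq (.var 23) (.var 24)) (.letNat 88 (.const 0))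
    (.letNat 88 (.get 41 (.var 24)))) (.seq (.letNat 6 (.var 88)) (.letNat 87 (.var 24)))) <|
  .seq (.while (.nlt (.const 0) (.var 88)) (hop d)) (put d)

/-- The output `s'` describes a route with nodes `y i` and arcs `e i` in the graph of `s`. -/
structure Route (d : ℕ) (s s' : State) (m : ℕ) (y e : ℕ → ℕ) : Prop where
  length : s'.nat 6 0 = m
  point : ∀ i ≤ m, ∀ c : Fin d, s'.real 2 (i * d + c) = s.real 15 (y i * d + c) ∧
    s'.real 3 (i * d + c) = s.real 16 (y i * d + c)
  cell : ∀ i < m, s'.nat 7 i = s.nat 78 (s.nat 85 (e i)) ∧ s'.nat 8 i = s.nat 79 (s.nat 85 (e i))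

theorem wN_put (d b : ℕ) : (put d).wN b = false := by simp [put, Cmd.wN, Cmd.wN_fill]

theorem wR_put (d : ℕ) {b : ℕ} (h₂ : b ≠ 2) (h₃ : b ≠ 3) : (put d).wR b = false := by
  simp [put, Cmd.wR, Cmd.wR_fill h₂, Cmd.wR_fill h₃]

/-- Parents lead back to the start, so positions are filled from the last one downwards, and the
point at position 0 is written after the loop. Coinciding end nodes are treated separately, so that
the length is 0 without appeal to the stored depths. -/
theorem trace_runs (d : ℕ) : ∃ K, ∀ (s : State) (m : ℕ) (y e : ℕ → ℕ),
    (if s.nat 23 0 = s.nat 24 0 then 0 else s.nat 41 (s.nat 24 0)) = m → y m = s.nat 24 0 →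
    (∀ i < m, s.nat 83 (e i) = y i ∧ s.nat 40 (y (i + 1)) = e i + 1) →
    Runs (trace d) s (K * (m + 1)) fun s' => Route d s s' m y e := by
  refine ⟨(hop d).bound + (put d).bound + 40, fun s m y e hm hym hye => ?_⟩
  refine Runs.prefix (k₁ := 30) (k₂ := ((hop d).bound + 5 + 1) * (m + 1) + (put d).bound)
    (fun s' => s'.nat 88 0 = m ∧ s'.nat 6 0 = m ∧ s'.nat 87 0 = y m) (by decide) ?_ ?_ ?_
  · have e1 : (put d).bound ≤ (put d).bound * (m + 1) := Nat.le_mul_of_pos_right _ (by omega)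
    have e2 : ((hop d).bound + (put d).bound + 40) * (m + 1) =
      ((hop d).bound + 5 + 1) * (m + 1) + (put d).bound * (m + 1) + 34 * (m + 1) := by ring
    rw [e2]
    omega
  · simp only [Cmd.wp, Test.holds_neq, NExp.eval_get, NExp.eval_const, State.updNat_nat,
      Nat.reduceEqDiff, reduceIte, Function.update_self, hym]
    refine ⟨fun h => ?_, fun h => ?_⟩
    · rw [if_pos h] at hm
      simp [hm]
    · rw [if_neg h] at hm
      simp [hm]
  rintro s₁ hs₁ ⟨h88, h6, h87⟩
  have hwh : ∀ b, 8 < b → b < 87 → (hop d).wN b = false := by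
    intro b h1 h2
    simp [hop, Cmd.wN, wN_put]
    omega
  have hwr : ∀ b, b ≠ 2 → b ≠ 3 → (hop d).wR b = false := by
    intro b h1 h2
    simp [hop, Cmd.wR, wR_put d h1 h2]
  have f₁ : ∀ b, 8 < b → b < 87 → s₁.nat b = s.nat b := by
    intro b h1 h2
    refine hs₁.nat b ?_
    simp [Cmd.wN]
    omega
  have g₁ : s₁.real = s.real := funext fun b => hs₁.real b (by simp [Cmd.wR])
  have hloop := Runs.while_measure (b := .nlt (.const 0) (.var 88)) (c := hop d) (s₀ := s₁)
    (fun s' => s'.nat 6 0 = m ∧ s'.nat 88 0 ≤ m ∧ s'.nat 87 0 = y (s'.nat 88 0) ∧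
      (∀ i ≤ m, s'.nat 88 0 < i → ∀ c : Fin d, s'.real 2 (i * d + c) = s.real 15 (y i * d + c) ∧
        s'.real 3 (i * d + c) = s.real 16 (y i * d + c)) ∧
      ∀ i < m, s'.nat 88 0 ≤ i → s'.nat 7 i = s.nat 78 (s.nat 85 (e i)) ∧
        s'.nat 8 i = s.nat 79 (s.nat 85 (e i)))
    (fun s' => s'.nat 88 0) (hop d).bound
    ⟨h6, h88.le, by rw [h87, h88], fun i hi h => by omega, fun i hi h => by omega⟩
    (by
      rintro s₂ ⟨i1, i2, i3, i4, i5⟩ hs₂ hb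
      simp only [Test.holds_nlt, NExp.eval_get, NExp.eval_const] at hb
      have f₂ : ∀ b, 8 < b → b < 87 → s₂.nat b = s.nat b := fun b h1 h2 => by
        rw [hs₂.nat b (hwh b h1 h2), f₁ b h1 h2]
      have g₂ : ∀ b, b ≠ 2 → b ≠ 3 → s₂.real b = s.real b := fun b h1 h2 => by
        rw [hs₂.real b (hwr b h1 h2), g₁]
      obtain ⟨k, hk⟩ : ∃ k, s₂.nat 88 0 = k + 1 := ⟨s₂.nat 88 0 - 1, by omega⟩
      rw [hk] at i2 i3 i4 i5
      obtain ⟨a1, a2⟩ := hye k (by omega)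
      refine Runs.of_wp ?_
      rw [hop, Cmd.wp]
      refine Cmd.wp_mono (wp_put i3 hk) ?_
      rintro s₃ ⟨n₃, r₃, p₃, q₃⟩
      have e40 := f₂ 40 (by decide) (by decide)
      have e78 := f₂ 78 (by decide) (by decide)
      have e79 := f₂ 79 (by decide) (by decide)
      have e83 := f₂ 83 (by decide) (by decide)
      have e85 := f₂ 85 (by decide) (by decide)
      simp only [Cmd.wp, NExp.eval_get, NExp.eval_const, NExp.eval_sub, State.updNat_nat,
        Nat.reduceEqDiff, reduceIte, Function.update_self, n₃, i3, hk, e40, e78, e79, e83, e85, a2,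
        Nat.add_sub_cancel, a1, State.updNat_real, i1]
      refine ⟨⟨trivial, by omega, trivial, fun i hi hki c => ?_, fun i hi hki => ?_⟩, by omega⟩
      · rcases Nat.lt_or_ge (k + 1) i with h | h
        · obtain ⟨b1, b2⟩ := q₃ i h c
          rw [b1, b2]
          exact i4 i hi h c
        · obtain rfl : i = k + 1 := by omega
          obtain ⟨b1, b2⟩ := p₃ c
          rw [b1, b2, g₂ 15 (by decide) (by decide), g₂ 16 (by decide) (by decide)]
          exact ⟨rfl, rfl⟩
      · rcases Nat.lt_or_ge k i with h | h
        · rw [Function.update_of_ne h.ne', Function.update_of_ne h.ne']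
          exact i5 i hi h
        · obtain rfl : i = k := by omega
          simp only [Function.update_self, and_self])
  rw [h88] at hloop
  refine (hloop.seq (Q := fun s' => Route d s s' m y e) fun s₂ hs₂ h₂ => Runs.of_wp ?_).mono
    (by simp [Test.nlt, Test.cost, NExp.cost]) fun _ _ h => h
  obtain ⟨⟨i1, -, i3, i4, i5⟩, hb⟩ := h₂
  simp only [Test.holds_nlt, NExp.eval_get, NExp.eval_const, not_lt, Nat.le_zero] at hb
  rw [hb] at i3 i4 i5
  have g₂ : ∀ b, b ≠ 2 → b ≠ 3 → s₂.real b = s.real b := fun b h1 h2 => by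
    rw [hs₂.real b (by simpa [Cmd.wR] using hwr b h1 h2), g₁]
  refine Cmd.wp_mono (wp_put i3 hb) ?_
  rintro s₃ ⟨n₃, r₃, p₃, q₃⟩
  refine ⟨by rw [n₃, i1], fun i hi c => ?_, fun i hi => by rw [n₃]; exact i5 i hi (Nat.zero_le _)⟩
  rcases Nat.eq_zero_or_pos i with rfl | h
  · obtain ⟨b1, b2⟩ := p₃ c
    rw [b1, b2, g₂ 15 (by decide) (by decide), g₂ 16 (by decide) (by decide)]
    exact ⟨rfl, rfl⟩
  · obtain ⟨b1, b2⟩ := q₃ i h c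
    rw [b1, b2]
    exact i4 i hi h c

/-- The program that finds the optimal route. -/
def solve (d : ℕ) : Cmd :=
  .seq copy <| .seq bottleneck <| .seq copy <| .seq (.letReal 21 (.var 24)) <|
  .seq search (trace d)

/-- The nodes `x` and `y` are connected through stored arcs of weight at most `τ`. -/
def Connects (s : State) (τ : ℝ) (x y : ℕ) : Prop :=
  ArcConn (s.nat 86 0) (s.nat 83) (s.nat 84) (s.real 71) τ x y

theorem arcConn_congr {M M' : ℕ} {S S' D D' : ℕ → ℕ} {W W' : ℕ → ℝ} (hM : M' = M)
    (hS : ∀ a < M, S' a = S a) (hD : ∀ a < M, D' a = D a) (hW : ∀ a < M, W' a = W a) (m : ℝ)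
    (x y : ℕ) : ArcConn M' S' D' W' m x y ↔ ArcConn M S D W m x y := by
  subst hM
  have : (fun x y => ∃ a < M', S' a = x ∧ D' a = y ∧ W' a ≤ m) =
      fun x y => ∃ a < M', S a = x ∧ D a = y ∧ W a ≤ m := by
    ext x y
    refine exists_congr fun a => and_congr_right fun ha => ?_
    rw [hS a ha, hD a ha, hW a ha]
  rw [ArcConn, ArcConn, this]

theorem arcSymm_congr {M M' : ℕ} {S S' D D' : ℕ → ℕ} {W W' : ℕ → ℝ} (h : ArcSymm M S D W)
    (hM : M' = M) (hS : ∀ a < M, S' a = S a) (hD : ∀ a < M, D' a = D a)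
    (hW : ∀ a < M, W' a = W a) : ArcSymm M' S' D' W' := by
  subst hM
  intro a ha
  obtain ⟨a', ha', h1, h2, h3⟩ := h a ha
  exact ⟨a', ha', by rw [hS a' ha', hD a ha, h1], by rw [hD a' ha', hS a ha, h2],
    by rw [hW a' ha', hW a ha, h3]⟩

/-- A route from the first to the last node with `m` arcs of weight at most `B`. -/
structure IsRoute (s : State) (B : ℝ) (m : ℕ) (y e : ℕ → ℕ) : Prop where
  start : y 0 = srcNode s
  finish : y m = dstNode s
  arc : ∀ i < m, e i < s.nat 86 0 ∧ s.nat 83 (e i) = y i ∧ s.nat 84 (e i) = y (i + 1) ∧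
    s.real 71 (e i) ≤ B
  length_le : m ≤ s.nat 86 0 + 2

/-- The computation of the bottleneck value contracts its copy of the graph, so the graph is copied
a second time; a search at the optimal threshold then yields a route through the original nodes.
Optimality of `B` is claimed only for distinct end nodes, since coinciding ones are joined at every
threshold. -/
theorem solve_runs (d : ℕ) : ∃ K, ∀ (s : State),
    ArcSymm (s.nat 86 0) (s.nat 83) (s.nat 84) (s.real 71) →
    (∃ τ, Connects s τ (srcNode s) (dstNode s)) →
    Runs (solve d) s (K * (s.nat 86 0 + 1)) fun s' => ∃ (B : ℝ) (m : ℕ) (y e : ℕ → ℕ),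
      IsRoute s B m y e ∧ Route d s s' m y e ∧ (srcNode s = dstNode s → m = 0) ∧
      (srcNode s ≠ dstNode s → ∀ τ, Connects s τ (srcNode s) (dstNode s) → B ≤ τ) := by
  obtain ⟨K₁, hK₁⟩ := bottleneck_runs
  obtain ⟨K₂, hK₂⟩ := trace_runs d
  refine ⟨60 + K₁ + 60 + 10 + 2000 + 3 * K₂, fun s hsymm ⟨τ₀, hτ₀⟩ => ?_⟩
  generalize hM : s.nat 86 0 = M
  refine Runs.mono (k := 60 * (M + 1) + (K₁ * (M + 1) + (60 * (M + 1) + (10 * (M + 1) +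
    (2000 * (M + 1) + 3 * K₂ * (M + 1)))))) ?_ (le_of_eq (by ring)) fun _ _ h => h
  have hcopy := copy_runs s
  rw [hM] at hcopy
  refine hcopy.seq fun s₁ hs₁ h₁ => ?_
  have hb := hK₁ s₁ (arcSymm_congr hsymm h₁.card h₁.tail h₁.head h₁.weight)
  have hcard : (graphOf s₁).M = M := h₁.card.trans hM
  rw [hcard] at hb
  have hjoin : ∀ τ, (graphOf s₁).Joined τ ↔ Connects s τ (srcNode s) (dstNode s) := by
    intro τ
    rw [← h₁.src, ← h₁.dst]
    exact arcConn_congr h₁.card h₁.tail h₁.head h₁.weight τ _ _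
  refine hb.seq fun s₂ hs₂ h₂ => ?_
  have f₂ : ∀ b ∈ [71, 72, 74, 75, 76, 78, 79, 83, 84, 85, 86], s₂.nat b = s.nat b := by
    intro b hb
    simp only [List.mem_cons, List.not_mem_nil, or_false] at hb
    rcases hb with rfl | rfl | rfl | rfl | rfl | rfl | rfl | rfl | rfl | rfl | rfl <;>
    exact (hs₂.nat _ rfl).trans (hs₁.nat _ rfl)
  have g₂ : ∀ b ∈ [15, 16, 71], s₂.real b = s.real b := by
    intro b hb
    simp only [List.mem_cons, List.not_mem_nil, or_false] at hb
    rcases hb with rfl | rfl | rfl <;> exact (hs₂.real _ rfl).trans (hs₁.real _ rfl)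
  have hopt : Connects s (s₂.real 24 0) (srcNode s) (dstNode s) ∧ (srcNode s ≠ dstNode s →
      ∀ τ, Connects s τ (srcNode s) (dstNode s) → s₂.real 24 0 ≤ τ) := by
    refine ⟨(hjoin _).1 (h₂ τ₀ ((hjoin _).2 hτ₀)).1, fun hne τ hτ =>
      (h₂ τ ((hjoin _).2 hτ)).2 ?_⟩
    simpa only [graphOf, h₁.src, h₁.dst] using hne
  generalize hB : s₂.real 24 0 = B at hopt
  have hcopy := copy_runs s₂
  rw [f₂ 86 (by decide), hM] at hcopy
  refine hcopy.seq fun s₃ hs₃ h₃ => ?_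
  have hsrc : srcNode s₂ = srcNode s := by
    simp only [srcNode, f₂ 71 (by decide), f₂ 74 (by decide), f₂ 76 (by decide)]
  have hdst : dstNode s₂ = dstNode s := by
    simp only [dstNode, f₂ 72 (by decide), f₂ 75 (by decide), f₂ 76 (by decide)]
  obtain ⟨c1, c2, c3, c4, c5, c6⟩ := h₃
  rw [f₂ 86 (by decide), hM] at c1 c4 c5 c6
  rw [hsrc] at c2
  rw [hdst] at c3
  rw [f₂ 83 (by decide)] at c4
  rw [f₂ 84 (by decide)] at c5
  rw [g₂ 71 (by decide)] at c6
  rw [hM] at hsymm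
  let G : Graph := ⟨M, s.nat 83, s.nat 84, s.real 71, B, srcNode s, dstNode s, hsymm⟩
  have hset : Runs (.letReal 21 (.var 24)) s₃ (10 * (M + 1)) (Loaded G) := by
    refine (Runs.of_wp ?_).mono (?_ : _ ≤ 10 * (M + 1)) fun _ _ h => h
    · simp only [Cmd.wp, NExp.eval_const, RExp.eval_get, hs₃.real 24 rfl, hB]
      exact ⟨c1, c4, c5, fun a ha => by simpa [State.updReal_real] using c6 a ha,
        by simp [State.updReal_real, G], c2, c3⟩
    · simp only [Cmd.bound, NExp.cost, RExp.cost]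
      omega
  refine hset.seq fun s₄ hs₄ h₄ => ?_
  refine (search_runs G s₄ h₄).seq fun s₅ hs₅ h₅ => ?_
  have f₅ : ∀ b ∈ [71, 72, 74, 75, 76, 78, 79, 83, 84, 85, 86], s₅.nat b = s.nat b := by
    intro b hb
    rw [← f₂ b hb]
    simp only [List.mem_cons, List.not_mem_nil, or_false] at hb
    rcases hb with rfl | rfl | rfl | rfl | rfl | rfl | rfl | rfl | rfl | rfl | rfl <;>
    exact (hs₅.nat _ rfl).trans ((hs₄.nat _ rfl).trans (hs₃.nat _ rfl))
  have g₅ : ∀ b ∈ [15, 16, 71], s₅.real b = s.real b := by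
    intro b hb
    rw [← g₂ b hb]
    simp only [List.mem_cons, List.not_mem_nil, or_false] at hb
    rcases hb with rfl | rfl | rfl <;>
    exact (hs₅.real _ rfl).trans ((hs₄.real _ rfl).trans (hs₃.real _ rfl))
  have h23 : s₅.nat 23 0 = srcNode s := by rw [hs₅.nat 23 rfl, h₄.s_eq]
  have h24 : s₅.nat 24 0 = dstNode s := by rw [hs₅.nat 24 rfl, h₄.t_eq]
  have hsV : G.s ∈ G.verts := Graph.mem_verts.2 (.inl rfl)
  have htV : G.t ∈ G.verts := Graph.mem_verts.2 (.inr (.inl rfl))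
  have hμt : s₅.nat 32 G.t = G.s + 1 := by
    rw [← h₅.start]
    refine ((h₅.conn G.s hsV G.t htV).2 ?_).symm
    have := hopt.1
    rw [Connects, hM] at this
    exact this
  -- For distinct ends the length is the depth of the last node. It is less than the number of
  -- vertices, hence at most the number of arcs plus 2.
  obtain ⟨m, y, e, hm, hroute, hpar, h0⟩ : ∃ (m : ℕ) (y e : ℕ → ℕ),
      (if srcNode s = dstNode s then 0 else s₅.nat 41 (dstNode s)) = m ∧ IsRoute s B m y e ∧
      (∀ i < m, s₅.nat 40 (y (i + 1)) = e i + 1) ∧ (srcNode s = dstNode s → m = 0) := by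
    by_cases hst : srcNode s = dstNode s
    · exact ⟨0, fun _ => srcNode s, fun _ => 0, by simp [hst],
        ⟨rfl, hst, fun i hi => by omega, by omega⟩, fun i hi => by omega, fun _ => rfl⟩
    · obtain ⟨y, e, hy0, hyn, hye⟩ := h₅.exists_route _ G.t htV hμt rfl
      refine ⟨_, y, e, if_neg hst, ⟨hy0, hyn, fun i hi => ?_, ?_⟩, fun i hi => (hye i hi).2.2.2,
        fun h => absurd h hst⟩
      · obtain ⟨a1, a2, a3, -⟩ := hye i hi
        exact ⟨hM ▸ a1.1, a2, a3, a1.2⟩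
      · have a1 := h₅.depth G.t htV hμt
        have a2 := card_verts_le G
        have a3 : G.M = s.nat 86 0 := hM.symm
        have a4 : G.t = dstNode s := rfl
        rw [a4] at a1
        omega
  have htrace := hK₂ s₅ m y e (by rw [h23, h24]; exact hm) (by rw [h24]; exact hroute.finish)
    fun i hi => ⟨by rw [f₅ 83 (by decide)]; exact (hroute.arc i hi).2.1, hpar i hi⟩
  refine htrace.mono ?_ fun s' hs' h => ⟨B, m, y, e, hroute, ?_, h0, hopt.2⟩
  · have := hroute.length_le
    rw [hM] at this
    calc K₂ * (m + 1) ≤ K₂ * (3 * (M + 1)) := Nat.mul_le_mul_left _ (by omega)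
      _ = 3 * K₂ * (M + 1) := by ring
  · refine ⟨h.length, fun i hi c => ?_, fun i hi => ?_⟩
    · rw [← g₅ 15 (by decide), ← g₅ 16 (by decide)]
      exact h.point i hi c
    · rw [← f₅ 78 (by decide), ← f₅ 79 (by decide), ← f₅ 85 (by decide)]
      exact h.cell i hi

end Build

end RealRAM

namespace GeomComplex.Listing

open RealRAM.Build

variable {d : ℕ} {K : GeomComplex d} (L : K.Listing)

/-! ### Listings -/

/-- Entry `k` of the padded list of the vertices of simplex `i`. -/
noncomputable def vertIndex : ℕ → ℕ → ℕ := padded d L.cellCard L.cellVerts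

theorem face_eq_toFinset [DecidableEq (EuclideanSpace ℝ (Fin d))] (i : Fin K.size) :
    (L.face i).1 = ((L.cell i).map L.vert).toFinset := by
  ext v
  simp [L.mem_face]

theorem card_face (i : Fin K.size) : (L.face i).1.card = (L.cell i).length := by
  classical
  rw [L.face_eq_toFinset, List.toFinset_card_of_nodup ((L.cell_nodup i).map L.vert_injective),
    List.length_map]

theorem length_cell_pos (i : Fin K.size) : 0 < (L.cell i).length := by
  rw [← L.card_face, Finset.card_pos]
  exact (K.isRelLowerSet_faces (L.face i).2).1

theorem length_cell_le (i : Fin K.size) : (L.cell i).length ≤ d + 1 := by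
  rw [← L.card_face]
  have h := (K.indep _ (L.face i).2).card_le_finrank_succ
  rw [Fintype.card_coe] at h
  refine h.trans (Nat.succ_le_succ ((Submodule.finrank_le _).trans ?_))
  simp

theorem cellCard_eq (i : Fin K.size) : L.cellCard i = (L.cell i).length := by
  simp [cellCard]

theorem cellVerts_eq (i : Fin K.size) {k : ℕ} (hk : k < (L.cell i).length) :
    L.cellVerts (i * (d + 1) + k) = ((L.cell i)[k] : Fin L.numVerts) := by
  have hkd : k < d + 1 := hk.trans_le (L.length_cell_le i)
  have h1 : (i * (d + 1) + k) / (d + 1) = i := by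
    rw [mul_comm, Nat.mul_add_div (Nat.succ_pos d), Nat.div_eq_of_lt hkd, add_zero]
  have h2 : (i * (d + 1) + k) % (d + 1) = k := by
    rw [mul_comm, Nat.mul_add_mod, Nat.mod_eq_of_lt hkd]
  simp only [cellVerts, h1, h2, i.2, dif_pos, Fin.eta]
  rw [List.getD_eq_getElem _ _ (by simpa using hk), List.getElem_map]
  simp [← List.map_eq_flatMap]

theorem vertIndex_eq (i : Fin K.size) (k : ℕ) :
    L.vertIndex i k = ((L.cell i)[if k < (L.cell i).length then k else 0]'(by
      split_ifs with h
      · exact h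
      · exact L.length_cell_pos i) : Fin L.numVerts) := by
  have h0 := L.cellVerts_eq i (L.length_cell_pos i)
  rw [add_zero] at h0
  by_cases h : k < (L.cell i).length
  · simp [vertIndex, padded, L.cellCard_eq, h, L.cellVerts_eq i h]
  · simp [vertIndex, padded, L.cellCard_eq, h, h0]

theorem exists_vertIndex_eq_iff (i : Fin K.size) (v : Fin L.numVerts) :
    (∃ k < d + 1, L.vertIndex i k = v) ↔ v ∈ L.cell i := by
  constructor
  · rintro ⟨k, -, hk⟩
    rw [L.vertIndex_eq] at hk
    rw [← Fin.ext hk]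
    exact List.getElem_mem _
  · intro hv
    obtain ⟨k, hk, rfl⟩ := List.getElem_of_mem hv
    refine ⟨k, hk.trans_le (L.length_cell_le i), ?_⟩
    simp [L.vertIndex_eq, hk]

theorem exists_mem_cell (i : Fin K.size) (k : ℕ) : ∃ v ∈ L.cell i, L.vertIndex i k = v :=
  ⟨_, List.getElem_mem _, L.vertIndex_eq i k⟩

theorem vert_mem_face (i : Fin K.size) (v : Fin L.numVerts) :
    L.vert v ∈ (L.face i).1 ↔ v ∈ L.cell i := by
  rw [L.mem_face]
  exact ⟨fun ⟨j, hj, h⟩ => L.vert_injective h ▸ hj, fun h => ⟨v, h, rfl⟩⟩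

theorem sub_iff (i' i : Fin K.size) :
    Sub d L.vertIndex i' i ↔ (L.face i').1 ⊆ (L.face i).1 := by
  constructor
  · intro h x hx
    obtain ⟨v, hv, rfl⟩ := (L.mem_face i' x).1 hx
    obtain ⟨k, hk, hkv⟩ := (L.exists_vertIndex_eq_iff i' v).2 hv
    obtain ⟨k', hk', h'⟩ := h k hk
    exact (L.vert_mem_face i v).2 ((L.exists_vertIndex_eq_iff i v).1 ⟨k', hk', by rw [← h', hkv]⟩)
  · intro h k hk
    obtain ⟨v, hv, hkv⟩ := L.exists_mem_cell i' k
    obtain ⟨k', hk', h'⟩ := (L.exists_vertIndex_eq_iff i v).2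
      ((L.vert_mem_face i v).1 (h ((L.vert_mem_face i' v).2 hv)))
    exact ⟨k', hk', by rw [hkv, h']⟩

theorem coords_eq (v : Fin L.numVerts) (c : Fin d) : L.coords (v * d + c) = L.vert v c := by
  have hd : 0 < d := c.pos
  have h1 : ((v : ℕ) * d + c) / d = v := by
    rw [mul_comm, Nat.mul_add_div hd, Nat.div_eq_of_lt c.2, add_zero]
  have h2 : ((v : ℕ) * d + c) % d = c := by
    rw [mul_comm, Nat.mul_add_mod, Nat.mod_eq_of_lt c.2]
  simp [coords, h1, h2]

/-- Padding only repeats a vertex, so the set of points, and with it the hull, is that of the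
simplex. -/
theorem range_cellPoints (i : Fin K.size) :
    Set.range (cellPoints d L.vertIndex L.coords i) = ((L.face i).1 : Set _) := by
  have hpt : ∀ (k : Fin (d + 1)) (v : Fin L.numVerts), L.vertIndex i k = v →
      cellPoints d L.vertIndex L.coords i k = L.vert v := by
    intro k v h
    ext c
    simp only [cellPoints, h, coords_eq]
  ext x
  constructor
  · rintro ⟨k, rfl⟩
    obtain ⟨v, hv, h⟩ := L.exists_mem_cell i k
    rw [hpt k v h]
    exact (L.vert_mem_face i v).2 hv
  · intro hx
    obtain ⟨v, hv, rfl⟩ := (L.mem_face i x).1 hx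
    obtain ⟨k, hk, h⟩ := (L.exists_vertIndex_eq_iff i v).2 hv
    exact ⟨⟨k, hk⟩, hpt ⟨k, hk⟩ v h⟩

/-- Affine independence allows at most d + 1 vertices, hence at most 2^(d+1) subsets, and different
numbers belong to different simplices. -/
theorem facePairs_le : facePairs d L.vertIndex K.size ≤ 2 ^ (d + 1) * K.size := by
  classical
  have key : ∀ i ∈ Finset.range K.size,
      Nat.count (fun i' => Sub d L.vertIndex i' i) K.size ≤ 2 ^ (d + 1) := by
    intro i hi
    rw [Finset.mem_range] at hi
    have hinj : ((Finset.range K.size).filter fun i' => Sub d L.vertIndex i' i).card ≤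
        (L.face ⟨i, hi⟩).1.powerset.card := by
      refine Finset.card_le_card_of_injOn
        (fun i' => if h : i' < K.size then (L.face ⟨i', h⟩).1 else ∅) ?_ ?_
      · intro i' hi'
        simp only [Finset.coe_filter, Finset.mem_range, Set.mem_ofPred_eq] at hi'
        simp only [Finset.mem_coe, Finset.mem_powerset, dif_pos hi'.1]
        exact (L.sub_iff ⟨i', hi'.1⟩ ⟨i, hi⟩).1 hi'.2
      · intro a ha b hb hab
        simp only [Finset.coe_filter, Finset.mem_range, Set.mem_ofPred_eq] at ha hb
        simp only [dif_pos ha.1, dif_pos hb.1] at hab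
        have := L.face.injective (Subtype.ext hab)
        simpa using this
    rw [Nat.count_eq_card_filter_range]
    refine le_trans (le_of_eq ?_) (hinj.trans ?_)
    · congr!
    · rw [Finset.card_powerset, L.card_face]
      exact Nat.pow_le_pow_right (by decide) (L.length_cell_le _)
  calc facePairs d L.vertIndex K.size ≤ ∑ _i ∈ Finset.range K.size, 2 ^ (d + 1) := by
        refine Finset.sum_le_sum fun i hi => le_trans (le_of_eq ?_) (key i hi)
        congr!
    _ = _ := by simp [mul_comm]

open Classical in
/-- The number of a simplex. -/
noncomputable def num (Ψ : Finset (EuclideanSpace ℝ (Fin d))) : ℕ :=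
  if h : Ψ ∈ K.faces then L.face.symm ⟨Ψ, h⟩ else 0

theorem num_lt {Ψ : Finset (EuclideanSpace ℝ (Fin d))} (h : Ψ ∈ K.faces) : L.num Ψ < K.size := by
  simp [num, h]

theorem face_num {Ψ : Finset (EuclideanSpace ℝ (Fin d))} (h : Ψ ∈ K.faces) :
    (L.face ⟨L.num Ψ, L.num_lt h⟩).1 = Ψ := by
  simp [num, h]

theorem num_face (i : Fin K.size) : L.num (L.face i).1 = i := by
  simp [num]

theorem singleton_mem (v : Fin L.numVerts) : {L.vert v} ∈ K.faces := by
  have h : L.vert v ∈ Set.range L.vert := ⟨v, rfl⟩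
  rw [L.range_vert] at h
  exact h

theorem isVertexCell (s t v : Fin L.numVerts) {e : ℕ} (he : L.header s t e = v) :
    IsVertexCell d (L.header s t) L.cellCard L.cellVerts e (L.num {L.vert v}) := by
  refine ⟨L.num_lt (L.singleton_mem v), fun i hi => ?_⟩
  replace hi : i < K.size := hi
  have h0 := L.cellVerts_eq ⟨i, hi⟩ (L.length_cell_pos ⟨i, hi⟩)
  have hc := L.cellCard_eq ⟨i, hi⟩
  simp only [add_zero] at h0 hc
  rw [he, h0, hc]
  have hiff : ((L.cell ⟨i, hi⟩).length = 1 ∧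
      ((L.cell ⟨i, hi⟩)[0]'(L.length_cell_pos ⟨i, hi⟩) : ℕ) = v) ↔
      (L.face ⟨i, hi⟩).1 = {L.vert v} := by
    rw [← L.card_face]
    have hmem : L.vert ((L.cell ⟨i, hi⟩)[0]'(L.length_cell_pos ⟨i, hi⟩)) ∈ (L.face ⟨i, hi⟩).1 :=
      (L.vert_mem_face _ _).2 (List.getElem_mem _)
    constructor
    · rintro ⟨h1, h2⟩
      obtain ⟨x, hx⟩ := Finset.card_eq_one.1 h1
      rw [hx, Finset.mem_singleton, Fin.ext h2] at hmem
      rw [hx, hmem]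
    · intro h
      rw [h, Finset.mem_singleton] at hmem
      exact ⟨by rw [h, Finset.card_singleton], by rw [L.vert_injective hmem]⟩
  rw [hiff]
  constructor
  · intro h
    rw [← h, L.num_face]
  · rintro rfl
    exact L.face_num (L.singleton_mem v)

end GeomComplex.Listing

/-! ### Widths of curves -/

section Width

variable {d : ℕ}

theorem dist_le_curveWidth (π σ : C(unitInterval, EuclideanSpace ℝ (Fin d)))
    (f g : C(unitInterval, unitInterval)) (u : unitInterval) :
    dist (π (f u)) (σ (g u)) ≤ curveWidth π σ f g := by
  have hc : Continuous fun u : unitInterval => dist (π (f u)) (σ (g u)) := by fun_prop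
  exact le_ciSup (isCompact_range hc).bddAbove u

theorem curveWidth_nonneg (π σ : C(unitInterval, EuclideanSpace ℝ (Fin d)))
    (f g : C(unitInterval, unitInterval)) : 0 ≤ curveWidth π σ f g :=
  dist_nonneg.trans (dist_le_curveWidth π σ f g 0)

theorem isWeakReparam_id : IsWeakReparam (ContinuousMap.id unitInterval) := ⟨rfl, rfl⟩

theorem weakFrechetDist_le_curveWidth (π σ : C(unitInterval, EuclideanSpace ℝ (Fin d))) :
    weakFrechetDist π σ ≤ curveWidth π σ (ContinuousMap.id _) (ContinuousMap.id _) :=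
  csInf_le ⟨0, fun _ ⟨f, g, _, _, hw⟩ => hw ▸ curveWidth_nonneg π σ f g⟩
    ⟨_, _, isWeakReparam_id, isWeakReparam_id, rfl⟩

theorem frechetDist_le_curveWidth (π σ : C(unitInterval, EuclideanSpace ℝ (Fin d))) :
    frechetDist π σ ≤ curveWidth π σ (ContinuousMap.id _) (ContinuousMap.id _) :=
  csInf_le ⟨0, fun _ ⟨f, g, _, _, _, _, hw⟩ => hw ▸ curveWidth_nonneg π σ f g⟩
    ⟨_, _, isWeakReparam_id, Function.injective_id, isWeakReparam_id, Function.injective_id, rfl⟩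

theorem le_weakFrechetDist {π σ : C(unitInterval, EuclideanSpace ℝ (Fin d))} {w : ℝ}
    (h : ∀ f g, IsWeakReparam f → IsWeakReparam g → w ≤ curveWidth π σ f g) :
    w ≤ weakFrechetDist π σ :=
  le_csInf ⟨_, _, _, isWeakReparam_id, isWeakReparam_id, rfl⟩
    fun _ ⟨f, g, hf, hg, hw⟩ => hw ▸ h f g hf hg

/-- Injective reparameterizations are in particular weak ones, so one lower bound over weak
reparameterizations serves both distances. -/
theorem le_frechetDist {π σ : C(unitInterval, EuclideanSpace ℝ (Fin d))} {w : ℝ}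
    (h : ∀ f g, IsWeakReparam f → IsWeakReparam g → w ≤ curveWidth π σ f g) :
    w ≤ frechetDist π σ :=
  le_csInf ⟨_, _, _, isWeakReparam_id, Function.injective_id, isWeakReparam_id,
    Function.injective_id, rfl⟩ fun _ ⟨f, g, hf, _, hg, _, hw⟩ => hw ▸ h f g hf hg

end Width

namespace GeomComplex.Listing

open RealRAM RealRAM.Build

variable {d : ℕ}

section

variable {K : GeomComplex d} (L : K.Listing)

/-- The simplex with number `i`. -/
noncomputable def cellOf (i : ℕ) : Finset (EuclideanSpace ℝ (Fin d)) :=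
  if h : i < K.size then (L.face ⟨i, h⟩).1 else ∅

theorem cellOf_mem {i : ℕ} (h : i < K.size) : L.cellOf i ∈ K.faces := by
  rw [cellOf, dif_pos h]
  exact (L.face ⟨i, h⟩).2

theorem cellOf_num {Ψ : Finset (EuclideanSpace ℝ (Fin d))} (h : Ψ ∈ K.faces) :
    L.cellOf (L.num Ψ) = Ψ := by
  rw [cellOf, dif_pos (L.num_lt h), L.face_num h]

theorem range_cellPoints_cellOf {i : ℕ} (h : i < K.size) :
    Set.range (cellPoints d L.vertIndex L.coords i) = (L.cellOf i : Set _) := by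
  rw [cellOf, dif_pos h]
  exact L.range_cellPoints ⟨i, h⟩

theorem sub_iff_cellOf {i' i : ℕ} (h' : i' < K.size) (h : i < K.size) :
    Sub d L.vertIndex i' i ↔ L.cellOf i' ⊆ L.cellOf i := by
  rw [cellOf, cellOf, dif_pos h, dif_pos h']
  exact L.sub_iff ⟨i', h'⟩ ⟨i, h⟩

end

variable {K₁ K₂ : GeomComplex d} (L₁ : K₁.Listing) (L₂ : K₂.Listing)

/-! ### The graph of pairs of simplices -/

/-- The node of a pair of simplices. -/
noncomputable def nodeOf (P : Finset (EuclideanSpace ℝ (Fin d)) × Finset (EuclideanSpace ℝ (Fin d))) :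
    ℕ := L₁.num P.1 * K₂.size + L₂.num P.2

theorem node_div_mod {n₁ n₂ i j : ℕ} (hi : i < n₁) (hj : j < n₂) :
    (i * n₂ + j) / n₂ = i ∧ (i * n₂ + j) % n₂ = j ∧ i * n₂ + j < n₁ * n₂ := by
  have hn : 0 < n₂ := by omega
  refine ⟨?_, ?_, ?_⟩
  · rw [mul_comm, Nat.mul_add_div hn, Nat.div_eq_of_lt hj, add_zero]
  · rw [mul_comm, Nat.mul_add_mod, Nat.mod_eq_of_lt hj]
  · calc i * n₂ + j < i * n₂ + n₂ := Nat.add_lt_add_left hj _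
      _ = (i + 1) * n₂ := by ring
      _ ≤ _ := Nat.mul_le_mul_right _ hi

/-- The memory holds the graph of pairs of simplices of two listed complexes. -/
def HasGraph (s : State) (s₁ t₁ : Fin L₁.numVerts) (s₂ t₂ : Fin L₂.numVerts) : Prop :=
  Built d s L₁.vertIndex L₂.vertIndex L₁.coords L₂.coords K₁.size K₂.size
    (L₁.num {L₁.vert s₁}) (L₁.num {L₁.vert t₁}) (L₂.num {L₂.vert s₂}) (L₂.num {L₂.vert t₂})

/-- The points `p` and `q` are stored as the closest points of node `x`. -/
structure IsNode (s : State) (x : ℕ) (p q : EuclideanSpace ℝ (Fin d)) : Prop where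
  left : p ∈ convexHull ℝ (L₁.cellOf (x / K₂.size) : Set (EuclideanSpace ℝ (Fin d)))
  right : q ∈ convexHull ℝ (L₂.cellOf (x % K₂.size) : Set (EuclideanSpace ℝ (Fin d)))
  le : ∀ w, Near w (L₁.cellOf (x / K₂.size)) (L₂.cellOf (x % K₂.size)) → dist p q ≤ w
  weight : s.real 70 x = dist p q ^ 2
  fst : ∀ c : Fin d, s.real 15 (x * d + c) = p c
  snd : ∀ c : Fin d, s.real 16 (x * d + c) = q c
  row : s.nat 78 x = x / K₂.size
  col : s.nat 79 x = x % K₂.size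

variable {L₁ L₂}

theorem div_mod_lt {n₁ n₂ x : ℕ} (hx : x < n₁ * n₂) : x / n₂ < n₁ ∧ x % n₂ < n₂ := by
  have hn : 0 < n₂ := Nat.pos_of_ne_zero fun h => by simp [h] at hx
  exact ⟨(Nat.div_lt_iff_lt_mul hn).2 hx, Nat.mod_lt _ hn⟩

section Graph

variable {s : State} {s₁ t₁ : Fin L₁.numVerts} {s₂ t₂ : Fin L₂.numVerts}

theorem HasGraph.exists_isNode (h : HasGraph L₁ L₂ s s₁ t₁ s₂ t₂) :
    ∃ p q : ℕ → EuclideanSpace ℝ (Fin d), ∀ x < K₁.size * K₂.size,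
      IsNode L₁ L₂ s x (p x) (q x) := by
  have key : ∀ x, ∃ pq : EuclideanSpace ℝ (Fin d) × EuclideanSpace ℝ (Fin d),
      x < K₁.size * K₂.size → IsNode L₁ L₂ s x pq.1 pq.2 := by
    intro x
    by_cases hx : x < K₁.size * K₂.size
    · obtain ⟨p, q, hpq⟩ := h.nodes x hx
      obtain ⟨h1, h2⟩ := div_mod_lt hx
      have hl := hpq.found.left
      have hr := hpq.found.right
      have hle := hpq.found.le
      rw [L₁.range_cellPoints_cellOf h1] at hl hle
      rw [L₂.range_cellPoints_cellOf h2] at hr hle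
      exact ⟨(p, q), fun _ => ⟨hl, hr, fun w ⟨u, hu, v, hv, huv⟩ => (hle u hu v hv).trans huv,
        hpq.weight, hpq.fst, hpq.snd, hpq.row, hpq.col⟩⟩
    · exact ⟨(0, 0), fun h => absurd h hx⟩
  choose pq hpq using key
  exact ⟨fun x => (pq x).1, fun x => (pq x).2, hpq⟩

theorem step_cellOf {lo hi : ℕ}
    (h : Step d L₁.vertIndex L₂.vertIndex K₁.size K₂.size lo hi) :
    lo < K₁.size * K₂.size ∧ hi < K₁.size * K₂.size ∧
      L₁.cellOf (lo / K₂.size) ⊆ L₁.cellOf (hi / K₂.size) ∧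
      L₂.cellOf (lo % K₂.size) ⊆ L₂.cellOf (hi % K₂.size) := by
  rcases h with ⟨i, hi, i', hi', j, hj, hs, rfl, rfl⟩ | ⟨j, hj, j', hj', i, hi, hs, rfl, rfl⟩
  · obtain ⟨h1, h2, h3⟩ := node_div_mod hi hj
    obtain ⟨h1', h2', h3'⟩ := node_div_mod hi' hj
    rw [h1, h2, h1', h2']
    exact ⟨h3', h3, (L₁.sub_iff_cellOf hi' hi).1 hs, subset_rfl⟩
  · obtain ⟨h1, h2, h3⟩ := node_div_mod hi hj
    obtain ⟨h1', h2', h3'⟩ := node_div_mod hi hj'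
    rw [h1, h2, h1', h2']
    exact ⟨h3', h3, subset_rfl, (L₂.sub_iff_cellOf hj' hj).1 hs⟩

/-- One of two simplices is replaced by an adjacent one. -/
def Neighbours (K₁ K₂ : GeomComplex d)
    (P Q : Finset (EuclideanSpace ℝ (Fin d)) × Finset (EuclideanSpace ℝ (Fin d))) : Prop :=
  (P.1 ∈ K₁.faces ∧ P.2 ∈ K₂.faces) ∧ (Q.1 ∈ K₁.faces ∧ Q.2 ∈ K₂.faces) ∧
    (Adjacent P.1 Q.1 ∧ P.2 = Q.2 ∨ P.1 = Q.1 ∧ Adjacent P.2 Q.2)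

theorem step_of_neighbours
    {P Q : Finset (EuclideanSpace ℝ (Fin d)) × Finset (EuclideanSpace ℝ (Fin d))}
    (h : Neighbours K₁ K₂ P Q) :
    Step d L₁.vertIndex L₂.vertIndex K₁.size K₂.size (nodeOf L₁ L₂ P) (nodeOf L₁ L₂ Q) ∨
      Step d L₁.vertIndex L₂.vertIndex K₁.size K₂.size (nodeOf L₁ L₂ Q) (nodeOf L₁ L₂ P) := by
  have h₁ : ∀ {A A' B}, A ∈ K₁.faces → A' ∈ K₁.faces → B ∈ K₂.faces → A ⊆ A' →
      Step d L₁.vertIndex L₂.vertIndex K₁.size K₂.size (nodeOf L₁ L₂ (A, B))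
        (nodeOf L₁ L₂ (A', B)) := fun {A A' B} hA hA' hB hs =>
    .inl ⟨_, L₁.num_lt hA', _, L₁.num_lt hA, _, L₂.num_lt hB,
      (L₁.sub_iff_cellOf (L₁.num_lt hA) (L₁.num_lt hA')).2
        (by rwa [L₁.cellOf_num hA, L₁.cellOf_num hA']), rfl, rfl⟩
  have h₂ : ∀ {A B B'}, A ∈ K₁.faces → B ∈ K₂.faces → B' ∈ K₂.faces → B ⊆ B' →
      Step d L₁.vertIndex L₂.vertIndex K₁.size K₂.size (nodeOf L₁ L₂ (A, B))
        (nodeOf L₁ L₂ (A, B')) := fun {A B B'} hA hB hB' hs =>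
    .inr ⟨_, L₂.num_lt hB', _, L₂.num_lt hB, _, L₁.num_lt hA,
      (L₂.sub_iff_cellOf (L₂.num_lt hB) (L₂.num_lt hB')).2
        (by rwa [L₂.cellOf_num hB, L₂.cellOf_num hB']), rfl, rfl⟩
  obtain ⟨A, B⟩ := P
  obtain ⟨A', B'⟩ := Q
  obtain ⟨⟨hA, hB⟩, ⟨hA', hB'⟩, h⟩ := h
  dsimp only at hA hB hA' hB' h
  rcases h with ⟨h, rfl⟩ | ⟨rfl, h⟩
  · exact h.imp (h₁ hA hA' hB) (h₁ hA' hA hB)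
  · exact h.imp (h₂ hA hB hB') (h₂ hA hB' hB)

theorem HasGraph.exists_arc (h : HasGraph L₁ L₂ s s₁ t₁ s₂ t₂)
    {P Q : Finset (EuclideanSpace ℝ (Fin d)) × Finset (EuclideanSpace ℝ (Fin d))}
    (hPQ : Neighbours K₁ K₂ P Q) :
    ∃ a < s.nat 86 0, s.nat 83 a = nodeOf L₁ L₂ P ∧ s.nat 84 a = nodeOf L₁ L₂ Q ∧
      (s.real 71 a = s.real 70 (nodeOf L₁ L₂ P) ∨ s.real 71 a = s.real 70 (nodeOf L₁ L₂ Q)) := by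
  rcases step_of_neighbours (L₁ := L₁) (L₂ := L₂) hPQ with hs | hs
  · obtain ⟨a, ha, h1, h2, -, h3⟩ := h.arcs.complete _ _ _ _ ⟨hs, .inl ⟨rfl, rfl⟩⟩
    exact ⟨a, ha, h1, h2, .inl h3⟩
  · obtain ⟨a, ha, h1, h2, -, h3⟩ := h.arcs.complete _ _ _ _ ⟨hs, .inr ⟨rfl, rfl⟩⟩
    exact ⟨a, ha, h1, h2, .inr h3⟩

theorem HasGraph.arcSymm (h : HasGraph L₁ L₂ s s₁ t₁ s₂ t₂) :
    ArcSymm (s.nat 86 0) (s.nat 83) (s.nat 84) (s.real 71) := by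
  intro a ha
  obtain ⟨lo, ⟨h1, h2⟩, h3⟩ := h.arcs.sound a ha
  obtain ⟨a', ha', h4, h5, -, h6⟩ := h.arcs.complete (s.nat 84 a) (s.nat 83 a) _ lo
    ⟨h1, h2.symm.imp And.symm And.symm⟩
  exact ⟨a', ha', h4, h5, by rw [h6, h3]⟩

theorem HasGraph.weight_le (h : HasGraph L₁ L₂ s s₁ t₁ s₂ t₂)
    {P : Finset (EuclideanSpace ℝ (Fin d)) × Finset (EuclideanSpace ℝ (Fin d))} {w : ℝ}
    (h₁ : P.1 ∈ K₁.faces) (h₂ : P.2 ∈ K₂.faces) (hw : Near w P.1 P.2) :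
    s.real 70 (nodeOf L₁ L₂ P) ≤ w ^ 2 := by
  obtain ⟨p, q, hpq⟩ := h.exists_isNode
  obtain ⟨e1, e2, e3⟩ := node_div_mod (L₁.num_lt h₁) (L₂.num_lt h₂)
  have hx := hpq _ e3
  rw [nodeOf, hx.weight]
  have := hx.le w (by rwa [e1, e2, L₁.cellOf_num h₁, L₂.cellOf_num h₂])
  exact pow_le_pow_left₀ dist_nonneg this 2

/-- The weight of an arc is the weight of one of its ends, and both ends have squared distance at
most w². -/
theorem HasGraph.connects_of_pairStep (h : HasGraph L₁ L₂ s s₁ t₁ s₂ t₂) {w : ℝ}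
    {P Q : Finset (EuclideanSpace ℝ (Fin d)) × Finset (EuclideanSpace ℝ (Fin d))}
    (hPQ : Relation.ReflTransGen (PairStep K₁ K₂ w) P Q) :
    Connects s (w ^ 2) (nodeOf L₁ L₂ P) (nodeOf L₁ L₂ Q) := by
  induction hPQ with
  | refl => exact .refl
  | tail _ hst ih =>
    obtain ⟨⟨h1, h2, h3⟩, ⟨h4, h5, h6⟩, h7⟩ := hst
    obtain ⟨a, ha, hs, ht, hw⟩ := h.exists_arc ⟨⟨h1, h2⟩, ⟨h4, h5⟩, h7⟩
    refine .tail ih ⟨a, ha, hs, ht, ?_⟩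
    rcases hw with hw | hw
    · exact hw ▸ h.weight_le h1 h2 h3
    · exact hw ▸ h.weight_le h4 h5 h6

/-- The solver needs that the end nodes are joined at some threshold; the maximum of the weights
along a chain is one. -/
theorem HasGraph.exists_connects (h : HasGraph L₁ L₂ s s₁ t₁ s₂ t₂)
    {P Q : Finset (EuclideanSpace ℝ (Fin d)) × Finset (EuclideanSpace ℝ (Fin d))}
    (hPQ : Relation.ReflTransGen (Neighbours K₁ K₂) P Q) :
    ∃ τ, Connects s τ (nodeOf L₁ L₂ P) (nodeOf L₁ L₂ Q) := by
  induction hPQ with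
  | refl => exact ⟨0, .refl⟩
  | tail _ hst ih =>
    obtain ⟨τ, hτ⟩ := ih
    obtain ⟨a, ha, hs, ht, -⟩ := h.exists_arc hst
    exact ⟨max τ (s.real 71 a), .tail (ArcConn.mono (le_max_left _ _) hτ)
      ⟨a, ha, hs, ht, le_max_right _ _⟩⟩

/-- Move in the first complex while the second component rests, then the other way round. -/
theorem neighbours_of_connected (h₁ : K₁.Connected) (h₂ : K₂.Connected)
    {A A' B B' : Finset (EuclideanSpace ℝ (Fin d))} (hA : A ∈ K₁.faces) (hA' : A' ∈ K₁.faces)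
    (hB : B ∈ K₂.faces) (hB' : B' ∈ K₂.faces) :
    Relation.ReflTransGen (Neighbours K₁ K₂) (A, B) (A', B') := by
  have e₁ : Relation.ReflTransGen (Neighbours K₁ K₂) (A, B) (A', B) :=
    (h₁ A hA A' hA').lift (fun A => (A, B)) fun X Y h => ⟨⟨h.1, hB⟩, ⟨h.2.1, hB⟩, .inl ⟨h.2.2, rfl⟩⟩
  have e₂ : Relation.ReflTransGen (Neighbours K₁ K₂) (A', B) (A', B') :=
    (h₂ B hB B' hB').lift (fun B => (A', B)) fun X Y h =>
      ⟨⟨hA', h.1⟩, ⟨hA', h.2.1⟩, .inr ⟨rfl, h.2.2⟩⟩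
  exact e₁.trans e₂

theorem HasGraph.srcNode_eq (h : HasGraph L₁ L₂ s s₁ t₁ s₂ t₂) :
    srcNode s = nodeOf L₁ L₂ ({L₁.vert s₁}, {L₂.vert s₂}) := by
  rw [srcNode, h.src₁, h.src₂, h.row _ (L₁.num_lt (L₁.singleton_mem s₁)), nodeOf]

theorem HasGraph.dstNode_eq (h : HasGraph L₁ L₂ s s₁ t₁ s₂ t₂) :
    dstNode s = nodeOf L₁ L₂ ({L₁.vert t₁}, {L₂.vert t₂}) := by
  rw [dstNode, h.dst₁, h.dst₂, h.row _ (L₁.num_lt (L₁.singleton_mem t₁)), nodeOf]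

theorem nodeOf_spec {P : Finset (EuclideanSpace ℝ (Fin d)) × Finset (EuclideanSpace ℝ (Fin d))}
    (h₁ : P.1 ∈ K₁.faces) (h₂ : P.2 ∈ K₂.faces) :
    nodeOf L₁ L₂ P < K₁.size * K₂.size ∧ L₁.cellOf (nodeOf L₁ L₂ P / K₂.size) = P.1 ∧
      L₂.cellOf (nodeOf L₁ L₂ P % K₂.size) = P.2 := by
  obtain ⟨e1, e2, e3⟩ := node_div_mod (L₁.num_lt h₁) (L₂.num_lt h₂)
  rw [nodeOf, e1, e2, L₁.cellOf_num h₁, L₂.cellOf_num h₂]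
  exact ⟨e3, rfl, rfl⟩

/-- The data of the arc `a`: it joins `x` and `y`, which are both contained in `z`, and its weight
bounds the weights of both ends. -/
theorem HasGraph.arc_spec (h : HasGraph L₁ L₂ s s₁ t₁ s₂ t₂) {a x y : ℕ} (ha : a < s.nat 86 0)
    (hx : s.nat 83 a = x) (hy : s.nat 84 a = y) :
    x < K₁.size * K₂.size ∧ y < K₁.size * K₂.size ∧ s.nat 85 a < K₁.size * K₂.size ∧
      (L₁.cellOf (x / K₂.size) ⊆ L₁.cellOf (s.nat 85 a / K₂.size) ∧
        L₁.cellOf (y / K₂.size) ⊆ L₁.cellOf (s.nat 85 a / K₂.size)) ∧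
      (L₂.cellOf (x % K₂.size) ⊆ L₂.cellOf (s.nat 85 a % K₂.size) ∧
        L₂.cellOf (y % K₂.size) ⊆ L₂.cellOf (s.nat 85 a % K₂.size)) ∧
      s.real 70 x ≤ s.real 71 a ∧ s.real 70 y ≤ s.real 71 a := by
  obtain ⟨lo, ⟨hstep, hor⟩, hw⟩ := h.arcs.sound a ha
  rw [hx, hy] at hor
  rw [hw]
  generalize s.nat 85 a = z at *
  obtain ⟨hlo, hhi, hs₁, hs₂⟩ := step_cellOf hstep
  obtain ⟨p, q, hpq⟩ := h.exists_isNode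
  -- The upper end has larger hulls and hence a smaller distance, so the weight of the lower end
  -- bounds both.
  have hle : s.real 70 z ≤ s.real 70 lo := by
    rw [(hpq _ hlo).weight, (hpq _ hhi).weight]
    refine pow_le_pow_left₀ dist_nonneg ((hpq _ hhi).le _ ⟨_, ?_, _, ?_, le_rfl⟩) 2
    · exact convexHull_mono (Finset.coe_subset.2 hs₁) (hpq _ hlo).left
    · exact convexHull_mono (Finset.coe_subset.2 hs₂) (hpq _ hlo).right
  rcases hor with ⟨rfl, rfl⟩ | ⟨rfl, rfl⟩
  · exact ⟨hlo, hhi, hhi, ⟨hs₁, subset_rfl⟩, ⟨hs₂, subset_rfl⟩, le_rfl, hle⟩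
  · exact ⟨hhi, hlo, hhi, ⟨subset_rfl, hs₁⟩, ⟨subset_rfl, hs₂⟩, hle, le_rfl⟩

/-- The curves that belong to an optimal route. -/
theorem HasGraph.exists_paths (h : HasGraph L₁ L₂ s s₁ t₁ s₂ t₂) {out : State} {B : ℝ} {m : ℕ}
    {y e : ℕ → ℕ} (hR : IsRoute s B m y e) (hout : Route d s out m y e)
    (h0 : srcNode s = dstNode s → m = 0)
    (hopt : srcNode s ≠ dstNode s → ∀ τ, Connects s τ (srcNode s) (dstNode s) → B ≤ τ) :
    ∃ (π σ : C(unitInterval, EuclideanSpace ℝ (Fin d)))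
      (φ ψ : unitInterval → Finset (EuclideanSpace ℝ (Fin d))) (w₀ : ℝ),
      DescribesCurve L₁ (outLength out) (outPoint d out 2) (out.nat 7) π φ ∧
      DescribesCurve L₂ (outLength out) (outPoint d out 3) (out.nat 8) σ ψ ∧
      K₁.IsPath (L₁.vert s₁) (L₁.vert t₁) π φ ∧ K₂.IsPath (L₂.vert s₂) (L₂.vert t₂) σ ψ ∧
      (∀ u, dist (π u) (σ u) ≤ w₀) ∧
      ∀ w, Relation.ReflTransGen (PairStep K₁ K₂ w) ({L₁.vert s₁}, {L₂.vert s₂})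
        ({L₁.vert t₁}, {L₂.vert t₂}) → Near w {L₁.vert s₁} {L₂.vert s₂} → w₀ ≤ w := by
  obtain ⟨p, q, hpq⟩ := h.exists_isNode
  obtain ⟨hsN, hs1, hs2⟩ := nodeOf_spec (L₁ := L₁) (L₂ := L₂) (P := ({L₁.vert s₁}, {L₂.vert s₂}))
    (L₁.singleton_mem s₁) (L₂.singleton_mem s₂)
  obtain ⟨htN, ht1, ht2⟩ := nodeOf_spec (L₁ := L₁) (L₂ := L₂) (P := ({L₁.vert t₁}, {L₂.vert t₂}))
    (L₁.singleton_mem t₁) (L₂.singleton_mem t₂)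
  rw [← h.srcNode_eq] at hsN hs1 hs2
  rw [← h.dstNode_eq] at htN ht1 ht2
  have harc := fun i hi => h.arc_spec (hR.arc i hi).1 (hR.arc i hi).2.1 (hR.arc i hi).2.2.1
  have hy : ∀ k ≤ m, y k < K₁.size * K₂.size := by
    intro k hk
    rcases Nat.lt_or_ge k m with hk' | hk'
    · exact (harc k hk').1
    · obtain rfl : k = m := le_antisymm hk hk'
      rwa [hR.finish]
  have hm : outLength out = m := hout.length
  have hp2 : ∀ k ≤ m, outPoint d out 2 k = p (y k) := fun k hk => by
    ext c
    rw [← (hpq _ (hy k hk)).fst c, ← (hout.point k hk c).1]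
    rfl
  have hp3 : ∀ k ≤ m, outPoint d out 3 k = q (y k) := fun k hk => by
    ext c
    rw [← (hpq _ (hy k hk)).snd c, ← (hout.point k hk c).2]
    rfl
  obtain ⟨φ, hφ, hφT⟩ := isPath_polyline (K := K₁) (m := m) (s := L₁.vert s₁) (t := L₁.vert t₁)
    (F := fun k => L₁.cellOf (y k / K₂.size))
    (T := fun k => L₁.cellOf (s.nat 85 (e k) / K₂.size)) (p := outPoint d out 2)
    (fun k hk => L₁.cellOf_mem (div_mod_lt (hy k hk)).1)
    (fun k hk => L₁.cellOf_mem (div_mod_lt (harc k hk).2.2.1).1)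
    (fun k hk => (harc k hk).2.2.2.1)
    (fun k hk => by rw [hp2 k hk]; exact (hpq _ (hy k hk)).left)
    (by rw [hR.start, hs1]) (by rw [hR.finish, ht1])
  obtain ⟨ψ, hψ, hψT⟩ := isPath_polyline (K := K₂) (m := m) (s := L₂.vert s₂) (t := L₂.vert t₂)
    (F := fun k => L₂.cellOf (y k % K₂.size))
    (T := fun k => L₂.cellOf (s.nat 85 (e k) % K₂.size)) (p := outPoint d out 3)
    (fun k hk => L₂.cellOf_mem (div_mod_lt (hy k hk)).2)
    (fun k hk => L₂.cellOf_mem (div_mod_lt (harc k hk).2.2.1).2)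
    (fun k hk => (harc k hk).2.2.2.2.1)
    (fun k hk => by rw [hp3 k hk]; exact (hpq _ (hy k hk)).right)
    (by rw [hR.start, hs2]) (by rw [hR.finish, ht2])
  obtain ⟨w₀, hw₀, hmin⟩ : ∃ w₀, (∀ k ≤ m, dist (p (y k)) (q (y k)) ≤ w₀) ∧
      ∀ w, Relation.ReflTransGen (PairStep K₁ K₂ w) ({L₁.vert s₁}, {L₂.vert s₂})
        ({L₁.vert t₁}, {L₂.vert t₂}) → Near w {L₁.vert s₁} {L₂.vert s₂} → w₀ ≤ w := by
    -- If the end nodes coincide, the curves are constant and nothing is known about `B`; the bound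
    -- then comes from the assumption `Near` on the start vertices.
    by_cases hst : srcNode s = dstNode s
    · obtain rfl := h0 hst
      refine ⟨dist (p (y 0)) (q (y 0)), fun k hk => ?_, fun w _ hw => ?_⟩
      · obtain rfl : k = 0 := by omega
        exact le_rfl
      · refine (hpq _ (hy 0 le_rfl)).le w ?_
        rwa [hR.start, hs1, hs2]
    · have hmpos : 0 < m := by
        by_contra hcon
        obtain rfl : m = 0 := by omega
        exact hst (hR.start.symm.trans hR.finish)
      -- The weights are squared distances, so the width is `√B`. The assumption `Near` also
      -- supplies `0 ≤ w`, which is needed to pass from `B ≤ w ^ 2` to `√B ≤ w`.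
      refine ⟨√B, fun k hk => Real.le_sqrt_of_sq_le ?_, fun w hw hn => ?_⟩
      · rw [← (hpq _ (hy k hk)).weight]
        -- Every node but the last is the tail of an arc of the route; the last one is the head of
        -- the preceding arc.
        rcases Nat.lt_or_ge k m with hk' | hk'
        · exact (harc k hk').2.2.2.2.2.1.trans (hR.arc k hk').2.2.2
        · obtain ⟨j, rfl⟩ : ∃ j, k = j + 1 := ⟨k - 1, by omega⟩
          exact (harc j (by omega)).2.2.2.2.2.2.trans (hR.arc j (by omega)).2.2.2
      · obtain ⟨u, -, v, -, huv⟩ := hn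
        refine Real.sqrt_le_iff.2 ⟨dist_nonneg.trans huv, hopt hst _ ?_⟩
        rw [h.srcNode_eq, h.dstNode_eq]
        exact h.connects_of_pairStep hw
  refine ⟨polylineMap m (outPoint d out 2), polylineMap m (outPoint d out 3), φ, ψ, w₀, ?_, ?_, hφ,
    hψ, dist_polyline_le fun k hk => by rw [hp2 k hk, hp3 k hk]; exact hw₀ k hk, hmin⟩
  · refine ⟨fun u => by rw [hm]; rfl, fun i hi => ?_⟩
    rw [hm] at hi
    have hz := (harc i hi).2.2.1
    have hc : out.nat 7 i = s.nat 85 (e i) / K₂.size := (hout.cell i hi).1.trans (hpq _ hz).row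
    have hlt := (div_mod_lt hz).1
    rw [← hc] at hlt
    refine ⟨hlt, fun u h1 h2 => ?_⟩
    rw [hm] at h1 h2
    have := hφT i hi u h1 h2
    rwa [← hc, cellOf, dif_pos hlt] at this
  · refine ⟨fun u => by rw [hm]; rfl, fun i hi => ?_⟩
    rw [hm] at hi
    have hz := (harc i hi).2.2.1
    have hc : out.nat 8 i = s.nat 85 (e i) % K₂.size := (hout.cell i hi).2.trans (hpq _ hz).col
    have hlt := (div_mod_lt hz).2
    rw [← hc] at hlt
    refine ⟨hlt, fun u h1 h2 => ?_⟩
    rw [hm] at h1 h2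
    have := hψT i hi u h1 h2
    rwa [← hc, cellOf, dif_pos hlt] at this

end Graph

end GeomComplex.Listing

/-! ### Optimality of the computed curves and total running time -/

open RealRAM RealRAM.Build GeomComplex GeomComplex.Listing in
theorem mainTheorem1 (d : ℕ) :
    ∃ (P : RealRAM.Cmd) (C : ℕ), ∀ (K₁ K₂ : GeomComplex d), K₁.Connected → K₂.Connected →
      ∀ (L₁ : K₁.Listing) (L₂ : K₂.Listing)
        (s₁ t₁ : Fin L₁.numVerts) (s₂ t₂ : Fin L₂.numVerts),
      ∃ (T : ℕ) (out : RealRAM.State),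
        RealRAM.Exec P (inputState L₁ s₁ t₁ L₂ s₂ t₂) T out ∧
        T ≤ C * (max K₁.size K₂.size) ^ 2 ∧
        outLength out ≤ C * (max K₁.size K₂.size) ^ 2 ∧
        ∃ (π σ : C(unitInterval, EuclideanSpace ℝ (Fin d)))
          (φ ψ : unitInterval → Finset (EuclideanSpace ℝ (Fin d))),
          DescribesCurve L₁ (outLength out) (outPoint d out 2) (out.nat 7) π φ ∧
          DescribesCurve L₂ (outLength out) (outPoint d out 3) (out.nat 8) σ ψ ∧
          K₁.IsPath (L₁.vert s₁) (L₁.vert t₁) π φ ∧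
          K₂.IsPath (L₂.vert s₂) (L₂.vert t₂) σ ψ ∧
          curveWidth π σ (ContinuousMap.id unitInterval) (ContinuousMap.id unitInterval) =
            weakFrechetDist π σ ∧
          ∀ (π' σ' : C(unitInterval, EuclideanSpace ℝ (Fin d)))
            (φ' ψ' : unitInterval → Finset (EuclideanSpace ℝ (Fin d))),
            K₁.IsPath (L₁.vert s₁) (L₁.vert t₁) π' φ' →
            K₂.IsPath (L₂.vert s₂) (L₂.vert t₂) σ' ψ' →
              weakFrechetDist π σ ≤ weakFrechetDist π' σ' ∧
              frechetDist π σ ≤ frechetDist π' σ' := by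
  obtain ⟨Kb, hKb⟩ := build_runs d (2 ^ (d + 1))
  obtain ⟨Ks, hKs⟩ := solve_runs d
  set E := 2 ^ (d + 1)
  refine ⟨.seq (build d) (solve d), 4 * Kb + Ks * (4 * E + 1) + 4 * E + 2,
    fun K₁ K₂ hc₁ hc₂ L₁ L₂ s₁ t₁ s₂ t₂ => ?_⟩
  set N := max K₁.size K₂.size with hN
  have hn₁ : K₁.size ≤ N := le_max_left _ _
  have hn₂ : K₂.size ≤ N := le_max_right _ _
  -- The start vertex is a simplex, so `N` is positive and the terms of lower order can be absorbed
  -- into `N ^ 2`.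
  have hNpos : 1 ≤ N :=
    (Nat.succ_le_of_lt ((Nat.zero_le _).trans_lt (L₁.num_lt (L₁.singleton_mem s₁)))).trans hn₁
  have hF₁ : facePairs d L₁.vertIndex K₁.size ≤ E * N :=
    L₁.facePairs_le.trans (Nat.mul_le_mul_left _ hn₁)
  have hF₂ : facePairs d L₂.vertIndex K₂.size ≤ E * N :=
    L₂.facePairs_le.trans (Nat.mul_le_mul_left _ hn₂)
  have hrun := (hKb (inputState L₁ s₁ t₁ L₂ s₂ t₂) L₁.vertIndex L₂.vertIndex N _ _ _ _ hn₁ hn₂ rfl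
    rfl hF₁ hF₂ (L₁.isVertexCell s₁ t₁ s₁ rfl) (L₁.isVertexCell s₁ t₁ t₁ rfl)
    (L₂.isVertexCell s₂ t₂ s₂ rfl) (L₂.isVertexCell s₂ t₂ t₂ rfl)).seq
    (c₂ := solve d) (k₂ := Ks * (4 * E * (N * N) + 1)) (Q := fun out => ∃ (s : State) (B : ℝ)
      (m : ℕ) (y e : ℕ → ℕ), HasGraph L₁ L₂ s s₁ t₁ s₂ t₂ ∧ s.nat 86 0 ≤ 4 * E * (N * N) ∧
      IsRoute s B m y e ∧ Route d s out m y e ∧ (srcNode s = dstNode s → m = 0) ∧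
      (srcNode s ≠ dstNode s → ∀ τ, Connects s τ (srcNode s) (dstNode s) → B ≤ τ))
    fun s _ hs => by
      replace hs : HasGraph L₁ L₂ s s₁ t₁ s₂ t₂ := hs
      -- For every simplex of the other complex a face pair contributes one arc in each direction,
      -- and each complex has at most `E * N` face pairs.
      have hM : s.nat 86 0 ≤ 4 * E * (N * N) := by
        have e₁ := Nat.mul_le_mul (Nat.mul_le_mul_left 2 hn₂) hF₁
        have e₂ := Nat.mul_le_mul (Nat.mul_le_mul_left 2 hn₁) hF₂
        have e₃ : 4 * E * (N * N) = 2 * N * (E * N) + 2 * N * (E * N) := by ring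
        rw [hs.count, e₃]
        exact Nat.add_le_add e₁ e₂
      refine (hKs s hs.arcSymm ?_).mono (Nat.mul_le_mul_left _ (Nat.succ_le_succ hM))
        fun out _ ⟨B, m, y, e, h⟩ => ⟨s, B, m, y, e, hs, hM, h⟩
      rw [hs.srcNode_eq, hs.dstNode_eq]
      exact hs.exists_connects (neighbours_of_connected hc₁ hc₂ (L₁.singleton_mem s₁)
        (L₁.singleton_mem t₁) (L₂.singleton_mem s₂) (L₂.singleton_mem t₂))
  obtain ⟨T, out, hexec, hT, s, B, m, y, e, hG, hM, hR, hout, h0, hopt⟩ := hrun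
  have hNN : 1 ≤ N * N := Nat.mul_pos hNpos hNpos
  refine ⟨T, out, hexec, ?_, ?_, ?_⟩
  · have e₁ : (N + 1) * (N + 1) ≤ 4 * (N * N) :=
      (Nat.mul_le_mul (by omega : N + 1 ≤ 2 * N) (by omega : N + 1 ≤ 2 * N)).trans
        (le_of_eq (by ring))
    have e₂ : 4 * E * (N * N) + 1 ≤ (4 * E + 1) * (N * N) := by
      rw [add_mul, one_mul]
      omega
    calc T ≤ Kb * ((N + 1) * (N + 1)) + Ks * (4 * E * (N * N) + 1) := hT
      _ ≤ Kb * (4 * (N * N)) + Ks * ((4 * E + 1) * (N * N)) :=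
        Nat.add_le_add (Nat.mul_le_mul_left _ e₁) (Nat.mul_le_mul_left _ e₂)
      _ = (4 * Kb + Ks * (4 * E + 1)) * N ^ 2 := by ring
      _ ≤ _ := Nat.mul_le_mul_right _ (by omega)
  · have e₁ : outLength out ≤ 4 * E * (N * N) + 2 := by
      rw [outLength, hout.length]
      exact hR.length_le.trans (Nat.add_le_add_right hM 2)
    calc outLength out ≤ 4 * E * (N * N) + 2 * (N * N) := by omega
      _ = (4 * E + 2) * N ^ 2 := by ring
      _ ≤ _ := Nat.mul_le_mul_right _ (by omega)
  obtain ⟨π, σ, φ, ψ, w₀, hπ, hσ, hφ, hψ, hw₀, hmin⟩ := hG.exists_paths hR hout h0 hopt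
  -- The bound is for weak reparameterizations, hence for both distances. Time 0 of the traversal
  -- shows that the start vertices are near, as required when the end nodes coincide.
  have hlow : ∀ (π' σ' : C(unitInterval, EuclideanSpace ℝ (Fin d)))
      (φ' ψ' : unitInterval → Finset (EuclideanSpace ℝ (Fin d))),
      K₁.IsPath (L₁.vert s₁) (L₁.vert t₁) π' φ' → K₂.IsPath (L₂.vert s₂) (L₂.vert t₂) σ' ψ' →
      ∀ f g, IsWeakReparam f → IsWeakReparam g → w₀ ≤ curveWidth π' σ' f g := by
    intro π' σ' φ' ψ' h₁ h₂ f g hf hg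
    refine hmin _ (pairStep_of_isPath h₁ h₂ hf hg fun u => dist_le_curveWidth π' σ' f g u)
      ⟨π' 0, ?_, σ' 0, ?_, ?_⟩
    · have := (h₁.realizes 0).1
      rwa [h₁.source] at this
    · have := (h₂.realizes 0).1
      rwa [h₂.source] at this
    · have := dist_le_curveWidth π' σ' f g 0
      rwa [hf.1, hg.1] at this
  -- The identity is an injective reparameterization, so `w₀` bounds both distances of the output
  -- from above; together with `hlow` for the output itself, the simultaneous traversal is optimal.
  have hup : curveWidth π σ (ContinuousMap.id unitInterval) (ContinuousMap.id unitInterval) ≤ w₀ :=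
    ciSup_le hw₀
  refine ⟨π, σ, φ, ψ, hπ, hσ, hφ, hψ, le_antisymm ?_ (weakFrechetDist_le_curveWidth π σ),
    fun π' σ' φ' ψ' h₁ h₂ => ⟨?_, ?_⟩⟩
  · exact hup.trans (le_weakFrechetDist (hlow π σ φ ψ hφ hψ))
  · exact (weakFrechetDist_le_curveWidth π σ).trans
      (hup.trans (le_weakFrechetDist (hlow π' σ' φ' ψ' h₁ h₂)))
  · exact (frechetDist_le_curveWidth π σ).trans
      (hup.trans (le_frechetDist (hlow π' σ' φ' ψ' h₁ h₂)))
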